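/- **Theorem 1.2.** Let $H=\mathbb R\times(0,\infty)$. For $\alpha\in(0,\frac12)$ consider the g-SQG equation $$\partial_t\theta+u\cdot\nabla\theta=0,\qquad u(t,x)=\int_{H}\Big(\frac{(x-y)^\perp}{|x-y|^{2+2\alpha}}-\frac{(x-\bar y)^\perp}{|x-\bar y|^{2+2\alpha}}\Big)\theta(t,y)\,dy ,$$ where $y^\perp=(y_2,-y_1)$ and $\bar y=(y_1,-y_2)$. For $\beta\in[0,1)$ let $X_\beta=W^{1,\infty}_\beta(H)\cap L^1(H)$, with norm $$\|\theta\|_{X_\beta}=\|\theta\|_{L^\infty}+\|\partial_{x_1}\theta\|_{L^\infty}+\|\min\{x_2^\beta,1\}\,\partial_{x_2}\theta\|_{L^\infty}+\|\theta\|_{L^1}.$$ A classical solution on $[0,T]$ with datum $\theta_0$ is a function $\theta\in L^\infty([0,T];X_\beta)$ that is locally Lipschitz on $[0,T]\times H$, satisfies $\theta(0,\cdot)=\theta_0$, and satisfies the equation almost everywhere. Let $\lambda_\beta(s)=((1-\beta)s)^{1/(1-\beta)}$ for $0<s<(1-\beta)^{-1}$ and $\lambda_\beta(s)=s-\frac{\beta}{1-\beta}$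 for $s\ge(1-\beta)^{-1}$. Let $\Lambda_\beta(x)=(x_1,\lambda_\beta(x_2))$ and $\phi_1(x)=\max\{0,1-|x|\}$, and let $d$ be the Euclidean distance on $\mathbb R^2$. Let $\alpha\in(0,\frac12)$ and $\beta\in[0,1)\setminus[2\alpha,1-2\alpha]$ (where $[2\alpha,1-2\alpha]=\emptyset$ if $\alpha>\frac14$). Then the equation is ill-posed in $X_\beta$ in the following sense. 1. Suppose $\beta<2\alpha$. There is $c>0$ such that $a_n:=c\,2^{-8n/(1-2\alpha)^2}\le 2^{-4n-1}$ for all $n\ge1$ and the following holds. Let $\phi_0(x)=\min\{1,d(x,\mathbb R^2\setminus([-3,3]\times[-1,2+(1-\beta)^{-1}]))\}$. The function $$\theta_0=\Big(\phi_0+\sum_{n\ge1}a_n\,\phi_1\Big(\frac{\cdot-(0,2^{-4n})}{a_n}\Big)\Big)\circ\Lambda_\beta^{-1}$$ belongs to $X_\beta$, and for no $T>0$ is there a classical solution $\theta\in L^\infty([0,T];X_\beta)$ with datum $\theta_0$. 2. Suppose $\beta>1-2\alpha$. There is $\gamma>0$ such that $a_n:=2^{-\gamma n}\le2^{-4n-1}$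 for all $n\ge1$ and the following holds. Let $\phi_0(x)=\min\{1,d(x,\mathbb R^2\setminus([-3,0]\times[0,3]))\}$, and for $N\in\{0,1,2,\dots\}\cup\{\infty\}$ let $$\theta_{0,N}=\phi_0+\Big(\sum_{1\le n\le N}\frac{a_n}{n}\,\phi_1\Big(\frac{\cdot-(\lambda_\beta(2^{-4n}),2^{-4n})}{a_n}\Big)\Big)\circ\Lambda_\beta^{-1}.$$ All $\theta_{0,N}$ belong to $X_\beta$, and $\theta_{0,N}\to\theta_{0,\infty}$ in $X_\beta$ as $N\to\infty$. However, for no $T>0$ and no strictly increasing sequence $(N_k)$ are there classical solutions $\theta_k\in L^\infty([0,T];X_\beta)$ with data $\theta_{0,N_k}$ that converge in $L^\infty([0,T];X_\beta)$ as $k\to\infty$. -/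

import Mathlib

open MeasureTheory Set Filter Topology
open scoped ENNReal

noncomputable section

namespace GSQG

/-- The plane `ℝ²` with its Euclidean norm; `x 0` and `x 1` are the coordinates `x₁` and `x₂`. -/
abbrev Plane := EuclideanSpace ℝ (Fin 2)

/-- The open half-plane `ℝ × ℝ⁺`. -/
def halfPlane : Set Plane := {x | 0 < x 1}

/-- Lebesgue measure on the half-plane. -/
def hpVolume : Measure Plane := volume.restrict halfPlane

/-- The coordinate vectors of `ℝ²`. -/
def e (i : Fin 2) : Plane := EuclideanSpace.single i 1

/-- `x̄ = (x₁, -x₂)`. -/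
def bar (x : Plane) : Plane := !₂[x 0, -x 1]

/-- `x^⊥ = (x₂, -x₁)`. -/
def perp (x : Plane) : Plane := !₂[x 1, -x 0]

/-- The kernel `x^⊥ / |x|^{2+2α}`. -/
def kernel (α : ℝ) (x : Plane) : Plane := (‖x‖ ^ (2 + 2 * α))⁻¹ • perp x

/-- The g-SQG velocity on the half-plane generated by the scalar `f`:
`u(x) = ∫_{ℝ×ℝ⁺} ( (x-y)^⊥ / |x-y|^{2+2α} - (x-ȳ)^⊥ / |x-ȳ|^{2+2α} ) f(y) dy`. -/
def velocity (α : ℝ) (f : Plane → ℝ) (x : Plane) : Plane :=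
  ∫ y, f y • (kernel α (x - y) - kernel α (x - bar y)) ∂hpVolume

/-- The norm
`‖f‖_{L^∞} + ‖∂_{x₁} f‖_{L^∞} + ‖min{x₂^β,1} ∂_{x₂} f‖_{L^∞} + ‖f‖_{L^1}` on the half-plane,
with values in `[0,∞]`. It is used for locally Lipschitz functions, which are differentiable
almost everywhere and whose pointwise derivatives are their weak derivatives. -/
def xNorm (β : ℝ) (f : Plane → ℝ) : ℝ≥0∞ :=
  eLpNorm f ∞ hpVolume
    + (eLpNorm (fun x => fderiv ℝ f x (e 0)) ∞ hpVolume
      + eLpNorm (fun x => min ((x 1) ^ β) 1 * fderiv ℝ f x (e 1)) ∞ hpVolume)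
    + eLpNorm f 1 hpVolume

/-- Membership in `X_β = W^{1,∞}_β(ℝ×ℝ⁺) ∩ L¹(ℝ×ℝ⁺)`. The norm bounds the weak gradient on every
compact subset of the open half-plane, so that every element is locally Lipschitz there (up to
equality almost everywhere). Only the values of `f` on the half-plane matter. -/
def MemX (β : ℝ) (f : Plane → ℝ) : Prop :=
  LocallyLipschitzOn halfPlane f ∧ xNorm β f < ∞

/-- The norm of `L^∞([0,T]; X_β)`. -/
def timeNorm (β T : ℝ) (θ : ℝ → Plane → ℝ) : ℝ≥0∞ :=
  essSup (fun t => xNorm β (θ t)) (volume.restrict (Icc 0 T))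

/-- Membership in `L^∞([0,T]; X_β)`. -/
def MemLinftyX (β T : ℝ) (θ : ℝ → Plane → ℝ) : Prop :=
  (∀ᵐ t ∂(volume.restrict (Icc 0 T)), MemX β (θ t)) ∧ timeNorm β T θ < ∞

/-- `θ ∈ L^∞([0,T]; X_β)` is a classical solution of `∂ₜθ + u·∇θ = 0` on `[0,T] × (ℝ×ℝ⁺)`
with initial datum `θ₀`: it is locally Lipschitz in `(t,x)`, and the equation, with
`u` the velocity generated by `θ(t,·)`, holds almost everywhere. -/
structure IsClassicalSolution (α β T : ℝ) (θ₀ : Plane → ℝ) (θ : ℝ → Plane → ℝ) : Prop where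
  memLinftyX : MemLinftyX β T θ
  locallyLipschitz :
    LocallyLipschitzOn (Icc 0 T ×ˢ halfPlane) (fun p : ℝ × Plane => θ p.1 p.2)
  initial : ∀ x ∈ halfPlane, θ 0 x = θ₀ x
  equation : ∀ᵐ p : ℝ × Plane ∂(volume.restrict (Icc 0 T ×ˢ halfPlane)),
    deriv (fun t => θ t p.2) p.1 + fderiv ℝ (θ p.1) p.2 (velocity α (θ p.1) p.2) = 0

/-- The stretching function `λ_β` on `(0,∞)`. -/
def lam (β s : ℝ) : ℝ :=
  if s < (1 - β)⁻¹ then (1 - β) ^ (1 / (1 - β)) * s ^ (1 / (1 - β)) else s - β / (1 - β)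

/-- The inverse of `λ_β` on `(0,∞)`; see `lam_lamInv` and `lamInv_lam`. -/
def lamInv (β s : ℝ) : ℝ :=
  if s < 1 then (1 - β)⁻¹ * s ^ (1 - β) else s + β / (1 - β)

theorem lamInv_pos {β s : ℝ} (hβ₀ : 0 ≤ β) (hβ : β < 1) (hs : 0 < s) : 0 < lamInv β s := by
  have h1 : 0 < 1 - β := by linarith
  unfold lamInv
  split_ifs with h
  · positivity
  · have : 0 ≤ β / (1 - β) := div_nonneg hβ₀ h1.le
    linarith

theorem lam_pos {β s : ℝ} (hβ : β < 1) (hs : 0 < s) : 0 < lam β s := by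
  have h1 : 0 < 1 - β := by linarith
  unfold lam
  split_ifs with h
  · positivity
  · have h2 : (1 - β)⁻¹ ≤ s := not_lt.mp h
    have h3 : (1 - β)⁻¹ - β / (1 - β) = 1 := by field_simp
    linarith

theorem lam_lamInv {β s : ℝ} (hβ : β < 1) (hs : 0 < s) : lam β (lamInv β s) = s := by
  have h1 : 0 < 1 - β := by linarith
  have h3 : (1 - β)⁻¹ - β / (1 - β) = 1 := by field_simp
  unfold lamInv
  split_ifs with h
  · have hp : s ^ (1 - β) < 1 := Real.rpow_lt_one hs.le h h1
    have hlt : (1 - β)⁻¹ * s ^ (1 - β) < (1 - β)⁻¹ := by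
      have : 0 < (1 - β)⁻¹ := by positivity
      nlinarith
    unfold lam
    rw [if_pos hlt, ← Real.mul_rpow h1.le (by positivity), ← mul_assoc,
      mul_inv_cancel₀ h1.ne', one_mul, ← Real.rpow_mul hs.le, mul_one_div_cancel h1.ne',
      Real.rpow_one]
  · unfold lam
    rw [if_neg (by linarith)]
    ring

theorem lamInv_lam {β s : ℝ} (hβ : β < 1) (hs : 0 < s) : lamInv β (lam β s) = s := by
  have h1 : 0 < 1 - β := by linarith
  have h3 : (1 - β)⁻¹ - β / (1 - β) = 1 := by field_simp
  unfold lam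
  split_ifs with h
  · have hm : (1 - β) * s < 1 := by
      have := mul_lt_mul_of_pos_left h h1
      rwa [mul_inv_cancel₀ h1.ne'] at this
    rw [← Real.mul_rpow h1.le hs.le]
    unfold lamInv
    rw [if_pos (Real.rpow_lt_one (by positivity) hm (by positivity)),
      ← Real.rpow_mul (by positivity), one_div_mul_cancel h1.ne', Real.rpow_one, ← mul_assoc,
      inv_mul_cancel₀ h1.ne', one_mul]
  · unfold lamInv
    rw [if_neg (by linarith)]
    ring

/-- `Λ_β^{-1}(x) = (x₁, λ_β^{-1}(x₂))`, the inverse of `Λ_β(x) = (x₁, λ_β(x₂))` on `ℝ×ℝ⁺`. -/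
def stretchInv (β : ℝ) (x : Plane) : Plane := !₂[x 0, lamInv β (x 1)]

/-- The closed rectangle `[a,b] × [c,d]`. -/
def rect (a b c d : ℝ) : Set Plane := {x | x 0 ∈ Icc a b ∧ x 1 ∈ Icc c d}

/-- `min{1, d(x, ℝ² ∖ R)}`. -/
def plateau (R : Set Plane) (x : Plane) : ℝ := min 1 (Metric.infDist x Rᶜ)

/-- The cap `max{0, 1 - |x|}`. -/
def cap (x : Plane) : ℝ := max 0 (1 - ‖x‖)

/-- The datum `(φ₀ + ∑_{n≥1} aₙ φ₁((· - (0, 2^{-4n}))/aₙ)) ∘ Λ_β^{-1}`, with `φ₁` the cap and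
`φ₀ = min{1, d(·, ℝ² ∖ ([-3,3] × [-1, 2+(1-β)^{-1}]))}`. -/
def tangentialDatum (β : ℝ) (a : ℕ → ℝ) (x : Plane) : ℝ :=
  plateau (rect (-3) 3 (-1) (2 + (1 - β)⁻¹)) (stretchInv β x)
    + ∑' n : ℕ, a (n + 1) *
        cap ((a (n + 1))⁻¹ • (stretchInv β x - !₂[0, ((2 : ℝ) ^ (4 * (n + 1)))⁻¹]))

/-- `(aₙ/n) φ₁((· - (λ_β(2^{-4n}), 2^{-4n}))/aₙ) ∘ Λ_β^{-1}`, with `φ₁` the cap. -/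
def diagonalCap (β : ℝ) (a : ℕ → ℝ) (n : ℕ) (x : Plane) : ℝ :=
  a n / n * cap ((a n)⁻¹ •
    (stretchInv β x - !₂[lam β ((2 : ℝ) ^ (4 * n))⁻¹, ((2 : ℝ) ^ (4 * n))⁻¹]))

/-- The datum `φ₀ + ∑_{n≥1} diagonalCap n`, with
`φ₀ = min{1, d(·, ℝ² ∖ ([-3,0] × [0,3]))}`. -/
def normalDatum (β : ℝ) (a : ℕ → ℝ) (x : Plane) : ℝ :=
  plateau (rect (-3) 0 0 3) x + ∑' n : ℕ, diagonalCap β a (n + 1) x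

/-- The same datum with the sum truncated at `n = n₀`. -/
def normalDatumTrunc (β : ℝ) (a : ℕ → ℝ) (n₀ : ℕ) (x : Plane) : ℝ :=
  plateau (rect (-3) 0 0 3) x + ∑ n ∈ Finset.Icc 1 n₀, diagonalCap β a n x

end GSQG

end

noncomputable section

namespace GSQG

/-! ### Radial power functions on the plane -/

/-- The area of the unit disc. -/
def discArea : ℝ := volume.real (Metric.ball (0 : Plane) 1)

/-- `|z|^{-s}` on the disc of radius `R`, extended by zero. -/
def innerPow (R s : ℝ) (z : Plane) : ℝ := if ‖z‖ < R then ‖z‖ ^ (-s) else 0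

/-- `|z|^{-s}` outside the disc of radius `R`, extended by zero. -/
def outerPow (R s : ℝ) (z : Plane) : ℝ := if R ≤ ‖z‖ then ‖z‖ ^ (-s) else 0

/-- `max{|z|, R}^{-s}`. -/
def maxPow (R s : ℝ) (z : Plane) : ℝ := (max ‖z‖ R) ^ (-s)

lemma discArea_nonneg : 0 ≤ discArea := measureReal_nonneg

lemma innerPow_nonneg (R s : ℝ) (z : Plane) : 0 ≤ innerPow R s z := by
  unfold innerPow; split_ifs <;> positivity

lemma outerPow_nonneg (R s : ℝ) (z : Plane) : 0 ≤ outerPow R s z := by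
  unfold outerPow; split_ifs <;> positivity

lemma maxPow_nonneg (R s : ℝ) (z : Plane) : 0 ≤ maxPow R s z := by
  unfold maxPow
  exact Real.rpow_nonneg (le_max_of_le_left (norm_nonneg _)) _

lemma finrank_plane : Module.finrank ℝ Plane = 2 := by simp

lemma radial_inner {R s : ℝ} (hs : s < 2) (hR : 0 < R) :
    IntegrableOn (fun y : ℝ => y ^ (2 - 1) • (if y < R then y ^ (-s) else 0)) (Ioi 0) ∧
    ∫ y in Ioi (0 : ℝ), y ^ (2 - 1) • (if y < R then y ^ (-s) else 0) = R ^ (2 - s) / (2 - s) := by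
  have key : EqOn (fun y : ℝ => y ^ (2 - 1) • (if y < R then y ^ (-s) else 0))
      ((Iio R).indicator (fun y => y ^ (1 - s))) (Ioi 0) := by
    intro y hy
    have hy : (0 : ℝ) < y := hy
    by_cases h : y < R
    · simp only [h, if_true, indicator, mem_Iio, smul_eq_mul]
      rw [sub_eq_add_neg, Real.rpow_add hy]; simp
    · simp [h, indicator]
  have hset : Ioi (0 : ℝ) ∩ Iio R = Ioo 0 R := rfl
  constructor
  · rw [integrableOn_congr_fun key measurableSet_Ioi, IntegrableOn,
      integrable_indicator_iff measurableSet_Iio, IntegrableOn,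
      Measure.restrict_restrict measurableSet_Iio, inter_comm, hset]
    have := (intervalIntegral.intervalIntegrable_rpow' (a := 0) (b := R) (r := 1 - s) (by linarith))
    rw [intervalIntegrable_iff_integrableOn_Ioo_of_le hR.le] at this
    exact this
  · rw [setIntegral_congr_fun measurableSet_Ioi key, setIntegral_indicator measurableSet_Iio, hset,
      ← integral_Ioc_eq_integral_Ioo, ← intervalIntegral.integral_of_le hR.le,
      integral_rpow (Or.inl (by linarith))]
    rw [Real.zero_rpow (by linarith)]
    ring_nf

lemma radial_outer {R s : ℝ} (hs : 2 < s) (hR : 0 < R) :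
    IntegrableOn (fun y : ℝ => y ^ (2 - 1) • (if R ≤ y then y ^ (-s) else 0)) (Ioi 0) ∧
    ∫ y in Ioi (0 : ℝ), y ^ (2 - 1) • (if R ≤ y then y ^ (-s) else 0) = R ^ (2 - s) / (s - 2) := by
  have key : EqOn (fun y : ℝ => y ^ (2 - 1) • (if R ≤ y then y ^ (-s) else 0))
      ((Ici R).indicator (fun y => y ^ (1 - s))) (Ioi 0) := by
    intro y hy
    have hy : (0 : ℝ) < y := hy
    by_cases h : R ≤ y
    · simp only [h, if_true, indicator, mem_Ici, smul_eq_mul]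
      rw [sub_eq_add_neg, Real.rpow_add hy]; simp
    · simp [h, indicator]
  have hset : Ioi (0 : ℝ) ∩ Ici R = Ici R :=
    inter_eq_right.2 (fun y hy => lt_of_lt_of_le hR hy)
  constructor
  · rw [integrableOn_congr_fun key measurableSet_Ioi, IntegrableOn,
      integrable_indicator_iff measurableSet_Ici, IntegrableOn,
      Measure.restrict_restrict measurableSet_Ici, inter_comm, hset]
    have := integrableOn_Ioi_rpow_of_lt (a := 1 - s) (by linarith) hR
    rwa [← integrableOn_Ici_iff_integrableOn_Ioi] at this
  · rw [setIntegral_congr_fun measurableSet_Ioi key, setIntegral_indicator measurableSet_Ici, hset,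
      integral_Ici_eq_integral_Ioi, integral_Ioi_rpow_of_lt (by linarith) hR]
    rw [show (1 - s + 1) = -(s - 2) by ring, neg_div_neg_eq, show -(s - 2) = 2 - s by ring]

lemma integrable_innerPow {R s : ℝ} (hs : s < 2) (hR : 0 < R) : Integrable (innerPow R s) := by
  have := (integrable_fun_norm_addHaar (volume : Measure Plane)
    (f := fun y : ℝ => if y < R then y ^ (-s) else 0)).2
  rw [finrank_plane] at this
  exact this (radial_inner hs hR).1

lemma integral_innerPow {R s : ℝ} (hs : s < 2) (hR : 0 < R) :
    ∫ z, innerPow R s z = 2 * discArea / (2 - s) * R ^ (2 - s) := by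
  have := integral_fun_norm_addHaar (volume : Measure Plane)
    (fun y : ℝ => if y < R then y ^ (-s) else 0)
  rw [finrank_plane, (radial_inner hs hR).2] at this
  unfold innerPow
  rw [this]; simp only [nsmul_eq_mul, smul_eq_mul, discArea]; push_cast; ring

lemma integrable_outerPow {R s : ℝ} (hs : 2 < s) (hR : 0 < R) : Integrable (outerPow R s) := by
  have := (integrable_fun_norm_addHaar (volume : Measure Plane)
    (f := fun y : ℝ => if R ≤ y then y ^ (-s) else 0)).2
  rw [finrank_plane] at this
  exact this (radial_outer hs hR).1

lemma integral_outerPow {R s : ℝ} (hs : 2 < s) (hR : 0 < R) :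
    ∫ z, outerPow R s z = 2 * discArea / (s - 2) * R ^ (2 - s) := by
  have := integral_fun_norm_addHaar (volume : Measure Plane)
    (fun y : ℝ => if R ≤ y then y ^ (-s) else 0)
  rw [finrank_plane, (radial_outer hs hR).2] at this
  unfold outerPow
  rw [this]; simp only [nsmul_eq_mul, smul_eq_mul, discArea]; push_cast; ring

lemma maxPow_eq (R s : ℝ) (z : Plane) :
    maxPow R s z = R ^ (-s) * innerPow R 0 z + outerPow R s z := by
  unfold maxPow innerPow outerPow
  by_cases h : ‖z‖ < R
  · simp [h, not_le.2 h, max_eq_right h.le]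
  · simp [h, not_lt.1 h]

lemma integrable_maxPow {R s : ℝ} (hs : 2 < s) (hR : 0 < R) : Integrable (maxPow R s) := by
  have : maxPow R s = fun z => R ^ (-s) * innerPow R 0 z + outerPow R s z :=
    funext (maxPow_eq R s)
  rw [this]
  exact ((integrable_innerPow (by norm_num) hR).const_mul _).add (integrable_outerPow hs hR)

lemma integral_maxPow {R s : ℝ} (hs : 2 < s) (hR : 0 < R) :
    ∫ z, maxPow R s z = (discArea + 2 * discArea / (s - 2)) * R ^ (2 - s) := by
  simp only [maxPow_eq]
  rw [integral_add ((integrable_innerPow (by norm_num) hR).const_mul _) (integrable_outerPow hs hR),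
    integral_const_mul, integral_innerPow (by norm_num) hR, integral_outerPow hs hR,
    show 2 - s = -s + 2 by ring, Real.rpow_add hR]
  simp; ring

/-! ### The Biot–Savart kernel and its truncation -/

/-- The components of the kernel truncated at scale `R`. -/
def truncKernel (α R : ℝ) (i : Fin 2) (z : Plane) : ℝ := perp z i * maxPow R (2 + 2 * α) z

lemma abs_coord_le (z : Plane) (i : Fin 2) : |z i| ≤ ‖z‖ := by
  simpa using PiLp.norm_apply_le z i

lemma norm_perp (z : Plane) : ‖perp z‖ = ‖z‖ := by
  simp [EuclideanSpace.norm_eq, perp, add_comm]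

lemma abs_perp_le (z : Plane) (i : Fin 2) : |perp z i| ≤ ‖z‖ := by
  simpa [norm_perp] using abs_coord_le (perp z) i

lemma perp_add (z w : Plane) : perp (z + w) = perp z + perp w := by
  ext i; fin_cases i <;> simp [perp]; ring

lemma kernel_apply (α : ℝ) (z : Plane) (i : Fin 2) :
    kernel α z i = perp z i * ‖z‖ ^ (-(2 + 2 * α)) := by
  rw [Real.rpow_neg (norm_nonneg _)]
  simp [kernel, mul_comm]

lemma measurable_coord (i : Fin 2) : Measurable (fun z : Plane => z i) := by fun_prop

lemma continuous_perp : Continuous perp := by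
  unfold perp; fun_prop

lemma measurable_kernel (α : ℝ) (i : Fin 2) : Measurable (fun z => kernel α z i) := by
  have h : Measurable (fun z : Plane => perp z i) :=
    (measurable_coord i).comp continuous_perp.measurable
  simp only [kernel_apply]
  exact h.mul (measurable_norm.pow_const _)

lemma measurable_truncKernel (α R : ℝ) (i : Fin 2) : Measurable (truncKernel α R i) := by
  have h : Measurable (fun z : Plane => perp z i) :=
    (measurable_coord i).comp continuous_perp.measurable
  unfold truncKernel maxPow
  exact h.mul ((measurable_norm.max measurable_const).pow_const _)

lemma abs_kernel_le {α : ℝ} (hα : 0 < α) (z : Plane) (i : Fin 2) :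
    |kernel α z i| ≤ ‖z‖ ^ (-(1 + 2 * α)) := by
  rw [kernel_apply, abs_mul, abs_of_nonneg (by positivity : 0 ≤ ‖z‖ ^ (-(2 + 2 * α)))]
  rcases eq_or_ne z 0 with rfl | hz
  · rw [norm_zero, Real.zero_rpow (by linarith)]; simp; positivity
  · have hz : 0 < ‖z‖ := norm_pos_iff.2 hz
    rw [show -(1 + 2 * α) = 1 + -(2 + 2 * α) by ring, Real.rpow_add hz, Real.rpow_one]
    exact mul_le_mul_of_nonneg_right (abs_perp_le z i) (by positivity)

lemma truncKernel_eq_kernel {α R : ℝ} {z : Plane} (i : Fin 2) (hz : R ≤ ‖z‖) :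
    truncKernel α R i z = kernel α z i := by
  rw [kernel_apply, truncKernel, maxPow, max_eq_left hz]

lemma abs_truncKernel_le {α R : ℝ} (hα : 0 < α) (hR : 0 < R) (z : Plane) (i : Fin 2) :
    |truncKernel α R i z| ≤ R ^ (-(1 + 2 * α)) := by
  have hm : R ≤ max ‖z‖ R := le_max_right _ _
  have hm0 : 0 < max ‖z‖ R := hR.trans_le hm
  rw [truncKernel, abs_mul, abs_of_nonneg (maxPow_nonneg _ _ _), maxPow]
  calc |perp z i| * max ‖z‖ R ^ (-(2 + 2 * α))
      ≤ max ‖z‖ R * max ‖z‖ R ^ (-(2 + 2 * α)) := by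
        gcongr
        exact (abs_perp_le z i).trans (le_max_left _ _)
    _ = max ‖z‖ R ^ (-(1 + 2 * α)) := by
        rw [show -(1 + 2 * α) = 1 + -(2 + 2 * α) by ring, Real.rpow_add hm0, Real.rpow_one]
    _ ≤ R ^ (-(1 + 2 * α)) := Real.rpow_le_rpow_of_nonpos hR hm (by linarith)

lemma abs_kernel_sub_truncKernel_le {α R : ℝ} (hα : 0 < α) (z : Plane) (i : Fin 2) :
    |kernel α z i - truncKernel α R i z| ≤ innerPow R (1 + 2 * α) z := by
  unfold innerPow
  split_ifs with h
  · rcases eq_or_ne z 0 with rfl | hz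
    · simp only [truncKernel, kernel, perp]; simp; fin_cases i <;> simp <;> positivity
    have hz : 0 < ‖z‖ := norm_pos_iff.2 hz
    rw [kernel_apply, truncKernel, ← mul_sub, abs_mul]
    have h1 : maxPow R (2 + 2 * α) z ≤ ‖z‖ ^ (-(2 + 2 * α)) := by
      unfold maxPow
      exact Real.rpow_le_rpow_of_nonpos hz (le_max_left _ _) (by linarith)
    have h0 := maxPow_nonneg R (2 + 2 * α) z
    rw [abs_of_nonneg (by linarith : 0 ≤ ‖z‖ ^ (-(2 + 2 * α)) - maxPow R (2 + 2 * α) z)]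
    rw [show -(1 + 2 * α) = 1 + -(2 + 2 * α) by ring, Real.rpow_add hz, Real.rpow_one]
    have := abs_perp_le z i
    gcongr
    linarith
  · rw [truncKernel_eq_kernel i (not_lt.1 h)]; simp

lemma rpow_neg_lipschitz {m m' s : ℝ} (hs : 0 < s) (hm : 0 < m) (h : |m' - m| ≤ m / 2) :
    |m' ^ (-s) - m ^ (-s)| ≤ s * 2 ^ (s + 1) * m ^ (-s - 1) * |m' - m| := by
  have hle : m / 2 ≤ m' := by have := (abs_le.1 h).1; linarith
  have hbd : ∀ x ∈ Ici (m / 2), ‖-s * x ^ (-s - 1)‖ ≤ s * 2 ^ (s + 1) * m ^ (-s - 1) := by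
    intro x hx
    have hx : m / 2 ≤ x := hx
    have hx0 : 0 < x := by linarith
    rw [norm_mul, norm_neg, Real.norm_of_nonneg hs.le, Real.norm_of_nonneg (by positivity), mul_assoc]
    gcongr
    calc x ^ (-s - 1) ≤ (m / 2) ^ (-s - 1) :=
          Real.rpow_le_rpow_of_nonpos (by linarith) hx (by linarith)
      _ = 2 ^ (s + 1) * m ^ (-s - 1) := by
          rw [Real.div_rpow hm.le (by norm_num), show -s - 1 = -(s + 1) by ring,
            Real.rpow_neg (by norm_num : (0 : ℝ) ≤ 2)]
          field_simp
  have := (convex_Ici (m / 2)).norm_image_sub_le_of_norm_hasDerivWithin_le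
    (f := fun x : ℝ => x ^ (-s)) (f' := fun x => -s * x ^ (-s - 1)) (C := s * 2 ^ (s + 1) * m ^ (-s - 1))
    (fun x hx => (Real.hasDerivAt_rpow_const (Or.inl (by
      have : m / 2 ≤ x := hx
      linarith))).hasDerivWithinAt) hbd (x := m) (y := m') (by simp; linarith) hle
  simpa using this

lemma exists_truncKernel_lipschitz {α : ℝ} (hα : 0 < α) : ∃ C : ℝ, 0 < C ∧
    ∀ (R : ℝ) (v z : Plane) (i : Fin 2), 0 < R → ‖v‖ ≤ R / 2 →
      |truncKernel α R i (z + v) - truncKernel α R i z| ≤ C * ‖v‖ * maxPow R (2 + 2 * α) z := by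
  set s := 2 + 2 * α with hs
  have hs0 : 0 < s := by positivity
  refine ⟨2 ^ s + s * 2 ^ (s + 1), by positivity, ?_⟩
  intro R v z i hR hv
  set m := max ‖z‖ R
  set m' := max ‖z + v‖ R
  have hmR : R ≤ m := le_max_right _ _
  have hm : 0 < m := hR.trans_le hmR
  have hm' : 0 < m' := hR.trans_le (le_max_right _ _)
  have hd : |m' - m| ≤ ‖v‖ := by
    calc |m' - m| ≤ max |‖z + v‖ - ‖z‖| |R - R| := abs_max_sub_max_le_max _ _ _ _
      _ ≤ ‖v‖ := by
        simp only [sub_self, abs_zero]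
        refine max_le ?_ (norm_nonneg _)
        simpa using abs_norm_sub_norm_le (z + v) z
  have hdm : |m' - m| ≤ m / 2 := by linarith
  have hlow : m / 2 ≤ m' := by have := (abs_le.1 hdm).1; linarith
  have h1 : m' ^ (-s) ≤ 2 ^ s * m ^ (-s) := by
    calc m' ^ (-s) ≤ (m / 2) ^ (-s) :=
          Real.rpow_le_rpow_of_nonpos (by linarith) hlow (by linarith)
      _ = 2 ^ s * m ^ (-s) := by
          rw [Real.div_rpow hm.le (by norm_num), Real.rpow_neg (by norm_num : (0 : ℝ) ≤ 2)]
          field_simp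
  have h2 := rpow_neg_lipschitz hs0 hm hdm
  have hz : |perp z i| ≤ m := (abs_perp_le z i).trans (le_max_left _ _)
  have heq : truncKernel α R i (z + v) - truncKernel α R i z
      = perp v i * m' ^ (-s) + perp z i * (m' ^ (-s) - m ^ (-s)) := by
    simp only [truncKernel, maxPow, perp_add, PiLp.add_apply, ← hs]; ring
  rw [heq]
  calc _ ≤ |perp v i| * m' ^ (-s) + |perp z i| * |m' ^ (-s) - m ^ (-s)| := by
        refine (abs_add_le _ _).trans ?_
        rw [abs_mul, abs_mul, abs_of_nonneg (by positivity : 0 ≤ m' ^ (-s))]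
    _ ≤ ‖v‖ * (2 ^ s * m ^ (-s)) + m * (s * 2 ^ (s + 1) * m ^ (-s - 1) * ‖v‖) := by
        gcongr
        · exact abs_perp_le v i
        · exact h2.trans (by gcongr)
    _ = (2 ^ s + s * 2 ^ (s + 1)) * ‖v‖ * m ^ (-s) := by
        have : m * m ^ (-s - 1) = m ^ (-s) := by
          rw [Real.rpow_sub hm, Real.rpow_one]; field_simp
        linear_combination (s * 2 ^ (s + 1) * ‖v‖) * this
    _ = _ := by simp only [maxPow]; rfl

/-! ### Reflections and odd extensions -/

/-- Reflection of the `i`-th coordinate as a linear isometry. -/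
def reflect (i : Fin 2) : Plane ≃ₗᵢ[ℝ] Plane :=
  LinearIsometryEquiv.piLpCongrRight 2
    (fun j => if j = i then LinearIsometryEquiv.neg ℝ else LinearIsometryEquiv.refl ℝ ℝ)

lemma reflect_one (z : Plane) : reflect 1 z = bar z := by
  ext j; fin_cases j <;> simp [reflect, bar]

lemma reflect_zero (z : Plane) : reflect 0 z = !₂[-z 0, z 1] := by
  ext j; fin_cases j <;> simp [reflect]

lemma bar_bar (z : Plane) : bar (bar z) = z := by
  ext j; fin_cases j <;> simp [bar]

lemma bar_apply_zero (z : Plane) : bar z 0 = z 0 := by simp [bar]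

lemma bar_apply_one (z : Plane) : bar z 1 = -z 1 := by simp [bar]

lemma norm_bar (z : Plane) : ‖bar z‖ = ‖z‖ := by
  rw [← reflect_one, LinearIsometryEquiv.norm_map]

lemma measurePreserving_bar : MeasurePreserving bar (volume : Measure Plane) volume := by
  have := (reflect 1).measurePreserving
  rwa [show (reflect 1 : Plane → Plane) = bar from funext reflect_one] at this

lemma measurableEmbedding_bar : MeasurableEmbedding bar := by
  have := (reflect 1).toHomeomorph.measurableEmbedding
  have h : ((reflect 1).toHomeomorph : Plane → Plane) = bar := funext reflect_one
  rwa [h] at this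

lemma measurableSet_halfPlane : MeasurableSet halfPlane :=
  measurableSet_lt measurable_const (measurable_coord 1)

lemma isOpen_halfPlane : IsOpen halfPlane :=
  isOpen_lt continuous_const (by fun_prop : Continuous fun x : Plane => x 1)

lemma mem_halfPlane {x : Plane} : x ∈ halfPlane ↔ 0 < x 1 := Iff.rfl

/-- The extension of a function on the half-plane that is odd in the second coordinate. -/
def oddExt (g : Plane → ℝ) (y : Plane) : ℝ :=
  halfPlane.indicator g y - halfPlane.indicator g (bar y)

lemma oddExt_of_pos {g : Plane → ℝ} {y : Plane} (hy : 0 < y 1) : oddExt g y = g y := by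
  have h1 : y ∈ halfPlane := hy
  have h2 : bar y ∉ halfPlane := by simp [mem_halfPlane, bar_apply_one, hy.le]
  simp [oddExt, h1, h2]

lemma oddExt_bar (g : Plane → ℝ) (y : Plane) : oddExt g (bar y) = -oddExt g y := by
  simp [oddExt, bar_bar]

lemma oddExt_of_neg {g : Plane → ℝ} {y : Plane} (hy : y 1 < 0) : oddExt g y = -g (bar y) := by
  rw [← oddExt_of_pos (g := g) (y := bar y) (by simp [bar_apply_one, hy]), oddExt_bar, neg_neg]

lemma oddExt_of_zero {g : Plane → ℝ} {y : Plane} (hy : y 1 = 0) : oddExt g y = 0 := by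
  have h1 : y ∉ halfPlane := by simp [mem_halfPlane, hy]
  have h2 : bar y ∉ halfPlane := by simp [mem_halfPlane, bar_apply_one, hy]
  simp [oddExt, h1, h2]

lemma oddExt_sub (f g : Plane → ℝ) (y : Plane) :
    oddExt (fun y => f y - g y) y = oddExt f y - oddExt g y := by
  rcases lt_trichotomy (y 1) 0 with h | h | h
  · simp [oddExt_of_neg h]; ring
  · simp [oddExt_of_zero h]
  · simp [oddExt_of_pos h]

/-- Functions that are measurable, bounded by `B`, and have `L^1` norm at most `B`. -/
structure Admissible (B : ℝ) (G : Plane → ℝ) : Prop where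
  bound : ∀ y, |G y| ≤ B
  int : Integrable G
  l1 : ∫ y, |G y| ≤ B

lemma Admissible.nonneg {B : ℝ} {G : Plane → ℝ} (h : Admissible B G) : 0 ≤ B :=
  (abs_nonneg _).trans (h.bound 0)

lemma abs_oddExt_le {g : Plane → ℝ} {B : ℝ} (hB : 0 ≤ B) (h : ∀ y ∈ halfPlane, |g y| ≤ B) (y : Plane) :
    |oddExt g y| ≤ B := by
  rcases lt_trichotomy (y 1) 0 with h' | h' | h'
  · rw [oddExt_of_neg h', abs_neg]; exact h _ (by simp [mem_halfPlane, bar_apply_one, h'])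
  · simpa [oddExt_of_zero h'] using hB
  · rw [oddExt_of_pos h']; exact h _ h'

lemma integrable_oddExt {g : Plane → ℝ} (h : IntegrableOn g halfPlane) : Integrable (oddExt g) := by
  have h1 : Integrable (halfPlane.indicator g) := (integrable_indicator_iff measurableSet_halfPlane).2 h
  exact h1.sub ((measurePreserving_bar.integrable_comp_emb measurableEmbedding_bar).2 h1)

lemma admissible_oddExt {g : Plane → ℝ} {B : ℝ} (hB : 0 ≤ B) (h : ∀ y ∈ halfPlane, |g y| ≤ B)
    (hint : IntegrableOn g halfPlane) (hl : ∫ y in halfPlane, |g y| ≤ B) :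
    Admissible (2 * B) (oddExt g) := by
  refine ⟨fun y => (abs_oddExt_le hB h y).trans (by linarith), integrable_oddExt hint, ?_⟩
  have h1 : Integrable (halfPlane.indicator g) := (integrable_indicator_iff measurableSet_halfPlane).2 hint
  have h2 : Integrable (fun y => halfPlane.indicator g (bar y)) :=
    (measurePreserving_bar.integrable_comp_emb measurableEmbedding_bar).2 h1
  have h3 : ∫ y, |halfPlane.indicator g y| = ∫ y in halfPlane, |g y| := by
    rw [← integral_indicator measurableSet_halfPlane]
    congr 1; ext y
    by_cases hy : y ∈ halfPlane <;> simp [hy]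
  have h4 : ∫ y, |halfPlane.indicator g (bar y)| = ∫ y in halfPlane, |g y| := by
    rw [← h3]
    exact measurePreserving_bar.integral_comp measurableEmbedding_bar
      (fun y => |halfPlane.indicator g y|)
  calc ∫ y, |oddExt g y| ≤ ∫ y, (|halfPlane.indicator g y| + |halfPlane.indicator g (bar y)|) := by
        refine integral_mono (integrable_oddExt hint).abs (h1.abs.add h2.abs) fun y => ?_
        exact abs_sub _ _
    _ = 2 * ∫ y in halfPlane, |g y| := by
        rw [integral_add h1.abs h2.abs, h3, h4]; ring
    _ ≤ 2 * B := by linarith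

lemma integral_mul_odd {w G : Plane → ℝ} (hG : ∀ y, G (bar y) = -G y)
    (hint : Integrable (fun y => w y * G y)) :
    ∫ y, w y * G y = ∫ y in halfPlane, (w y - w (bar y)) * G y := by
  have hc : ∫ y in halfPlaneᶜ, w y * G y = ∫ y in halfPlane, w (bar y) * G (bar y) := by
    have h0 : halfPlaneᶜ =ᵐ[volume] bar ⁻¹' halfPlane := by
      have hz : ∀ᵐ y : Plane, y 1 ≠ 0 := by
        have hm : (volume : Measure Plane) (LinearMap.ker
          ((EuclideanSpace.proj (1 : Fin 2) : Plane →L[ℝ] ℝ) : Plane →ₗ[ℝ] ℝ) : Set Plane) = 0 := by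
          refine Measure.addHaar_submodule _ _ fun h => ?_
          have : e 1 ∈ LinearMap.ker
            ((EuclideanSpace.proj (1 : Fin 2) : Plane →L[ℝ] ℝ) : Plane →ₗ[ℝ] ℝ) := h ▸ trivial
          simp [e] at this
        rw [ae_iff]
        convert hm using 2
        ext y; simp
      filter_upwards [hz] with y hy
      apply propext
      change ¬ (0 < y 1) ↔ 0 < bar y 1
      rw [bar_apply_one, not_lt, neg_pos]
      exact ⟨fun h => lt_of_le_of_ne h hy, le_of_lt⟩
    refine (setIntegral_congr_set h0).trans ?_
    have := measurePreserving_bar.setIntegral_preimage_emb measurableEmbedding_bar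
      (fun y => w (bar y) * G (bar y)) halfPlane
    simpa [bar_bar] using this
  have hb : Integrable (fun y => w (bar y) * G (bar y)) :=
    (measurePreserving_bar.integrable_comp_emb measurableEmbedding_bar).2 hint
  rw [← integral_add_compl measurableSet_halfPlane hint, hc,
    ← integral_add hint.integrableOn hb.integrableOn]
  congr 1; ext y; rw [hG]; ring

/-! ### The velocity as a convolution -/

/-- The components of the convolution of the kernel with `G`. -/
def conv (α : ℝ) (G : Plane → ℝ) (i : Fin 2) (x : Plane) : ℝ := ∫ z, kernel α z i * G (x - z)

section
variable {α B : ℝ} {G : Plane → ℝ}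

lemma Admissible.comp_sub (hG : Admissible B G) (x : Plane) : Integrable (fun z => G (x - z)) :=
  hG.int.comp_sub_left x

lemma integrable_near {R : ℝ} (hα : 0 < α) (hα' : α < 1 / 2) (hR : 0 < R) (hG : Admissible B G)
    (i : Fin 2) (x : Plane) :
    Integrable (fun z => (kernel α z i - truncKernel α R i z) * G (x - z)) := by
  refine ((integrable_innerPow (s := 1 + 2 * α) (by linarith) hR).mul_const B).mono'
    (((measurable_kernel α i).sub (measurable_truncKernel α R i)).aestronglyMeasurable.mul
      (hG.comp_sub x).1) (Eventually.of_forall fun z => ?_)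
  rw [Real.norm_eq_abs, abs_mul]
  exact mul_le_mul (abs_kernel_sub_truncKernel_le hα z i) (hG.bound _) (abs_nonneg _)
    (innerPow_nonneg _ _ _)

lemma integrable_far {R : ℝ} (hα : 0 < α) (hR : 0 < R) (hG : Admissible B G)
    (i : Fin 2) (x : Plane) : Integrable (fun z => truncKernel α R i z * G (x - z)) := by
  refine (hG.comp_sub x).bdd_mul (measurable_truncKernel α R i).aestronglyMeasurable
    (c := R ^ (-(1 + 2 * α))) (Eventually.of_forall fun z => ?_)
  exact abs_truncKernel_le hα hR z i

lemma conv_eq_near_add_far {R : ℝ} (hα : 0 < α) (hα' : α < 1 / 2) (hR : 0 < R) (hG : Admissible B G)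
    (i : Fin 2) (x : Plane) :
    conv α G i x = (∫ z, (kernel α z i - truncKernel α R i z) * G (x - z))
      + ∫ z, truncKernel α R i z * G (x - z) := by
  rw [← integral_add (integrable_near hα hα' hR hG i x) (integrable_far hα hR hG i x), conv]
  congr 1; ext z; ring

lemma integrable_conv (hα : 0 < α) (hα' : α < 1 / 2) (hG : Admissible B G)
    (i : Fin 2) (x : Plane) : Integrable (fun z => kernel α z i * G (x - z)) := by
  refine ((integrable_near hα hα' one_pos hG i x).add (integrable_far hα one_pos hG i x)).congr
    (Eventually.of_forall fun z => ?_)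
  simp only [Pi.add_apply]; ring

lemma conv_sub {B' : ℝ} {F : Plane → ℝ} (hα : 0 < α) (hα' : α < 1 / 2) (hG : Admissible B G)
    (hF : Admissible B' F) (i : Fin 2) (x : Plane) :
    conv α (fun y => G y - F y) i x = conv α G i x - conv α F i x := by
  simp only [conv]
  rw [← integral_sub (integrable_conv hα hα' hG i x) (integrable_conv hα hα' hF i x)]
  congr 1; ext z; ring

lemma conv_eq_integral_sub (i : Fin 2) (x : Plane) :
    conv α G i x = ∫ y, kernel α (x - y) i * G y := by
  rw [conv, ← integral_sub_left_eq_self _ volume x]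
  simp

lemma far_shift {R : ℝ} (i : Fin 2) (x v : Plane) :
    ∫ z, truncKernel α R i z * G (x + v - z) = ∫ z, truncKernel α R i (z + v) * G (x - z) := by
  rw [← integral_add_right_eq_self _ v]
  congr 1; ext z; congr 2; abel

lemma integrable_far_shift {R : ℝ} (hα : 0 < α) (hR : 0 < R) (hG : Admissible B G)
    (i : Fin 2) (x v : Plane) : Integrable (fun z => truncKernel α R i (z + v) * G (x - z)) := by
  refine ((integrable_far hα hR hG i (x + v)).comp_add_right v).congr (Eventually.of_forall fun z => ?_)
  simp only; congr 2; abel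

lemma far_diff {R : ℝ} (hα : 0 < α) (hR : 0 < R) (hG : Admissible B G) (i : Fin 2) (x v : Plane) :
    (∫ z, truncKernel α R i z * G (x + v - z)) - ∫ z, truncKernel α R i z * G (x - z)
      = ∫ z, (truncKernel α R i (z + v) - truncKernel α R i z) * G (x - z) := by
  rw [far_shift, ← integral_sub (integrable_far_shift hα hR hG i x v) (integrable_far hα hR hG i x)]
  congr 1; ext z; ring

lemma integrable_far_diff {R : ℝ} (hα : 0 < α) (hR : 0 < R) (hG : Admissible B G) (i : Fin 2)
    (x v : Plane) :
    Integrable fun z => (truncKernel α R i (z + v) - truncKernel α R i z) * G (x - z) := by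
  refine ((integrable_far_shift hα hR hG i x v).sub (integrable_far hα hR hG i x)).congr
    (Eventually.of_forall fun z => ?_)
  simp only [Pi.sub_apply]; ring

lemma integrable_maxPow_mul {R : ℝ} (hα : 0 < α) (hR : 0 < R) (hG : Admissible B G) (x : Plane) :
    Integrable (fun z => maxPow R (2 + 2 * α) z * |G (x - z)|) := by
  refine (integrable_maxPow (s := 2 + 2 * α) (by linarith) hR).mul_bdd (c := B)
    (hG.comp_sub x).abs.1 (Eventually.of_forall fun z => ?_)
  simpa using hG.bound (x - z)

lemma near_diff_le {R L D : ℝ} (hα : 0 < α) (hα' : α < 1 / 2) (hR : 0 < R) (hG : Admissible B G)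
    (i : Fin 2) (x v : Plane)
    (hL : ∀ z : Plane, ‖z‖ < R → |G (x + v - z) - G (x - z)| ≤ L * D) :
    |(∫ z, (kernel α z i - truncKernel α R i z) * G (x + v - z))
      - ∫ z, (kernel α z i - truncKernel α R i z) * G (x - z)|
      ≤ L * D * (2 * discArea / (1 - 2 * α) * R ^ (1 - 2 * α)) := by
  rw [← integral_sub (integrable_near hα hα' hR hG i _) (integrable_near hα hα' hR hG i x),
    ← Real.norm_eq_abs]
  have hI := integral_innerPow (s := 1 + 2 * α) (by linarith) hR
  rw [show (2 : ℝ) - (1 + 2 * α) = 1 - 2 * α by ring] at hI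
  rw [← hI, mul_comm, ← integral_mul_const]
  refine norm_integral_le_of_norm_le
    ((integrable_innerPow (s := 1 + 2 * α) (by linarith) hR).mul_const _)
    (Eventually.of_forall fun z => ?_)
  rw [← mul_sub, Real.norm_eq_abs, abs_mul]
  by_cases hz : ‖z‖ < R
  · exact mul_le_mul (abs_kernel_sub_truncKernel_le hα z i) (hL z hz) (abs_nonneg _)
      (innerPow_nonneg _ _ _)
  · have : innerPow R (1 + 2 * α) z = 0 := by simp [innerPow, hz]
    rw [this, zero_mul, truncKernel_eq_kernel i (not_lt.1 hz)]; simp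

end

/-- Splitting of velocity differences at scale `R`. -/
lemma exists_conv_diff_le {α : ℝ} (hα : 0 < α) (hα' : α < 1 / 2) : ∃ C : ℝ, 0 < C ∧
    ∀ (B R L : ℝ) (G : Plane → ℝ) (i : Fin 2) (x v : Plane), Admissible B G → 0 < R → 0 ≤ L →
      ‖v‖ ≤ R / 2 → (∀ z : Plane, ‖z‖ < R → |G (x + v - z) - G (x - z)| ≤ L * ‖v‖) →
      |conv α G i (x + v) - conv α G i x|
        ≤ C * ‖v‖ * (L * R ^ (1 - 2 * α) + ∫ z, maxPow R (2 + 2 * α) z * |G (x - z)|) := by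
  obtain ⟨C₁, hC₁, hlip⟩ := exists_truncKernel_lipschitz hα
  set C₂ := 2 * discArea / (1 - 2 * α)
  have hC₂ : 0 ≤ C₂ := div_nonneg (by have := discArea_nonneg; linarith) (by linarith)
  refine ⟨C₁ + C₂, by linarith, ?_⟩
  intro B R L G i x v hG hR hL0 hv hL
  have hnear := near_diff_le hα hα' hR hG i x v hL
  have hfar : |(∫ z, truncKernel α R i z * G (x + v - z)) - ∫ z, truncKernel α R i z * G (x - z)|
      ≤ C₁ * ‖v‖ * ∫ z, maxPow R (2 + 2 * α) z * |G (x - z)| := by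
    rw [far_diff hα hR hG, ← integral_const_mul, ← Real.norm_eq_abs]
    refine norm_integral_le_of_norm_le ((integrable_maxPow_mul hα hR hG x).const_mul _)
      (Eventually.of_forall fun z => ?_)
    rw [Real.norm_eq_abs, abs_mul, ← mul_assoc]
    exact mul_le_mul_of_nonneg_right (hlip R v z i hR hv) (abs_nonneg _)
  rw [conv_eq_near_add_far hα hα' hR hG, conv_eq_near_add_far hα hα' hR hG]
  set J := ∫ z, maxPow R (2 + 2 * α) z * |G (x - z)|
  have hJ : 0 ≤ J := integral_nonneg fun z => mul_nonneg (maxPow_nonneg _ _ _) (abs_nonneg _)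
  have hRp : 0 ≤ R ^ (1 - 2 * α) := by positivity
  rw [add_sub_add_comm]
  refine (abs_add_le _ _).trans ((add_le_add hnear hfar).trans ?_)
  have h1 : 0 ≤ C₁ * ‖v‖ * (L * R ^ (1 - 2 * α)) := by positivity
  have h2 : 0 ≤ C₂ * ‖v‖ * J := by positivity
  change L * ‖v‖ * (C₂ * R ^ (1 - 2 * α)) + C₁ * ‖v‖ * J ≤ _
  linarith

lemma ae_ne_zero : ∀ᵐ z : Plane, z ≠ 0 := by
  simp [ae_iff]

lemma integral_maxPow_mul_le {α B R : ℝ} {G : Plane → ℝ} (hα : 0 < α) (hR : 0 < R)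
    (hG : Admissible B G) (x : Plane) :
    ∫ z, maxPow R (2 + 2 * α) z * |G (x - z)|
      ≤ (discArea + discArea / α) * R ^ (-(2 * α)) * B := by
  have h := integral_maxPow (s := 2 + 2 * α) (by linarith) hR
  calc _ ≤ ∫ z, maxPow R (2 + 2 * α) z * B := by
        refine integral_mono (integrable_maxPow_mul hα hR hG x)
          ((integrable_maxPow (s := 2 + 2 * α) (by linarith) hR).mul_const B) fun z => ?_
        exact mul_le_mul_of_nonneg_left (hG.bound _) (maxPow_nonneg _ _ _)
    _ = _ := by
        rw [integral_mul_const, h, show (2 : ℝ) - (2 + 2 * α) = -(2 * α) by ring,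
          show 2 + 2 * α - 2 = 2 * α by ring, mul_div_mul_left _ _ (by norm_num : (2 : ℝ) ≠ 0)]

lemma exists_integral_maxPow_mul_le {α : ℝ} (hα : 0 < α) (hα' : α < 1 / 2) : ∃ C : ℝ, 0 < C ∧
    ∀ (A B R : ℝ) (G : Plane → ℝ) (x : Plane), Admissible B G → 0 < R → 0 ≤ A →
      (∀ z : Plane, ‖z‖ < 1 → |G (x - z)| ≤ A * max ‖z‖ R) →
      ∫ z, maxPow R (2 + 2 * α) z * |G (x - z)| ≤ C * (A + B) := by
  set C₁ := ∫ z, innerPow 1 (1 + 2 * α) z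
  set C₂ := ∫ z, outerPow 1 (2 + 2 * α) z
  have hi := integrable_innerPow (R := 1) (s := 1 + 2 * α) (by linarith) one_pos
  have ho := integrable_outerPow (R := 1) (s := 2 + 2 * α) (by linarith) one_pos
  have hC₁ : 0 ≤ C₁ := integral_nonneg (innerPow_nonneg _ _)
  have hC₂ : 0 ≤ C₂ := integral_nonneg (outerPow_nonneg _ _)
  refine ⟨C₁ + C₂ + 1, by linarith, ?_⟩
  intro A B R G x hG hR hA h
  have hB := hG.nonneg
  calc _ ≤ ∫ z, (A * innerPow 1 (1 + 2 * α) z + B * outerPow 1 (2 + 2 * α) z) := by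
        refine integral_mono_ae (integrable_maxPow_mul hα hR hG x)
          ((hi.const_mul _).add (ho.const_mul _)) ?_
        filter_upwards [ae_ne_zero] with z hz
        have hz : 0 < ‖z‖ := norm_pos_iff.2 hz
        have hm : 0 < max ‖z‖ R := lt_max_of_lt_left hz
        by_cases hz1 : ‖z‖ < 1
        · simp only [innerPow, outerPow, hz1, not_le.2 hz1, if_true, if_false, mul_zero, add_zero]
          calc maxPow R (2 + 2 * α) z * |G (x - z)|
              ≤ maxPow R (2 + 2 * α) z * (A * max ‖z‖ R) :=
                mul_le_mul_of_nonneg_left (h z hz1) (maxPow_nonneg _ _ _)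
            _ = A * max ‖z‖ R ^ (-(1 + 2 * α)) := by
                rw [maxPow, show -(1 + 2 * α) = -(2 + 2 * α) + 1 by ring, Real.rpow_add hm,
                  Real.rpow_one]; ring
            _ ≤ A * ‖z‖ ^ (-(1 + 2 * α)) :=
                mul_le_mul_of_nonneg_left (Real.rpow_le_rpow_of_nonpos hz (le_max_left _ _)
                  (by linarith)) hA
        · have hz1' := not_lt.1 hz1
          simp only [innerPow, outerPow, hz1, hz1', if_true, if_false, mul_zero, zero_add]
          rw [mul_comm]
          refine mul_le_mul (hG.bound _) ?_ (maxPow_nonneg _ _ _) hB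
          exact Real.rpow_le_rpow_of_nonpos hz (le_max_left _ _) (by linarith)
    _ = A * C₁ + B * C₂ := by
        rw [integral_add (hi.const_mul _) (ho.const_mul _), integral_const_mul, integral_const_mul]
    _ ≤ _ := by nlinarith [mul_nonneg hA hC₂, mul_nonneg hB hC₁]

lemma exists_abs_conv_le {α : ℝ} (hα : 0 < α) (hα' : α < 1 / 2) : ∃ C : ℝ, 0 < C ∧
    ∀ (B : ℝ) (G : Plane → ℝ) (i : Fin 2) (x : Plane), Admissible B G → |conv α G i x| ≤ C * B := by
  set C₁ := ∫ z, innerPow 1 (1 + 2 * α) z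
  have hi := integrable_innerPow (R := 1) (s := 1 + 2 * α) (by linarith) one_pos
  have hC₁ : 0 ≤ C₁ := integral_nonneg (innerPow_nonneg _ _)
  refine ⟨C₁ + 1, by linarith, ?_⟩
  intro B G i x hG
  have hB := hG.nonneg
  have hs := (hG.comp_sub x).abs
  calc |conv α G i x| ≤ ∫ z, (B * innerPow 1 (1 + 2 * α) z + |G (x - z)|) := by
        rw [conv, ← Real.norm_eq_abs]
        refine norm_integral_le_of_norm_le ((hi.const_mul _).add hs) (Eventually.of_forall fun z => ?_)
        rw [Real.norm_eq_abs, abs_mul]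
        have hk := abs_kernel_le hα z i
        by_cases hz1 : ‖z‖ < 1
        · simp only [innerPow, hz1, if_true]
          have := mul_le_mul hk (hG.bound (x - z)) (abs_nonneg _) (by positivity)
          have := abs_nonneg (G (x - z))
          linarith
        · have hz1' := not_lt.1 hz1
          simp only [innerPow, hz1, if_false, mul_zero, zero_add]
          have : ‖z‖ ^ (-(1 + 2 * α)) ≤ 1 := Real.rpow_le_one_of_one_le_of_nonpos hz1' (by linarith)
          exact mul_le_of_le_one_left (abs_nonneg _) (hk.trans this)
    _ = B * C₁ + ∫ z, |G z| := by
        rw [integral_add (hi.const_mul _) hs, integral_const_mul,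
          integral_sub_left_eq_self (fun z => |G z|) volume x]
    _ ≤ _ := by linarith [hG.l1]

lemma exists_conv_lipschitz_dir {α : ℝ} (hα : 0 < α) (hα' : α < 1 / 2) : ∃ C : ℝ, 0 < C ∧
    ∀ (B : ℝ) (G : Plane → ℝ) (i : Fin 2) (x v : Plane), Admissible B G →
      (∀ y, |G (y + v) - G y| ≤ B * ‖v‖) → |conv α G i (x + v) - conv α G i x| ≤ C * B * ‖v‖ := by
  obtain ⟨C₀, hC₀, h0⟩ := exists_abs_conv_le hα hα'
  obtain ⟨C₁, hC₁, h1⟩ := exists_conv_diff_le hα hα'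
  set C₂ := discArea + discArea / α
  have hC₂ : 0 ≤ C₂ := add_nonneg discArea_nonneg (div_nonneg discArea_nonneg hα.le)
  refine ⟨4 * C₀ + C₁ * (1 + C₂), by positivity, ?_⟩
  intro B G i x v hG hv
  have hB := hG.nonneg
  by_cases hv1 : ‖v‖ ≤ 1 / 2
  · have := h1 B 1 B G i x v hG one_pos hB hv1 (fun z _ => by
      have := hv (x - z); rwa [show x - z + v = x + v - z by abel] at this)
    have hj := integral_maxPow_mul_le hα one_pos hG x
    rw [Real.one_rpow] at this hj
    refine this.trans ?_
    have hj' : B * 1 + ∫ z, maxPow 1 (2 + 2 * α) z * |G (x - z)| ≤ (1 + C₂) * B := by linarith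
    calc C₁ * ‖v‖ * _ ≤ C₁ * ‖v‖ * ((1 + C₂) * B) := by gcongr
      _ ≤ _ := by
        have : 0 ≤ 4 * C₀ * B * ‖v‖ := by positivity
        linarith
  · have hv1 := not_le.1 hv1
    have a1 := h0 B G i x hG
    have a2 := h0 B G i (x + v) hG
    have a3 : |conv α G i (x + v) - conv α G i x| ≤ 2 * C₀ * B :=
      (abs_sub _ _).trans (by linarith)
    have h5 : 0 ≤ C₁ * (1 + C₂) * B * ‖v‖ := by positivity
    have h6 : 2 * C₀ * B ≤ 4 * C₀ * B * ‖v‖ := by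
      have : 0 ≤ C₀ * B := by positivity
      nlinarith
    linarith

lemma velocity_apply {α B : ℝ} {g : Plane → ℝ} (hα : 0 < α) (hα' : α < 1 / 2)
    (hG : Admissible B (oddExt g)) (x : Plane) (i : Fin 2) :
    velocity α g x i = conv α (oddExt g) i x := by
  have hint : ∀ j, Integrable (fun y => kernel α (x - y) j * oddExt g y) := fun j => by
    have := (integrable_conv hα hα' hG j x).comp_sub_left x
    simpa using this
  have hb : ∀ j, Integrable (fun y => kernel α (x - bar y) j * oddExt g (bar y)) := fun j =>
    (measurePreserving_bar.integrable_comp_emb measurableEmbedding_bar).2 (hint j)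
  have hcoord : ∀ j, IntegrableOn
      (fun y => (g y • (kernel α (x - y) - kernel α (x - bar y))) j) halfPlane := fun j => by
    have h1 := ((hint j).add (hb j)).integrableOn (s := halfPlane)
    refine h1.congr_fun (fun y hy => ?_) measurableSet_halfPlane
    have hy : 0 < y 1 := hy
    simp only [Pi.add_apply, oddExt_bar, oddExt_of_pos hy, PiLp.smul_apply, PiLp.sub_apply, smul_eq_mul]
    ring
  have hall : IntegrableOn (fun y => g y • (kernel α (x - y) - kernel α (x - bar y))) halfPlane := by
    rw [IntegrableOn]
    have : Integrable (fun y => WithLp.ofLp (g y • (kernel α (x - y) - kernel α (x - bar y))))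
        (volume.restrict halfPlane) := Integrable.of_eval hcoord
    have h2 := (EuclideanSpace.equiv (Fin 2) ℝ).symm.toContinuousLinearMap.integrable_comp this
    exact h2
  rw [conv_eq_integral_sub, integral_mul_odd (oddExt_bar g) (hint i), velocity, hpVolume]
  have hp : ∫ y in halfPlane, (g y • (kernel α (x - y) - kernel α (x - bar y))) i
      = (∫ y in halfPlane, g y • (kernel α (x - y) - kernel α (x - bar y))) i :=
    (EuclideanSpace.proj i : Plane →L[ℝ] ℝ).integral_comp_comm hall
  rw [← hp]
  refine setIntegral_congr_fun measurableSet_halfPlane fun y hy => ?_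
  have hy : 0 < y 1 := hy
  simp only [oddExt_of_pos hy, PiLp.smul_apply, PiLp.sub_apply, smul_eq_mul]
  ring

lemma conv_eq_zero_of_odd {α : ℝ} {G : Plane → ℝ} (hG : ∀ y, G (bar y) = -G y) {x : Plane}
    (hx : x 1 = 0) : conv α G 1 x = 0 := by
  have h1 : conv α G 1 x = -conv α G 1 x := by
    rw [conv_eq_integral_sub, ← integral_neg]
    have := measurePreserving_bar.integral_comp measurableEmbedding_bar
      (fun y => kernel α (x - y) 1 * G y)
    rw [← this]
    congr 1; ext y
    have hb : x - bar y = bar (x - y) := by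
      ext j; fin_cases j <;> simp [bar, hx]
    rw [hG, hb, kernel_apply, kernel_apply, norm_bar]
    simp [perp, bar]
  linarith

/-! ### Antisymmetry in the first coordinate -/

lemma norm_reflect (i : Fin 2) (z : Plane) : ‖reflect i z‖ = ‖z‖ := LinearIsometryEquiv.norm_map _ _

lemma perp_reflect (z : Plane) : perp (reflect 0 z) 1 = -perp z 1 := by
  rw [reflect_zero]; simp [perp]

lemma kernel_reflect (α : ℝ) (z : Plane) : kernel α (reflect 0 z) 1 = -kernel α z 1 := by
  rw [kernel_apply, kernel_apply, norm_reflect, perp_reflect]; ring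

lemma truncKernel_reflect (α R : ℝ) (z : Plane) :
    truncKernel α R 1 (reflect 0 z) = -truncKernel α R 1 z := by
  rw [truncKernel, truncKernel, perp_reflect, maxPow, maxPow, norm_reflect]; ring

lemma abs_integral_antisymm_le {w b G : Plane → ℝ} {x : Plane} (hw : ∀ z, w (reflect 0 z) = -w z)
    (hint : Integrable (fun z => w z * G (x - z))) (hb : Integrable b)
    (h : ∀ z, |w z| * |G (x - z) - G (x - reflect 0 z)| ≤ 2 * b z) :
    |∫ z, w z * G (x - z)| ≤ ∫ z, b z := by
  have hmp := (reflect 0).measurePreserving (E := Plane)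
  have hme : MeasurableEmbedding (reflect 0 : Plane → Plane) :=
    (reflect 0).toHomeomorph.measurableEmbedding
  have h1 : ∫ z, w z * G (x - z) = ∫ z, -(w z * G (x - reflect 0 z)) := by
    rw [← hmp.integral_comp hme (fun z => w z * G (x - z))]
    congr 1; ext z; rw [hw]; ring
  have hint2 : Integrable (fun z => -(w z * G (x - reflect 0 z))) := by
    have := (hmp.integrable_comp_emb hme).2 hint
    refine this.congr (Eventually.of_forall fun z => ?_)
    simp [hw]
  have h2 : ∫ z, w z * G (x - z) = ∫ z, 2⁻¹ * (w z * (G (x - z) - G (x - reflect 0 z))) := by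
    have h3 : (2 : ℝ) * ∫ z, w z * G (x - z)
        = ∫ z, w z * (G (x - z) - G (x - reflect 0 z)) := by
      rw [two_mul]
      nth_rewrite 2 [h1]
      rw [← integral_add hint hint2]
      congr 1; ext z; ring
    rw [integral_const_mul, ← h3]; ring
  rw [h2, ← Real.norm_eq_abs]
  refine norm_integral_le_of_norm_le hb (Eventually.of_forall fun z => ?_)
  rw [Real.norm_eq_abs, abs_mul, abs_mul, abs_of_pos (by norm_num : (0 : ℝ) < 2⁻¹)]
  linarith [h z]

lemma norm_smul_e (d : ℝ) (i : Fin 2) : ‖d • e i‖ = |d| := by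
  simp [e, norm_smul]

lemma reflect_add_smul_e (z : Plane) (d : ℝ) : reflect 0 z + d • e 1 = reflect 0 (z + d • e 1) := by
  rw [reflect_zero, reflect_zero]
  ext j; fin_cases j <;> simp [e]

/-- The normal velocity is Lipschitz in the normal direction. -/
lemma exists_conv_normal_lipschitz {α : ℝ} (hα : 0 < α) (hα' : α < 1 / 2) : ∃ C : ℝ, 0 < C ∧
    ∀ (B : ℝ) (G : Plane → ℝ) (x : Plane) (d : ℝ), Admissible B G →
      (∀ y y' : Plane, y 1 = y' 1 → |G y - G y'| ≤ B * |y 0 - y' 0|) →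
      |conv α G 1 (x + d • e 1) - conv α G 1 x| ≤ C * B * |d| := by
  obtain ⟨C₀, hC₀, h0⟩ := exists_abs_conv_le hα hα'
  obtain ⟨C₁, hC₁, hlip⟩ := exists_truncKernel_lipschitz hα
  have hi := integrable_innerPow (R := 1) (s := 1 + 2 * α) (by linarith) one_pos
  have ho := integrable_outerPow (R := 1) (s := 2 + 2 * α) (by linarith) one_pos
  set I₁ := ∫ z, innerPow 1 (1 + 2 * α) z
  set I₂ := ∫ z, outerPow 1 (2 + 2 * α) z
  have hI₁ : 0 ≤ I₁ := integral_nonneg (innerPow_nonneg _ _)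
  have hI₂ : 0 ≤ I₂ := integral_nonneg (outerPow_nonneg _ _)
  set C₂ := 2 * discArea / (2 - 2 * α)
  have hC₂ : 0 ≤ C₂ := div_nonneg (by have := discArea_nonneg; linarith) (by linarith)
  refine ⟨4 * C₀ + (4 * C₂ + C₁ * (I₁ + I₂)), by positivity, ?_⟩
  intro B G x d hG hlipG
  have hB := hG.nonneg
  have hW1 : ∀ x z : Plane, |G (x - z) - G (x - reflect 0 z)| ≤ 2 * (B * ‖z‖) := fun x z => by
    refine (hlipG _ _ (by simp [reflect_zero])).trans ?_
    have h : (x - z) 0 - (x - reflect 0 z) 0 = -(2 * z 0) := by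
      simp [reflect_zero]; ring
    rw [h, abs_neg, abs_mul, abs_two]
    have := mul_le_mul_of_nonneg_left (abs_coord_le z 0) hB
    linarith
  have hW2 : ∀ x z : Plane, |G (x - z) - G (x - reflect 0 z)| ≤ 2 * B := fun x z =>
    (abs_sub _ _).trans (by linarith [hG.bound (x - z), hG.bound (x - reflect 0 z)])
  rcases eq_or_ne d 0 with rfl | hd0
  · simp
  have hd0' : 0 < |d| := abs_pos.2 hd0
  by_cases hd : |d| ≤ 1 / 2
  · set R := 2 * |d| with hR
    have hRpos : 0 < R := by positivity
    have hR1 : R ≤ 1 := by linarith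
    have hRp : R ^ (2 - 2 * α) ≤ R := by
      calc R ^ (2 - 2 * α) ≤ R ^ (1 : ℝ) :=
            Real.rpow_le_rpow_of_exponent_ge hRpos hR1 (by linarith)
        _ = R := Real.rpow_one R
    have hnear : ∀ x, |∫ z, (kernel α z 1 - truncKernel α R 1 z) * G (x - z)| ≤ B * (C₂ * R) := by
      intro x
      have hb := (integrable_innerPow (R := R) (s := 2 * α) (by linarith) hRpos).const_mul B
      refine (abs_integral_antisymm_le (fun z => ?_) (integrable_near hα hα' hRpos hG 1 x) hb
        (fun z => ?_)).trans ?_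
      · rw [kernel_reflect, truncKernel_reflect]; ring
      · have h1 := abs_kernel_sub_truncKernel_le (R := R) hα z 1
        have h2 := mul_le_mul h1 (hW1 x z) (abs_nonneg _) (innerPow_nonneg _ _ _)
        refine h2.trans ?_
        by_cases hz : ‖z‖ < R
        · simp only [innerPow, hz, if_true]
          rcases eq_or_ne z 0 with rfl | hz0
          · simp only [norm_zero]; ring_nf; positivity
          · have hz0 : 0 < ‖z‖ := norm_pos_iff.2 hz0
            rw [show -(2 * α) = -(1 + 2 * α) + 1 by ring, Real.rpow_add hz0, Real.rpow_one]
            apply le_of_eq; ring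
        · simp [innerPow, hz]
      · rw [integral_const_mul, integral_innerPow (by linarith) hRpos]
        gcongr
    have hfar : |(∫ z, truncKernel α R 1 z * G (x + d • e 1 - z)) - ∫ z, truncKernel α R 1 z * G (x - z)|
        ≤ C₁ * |d| * (B * (I₁ + I₂)) := by
      rw [far_diff hα hRpos hG]
      have hb := ((hi.add ho).const_mul (C₁ * |d| * B))
      refine (abs_integral_antisymm_le (fun z => ?_) (integrable_far_diff hα hRpos hG 1 x _) hb
        (fun z => ?_)).trans ?_
      · rw [reflect_add_smul_e, truncKernel_reflect, truncKernel_reflect]; ring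
      · have h1 := hlip R (d • e 1) z 1 hRpos (by rw [norm_smul_e, hR]; linarith)
        rw [norm_smul_e] at h1
        have hm : maxPow R (2 + 2 * α) z * |G (x - z) - G (x - reflect 0 z)|
            ≤ 2 * B * (innerPow 1 (1 + 2 * α) z + outerPow 1 (2 + 2 * α) z) := by
          rcases eq_or_ne z 0 with rfl | hz0
          · have := hW1 x 0
            rw [norm_zero, mul_zero, mul_zero] at this
            have h3 : |G (x - 0) - G (x - reflect 0 0)| = 0 := le_antisymm this (abs_nonneg _)
            rw [h3, mul_zero]
            have := innerPow_nonneg 1 (1 + 2 * α) 0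
            have := outerPow_nonneg 1 (2 + 2 * α) 0
            positivity
          have hz0 : 0 < ‖z‖ := norm_pos_iff.2 hz0
          have hmax : maxPow R (2 + 2 * α) z ≤ ‖z‖ ^ (-(2 + 2 * α)) :=
            Real.rpow_le_rpow_of_nonpos hz0 (le_max_left _ _) (by linarith)
          by_cases hz1 : ‖z‖ < 1
          · simp only [innerPow, outerPow, hz1, not_le.2 hz1, if_true, if_false, add_zero]
            refine (mul_le_mul hmax (hW1 x z) (abs_nonneg _) (by positivity)).trans ?_
            rw [show -(1 + 2 * α) = -(2 + 2 * α) + 1 by ring, Real.rpow_add hz0, Real.rpow_one]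
            apply le_of_eq; ring
          · simp only [innerPow, outerPow, hz1, not_lt.1 hz1, if_true, if_false, zero_add]
            refine (mul_le_mul hmax (hW2 x z) (abs_nonneg _) (by positivity)).trans ?_
            apply le_of_eq; ring
        calc _ ≤ C₁ * |d| * maxPow R (2 + 2 * α) z * |G (x - z) - G (x - reflect 0 z)| :=
              mul_le_mul_of_nonneg_right h1 (abs_nonneg _)
          _ = C₁ * |d| * (maxPow R (2 + 2 * α) z * |G (x - z) - G (x - reflect 0 z)|) := by ring
          _ ≤ C₁ * |d| * (2 * B * (innerPow 1 (1 + 2 * α) z + outerPow 1 (2 + 2 * α) z)) := by gcongr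
          _ = _ := by simp only [Pi.add_apply]; ring
      · rw [integral_const_mul]
        simp only [Pi.add_apply]
        rw [integral_add hi ho]
        apply le_of_eq; ring
    rw [conv_eq_near_add_far hα hα' hRpos hG, conv_eq_near_add_far hα hα' hRpos hG,
      add_sub_add_comm]
    refine (abs_add_le _ _).trans ?_
    have hn := (abs_sub (∫ z, (kernel α z 1 - truncKernel α R 1 z) * G (x + d • e 1 - z))
      (∫ z, (kernel α z 1 - truncKernel α R 1 z) * G (x - z))).trans
      (add_le_add (hnear _) (hnear _))
    have : 0 ≤ C₀ * B * |d| := by positivity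
    rw [hR] at hn
    linarith
  · have hd := not_le.1 hd
    have a3 := (abs_sub (conv α G 1 (x + d • e 1)) (conv α G 1 x)).trans
      (add_le_add (h0 B G 1 _ hG) (h0 B G 1 x hG))
    have h5 : 0 ≤ (4 * C₂ + C₁ * (I₁ + I₂)) * B * |d| := by positivity
    have h6 : 2 * (C₀ * B) ≤ 4 * C₀ * B * |d| := by
      have : 0 ≤ C₀ * B := by positivity
      nlinarith
    linarith

/-! ### Cancellation between the kernel and its image -/

lemma norm_sq_eq (z : Plane) : ‖z‖ ^ 2 = z 0 ^ 2 + z 1 ^ 2 := by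
  rw [EuclideanSpace.norm_sq_eq]; simp

/-- The second kernel component as a function of two real variables. -/
def kerTwo (α a s : ℝ) : ℝ := -a * (a ^ 2 + s ^ 2) ^ (-(1 + α))

lemma kernel_one_eq (α : ℝ) (z : Plane) : kernel α z 1 = kerTwo α (z 0) (z 1) := by
  rw [kernel_apply, kerTwo, ← norm_sq_eq, ← Real.rpow_natCast, ← Real.rpow_mul (norm_nonneg _)]
  simp only [perp]
  congr 2
  push_cast; ring

lemma kerTwo_abs (α a s : ℝ) : kerTwo α a |s| = kerTwo α a s := by simp [kerTwo]

/-- `∂_s` of `kerTwo`. -/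
def kerTwoS (α a s : ℝ) : ℝ := (2 + 2 * α) * (a * s) * (a ^ 2 + s ^ 2) ^ (-(2 + α))

lemma hasDerivAt_kerTwo (α a s : ℝ) (h : 0 < a ^ 2 + s ^ 2) :
    HasDerivAt (kerTwo α a) (kerTwoS α a s) s := by
  have h1 : HasDerivAt (fun s : ℝ => a ^ 2 + s ^ 2) (2 * s) s := by
    simpa using (hasDerivAt_pow 2 s).const_add (a ^ 2)
  have h2 := (h1.rpow_const (p := -(1 + α)) (Or.inl h.ne')).const_mul (-a)
  refine h2.congr_deriv ?_
  rw [kerTwoS, show -(1 + α) - 1 = -(2 + α) by ring]; ring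

lemma hasDerivAt_kerTwoS (α a s : ℝ) (h : 0 < a ^ 2 + s ^ 2) :
    HasDerivAt (fun a => kerTwoS α a s) ((2 + 2 * α) * s * ((a ^ 2 + s ^ 2) ^ (-(2 + α))
      - (4 + 2 * α) * a ^ 2 * (a ^ 2 + s ^ 2) ^ (-(3 + α)))) a := by
  have h1 : HasDerivAt (fun a : ℝ => a ^ 2 + s ^ 2) (2 * a) a := by
    simpa using (hasDerivAt_pow 2 a).add_const (s ^ 2)
  have h0 : HasDerivAt (fun a : ℝ => (2 + 2 * α) * (a * s)) ((2 + 2 * α) * s) a := by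
    simpa using ((hasDerivAt_id a).mul_const s).const_mul (2 + 2 * α)
  have h2 := h0.mul (h1.rpow_const (p := -(2 + α)) (Or.inl h.ne'))
  refine h2.congr_deriv ?_
  rw [show -(2 + α) - 1 = -(3 + α) by ring]; ring

lemma abs_kerTwoS_le {α : ℝ} (hα : 0 < α) (a s : ℝ) (h : 0 < a ^ 2 + s ^ 2) :
    |kerTwoS α a s| ≤ (2 + 2 * α) * (a ^ 2 + s ^ 2) ^ (-(1 + α)) := by
  set ρ := a ^ 2 + s ^ 2
  have h1 : |a * s| ≤ ρ := by
    rw [abs_le]; constructor <;> nlinarith [sq_nonneg (a + s), sq_nonneg (a - s)]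
  rw [kerTwoS, abs_mul, abs_mul, abs_of_pos (by linarith : 0 < 2 + 2 * α),
    abs_of_nonneg (by positivity : 0 ≤ ρ ^ (-(2 + α))), mul_assoc]
  gcongr
  calc |a * s| * ρ ^ (-(2 + α)) ≤ ρ * ρ ^ (-(2 + α)) := by gcongr
    _ = ρ ^ (-(1 + α)) := by
      rw [show -(1 + α) = 1 + -(2 + α) by ring, Real.rpow_add h, Real.rpow_one]

lemma abs_kerTwoSA_le {α : ℝ} (hα : 0 < α) (a s : ℝ) (h : 0 < a ^ 2 + s ^ 2) :
    |(2 + 2 * α) * s * ((a ^ 2 + s ^ 2) ^ (-(2 + α))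
      - (4 + 2 * α) * a ^ 2 * (a ^ 2 + s ^ 2) ^ (-(3 + α)))|
      ≤ (2 + 2 * α) * (5 + 2 * α) * (a ^ 2 + s ^ 2) ^ (-(3 / 2 + α)) := by
  set ρ := a ^ 2 + s ^ 2
  have hs : |s| ≤ ρ ^ (1 / 2 : ℝ) := by
    rw [← Real.sqrt_eq_rpow]; exact Real.abs_le_sqrt (by nlinarith [sq_nonneg a])
  have ha : a ^ 2 ≤ ρ := by nlinarith [sq_nonneg s]
  have h1 : a ^ 2 * ρ ^ (-(3 + α)) ≤ ρ ^ (-(2 + α)) := by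
    calc a ^ 2 * ρ ^ (-(3 + α)) ≤ ρ * ρ ^ (-(3 + α)) := by gcongr
      _ = ρ ^ (-(2 + α)) := by
        rw [show -(2 + α) = 1 + -(3 + α) by ring, Real.rpow_add h, Real.rpow_one]
  have h2 : |ρ ^ (-(2 + α)) - (4 + 2 * α) * a ^ 2 * ρ ^ (-(3 + α))| ≤ (5 + 2 * α) * ρ ^ (-(2 + α)) := by
    have p1 : 0 ≤ ρ ^ (-(2 + α)) := by positivity
    have p2 : 0 ≤ a ^ 2 * ρ ^ (-(3 + α)) := by positivity
    have p3 := mul_le_mul_of_nonneg_left h1 (by linarith : 0 ≤ 4 + 2 * α)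
    have p4 := mul_nonneg (by linarith : 0 ≤ 4 + 2 * α) p2
    rw [abs_le]; constructor <;> linarith
  rw [abs_mul, abs_mul, abs_of_pos (by linarith : 0 < 2 + 2 * α)]
  calc (2 + 2 * α) * |s| * |ρ ^ (-(2 + α)) - (4 + 2 * α) * a ^ 2 * ρ ^ (-(3 + α))|
      ≤ (2 + 2 * α) * ρ ^ (1 / 2 : ℝ) * ((5 + 2 * α) * ρ ^ (-(2 + α))) := by gcongr
    _ = (2 + 2 * α) * (5 + 2 * α) * (ρ ^ (1 / 2 : ℝ) * ρ ^ (-(2 + α))) := by ring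
    _ = _ := by rw [← Real.rpow_add h]; congr 2; ring

lemma rpow_neg_half_le {r ρ t : ℝ} (ht : 0 ≤ t) (hr : 0 < r) (h : r ^ 2 / 4 ≤ ρ) :
    ρ ^ (-t) ≤ 4 ^ t * r ^ (-(2 * t)) := by
  calc ρ ^ (-t) ≤ (r ^ 2 / 4) ^ (-t) :=
        Real.rpow_le_rpow_of_nonpos (by positivity) h (by linarith)
    _ = 4 ^ t * r ^ (-(2 * t)) := by
      rw [Real.div_rpow (by positivity) (by norm_num), Real.rpow_neg (by norm_num : (0 : ℝ) ≤ 4),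
        ← Real.rpow_natCast r 2, ← Real.rpow_mul hr.le]
      rw [show ((2 : ℕ) : ℝ) * -t = -(2 * t) by push_cast; ring]
      field_simp

lemma kerTwo_diff_le {α a s s' r : ℝ} (hα : 0 < α) (hr : 0 < r)
    (h : ∀ σ ∈ uIcc s s', r ^ 2 ≤ a ^ 2 + σ ^ 2) :
    |kerTwo α a s' - kerTwo α a s|
      ≤ (2 + 2 * α) * 4 ^ (1 + α) * r ^ (-(2 + 2 * α)) * |s' - s| := by
  have := (convex_uIcc s s').norm_image_sub_le_of_norm_hasDerivWithin_le
    (f := kerTwo α a) (f' := kerTwoS α a) (C := (2 + 2 * α) * 4 ^ (1 + α) * r ^ (-(2 + 2 * α)))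
    (fun σ hσ => (hasDerivAt_kerTwo α a σ (lt_of_lt_of_le (by positivity) (h σ hσ))).hasDerivWithinAt)
    (fun σ hσ => ?_) left_mem_uIcc right_mem_uIcc
  · simpa using this
  · have h1 := h σ hσ
    have hpos : 0 < a ^ 2 + σ ^ 2 := lt_of_lt_of_le (by positivity) h1
    refine (abs_kerTwoS_le hα a σ hpos).trans ?_
    rw [mul_assoc]
    gcongr
    have := rpow_neg_half_le (t := 1 + α) (ρ := a ^ 2 + σ ^ 2) (by linarith) hr
      (by nlinarith [sq_nonneg r])
    rwa [show 2 * (1 + α) = 2 + 2 * α by ring] at this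

lemma kerTwo_mixed_diff_le {α a d s s' r : ℝ} (hα : 0 < α) (hr : 0 < r) (hd : |d| ≤ r / 2)
    (h : ∀ σ ∈ uIcc s s', r ^ 2 ≤ a ^ 2 + σ ^ 2) :
    |(kerTwo α (a + d) s' - kerTwo α a s') - (kerTwo α (a + d) s - kerTwo α a s)|
      ≤ (2 + 2 * α) * (5 + 2 * α) * 4 ^ (3 / 2 + α) * r ^ (-(3 + 2 * α)) * |d| * |s' - s| := by
  have hlow : ∀ σ ∈ uIcc s s', ∀ b ∈ uIcc a (a + d), r ^ 2 / 4 ≤ b ^ 2 + σ ^ 2 := by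
    intro σ hσ b hb
    have h1 := h σ hσ
    have h2 : |b - a| ≤ |d| := by
      have := abs_sub_left_of_mem_uIcc hb
      simpa using this
    have h3 : (b - a) ^ 2 ≤ r ^ 2 / 4 := by
      have : |b - a| ≤ r / 2 := h2.trans hd
      have := sq_le_sq' (by linarith [abs_nonneg (b - a)] : -(r / 2) ≤ |b - a|) this
      rw [sq_abs] at this; linarith
    nlinarith [sq_nonneg (2 * b - a), sq_nonneg σ]
  have hr4 : (0 : ℝ) < r ^ 2 / 4 := by positivity
  have := (convex_uIcc s s').norm_image_sub_le_of_norm_hasDerivWithin_le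
    (f := fun σ => kerTwo α (a + d) σ - kerTwo α a σ)
    (f' := fun σ => kerTwoS α (a + d) σ - kerTwoS α a σ)
    (C := (2 + 2 * α) * (5 + 2 * α) * 4 ^ (3 / 2 + α) * r ^ (-(3 + 2 * α)) * |d|)
    (fun σ hσ => ((hasDerivAt_kerTwo α (a + d) σ
        (hr4.trans_le (hlow σ hσ _ right_mem_uIcc))).sub
      (hasDerivAt_kerTwo α a σ (hr4.trans_le (hlow σ hσ _ left_mem_uIcc)))).hasDerivWithinAt)
    (fun σ hσ => ?_) left_mem_uIcc right_mem_uIcc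
  · simpa using this
  · have h2 := (convex_uIcc a (a + d)).norm_image_sub_le_of_norm_hasDerivWithin_le
      (f := fun b => kerTwoS α b σ) (C := (2 + 2 * α) * (5 + 2 * α) * 4 ^ (3 / 2 + α) * r ^ (-(3 + 2 * α)))
      (fun b hb => (hasDerivAt_kerTwoS α b σ (hr4.trans_le (hlow σ hσ b hb))).hasDerivWithinAt)
      (fun b hb => ?_) left_mem_uIcc right_mem_uIcc
    · simpa using h2
    · refine (abs_kerTwoSA_le hα b σ (hr4.trans_le (hlow σ hσ b hb))).trans ?_
      rw [mul_assoc _ (4 ^ (3 / 2 + α) : ℝ)]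
      gcongr
      have := rpow_neg_half_le (t := 3 / 2 + α) (ρ := b ^ 2 + σ ^ 2) (by linarith) hr
        (hlow σ hσ b hb)
      rwa [show 2 * (3 / 2 + α) = 3 + 2 * α by ring] at this

lemma image_path {x y : Plane} (hx : 0 < x 1) (hy : 0 < y 1) :
    (∀ σ ∈ uIcc |(x - y) 1| ((x - bar y) 1), ‖x - y‖ ^ 2 ≤ (x - y) 0 ^ 2 + σ ^ 2) ∧
      |(x - bar y) 1 - (|(x - y) 1|)| ≤ 2 * x 1 := by
  have h1 : (x - bar y) 1 = x 1 + y 1 := by simp [bar]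
  have h2 : (x - y) 1 = x 1 - y 1 := by simp
  have h3 : |x 1 - y 1| ≤ x 1 + y 1 := by
    rw [abs_le]; constructor <;> linarith
  rw [h1, h2]
  constructor
  · intro σ hσ
    rw [uIcc_of_le h3] at hσ
    rw [norm_sq_eq, h2]
    have := sq_le_sq' (by linarith [abs_nonneg (x 1 - y 1), hσ.1] : -σ ≤ |x 1 - y 1|) hσ.1
    rw [sq_abs] at this
    linarith
  · rw [abs_of_nonneg (by linarith)]
    have := neg_abs_le (x 1 - y 1)
    linarith [le_abs_self (x 1 - y 1), neg_abs_le (x 1 - y 1)]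

lemma exists_kernel_image_le {α : ℝ} (hα : 0 < α) : ∃ C : ℝ, 0 < C ∧
    ∀ x y : Plane, 0 < x 1 → 0 < y 1 → 0 < ‖x - y‖ →
      |kernel α (x - y) 1 - kernel α (x - bar y) 1| ≤ C * x 1 * ‖x - y‖ ^ (-(2 + 2 * α)) := by
  refine ⟨2 * ((2 + 2 * α) * 4 ^ (1 + α)), by positivity, fun x y hx hy hr => ?_⟩
  obtain ⟨h1, h2⟩ := image_path hx hy
  have h3 := kerTwo_diff_le hα hr h1
  have h0 : (x - bar y) 0 = (x - y) 0 := by simp [bar]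
  rw [kernel_one_eq, kernel_one_eq, h0, ← kerTwo_abs α _ ((x - y) 1), abs_sub_comm]
  refine h3.trans ?_
  calc _ ≤ (2 + 2 * α) * 4 ^ (1 + α) * ‖x - y‖ ^ (-(2 + 2 * α)) * (2 * x 1) := by gcongr
    _ = _ := by ring

lemma exists_kernel_image_diff_le {α : ℝ} (hα : 0 < α) : ∃ C : ℝ, 0 < C ∧
    ∀ (x y : Plane) (d : ℝ), 0 < x 1 → 0 < y 1 → 0 < ‖x - y‖ → |d| ≤ ‖x - y‖ / 2 →
      |(kernel α (x - y + d • e 0) 1 - kernel α (x - y) 1)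
        - (kernel α (x - bar y + d • e 0) 1 - kernel α (x - bar y) 1)|
        ≤ C * |d| * x 1 * ‖x - y‖ ^ (-(3 + 2 * α)) := by
  refine ⟨2 * ((2 + 2 * α) * (5 + 2 * α) * 4 ^ (3 / 2 + α)), by positivity,
    fun x y d hx hy hr hd => ?_⟩
  obtain ⟨h1, h2⟩ := image_path hx hy
  have h3 := kerTwo_mixed_diff_le hα hr hd h1
  have h0 : (x - bar y) 0 = (x - y) 0 := by simp [bar]
  have h4 : ∀ z : Plane, (z + d • e 0) 0 = z 0 + d ∧ (z + d • e 0) 1 = z 1 := fun z => by simp [e]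
  rw [kernel_one_eq, kernel_one_eq, kernel_one_eq, kernel_one_eq, (h4 _).1, (h4 _).2, (h4 _).1,
    (h4 _).2, h0, ← kerTwo_abs α _ ((x - y) 1), ← kerTwo_abs α ((x - y) 0) ((x - y) 1), abs_sub_comm]
  refine h3.trans ?_
  calc _ ≤ (2 + 2 * α) * (5 + 2 * α) * 4 ^ (3 / 2 + α) * ‖x - y‖ ^ (-(3 + 2 * α)) * |d| * (2 * x 1) := by
        gcongr
    _ = _ := by ring

lemma integral_le_of_halfPlane {b : Plane → ℝ} (hb : Integrable b) (h0 : ∀ z, 0 ≤ b z) :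
    ∫ y in halfPlane, b y ≤ ∫ y, b y :=
  setIntegral_le_integral hb (Eventually.of_forall h0)

lemma norm_sub_le_norm_sub_bar {x y : Plane} (hx : 0 < x 1) (hy : 0 < y 1) :
    ‖x - y‖ ≤ ‖x - bar y‖ := by
  refine le_of_sq_le_sq ?_ (norm_nonneg _)
  rw [norm_sq_eq, norm_sq_eq]
  simp [bar]
  nlinarith [mul_pos hx hy]

lemma bar_add_smul_e_zero (y : Plane) (d : ℝ) : bar y + d • e 0 = bar (y + d • e 0) := by
  ext j; fin_cases j <;> simp [bar, e]

lemma maxPow_anti {R s : ℝ} (hR : 0 < R) (hs : 0 ≤ s) {z w : Plane} (h : ‖z‖ ≤ ‖w‖) :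
    maxPow R s w ≤ maxPow R s z :=
  Real.rpow_le_rpow_of_nonpos (lt_max_of_lt_right hR) (max_le_max_right _ h) (by linarith)

/-- Tangential differences of the normal velocity generated by a function that is small near `x`. -/
lemma exists_conv_tangential_le {α κ : ℝ} (hα : 0 < α) (hα' : α < 1 / 2) (hκ' : κ < 2 * α) :
    ∃ C : ℝ, 0 < C ∧
    ∀ (B R L A₁ A : ℝ) (F : Plane → ℝ) (x : Plane) (d : ℝ), Admissible B F →
      (∀ y, F (bar y) = -F y) → 0 < R → R ≤ x 1 / 4 → x 1 ≤ 1 / 2 → |d| ≤ R / 2 →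
      0 ≤ L → 0 ≤ A₁ → 0 ≤ A →
      (∀ z : Plane, ‖z‖ < R → |F (x + d • e 0 - z) - F (x - z)| ≤ L * |d|) →
      (∀ y ∈ halfPlane, ‖x - y‖ < x 1 → |F y| ≤ A₁) →
      (∀ y ∈ halfPlane, x 1 ≤ ‖x - y‖ → ‖x - y‖ < 1 / 2 → |F y| ≤ A * ‖x - y‖ ^ (1 + κ)) →
      |conv α F 1 (x + d • e 0) - conv α F 1 x|
        ≤ C * |d| * (L * R ^ (1 - 2 * α) + A₁ * R ^ (-(2 * α)) + A * x 1 ^ (1 - 2 * α + κ)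
          + B * x 1) := by
  obtain ⟨C₁, hC₁, hlip⟩ := exists_truncKernel_lipschitz hα
  obtain ⟨C₂, hC₂, himg⟩ := exists_kernel_image_diff_le hα
  set D₀ := 2 * discArea / (1 - 2 * α)
  have hda := discArea_nonneg
  have hD₀ : 0 ≤ D₀ := div_nonneg (by linarith) (by linarith)
  set D₁ := discArea + 2 * discArea / (2 + 2 * α - 2)
  have hD₁ : 0 ≤ D₁ := add_nonneg hda (div_nonneg (by linarith) (by linarith))
  set D₂ := 2 * discArea / (2 + 2 * α - κ - 2)
  have hD₂ : 0 ≤ D₂ := div_nonneg (by linarith) (by linarith)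
  set D₃ := ∫ z, outerPow (1 / 2) (3 + 2 * α) z
  have hD₃ : 0 ≤ D₃ := integral_nonneg (outerPow_nonneg _ _)
  refine ⟨D₀ + 2 * C₁ * D₁ + C₂ * D₂ + C₂ * D₃ + 1, by positivity, ?_⟩
  intro B R L A₁ A F x d hF hodd hR hRx hx1 hd hL0 hA₁ hA hL h1 h2
  set h := x 1 with hh
  have hh0 : 0 < h := by linarith
  have hB := hF.nonneg
  set m : Plane → ℝ := fun z => truncKernel α R 1 (z + d • e 0) - truncKernel α R 1 z with hm
  have hnear := near_diff_le (D := |d|) hα hα' hR hF 1 x (d • e 0) hL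
  have hmint := integrable_far_diff hα hR hF 1 x (d • e 0)
  have hi₁ := integrable_maxPow (s := 2 + 2 * α) (by linarith) hR
  have hi₂ := integrable_outerPow (R := h) (s := 2 + 2 * α - κ) (by linarith) hh0
  have hi₃ := integrable_outerPow (R := 1 / 2) (s := 3 + 2 * α) (by linarith) (by norm_num)
  set b : Plane → ℝ := fun z => |d| * (2 * C₁ * A₁ * maxPow R (2 + 2 * α) z
    + C₂ * A * h * outerPow h (2 + 2 * α - κ) z + C₂ * B * h * outerPow (1 / 2) (3 + 2 * α) z) with hbdef
  have hb0 : ∀ z, 0 ≤ b z := fun z => by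
    have := maxPow_nonneg R (2 + 2 * α) z
    have := outerPow_nonneg h (2 + 2 * α - κ) z
    have := outerPow_nonneg (1 / 2) (3 + 2 * α) z
    positivity
  have hbi : Integrable b :=
    ((((hi₁.const_mul _).add (hi₂.const_mul _)).add (hi₃.const_mul _)).const_mul _)
  have hbI : ∫ z, b z = |d| * (2 * C₁ * A₁ * (D₁ * R ^ (-(2 * α))) + C₂ * A * h * (D₂ * h ^ (κ - 2 * α))
      + C₂ * B * h * D₃) := by
    have h12 : Integrable (fun z => 2 * C₁ * A₁ * maxPow R (2 + 2 * α) z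
        + C₂ * A * h * outerPow h (2 + 2 * α - κ) z) := (hi₁.const_mul _).add (hi₂.const_mul _)
    rw [hbdef, integral_const_mul, integral_add h12 (hi₃.const_mul _),
      integral_add (hi₁.const_mul _) (hi₂.const_mul _), integral_const_mul,
      integral_const_mul, integral_const_mul, integral_maxPow (by linarith) hR,
      integral_outerPow (by linarith) hh0, show (2 : ℝ) - (2 + 2 * α) = -(2 * α) by ring,
      show (2 : ℝ) - (2 + 2 * α - κ) = κ - 2 * α by ring]
  have hfar : |(∫ z, truncKernel α R 1 z * F (x + d • e 0 - z)) - ∫ z, truncKernel α R 1 z * F (x - z)|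
      ≤ ∫ z, b z := by
    rw [far_diff hα hR hF]
    have hm1 : ∫ z, m z * F (x - z) = ∫ y, m (x - y) * F y := by
      rw [← integral_sub_left_eq_self _ volume x]; simp
    have hm2 : Integrable (fun y => m (x - y) * F y) := by
      have := hmint.comp_sub_left x
      simpa using this
    change |∫ z, m z * F (x - z)| ≤ _
    rw [hm1, integral_mul_odd hodd hm2]
    have hbs : Integrable (fun y => b (x - y)) := hbi.comp_sub_left x
    have hbs' : ∫ y, b (x - y) = ∫ z, b z := integral_sub_left_eq_self b volume x
    rw [← hbs', ← Real.norm_eq_abs]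
    refine le_trans ?_ (integral_le_of_halfPlane hbs (fun y => hb0 _))
    refine norm_integral_le_of_norm_le hbs.integrableOn ?_
    filter_upwards [ae_restrict_mem measurableSet_halfPlane, ae_restrict_of_ae
      (Measure.ae_ne volume x)] with y hy hyx
    have hy : 0 < y 1 := hy
    have hr : 0 < ‖x - y‖ := norm_pos_iff.2 (sub_ne_zero.2 hyx.symm)
    have hbar := norm_sub_le_norm_sub_bar hh0 hy
    rw [Real.norm_eq_abs, abs_mul]
    have p1 := maxPow_nonneg R (2 + 2 * α) (x - y)
    have p2 := outerPow_nonneg h (2 + 2 * α - κ) (x - y)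
    have p3 := outerPow_nonneg (1 / 2) (3 + 2 * α) (x - y)
    by_cases hrh : ‖x - y‖ < h
    · have e1 := hlip R (d • e 0) (x - y) 1 hR (by rwa [norm_smul_e])
      have e2 := hlip R (d • e 0) (x - bar y) 1 hR (by rwa [norm_smul_e])
      rw [norm_smul_e] at e1 e2
      have e3 := maxPow_anti (s := 2 + 2 * α) hR (by linarith) hbar
      have e4 : |m (x - y) - m (x - bar y)| ≤ 2 * C₁ * |d| * maxPow R (2 + 2 * α) (x - y) := by
        refine (abs_sub _ _).trans ((add_le_add e1 e2).trans ?_)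
        have := mul_le_mul_of_nonneg_left e3 (by positivity : 0 ≤ C₁ * |d|)
        linarith
      calc _ ≤ 2 * C₁ * |d| * maxPow R (2 + 2 * α) (x - y) * A₁ :=
            mul_le_mul e4 (h1 y hy hrh) (abs_nonneg _) (by positivity)
        _ = |d| * (2 * C₁ * A₁ * maxPow R (2 + 2 * α) (x - y) + 0 + 0) := by ring
        _ ≤ _ := by
            refine mul_le_mul_of_nonneg_left ?_ (abs_nonneg _)
            gcongr <;> positivity
    · have hrh := not_lt.1 hrh
      have hd4 : |d| ≤ ‖x - y‖ / 2 := by linarith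
      have hbig : ∀ z : Plane, h ≤ ‖z‖ → m z = kernel α (z + d • e 0) 1 - kernel α z 1 := by
        intro z hz
        rw [hm]; simp only
        have := norm_sub_le_norm_add z (d • e 0)
        rw [norm_smul_e] at this
        rw [truncKernel_eq_kernel 1 (by linarith), truncKernel_eq_kernel 1 (by linarith)]
      have e1 := himg x y d hh0 hy hr hd4
      rw [hbig _ hrh, hbig _ (hrh.trans hbar)]
      by_cases hr2 : ‖x - y‖ < 1 / 2
      · calc _ ≤ C₂ * |d| * h * ‖x - y‖ ^ (-(3 + 2 * α)) * (A * ‖x - y‖ ^ (1 + κ)) :=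
              mul_le_mul e1 (h2 y hy hrh hr2) (abs_nonneg _) (by positivity)
          _ = |d| * (0 + C₂ * A * h * outerPow h (2 + 2 * α - κ) (x - y) + 0) := by
              have : ‖x - y‖ ^ (-(3 + 2 * α)) * ‖x - y‖ ^ (1 + κ) = outerPow h (2 + 2 * α - κ) (x - y) := by
                rw [outerPow, if_pos hrh, ← Real.rpow_add hr]; congr 1; ring
              rw [← this]; ring
          _ ≤ _ := by
              refine mul_le_mul_of_nonneg_left ?_ (abs_nonneg _)
              gcongr <;> positivity
      · calc _ ≤ C₂ * |d| * h * ‖x - y‖ ^ (-(3 + 2 * α)) * B :=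
              mul_le_mul e1 (hF.bound y) (abs_nonneg _) (by positivity)
          _ = |d| * (0 + 0 + C₂ * B * h * outerPow (1 / 2) (3 + 2 * α) (x - y)) := by
              rw [outerPow, if_pos (not_lt.1 hr2)]; ring
          _ ≤ _ := by
              refine mul_le_mul_of_nonneg_left ?_ (abs_nonneg _)
              gcongr <;> positivity
  rw [conv_eq_near_add_far hα hα' hR hF, conv_eq_near_add_far hα hα' hR hF, add_sub_add_comm]
  refine (abs_add_le _ _).trans ((add_le_add hnear hfar).trans ?_)
  rw [hbI]
  have hpow : h * h ^ (κ - 2 * α) = h ^ (1 - 2 * α + κ) := by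
    rw [show 1 - 2 * α + κ = 1 + (κ - 2 * α) by ring, Real.rpow_add hh0, Real.rpow_one]
  have q0 : 0 ≤ L * R ^ (1 - 2 * α) := by positivity
  have q1 : 0 ≤ A₁ * R ^ (-(2 * α)) := by positivity
  have q2 : 0 ≤ A * h ^ (1 - 2 * α + κ) := by positivity
  have q3 : 0 ≤ B * h := by positivity
  have hgoal : L * |d| * (D₀ * R ^ (1 - 2 * α)) + |d| * (2 * C₁ * A₁ * (D₁ * R ^ (-(2 * α)))
      + C₂ * A * h * (D₂ * h ^ (κ - 2 * α)) + C₂ * B * h * D₃)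
      = |d| * (D₀ * (L * R ^ (1 - 2 * α)) + 2 * C₁ * D₁ * (A₁ * R ^ (-(2 * α)))
        + C₂ * D₂ * (A * h ^ (1 - 2 * α + κ)) + C₂ * D₃ * (B * h)) := by
    rw [← hpow]; ring
  rw [hgoal]
  have hgoal2 : ∀ K, K * |d| * (L * R ^ (1 - 2 * α) + A₁ * R ^ (-(2 * α)) + A * h ^ (1 - 2 * α + κ) + B * h)
      = |d| * (K * (L * R ^ (1 - 2 * α)) + K * (A₁ * R ^ (-(2 * α)))
        + K * (A * h ^ (1 - 2 * α + κ)) + K * (B * h)) := fun K => by ring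
  rw [hgoal2]
  have k1 : 0 ≤ 2 * C₁ * D₁ := by positivity
  have k2 : 0 ≤ C₂ * D₂ := by positivity
  have k3 : 0 ≤ C₂ * D₃ := by positivity
  gcongr <;> linarith

/-! ### Velocity differences as integrals of differences -/

lemma integrable_kernel_diff {α B : ℝ} {G : Plane → ℝ} (hα : 0 < α) (hα' : α < 1 / 2)
    (hG : Admissible B G) (i : Fin 2) (x v : Plane) :
    Integrable (fun y => kernel α (x - y) i * (G (y + v) - G y)) := by
  have h1 := (integrable_conv hα hα' hG i (x + v)).comp_sub_left x
  have h2 := (integrable_conv hα hα' hG i x).comp_sub_left x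
  refine (h1.sub h2).congr (Eventually.of_forall fun y => ?_)
  simp only [Pi.sub_apply]
  rw [show x + v - (x - y) = y + v by abel, show x - (x - y) = y by abel]; ring

lemma conv_add_sub {α B : ℝ} {G : Plane → ℝ} (hα : 0 < α) (hα' : α < 1 / 2)
    (hG : Admissible B G) (i : Fin 2) (x v : Plane) :
    conv α G i (x + v) - conv α G i x = ∫ y, kernel α (x - y) i * (G (y + v) - G y) := by
  rw [conv, conv, ← integral_sub (integrable_conv hα hα' hG i (x + v)) (integrable_conv hα hα' hG i x),
    ← integral_sub_left_eq_self _ volume x]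
  congr 1; ext y
  rw [show x + v - (x - y) = y + v by abel, show x - (x - y) = y by abel]; ring

lemma conv_add_sub_odd {α B : ℝ} {G : Plane → ℝ} (hα : 0 < α) (hα' : α < 1 / 2)
    (hG : Admissible B G) (hodd : ∀ y, G (bar y) = -G y) (x : Plane) (d : ℝ) :
    conv α G 1 (x + d • e 0) - conv α G 1 x
      = ∫ y in halfPlane, (kernel α (x - y) 1 - kernel α (x - bar y) 1) * (G (y + d • e 0) - G y) := by
  rw [conv_add_sub hα hα' hG]
  exact integral_mul_odd (w := fun y => kernel α (x - y) 1) (G := fun y => G (y + d • e 0) - G y)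
    (fun y => by rw [bar_add_smul_e_zero, hodd, hodd]; ring)
    (integrable_kernel_diff hα hα' hG 1 x _)

lemma integrableOn_kernel_diff_odd {α B : ℝ} {G : Plane → ℝ} (hα : 0 < α) (hα' : α < 1 / 2)
    (hG : Admissible B G) (hodd : ∀ y, G (bar y) = -G y) (x : Plane) (d : ℝ) :
    IntegrableOn (fun y => (kernel α (x - y) 1 - kernel α (x - bar y) 1) * (G (y + d • e 0) - G y))
      halfPlane := by
  have h1 := integrable_kernel_diff hα hα' hG 1 x (d • e 0)
  have h2 := (measurePreserving_bar.integrable_comp_emb measurableEmbedding_bar).2 h1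
  refine ((h1.add h2).congr (Eventually.of_forall fun y => ?_)).integrableOn
  simp only [Pi.add_apply, Function.comp_apply, bar_add_smul_e_zero, hodd]; ring

/-- The set of points whose coordinates lie in `s` and `t`. -/
def prodSet (s t : Set ℝ) : Set Plane := {y | y 0 ∈ s ∧ y 1 ∈ t}

lemma measurableSet_prodSet {s t : Set ℝ} (hs : MeasurableSet s) (ht : MeasurableSet t) :
    MeasurableSet (prodSet s t) :=
  (measurable_coord 0 hs).inter (measurable_coord 1 ht)

lemma volume_prodSet (s t : Set ℝ) (hs : MeasurableSet s) (ht : MeasurableSet t) :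
    volume (prodSet s t) = volume s * volume t := by
  have h := (PiLp.volume_preserving_ofLp (Fin 2)).measure_preimage
    (s := Set.pi univ ![s, t])
    (MeasurableSet.univ_pi (fun i => by fin_cases i <;> simpa)).nullMeasurableSet
  have h2 : (WithLp.ofLp : Plane → (Fin 2 → ℝ)) ⁻¹' Set.pi univ ![s, t] = prodSet s t := by
    ext y; simp [prodSet, Set.mem_pi, Fin.forall_fin_two]
  rw [h2] at h
  rw [h, volume_pi_pi]; simp

lemma integrable_indicator_prodSet {s t : Set ℝ} (hs : MeasurableSet s) (ht : MeasurableSet t)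
    (hs' : volume s ≠ ∞) (ht' : volume t ≠ ∞) (c : ℝ) :
    Integrable ((prodSet s t).indicator (fun _ => c)) := by
  rw [integrable_indicator_iff (measurableSet_prodSet hs ht)]
  exact integrableOn_const (by rw [volume_prodSet s t hs ht]; exact ENNReal.mul_ne_top hs' ht')

lemma integral_indicator_prodSet {s t : Set ℝ} (hs : MeasurableSet s) (ht : MeasurableSet t) (c : ℝ) :
    ∫ y, (prodSet s t).indicator (fun _ => c) y = volume.real s * volume.real t * c := by
  rw [integral_indicator_const _ (measurableSet_prodSet hs ht), measureReal_def,
    volume_prodSet s t hs ht, ENNReal.toReal_mul]; rfl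

/-! ### The velocity of a box -/

/-- The indicator function of `{|y₀ - a| < 1/2, 0 < y₁ < 1}`. -/
def box (a : ℝ) (y : Plane) : ℝ := if |y 0 - a| < 1 / 2 ∧ y 1 < 1 then 1 else 0

lemma abs_box_le (a : ℝ) (y : Plane) : |box a y| ≤ 1 := by
  unfold box; split_ifs <;> simp

lemma integrableOn_box (a : ℝ) : IntegrableOn (box a) halfPlane ∧ ∫ y in halfPlane, |box a y| = 1 := by
  have hI : MeasurableSet (Ioo (a - 1 / 2) (a + 1 / 2)) := measurableSet_Ioo
  have heq : EqOn ((prodSet (Ioo (a - 1 / 2) (a + 1 / 2)) (Ioo 0 1)).indicator (fun _ => (1 : ℝ)))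
      (box a) halfPlane := by
    intro y hy
    have hy : 0 < y 1 := hy
    have hiff : y ∈ prodSet (Ioo (a - 1 / 2) (a + 1 / 2)) (Ioo 0 1) ↔ |y 0 - a| < 1 / 2 ∧ y 1 < 1 := by
      simp only [prodSet, mem_ofPred_eq, mem_Ioo, abs_lt]
      constructor
      · rintro ⟨⟨h1, h2⟩, h3, h4⟩; exact ⟨⟨by linarith, by linarith⟩, h4⟩
      · rintro ⟨⟨h1, h2⟩, h4⟩; exact ⟨⟨by linarith, by linarith⟩, hy, h4⟩
    simp only [indicator, box, hiff]
  have hint := integrable_indicator_prodSet hI (measurableSet_Ioo (a := (0 : ℝ)) (b := 1))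
    (by simp) (by simp) 1
  have h1 : IntegrableOn (box a) halfPlane :=
    hint.integrableOn.congr_fun heq measurableSet_halfPlane
  refine ⟨h1, ?_⟩
  have h2 : ∫ y in halfPlane, |box a y| = ∫ y in halfPlane, box a y := by
    congr 1; ext y; unfold box; split_ifs <;> simp
  rw [h2, ← setIntegral_congr_fun measurableSet_halfPlane heq, setIntegral_eq_integral_of_forall_compl_eq_zero,
    integral_indicator_prodSet hI measurableSet_Ioo]
  · rw [Real.volume_real_Ioo_of_le (by linarith), Real.volume_real_Ioo_of_le (by linarith)]; ring
  · intro y hy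
    refine indicator_of_notMem (fun h => hy ?_) _
    exact h.2.1

lemma admissible_box (a : ℝ) : Admissible 2 (oddExt (box a)) := by
  have := admissible_oddExt (B := 1) zero_le_one (fun y _ => abs_box_le a y) (integrableOn_box a).1
    (integrableOn_box a).2.le
  simpa using this

lemma rpow_le_of_le {r q s : ℝ} (hq : 0 < q) (hs : 0 ≤ s) (h : q ≤ r) : r ^ (-s) ≤ q ^ (-s) :=
  Real.rpow_le_rpow_of_nonpos hq h (by linarith)

/-- Shear of the tangential velocity of a box near the boundary. -/
lemma exists_box_shear {α : ℝ} (hα : 0 < α) (hα' : α < 1 / 2) : ∃ c C : ℝ, 0 < c ∧ 0 < C ∧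
    ∀ (x : Plane) (d : ℝ), 0 < x 1 → x 1 ≤ 1 / 4 → 0 < d → d ≤ 1 / 4 → d ≤ x 1 →
      c * d * x 1 ^ (-(2 * α)) - C * d
        ≤ conv α (oddExt (box (x 0))) 0 (x + d • e 1) - conv α (oddExt (box (x 0))) 0 x := by
  refine ⟨4 * 3 ^ (-(2 + 2 * α)), 2 * 2 ^ (1 + 2 * α), by positivity, by positivity, ?_⟩
  intro x d hx hx4 hd hd4 hdx
  set h := x 1 with hh
  set c₀ : ℝ := h * (3 * h) ^ (-(2 + 2 * α)) with hc₀
  set K : ℝ := (1 / 2) ^ (-(1 + 2 * α)) with hK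
  have hadm := admissible_box (x 0)
  set Ψ := oddExt (box (x 0)) with hΨ
  rw [conv_add_sub hα hα' hadm]
  set S := prodSet (Ioo (x 0 - h) (x 0 + h)) (Ioo (-d) 0) with hS
  set T₁ := prodSet (Ioo (x 0 - 1 / 2) (x 0 + 1 / 2)) (Ico (1 - d) 1) with hT₁
  set T₂ := prodSet (Ioo (x 0 - 1 / 2) (x 0 + 1 / 2)) (Ioc (-1 - d) (-1)) with hT₂
  have iS := integrable_indicator_prodSet (s := Ioo (x 0 - h) (x 0 + h)) (t := Ioo (-d) 0)
    measurableSet_Ioo measurableSet_Ioo (by simp) (by simp) (2 * c₀)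
  have iT₁ := integrable_indicator_prodSet (s := Ioo (x 0 - 1 / 2) (x 0 + 1 / 2)) (t := Ico (1 - d) 1)
    measurableSet_Ioo measurableSet_Ico (by simp) (by simp) K
  have iT₂ := integrable_indicator_prodSet (s := Ioo (x 0 - 1 / 2) (x 0 + 1 / 2)) (t := Ioc (-1 - d) (-1))
    measurableSet_Ioo measurableSet_Ioc (by simp) (by simp) K
  have hlow : ∀ y, S.indicator (fun _ => 2 * c₀) y - T₁.indicator (fun _ => K) y
      - T₂.indicator (fun _ => K) y ≤ kernel α (x - y) 0 * (Ψ (y + d • e 1) - Ψ y) := by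
    intro y
    have hy0 : (y + d • e 1) 0 = y 0 := by simp [e]
    have hy1 : (y + d • e 1) 1 = y 1 + d := by simp [e]
    have hK0 : 0 ≤ K := by positivity
    have hc0 : 0 ≤ c₀ := by positivity
    have hker : kernel α (x - y) 0 = (h - y 1) * ‖x - y‖ ^ (-(2 + 2 * α)) := by
      rw [kernel_apply]; simp [perp, hh]
    have hΨval : ∀ w : Plane, Ψ w = if |w 0 - x 0| < 1 / 2 then
        (if 0 < w 1 ∧ w 1 < 1 then 1 else if w 1 < 0 ∧ -1 < w 1 then -1 else 0) else 0 := by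
      intro w
      rcases lt_trichotomy (w 1) 0 with hw | hw | hw
      · rw [hΨ, oddExt_of_neg hw, box, bar_apply_zero, bar_apply_one]
        have e1 : ¬ (0 < w 1 ∧ w 1 < 1) := fun hc => absurd hc.1 (not_lt.2 hw.le)
        by_cases ha : |w 0 - x 0| < 1 / 2 <;> by_cases hb : -1 < w 1
        · have : -w 1 < 1 := by linarith
          simp [-one_div, ha, hb, e1, hw, this]
        · have : ¬ (-w 1 < 1) := by linarith
          simp [-one_div, ha, hb, e1, this]
        · simp [-one_div, ha]
        · simp [-one_div, ha]
      · rw [hΨ, oddExt_of_zero hw]; simp [hw]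
      · rw [hΨ, oddExt_of_pos hw, box]
        by_cases ha : |w 0 - x 0| < 1 / 2 <;> by_cases hb : w 1 < 1 <;> simp [-one_div, ha, hb, hw, hw.le]
    rw [hΨval, hΨval, hy0, hy1]
    have hStrip : y ∈ S ∨ y ∈ T₁ ∨ y ∈ T₂ → |y 0 - x 0| < 1 / 2 := by
      rintro (h' | h' | h')
      · have := h'.1; rw [abs_lt]; constructor <;> linarith [this.1, this.2]
      · have := h'.1; rw [abs_lt]; constructor <;> linarith [this.1, this.2]
      · have := h'.1; rw [abs_lt]; constructor <;> linarith [this.1, this.2]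
    by_cases hstrip : |y 0 - x 0| < 1 / 2
    swap
    · have n1 : y ∉ S := fun h' => hstrip (hStrip (Or.inl h'))
      have n2 : y ∉ T₁ := fun h' => hstrip (hStrip (Or.inr (Or.inl h')))
      have n3 : y ∉ T₂ := fun h' => hstrip (hStrip (Or.inr (Or.inr h')))
      simp [-one_div, n1, n2, n3, hstrip]
    have hstrip' : y 0 ∈ Ioo (x 0 - 1 / 2) (x 0 + 1 / 2) := by
      rw [abs_lt] at hstrip; exact ⟨by linarith, by linarith⟩
    simp only [hstrip, if_true]
    have hkabs : 1 / 2 ≤ |h - y 1| → |kernel α (x - y) 0| ≤ K := by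
      intro hge
      refine (abs_kernel_le hα _ _).trans (rpow_le_of_le (by norm_num) (by linarith) ?_)
      have := abs_coord_le (x - y) 1
      simp only [PiLp.sub_apply, ← hh] at this
      linarith
    have nS : ¬ (-d < y 1 ∧ y 1 < 0) → S.indicator (fun _ => 2 * c₀) y = 0 := fun hn =>
      indicator_of_notMem (fun h' => hn h'.2) _
    have gT₁ : 0 ≤ T₁.indicator (fun _ => K) y := indicator_nonneg (fun _ _ => hK0) _
    have gT₂ : 0 ≤ T₂.indicator (fun _ => K) y := indicator_nonneg (fun _ _ => hK0) _
    have hpow : 0 ≤ ‖x - y‖ ^ (-(2 + 2 * α)) := by positivity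
    have hkpos : y 1 ≤ 0 → 0 ≤ kernel α (x - y) 0 := fun h' => by
      rw [hker]; exact mul_nonneg (by linarith) hpow
    rcases lt_or_ge (y 1) (-1 - d) with c1 | c1
    · rw [nS (by intro h'; linarith [h'.1])]
      rw [if_neg (by rintro ⟨h1, h2⟩; linarith), if_neg (by rintro ⟨h1, h2⟩; linarith),
        if_neg (by rintro ⟨h1, h2⟩; linarith), if_neg (by rintro ⟨h1, h2⟩; linarith)]
      linarith
    rcases le_or_gt (y 1) (-1) with c2 | c2
    · rw [nS (by intro h'; linarith [h'.1])]
      rw [if_neg (by rintro ⟨h1, h2⟩; linarith), if_neg (c := 0 < y 1 ∧ y 1 < 1) (by rintro ⟨h1, h2⟩; linarith),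
        if_neg (c := y 1 < 0 ∧ -1 < y 1) (by rintro ⟨h1, h2⟩; linarith)]
      have hk := hkabs (by rw [abs_of_pos (by linarith)]; linarith)
      by_cases c3 : y 1 = -1 - d
      · rw [if_neg (by rintro ⟨h1, h2⟩; linarith)]; linarith
      · have hmem : y ∈ T₂ := ⟨hstrip', lt_of_le_of_ne c1 (Ne.symm c3), c2⟩
        rw [indicator_of_mem hmem, if_pos ⟨by linarith, by
          have := lt_of_le_of_ne c1 (Ne.symm c3); linarith⟩]
        linarith [(abs_le.1 hk).2]
    rcases lt_or_ge (y 1) (-d) with c3 | c3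
    · rw [nS (by intro h'; linarith [h'.1])]
      rw [if_neg (by rintro ⟨h1, h2⟩; linarith), if_pos ⟨by linarith, by linarith⟩,
        if_neg (by rintro ⟨h1, h2⟩; linarith), if_pos ⟨by linarith, by linarith⟩]
      linarith
    rcases lt_trichotomy (y 1) 0 with c4 | c4 | c4
    · rw [if_neg (c := 0 < y 1 ∧ y 1 < 1) (by rintro ⟨h1, h2⟩; linarith),
        if_pos (c := y 1 < 0 ∧ -1 < y 1) ⟨by linarith, by linarith⟩]
      have hk := hkpos c4.le
      rcases eq_or_lt_of_le c3 with c5 | c5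
      · rw [nS (by intro h'; linarith [h'.1]), ← c5]
        simp
        linarith
      · rw [if_pos ⟨by linarith, by linarith⟩]
        by_cases hs : y ∈ S
        · rw [indicator_of_mem hs]
          have hnorm : ‖x - y‖ ≤ 3 * h := by
            refine le_of_sq_le_sq ?_ (by positivity)
            rw [norm_sq_eq]
            have h1 := hs.1
            simp only [PiLp.sub_apply, ← hh]
            have h2 : (x 0 - y 0) ^ 2 ≤ h ^ 2 := sq_le_sq' (by linarith [h1.2]) (by linarith [h1.1])
            have h3 : (h - y 1) ^ 2 ≤ (2 * h) ^ 2 := sq_le_sq' (by linarith) (by linarith)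
            nlinarith
          have hnp : 0 < ‖x - y‖ := by
            have := abs_coord_le (x - y) 1
            simp only [PiLp.sub_apply, ← hh] at this
            rw [abs_of_pos (by linarith)] at this
            linarith
          have : c₀ ≤ kernel α (x - y) 0 := by
            rw [hker, hc₀]
            exact mul_le_mul (by linarith) (rpow_le_of_le hnp (by linarith) hnorm) (by positivity)
              (by linarith)
          linarith
        · rw [indicator_of_notMem hs]; linarith
    · rw [nS (by intro h'; linarith [h'.2]), c4]
      have hk := hkpos c4.le
      simp
      rw [if_pos ⟨by linarith, by linarith⟩]; linarith
    · rw [nS (by intro h'; linarith [h'.2]), if_neg (c := y 1 + d < 0 ∧ -1 < y 1 + d)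
        (by rintro ⟨h1, h2⟩; linarith), if_neg (c := y 1 < 0 ∧ -1 < y 1) (by rintro ⟨h1, h2⟩; linarith)]
      rcases lt_or_ge (y 1) (1 - d) with c5 | c5
      · rw [if_pos ⟨by linarith, by linarith⟩, if_pos ⟨by linarith, by linarith⟩]; linarith
      · rw [if_neg (by rintro ⟨h1, h2⟩; linarith)]
        rcases lt_or_ge (y 1) 1 with c6 | c6
        · have hmem : y ∈ T₁ := ⟨hstrip', c5, c6⟩
          have hk := hkabs (by rw [abs_sub_comm, abs_of_pos (by linarith)]; linarith)
          rw [if_pos ⟨c4, c6⟩, indicator_of_mem hmem]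
          linarith [(abs_le.1 hk).2]
        · rw [if_neg (by rintro ⟨h1, h2⟩; linarith)]; linarith
  have hmono := integral_mono ((iS.sub iT₁).sub iT₂) (integrable_kernel_diff hα hα' hadm 0 x (d • e 1)) hlow
  refine le_trans (le_of_eq ?_) hmono
  rw [integral_sub' (iS.sub iT₁) iT₂, integral_sub' iS iT₁]
  rw [integral_indicator_prodSet measurableSet_Ioo measurableSet_Ioo,
    integral_indicator_prodSet measurableSet_Ioo measurableSet_Ico,
    integral_indicator_prodSet measurableSet_Ioo measurableSet_Ioc,
    Real.volume_real_Ioo_of_le (by linarith), Real.volume_real_Ioo_of_le (by linarith),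
    Real.volume_real_Ioo_of_le (by linarith), Real.volume_real_Ico_of_le (by linarith),
    Real.volume_real_Ioc_of_le (by linarith)]
  have e1 : h * c₀ = 3 ^ (-(2 + 2 * α)) * h ^ (-(2 * α)) := by
    rw [hc₀, Real.mul_rpow (by norm_num) hx.le, show -(2 * α) = 2 + -(2 + 2 * α) by ring,
      Real.rpow_add hx, Real.rpow_two]; ring
  have e2 : K = 2 ^ (1 + 2 * α) := by
    rw [hK, one_div, Real.inv_rpow (by norm_num), ← Real.rpow_neg (by norm_num), neg_neg]
  rw [e2]
  linear_combination (-4 * d) * e1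

/-- The normal velocity of a box has small tangential differences near the boundary. -/
lemma exists_box_tangential {α : ℝ} (hα : 0 < α) (hα' : α < 1 / 2) : ∃ C : ℝ, 0 < C ∧
    ∀ (x : Plane) (d : ℝ), 0 < x 1 → |d| ≤ 1 / 4 →
      |conv α (oddExt (box (x 0))) 1 (x + d • e 0) - conv α (oddExt (box (x 0))) 1 x|
        ≤ C * |d| * x 1 := by
  obtain ⟨C₁, hC₁, himg⟩ := exists_kernel_image_le hα
  refine ⟨4 * (C₁ * (1 / 4) ^ (-(2 + 2 * α))), by positivity, ?_⟩
  intro x d hx hd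
  have hadm := admissible_box (x 0)
  rw [conv_add_sub_odd hα hα' hadm (oddExt_bar _)]
  set K : ℝ := C₁ * x 1 * (1 / 4) ^ (-(2 + 2 * α)) with hK
  have hK0 : 0 ≤ K := by positivity
  set S₁ := prodSet (Icc (x 0 - 1 / 2 - |d|) (x 0 - 1 / 2 + |d|)) (Ioo 0 1)
  set S₂ := prodSet (Icc (x 0 + 1 / 2 - |d|) (x 0 + 1 / 2 + |d|)) (Ioo 0 1)
  have i₁ := integrable_indicator_prodSet (s := Icc (x 0 - 1 / 2 - |d|) (x 0 - 1 / 2 + |d|))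
    (t := Ioo 0 1) measurableSet_Icc measurableSet_Ioo (by simp) (by simp) K
  have i₂ := integrable_indicator_prodSet (s := Icc (x 0 + 1 / 2 - |d|) (x 0 + 1 / 2 + |d|))
    (t := Ioo 0 1) measurableSet_Icc measurableSet_Ioo (by simp) (by simp) K
  have hb : ∀ y ∈ halfPlane, ‖(kernel α (x - y) 1 - kernel α (x - bar y) 1)
      * (oddExt (box (x 0)) (y + d • e 0) - oddExt (box (x 0)) y)‖
      ≤ S₁.indicator (fun _ => K) y + S₂.indicator (fun _ => K) y := by
    intro y hy
    have hy : 0 < y 1 := hy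
    have hy0 : (y + d • e 0) 0 = y 0 + d := by simp [e]
    have hy1 : (y + d • e 0) 1 = y 1 := by simp [e]
    have g₁ : 0 ≤ S₁.indicator (fun _ => K) y := indicator_nonneg (fun _ _ => hK0) _
    have g₂ : 0 ≤ S₂.indicator (fun _ => K) y := indicator_nonneg (fun _ _ => hK0) _
    rw [oddExt_of_pos (by rw [hy1]; exact hy), oddExt_of_pos hy, box, box, hy0, hy1, norm_mul,
      Real.norm_eq_abs, Real.norm_eq_abs]
    have hd' := abs_le.1 (le_refl |d|)
    by_cases hmem : y ∈ S₁ ∪ S₂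
    · have hfar : 1 / 4 ≤ ‖x - y‖ := by
        refine le_trans ?_ (abs_coord_le (x - y) 0)
        simp only [PiLp.sub_apply]
        rcases hmem with hm | hm
        · exact le_trans (by linarith [hm.1.1, hm.1.2]) (le_abs_self _)
        · exact le_trans (by linarith [hm.1.1, hm.1.2]) (neg_le_abs _)
      have hk := himg x y hx hy (by linarith)
      have hk2 : |kernel α (x - y) 1 - kernel α (x - bar y) 1| ≤ K :=
        hk.trans (mul_le_mul_of_nonneg_left (rpow_le_of_le (by norm_num) (by linarith) hfar) (by positivity))
      have hone : |(if |y 0 + d - x 0| < 1 / 2 ∧ y 1 < 1 then (1 : ℝ) else 0)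
          - if |y 0 - x 0| < 1 / 2 ∧ y 1 < 1 then 1 else 0| ≤ 1 := by
        split_ifs <;> simp
      have : K ≤ S₁.indicator (fun _ => K) y + S₂.indicator (fun _ => K) y := by
        rcases hmem with hm | hm
        · rw [indicator_of_mem hm]; linarith
        · rw [indicator_of_mem hm]; linarith
      calc _ ≤ K * 1 := mul_le_mul hk2 hone (abs_nonneg _) hK0
        _ ≤ _ := by linarith
    · have heq : (if |y 0 + d - x 0| < 1 / 2 ∧ y 1 < 1 then (1 : ℝ) else 0)
          = if |y 0 - x 0| < 1 / 2 ∧ y 1 < 1 then 1 else 0 := by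
        by_cases h1 : y 1 < 1
        · have hn₁ : ¬ (x 0 - 1 / 2 - |d| ≤ y 0 ∧ y 0 ≤ x 0 - 1 / 2 + |d|) := fun hc =>
            hmem (Or.inl ⟨hc, hy, h1⟩)
          have hn₂ : ¬ (x 0 + 1 / 2 - |d| ≤ y 0 ∧ y 0 ≤ x 0 + 1 / 2 + |d|) := fun hc =>
            hmem (Or.inr ⟨hc, hy, h1⟩)
          have : |y 0 + d - x 0| < 1 / 2 ↔ |y 0 - x 0| < 1 / 2 := by
            rw [abs_lt, abs_lt]
            constructor
            · rintro ⟨a1, a2⟩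
              refine ⟨?_, ?_⟩
              · by_contra hc; exact hn₁ ⟨by linarith, by linarith⟩
              · by_contra hc; exact hn₂ ⟨by linarith, by linarith⟩
            · rintro ⟨a1, a2⟩
              refine ⟨?_, ?_⟩
              · by_contra hc; exact hn₁ ⟨by linarith, by linarith⟩
              · by_contra hc; exact hn₂ ⟨by linarith, by linarith⟩
          simp only [this]
        · simp [h1]
      rw [heq, sub_self, abs_zero, mul_zero]; linarith
  rw [← Real.norm_eq_abs]
  refine (norm_integral_le_of_norm_le (i₁.add i₂).integrableOn
    ((ae_restrict_iff' measurableSet_halfPlane).2 (Eventually.of_forall hb))).trans ?_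
  refine (integral_le_of_halfPlane (i₁.add i₂) (fun y => add_nonneg
    (indicator_nonneg (fun _ _ => hK0) _) (indicator_nonneg (fun _ _ => hK0) _))).trans (le_of_eq ?_)
  simp only [Pi.add_apply]
  have hd0 := abs_nonneg d
  rw [integral_add i₁ i₂, integral_indicator_prodSet measurableSet_Icc measurableSet_Ioo,
    integral_indicator_prodSet measurableSet_Icc measurableSet_Ioo,
    Real.volume_real_Icc_of_le (by linarith), Real.volume_real_Icc_of_le (by linarith),
    Real.volume_real_Ioo_of_le (by linarith)]
  rw [hK]; ring

/-! ### The velocity of a wedge -/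

lemma kerTwo_image_lower {α h a s s' : ℝ} (hα : 0 < α) (hh : 0 < h) (ha : h ≤ a) (ha' : a ≤ 3 / 2 * h)
    (hs : h / 2 ≤ s) (hs1 : s ≤ 2 * h) (ht : h ≤ s') (ht1 : s' ≤ 2 * h) :
    2 / 9 * 7 ^ (-(1 + α)) * h ^ (-(1 + 2 * α)) ≤ kerTwo α a (s + s') - kerTwo α a (s - s') := by
  set ρ := a ^ 2 + (s - s') ^ 2 with hρ
  set ρ' := a ^ 2 + (s + s') ^ 2 with hρ'
  have h1 : ρ' = ρ + 4 * (s * s') := by rw [hρ, hρ']; ring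
  have h2 : h / 2 * h ≤ s * s' := mul_le_mul hs ht hh.le (by linarith)
  have hρpos : 0 < ρ := by have : 0 < a := by linarith
                           positivity
  have h3 : ρ ≤ 7 * h ^ 2 := by
    have e1 : a ^ 2 ≤ (3 / 2 * h) ^ 2 := by gcongr; linarith
    have e2 : (s - s') ^ 2 ≤ (3 / 2 * h) ^ 2 := sq_le_sq' (by linarith) (by linarith)
    nlinarith
  have hρ'pos : 0 < ρ' := by nlinarith
  have h4 : ρ' ^ (-(1 + α)) ≤ 7 / 9 * ρ ^ (-(1 + α)) := by
    have e1 : 9 / 7 * ρ ≤ ρ' := by nlinarith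
    calc ρ' ^ (-(1 + α)) ≤ (9 / 7 * ρ) ^ (-(1 + α)) := rpow_le_of_le (by positivity) (by linarith) e1
      _ = (9 / 7) ^ (-(1 + α)) * ρ ^ (-(1 + α)) := Real.mul_rpow (by norm_num) hρpos.le
      _ ≤ (9 / 7) ^ (-1 : ℝ) * ρ ^ (-(1 + α)) := by
          refine mul_le_mul_of_nonneg_right ?_ (by positivity)
          exact Real.rpow_le_rpow_of_exponent_le (by norm_num) (by linarith)
      _ = _ := by rw [Real.rpow_neg_one]; norm_num
  have h5 : 7 ^ (-(1 + α)) * h ^ (-(2 + 2 * α)) ≤ ρ ^ (-(1 + α)) := by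
    calc 7 ^ (-(1 + α)) * h ^ (-(2 + 2 * α)) = (7 * h ^ 2) ^ (-(1 + α)) := by
          rw [Real.mul_rpow (by norm_num) (by positivity), ← Real.rpow_natCast, ← Real.rpow_mul hh.le]
          congr 2; push_cast; ring
      _ ≤ _ := rpow_le_of_le hρpos (by linarith) h3
  have h6 : kerTwo α a (s + s') - kerTwo α a (s - s') = a * (ρ ^ (-(1 + α)) - ρ' ^ (-(1 + α))) := by
    simp only [kerTwo, ← hρ, ← hρ']; ring
  rw [h6]
  have h7 : h ^ (-(1 + 2 * α)) = h * h ^ (-(2 + 2 * α)) := by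
    rw [show -(1 + 2 * α) = 1 + -(2 + 2 * α) by ring, Real.rpow_add hh, Real.rpow_one]
  rw [h7]
  have h8 : 0 ≤ ρ ^ (-(1 + α)) := by positivity
  calc 2 / 9 * 7 ^ (-(1 + α)) * (h * h ^ (-(2 + 2 * α)))
      = h * (2 / 9 * (7 ^ (-(1 + α)) * h ^ (-(2 + 2 * α)))) := by ring
    _ ≤ a * (2 / 9 * ρ ^ (-(1 + α))) := by gcongr; linarith
    _ ≤ _ := mul_le_mul_of_nonneg_left (by linarith) (by linarith)

/-- Lower bound for the tangential derivative of the normal velocity generated by a function that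
is nonincreasing in the first coordinate and has a kink near the origin. -/
lemma exists_wedge_lower {α : ℝ} (hα : 0 < α) (hα' : α < 1 / 2) : ∃ c C : ℝ, 0 < c ∧ 0 < C ∧
    ∀ (B V h d : ℝ) (ψ : Plane → ℝ) (x : Plane), Admissible B (oddExt ψ) → 0 < h → h ≤ 1 / 4 →
      0 < d → d ≤ h / 8 → x 0 = V + h → h / 2 ≤ x 1 → x 1 ≤ 2 * h →
      (∀ y ∈ halfPlane, |ψ (y + d • e 0) - ψ y| ≤ d) →
      (∀ y ∈ halfPlane, y 0 - V < -3 ∨ 3 < y 1 → ψ y = 0) →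
      (∀ y ∈ halfPlane, -2 ≤ y 0 - V → ψ (y + d • e 0) ≤ ψ y) →
      (∀ y ∈ halfPlane, V ≤ y 0 → ψ y = 0) →
      (∀ y ∈ halfPlane, -(h / 2) < y 0 - V → y 0 - V < -(h / 4) → h < y 1 → y 1 < 2 * h →
        ψ (y + d • e 0) = ψ y - d) →
      c * d * h ^ (1 - 2 * α) - C * d * h
        ≤ conv α (oddExt ψ) 1 (x + d • e 0) - conv α (oddExt ψ) 1 x := by
  obtain ⟨C₁, hC₁, himg⟩ := exists_kernel_image_le hα
  set c₁ : ℝ := 2 / 9 * 7 ^ (-(1 + α)) with hc₁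
  have hc₁0 : 0 < c₁ := by positivity
  refine ⟨c₁ / 4, 12 * C₁, by positivity, by positivity, ?_⟩
  intro B V h d ψ x hadm hh hh4 hd hdh hx0 hx1 hx1' hlip hsupp hanti hzero hkink
  have hx : 0 < x 1 := by linarith
  rw [conv_add_sub_odd hα hα' hadm (oddExt_bar _)]
  set c₀ : ℝ := c₁ * h ^ (-(1 + 2 * α)) * d with hc₀
  set K : ℝ := C₁ * (2 * h) * d with hK
  have hc₀0 : 0 ≤ c₀ := by positivity
  have hK0 : 0 ≤ K := by positivity
  set Q := prodSet (Ioo (V - h / 2) (V - h / 4)) (Ioo h (2 * h)) with hQ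
  set T := prodSet (Ioo (V - 4) (V - 2)) (Ioc 0 3) with hT
  have iQ := integrable_indicator_prodSet (s := Ioo (V - h / 2) (V - h / 4)) (t := Ioo h (2 * h))
    measurableSet_Ioo measurableSet_Ioo (by simp) (by simp) c₀
  have iT := integrable_indicator_prodSet (s := Ioo (V - 4) (V - 2)) (t := Ioc 0 3)
    measurableSet_Ioo measurableSet_Ioc (by simp) (by simp) K
  have hlow : ∀ y ∈ halfPlane, Q.indicator (fun _ => c₀) y - T.indicator (fun _ => K) y
      ≤ (kernel α (x - y) 1 - kernel α (x - bar y) 1) * (oddExt ψ (y + d • e 0) - oddExt ψ y) := by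
    intro y hyH
    have hy : 0 < y 1 := hyH
    have hy0 : (y + d • e 0) 0 = y 0 + d := by simp [e]
    have hy1 : (y + d • e 0) 1 = y 1 := by simp [e]
    have hyH' : y + d • e 0 ∈ halfPlane := by rw [mem_halfPlane, hy1]; exact hy
    have gT : 0 ≤ T.indicator (fun _ => K) y := indicator_nonneg (fun _ _ => hK0) _
    rw [oddExt_of_pos (by rw [hy1]; exact hy), oddExt_of_pos hy]
    have k1 : kernel α (x - y) 1 = kerTwo α (x 0 - y 0) (x 1 - y 1) := by
      rw [kernel_one_eq]; simp
    have k2 : kernel α (x - bar y) 1 = kerTwo α (x 0 - y 0) (x 1 + y 1) := by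
      rw [kernel_one_eq]; simp [bar]
    rcases le_or_gt V (y 0) with hV | hV
    · have n : y ∉ Q := fun h' => by linarith [h'.1.2]
      rw [indicator_of_notMem n, hzero _ hyH hV, hzero _ hyH' (by rw [hy0]; linarith)]
      linarith
    · rcases le_or_gt (-2) (y 0 - V) with h2 | h2
      · by_cases hq : y ∈ Q
        · rw [indicator_of_mem hq, hkink y hyH (by linarith [hq.1.1]) (by linarith [hq.1.2]) hq.2.1 hq.2.2,
            k1, k2]
          have := kerTwo_image_lower (α := α) (h := h) (a := x 0 - y 0) (s := x 1) (s' := y 1) hα hh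
            (by linarith) (by linarith [hq.1.1]) hx1 hx1' hq.2.1.le hq.2.2.le
          have := mul_le_mul_of_nonneg_right this hd.le
          rw [← hc₁] at this
          rw [hc₀]
          linarith
        · rw [indicator_of_notMem hq]
          have hk : kernel α (x - y) 1 - kernel α (x - bar y) 1 ≤ 0 := by
            rw [k1, k2, kerTwo, kerTwo]
            by_cases hxy : x 1 = y 1 ∧ False
            · exact hxy.2.elim
            have ha : 0 < x 0 - y 0 := by linarith
            have : ((x 0 - y 0) ^ 2 + (x 1 + y 1) ^ 2) ^ (-(1 + α))
                ≤ ((x 0 - y 0) ^ 2 + (x 1 - y 1) ^ 2) ^ (-(1 + α)) :=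
              rpow_le_of_le (by positivity) (by linarith) (by nlinarith [mul_pos hx hy])
            nlinarith
          have hψ := hanti y hyH h2
          have := mul_nonneg_of_nonpos_of_nonpos hk (sub_nonpos.2 hψ)
          linarith
      · have n : y ∉ Q := fun h' => by linarith [h'.1.1]
        rw [indicator_of_notMem n]
        by_cases ht : y ∈ T
        · rw [indicator_of_mem ht]
          have hr : 1 ≤ ‖x - y‖ := by
            refine le_trans ?_ (abs_coord_le (x - y) 0)
            simp only [PiLp.sub_apply]
            exact le_trans (by linarith) (le_abs_self _)
          have hk := himg x y hx hy (by linarith)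
          have hk2 : |kernel α (x - y) 1 - kernel α (x - bar y) 1| ≤ C₁ * (2 * h) := by
            refine hk.trans ?_
            have : ‖x - y‖ ^ (-(2 + 2 * α)) ≤ 1 :=
              Real.rpow_le_one_of_one_le_of_nonpos hr (by linarith)
            calc C₁ * x 1 * ‖x - y‖ ^ (-(2 + 2 * α)) ≤ C₁ * (2 * h) * 1 := by gcongr
              _ = _ := mul_one _
          have hm := mul_le_mul hk2 (hlip y hyH) (abs_nonneg _) (by positivity)
          rw [← abs_mul] at hm
          linarith [(abs_le.1 hm).1]
        · rw [indicator_of_notMem ht]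
          have hz : ψ (y + d • e 0) - ψ y = 0 := by
            by_cases h3 : 3 < y 1
            · rw [hsupp y hyH (Or.inr h3), hsupp _ hyH' (Or.inr (by rw [hy1]; exact h3)), sub_self]
            · have h4 : y 0 ≤ V - 4 := by
                by_contra hc
                exact ht ⟨⟨by linarith, by linarith⟩, hy, by linarith⟩
              rw [hsupp y hyH (Or.inl (by linarith)), hsupp _ hyH' (Or.inl (by rw [hy0]; linarith)),
                sub_self]
          rw [hz]; simp
  have hmono := setIntegral_mono_on (iQ.sub iT).integrableOn
    (integrableOn_kernel_diff_odd hα hα' hadm (oddExt_bar ψ) x d) measurableSet_halfPlane hlow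
  refine le_trans (le_of_eq ?_) hmono
  have hcompl : ∀ y ∉ halfPlane, (Q.indicator (fun _ => c₀) - T.indicator (fun _ => K)) y = 0 := by
    intro y hy
    have n1 : y ∉ Q := fun h' => hy (mem_halfPlane.2 (by linarith [h'.2.1]))
    have n2 : y ∉ T := fun h' => hy h'.2.1
    simp [n1, n2]
  have := setIntegral_eq_integral_of_forall_compl_eq_zero (μ := (volume : Measure Plane)) hcompl
  rw [this]
  simp only [Pi.sub_apply]
  rw [integral_sub iQ iT, integral_indicator_prodSet measurableSet_Ioo measurableSet_Ioo,
    integral_indicator_prodSet measurableSet_Ioo measurableSet_Ioc,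
    Real.volume_real_Ioo_of_le (by linarith), Real.volume_real_Ioo_of_le (by linarith),
    Real.volume_real_Ioo_of_le (by linarith), Real.volume_real_Ioc_of_le (by linarith)]
  have e1 : h ^ (1 - 2 * α) = h ^ 2 * h ^ (-(1 + 2 * α)) := by
    rw [show 1 - 2 * α = 2 + -(1 + 2 * α) by ring, Real.rpow_add hh, Real.rpow_two]
  rw [e1, hc₀, hK]; ring

/-- A locally Lipschitz function changes along a curve by at most the length of the parameter
interval times an almost everywhere bound for its derivative in the direction of the curve. -/
lemma abs_sub_le_along_curve {E : Type*} [NormedAddCommGroup E] [NormedSpace ℝ E]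
    [FiniteDimensional ℝ E] [MeasurableSpace E] [BorelSpace E] (μ : Measure E) [μ.IsAddHaarMeasure]
    {f : E → ℝ} {U : Set E} (hU : IsOpen U) (hf : LocallyLipschitzOn U f) {c c' : ℝ → E}
    {a b B r S : ℝ} (hab : a ≤ b) (hr : 0 < r)
    (hc : ∀ τ ∈ Icc a b, HasDerivWithinAt c (c' τ) (Icc a b) τ) (hS : ∀ τ ∈ Icc a b, ‖c' τ‖ ≤ S)
    (hcU : ∀ τ ∈ Icc a b, c τ ∈ U)
    (hB : ∀ᵐ p ∂μ, ∀ τ ∈ Icc a b, p ∈ Metric.ball (c τ) r → |fderiv ℝ f p (c' τ)| ≤ B) :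
    |f (c b) - f (c a)| ≤ B * (b - a) := by
  have hcc : ContinuousOn c (Icc a b) := fun τ hτ => (hc τ hτ).continuousWithinAt
  have hcomp : IsCompact (c '' Icc a b) := isCompact_Icc.image_of_continuousOn hcc
  obtain ⟨δ, hδ, hδU⟩ := hcomp.exists_cthickening_subset_open hU (by
    rintro _ ⟨τ, hτ, rfl⟩; exact hcU τ hτ)
  obtain ⟨K, hK⟩ := (hf.mono hδU).exists_lipschitzOnWith_of_compact hcomp.cthickening
  set ρ := min r δ
  have hρ : 0 < ρ := lt_min hr hδ
  have hmem : ∀ τ ∈ Icc a b, ∀ z : E, ‖z‖ < ρ → c τ + z ∈ Metric.thickening δ (c '' Icc a b) := by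
    intro τ hτ z hz
    rw [Metric.mem_thickening_iff]
    exact ⟨c τ, mem_image_of_mem c hτ, by simpa using hz.trans_le (min_le_right _ _)⟩
  have hmem' : ∀ τ ∈ Icc a b, ∀ z : E, ‖z‖ < ρ → c τ + z ∈ Metric.cthickening δ (c '' Icc a b) :=
    fun τ hτ z hz => Metric.thickening_subset_cthickening _ _ (hmem τ hτ z hz)
  have hdiff : ∀ᵐ p ∂μ, p ∈ Metric.thickening δ (c '' Icc a b) → DifferentiableAt ℝ f p := by
    filter_upwards [(hK.mono (Metric.thickening_subset_cthickening _ _)).ae_differentiableWithinAt_of_mem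
      (μ := μ)] with p hp hpm
    exact (hp hpm).differentiableAt (Metric.isOpen_thickening.mem_nhds hpm)
  have hgood := hdiff.and hB
  set P : E → Prop := fun p => (p ∈ Metric.thickening δ (c '' Icc a b) → DifferentiableAt ℝ f p) ∧
    ∀ τ ∈ Icc a b, p ∈ Metric.ball (c τ) r → |fderiv ℝ f p (c' τ)| ≤ B with hP
  set N := toMeasurable μ {p | ¬ P p}
  have hN : μ N = 0 := by rw [measure_toMeasurable]; exact hgood
  have hNP : ∀ p ∉ N, P p := fun p hp => by
    by_contra h; exact hp (subset_toMeasurable _ _ h)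
  have hcI : Continuous (IccExtend hab ((Icc a b).domRestrict c)) :=
    (continuousOn_iff_continuous_domRestrict.1 hcc).Icc_extend'
  set ce := IccExtend hab ((Icc a b).domRestrict c) with hce
  have hceq : ∀ τ ∈ Icc a b, ce τ = c τ := fun τ hτ => by rw [hce, IccExtend_of_mem hab _ hτ]; rfl
  have hmeas : MeasurableSet {x : ℝ × E | ce x.1 + x.2 ∉ N} := by
    have : Continuous fun x : ℝ × E => ce x.1 + x.2 := by fun_prop
    exact (this.measurable (measurableSet_toMeasurable _ _)).compl
  have hall : ∀ᵐ z ∂μ, ∀ᵐ τ : ℝ, ce τ + z ∉ N := by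
    rw [← Measure.ae_ae_comm hmeas]
    refine Eventually.of_forall fun τ => ?_
    have : μ ((fun z => ce τ + z) ⁻¹' N) = 0 := by rw [measure_preimage_add, hN]
    exact measure_eq_zero_iff_ae_notMem.1 this
  have hstep : ∀ z : E, (∀ᵐ τ : ℝ, ce τ + z ∉ N) → ‖z‖ < ρ →
      |f (c b + z) - f (c a + z)| ≤ B * (b - a) := by
    intro z hz hzρ
    set F : ℝ → ℝ := fun τ => f (c τ + z) with hF
    have hLip : ∃ K', LipschitzOnWith K' F (Icc a b) := by
      have h1 : LipschitzOnWith S.toNNReal c (Icc a b) :=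
        (convex_Icc a b).lipschitzOnWith_of_nnnorm_hasDerivWithin_le hc (fun τ hτ => by
          rw [← NNReal.coe_le_coe, coe_nnnorm]
          exact (hS τ hτ).trans (Real.le_coe_toNNReal S))
      refine ⟨K * S.toNNReal, ?_⟩
      have h2 : LipschitzOnWith S.toNNReal (fun τ => c τ + z) (Icc a b) := by
        intro x hx y hy; simpa using h1 hx hy
      exact hK.comp h2 (fun τ hτ => hmem' τ hτ z hzρ)
    obtain ⟨K', hK'⟩ := hLip
    have hac : AbsolutelyContinuousOnInterval F a b := by
      refine LipschitzOnWith.absolutelyContinuousOnInterval (K := K') ?_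
      rwa [uIcc_of_le hab]
    have hderiv : ∀ᵐ τ : ℝ, τ ∈ uIoc a b → ‖deriv F τ‖ ≤ B := by
      have hbne : ∀ᵐ τ : ℝ, τ ≠ b := Measure.ae_ne volume b
      filter_upwards [hz, hbne] with τ h1 h2 hτ
      rw [uIoc_of_le hab] at hτ
      have hτI : τ ∈ Icc a b := Ioc_subset_Icc_self hτ
      have hτo : Icc a b ∈ 𝓝 τ := Icc_mem_nhds hτ.1 (lt_of_le_of_ne hτ.2 h2)
      rw [hceq τ hτI] at h1
      have hgp := hNP _ h1
      have hd := (hgp.1 (hmem τ hτI z hzρ)).hasFDerivAt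
      have hcd := ((hc τ hτI).hasDerivAt hτo).add_const z
      have := hd.comp_hasDerivAt τ hcd
      rw [show deriv F τ = _ from this.deriv]
      refine hgp.2 τ hτI ?_
      simpa using hzρ.trans_le (min_le_left _ _)
    have := intervalIntegral.norm_integral_le_of_norm_le_const_ae hderiv
    rw [hac.integral_deriv_eq_sub, Real.norm_eq_abs, abs_of_nonneg (sub_nonneg.2 hab)] at this
    exact this
  have hdense : Dense {z : E | ∀ᵐ τ : ℝ, ce τ + z ∉ N} := Measure.dense_of_ae hall
  have hne := mem_closure_iff_nhdsWithin_neBot.1 (hdense 0)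
  have hcont : ∀ τ ∈ Icc a b, Tendsto (fun z => f (c τ + z)) (𝓝 0) (𝓝 (f (c τ))) := by
    intro τ hτ
    have h1 : ContinuousAt f (c τ) := by
      refine hK.continuousOn.continuousAt ?_
      refine mem_of_superset (Metric.isOpen_thickening.mem_nhds ?_)
        (Metric.thickening_subset_cthickening δ _)
      simpa using hmem τ hτ 0 (by simpa using hρ)
    have h2 : Tendsto (fun z : E => c τ + z) (𝓝 0) (𝓝 (c τ)) := by
      have : Continuous fun z : E => c τ + z := by fun_prop
      simpa using this.tendsto 0
    exact h1.tendsto.comp h2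
  refine le_of_tendsto (x := 𝓝[{z : E | ∀ᵐ τ : ℝ, ce τ + z ∉ N}] 0)
    ((((hcont b (right_mem_Icc.2 hab)).sub (hcont a (left_mem_Icc.2 hab))).abs).mono_left
      nhdsWithin_le_nhds) ?_
  have hball : ∀ᶠ z in 𝓝[{z : E | ∀ᵐ τ : ℝ, ce τ + z ∉ N}] (0 : E), ‖z‖ < ρ := by
    refine nhdsWithin_le_nhds ?_
    have := Metric.ball_mem_nhds (0 : E) hρ
    filter_upwards [this] with z hz
    simpa using hz
  filter_upwards [hball, self_mem_nhdsWithin] with z h1 h2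
  exact hstep z h2 h1

/-! ### Regularity of elements of `X_β` -/

/-- Quantitative regularity of a function on the half-plane with `X_β` norm at most `M`. -/
structure Slice (β M : ℝ) (g : Plane → ℝ) : Prop where
  cont : ContinuousOn g halfPlane
  bound : ∀ y ∈ halfPlane, |g y| ≤ M
  horiz : ∀ x ∈ halfPlane, ∀ y ∈ halfPlane, x 1 = y 1 → |g x - g y| ≤ M * |x 0 - y 0|
  vert : ∀ ℓ : ℝ, 0 < ℓ → ∀ x y : Plane, ℓ < x 1 → ℓ < y 1 → x 0 = y 0 →
    |g x - g y| ≤ M * max (ℓ ^ (-β)) 1 * |x 1 - y 1|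
  l1 : ∫⁻ y in halfPlane, ‖g y‖ₑ ≤ ENNReal.ofReal M

lemma Slice.nonneg {β M : ℝ} {g : Plane → ℝ} (h : Slice β M g) : 0 ≤ M :=
  (abs_nonneg _).trans (h.bound (e 1) (by simp [mem_halfPlane, e]))

lemma Slice.aestronglyMeasurable {β M : ℝ} {g : Plane → ℝ} (h : Slice β M g) :
    AEStronglyMeasurable g (volume.restrict halfPlane) :=
  h.cont.aestronglyMeasurable measurableSet_halfPlane

lemma Slice.integrableOn {β M : ℝ} {g : Plane → ℝ} (h : Slice β M g) : IntegrableOn g halfPlane :=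
  ⟨h.aestronglyMeasurable, lt_of_le_of_lt h.l1 ENNReal.ofReal_lt_top⟩

lemma Slice.integral_abs_le {β M : ℝ} {g : Plane → ℝ} (h : Slice β M g) :
    ∫ y in halfPlane, |g y| ≤ M := by
  have h1 : ∫ y in halfPlane, |g y| = (∫⁻ y in halfPlane, ‖g y‖ₑ).toReal :=
    integral_norm_eq_lintegral_enorm h.aestronglyMeasurable
  rw [h1]
  exact ENNReal.toReal_le_of_le_ofReal h.nonneg h.l1

lemma Slice.admissible {β M : ℝ} {g : Plane → ℝ} (h : Slice β M g) :
    Admissible (2 * M) (oddExt g) :=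
  admissible_oddExt h.nonneg h.bound h.integrableOn h.integral_abs_le

lemma Slice.limit {β M : ℝ} {g : ℕ → Plane → ℝ} {g' : Plane → ℝ} (h : ∀ k, Slice β M (g k))
    (hlim : ∀ y ∈ halfPlane, Tendsto (fun k => g k y) atTop (𝓝 (g' y)))
    (hcont : ContinuousOn g' halfPlane) : Slice β M g' where
  cont := hcont
  bound y hy := le_of_tendsto (hlim y hy).abs (Eventually.of_forall fun k => (h k).bound y hy)
  horiz x hx y hy hxy := le_of_tendsto ((hlim x hx).sub (hlim y hy)).abs
    (Eventually.of_forall fun k => (h k).horiz x hx y hy hxy)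
  vert ℓ hℓ x y hx hy hxy := le_of_tendsto
    ((hlim x (hℓ.trans hx)).sub (hlim y (hℓ.trans hy))).abs
    (Eventually.of_forall fun k => (h k).vert ℓ hℓ x y hx hy hxy)
  l1 := by
    have hle : ∫⁻ y in halfPlane, ‖g' y‖ₑ
        ≤ liminf (fun k => ∫⁻ y in halfPlane, ‖g k y‖ₑ) atTop := by
      calc ∫⁻ y in halfPlane, ‖g' y‖ₑ
          = ∫⁻ y in halfPlane, liminf (fun k => ‖g k y‖ₑ) atTop := by
            refine setLIntegral_congr_fun measurableSet_halfPlane fun y hy => ?_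
            exact ((hlim y hy).enorm).liminf_eq.symm
        _ ≤ _ := lintegral_liminf_le' fun k => (h k).aestronglyMeasurable.enorm
    refine hle.trans ?_
    refine liminf_le_of_frequently_le' (Eventually.of_forall fun k => (h k).l1).frequently

lemma add_smul_e_apply (x : Plane) (d : ℝ) (i j : Fin 2) :
    (x + d • e i) j = x j + if j = i then d else 0 := by
  simp [e]

lemma ae_abs_le_of_eLpNorm_top {g : Plane → ℝ} {M : ℝ} (hM : 0 ≤ M)
    (h : eLpNorm g ∞ hpVolume ≤ ENNReal.ofReal M) : ∀ᵐ y : Plane, y ∈ halfPlane → |g y| ≤ M := by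
  rw [eLpNorm_exponent_top] at h
  have := ae_le_eLpNormEssSup (f := g) (μ := hpVolume)
  rw [hpVolume, ae_restrict_iff' measurableSet_halfPlane] at this
  filter_upwards [this] with y hy hyH
  have h1 := (hy hyH).trans h
  rw [← ofReal_norm, ENNReal.ofReal_le_ofReal_iff hM] at h1
  exact h1

lemma hasDerivAt_line (x v : Plane) (τ : ℝ) : HasDerivAt (fun s : ℝ => x + s • v) v τ := by
  simpa using ((hasDerivAt_id τ).smul_const v).const_add x

lemma memX_slice {β M : ℝ} {g : Plane → ℝ} (hβ : 0 ≤ β) (hM : 0 ≤ M) (hg : MemX β g)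
    (hn : xNorm β g ≤ ENNReal.ofReal M) : Slice β M g := by
  have h1 : eLpNorm g ∞ hpVolume ≤ ENNReal.ofReal M :=
    le_trans (le_trans le_self_add le_self_add) hn
  have h2 : eLpNorm (fun x => fderiv ℝ g x (e 0)) ∞ hpVolume ≤ ENNReal.ofReal M :=
    le_trans (le_trans (le_trans le_self_add le_add_self) le_self_add) hn
  have h3 : eLpNorm (fun x => min ((x 1) ^ β) 1 * fderiv ℝ g x (e 1)) ∞ hpVolume ≤ ENNReal.ofReal M :=
    le_trans (le_trans (le_trans le_add_self le_add_self) le_self_add) hn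
  have h4 : eLpNorm g 1 hpVolume ≤ ENNReal.ofReal M := le_trans le_add_self hn
  have hcont : ContinuousOn g halfPlane := hg.1.continuousOn
  have a1 := ae_abs_le_of_eLpNorm_top hM h1
  have a2 := ae_abs_le_of_eLpNorm_top hM h2
  have a3 := ae_abs_le_of_eLpNorm_top hM h3
  have hoz : ∀ x y : Plane, x ∈ halfPlane → x 1 = y 1 → x 0 ≤ y 0 → |g y - g x| ≤ M * (y 0 - x 0) := by
    intro x y hx hxy hle
    have hx : 0 < x 1 := hx
    have := abs_sub_le_along_curve volume isOpen_halfPlane hg.1 (c := fun s => x + s • e 0)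
      (c' := fun _ => e 0) (a := 0) (b := y 0 - x 0) (B := M) (r := x 1) (S := 1) (by linarith) hx
      (fun τ _ => (hasDerivAt_line x (e 0) τ).hasDerivWithinAt) (fun _ _ => by simp [e])
      (fun τ _ => by rw [mem_halfPlane, add_smul_e_apply]; simpa using hx) ?_
    · have hy : x + (y 0 - x 0) • e 0 = y := by
        ext j; fin_cases j <;> simp [e, hxy]
      simpa [hy] using this
    · filter_upwards [a2] with p hp τ _ hpb
      refine hp ?_
      rw [Metric.mem_ball, dist_eq_norm] at hpb
      have := (abs_coord_le (p - (x + τ • e 0)) 1).trans_lt hpb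
      simp [e] at this
      rw [abs_lt] at this
      rw [mem_halfPlane]; linarith
  have hvt : ∀ ℓ : ℝ, 0 < ℓ → ∀ x y : Plane, ℓ < x 1 → x 0 = y 0 → x 1 ≤ y 1 →
      |g y - g x| ≤ M * max (ℓ ^ (-β)) 1 * (y 1 - x 1) := by
    intro ℓ hℓ x y hx hxy hle
    have := abs_sub_le_along_curve volume isOpen_halfPlane hg.1 (c := fun s => x + s • e 1)
      (c' := fun _ => e 1) (a := 0) (b := y 1 - x 1) (B := M * max (ℓ ^ (-β)) 1) (r := x 1 - ℓ) (S := 1)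
      (by linarith) (by linarith)
      (fun τ _ => (hasDerivAt_line x (e 1) τ).hasDerivWithinAt) (fun _ _ => by simp [e])
      (fun τ hτ => by
        rw [mem_halfPlane, add_smul_e_apply]; simp; linarith [hτ.1]) ?_
    · have hy : x + (y 1 - x 1) • e 1 = y := by
        ext j; fin_cases j <;> simp [e, hxy]
      simpa [hy] using this
    · filter_upwards [a3] with p hp τ hτ hpb
      rw [Metric.mem_ball, dist_eq_norm] at hpb
      have := (abs_coord_le (p - (x + τ • e 1)) 1).trans_lt hpb
      simp [e] at this
      rw [abs_lt] at this
      have hpℓ : ℓ < p 1 := by linarith [hτ.1]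
      have h5 := hp (hℓ.trans hpℓ)
      have hmin : 1 ≤ max (ℓ ^ (-β)) 1 * min (p 1 ^ β) 1 := by
        have q1 : ℓ ^ β ≤ p 1 ^ β := Real.rpow_le_rpow hℓ.le hpℓ.le hβ
        have q2 : 0 < ℓ ^ β := by positivity
        rcases le_total (p 1 ^ β) 1 with h6 | h6
        · rw [min_eq_left h6]
          calc (1 : ℝ) = ℓ ^ (-β) * ℓ ^ β := by rw [← Real.rpow_add hℓ]; simp
            _ ≤ max (ℓ ^ (-β)) 1 * p 1 ^ β := by
              gcongr
              exact le_max_left _ _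
        · rw [min_eq_right h6, mul_one]; exact le_max_right _ _
      have hmp : 0 ≤ min (p 1 ^ β) 1 := le_min (Real.rpow_nonneg (hℓ.trans hpℓ).le _) zero_le_one
      rw [abs_mul, abs_of_nonneg hmp] at h5
      have hmx : 0 ≤ max (ℓ ^ (-β)) 1 := le_max_of_le_right zero_le_one
      calc |fderiv ℝ g p (e 1)| ≤ (max (ℓ ^ (-β)) 1 * min (p 1 ^ β) 1) * |fderiv ℝ g p (e 1)| :=
            le_mul_of_one_le_left (abs_nonneg _) hmin
        _ = max (ℓ ^ (-β)) 1 * (min (p 1 ^ β) 1 * |fderiv ℝ g p (e 1)|) := by ring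
        _ ≤ max (ℓ ^ (-β)) 1 * M := by gcongr
        _ = _ := mul_comm _ _
  refine ⟨hcont, fun y hy => ?_, fun x hx y hy hxy => ?_, fun ℓ hℓ x y hx hy hxy => ?_, ?_⟩
  · have hd : Dense {y : Plane | y ∈ halfPlane → |g y| ≤ M} := Measure.dense_of_ae a1
    have hne := mem_closure_iff_nhdsWithin_neBot.1 (hd y)
    have hca : ContinuousAt g y := hcont.continuousAt (isOpen_halfPlane.mem_nhds hy)
    refine le_of_tendsto (x := 𝓝[{y : Plane | y ∈ halfPlane → |g y| ≤ M}] y)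
      ((hca.tendsto.abs).mono_left nhdsWithin_le_nhds) ?_
    filter_upwards [self_mem_nhdsWithin, nhdsWithin_le_nhds (isOpen_halfPlane.mem_nhds hy)]
      with z h5 h6 using h5 h6
  · rcases le_total (x 0) (y 0) with hle | hle
    · rw [abs_sub_comm, abs_sub_comm (x 0), abs_of_nonneg (sub_nonneg.2 hle)]
      exact hoz x y hx hxy hle
    · rw [abs_of_nonneg (sub_nonneg.2 hle)]
      exact hoz y x hy hxy.symm hle
  · rcases le_total (x 1) (y 1) with hle | hle
    · rw [abs_sub_comm, abs_sub_comm (x 1), abs_of_nonneg (sub_nonneg.2 hle)]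
      exact hvt ℓ hℓ x y hx hxy hle
    · rw [abs_of_nonneg (sub_nonneg.2 hle)]
      exact hvt ℓ hℓ y x hy hxy.symm hle
  · rw [eLpNorm_one_eq_lintegral_enorm] at h4
    exact h4

lemma continuousOn_slice {T : ℝ} {θ : ℝ → Plane → ℝ}
    (h : LocallyLipschitzOn (Icc 0 T ×ˢ halfPlane) (fun p : ℝ × Plane => θ p.1 p.2)) {t : ℝ}
    (ht : t ∈ Icc 0 T) : ContinuousOn (θ t) halfPlane :=
  h.continuousOn.comp (f := fun y => (t, y)) (by fun_prop) (fun y hy => ⟨ht, hy⟩)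

lemma continuousOn_time {T : ℝ} {θ : ℝ → Plane → ℝ}
    (h : LocallyLipschitzOn (Icc 0 T ×ˢ halfPlane) (fun p : ℝ × Plane => θ p.1 p.2)) {y : Plane}
    (hy : y ∈ halfPlane) : ContinuousOn (fun t => θ t y) (Icc 0 T) :=
  h.continuousOn.comp (f := fun t => (t, y)) (by fun_prop) (fun t ht => ⟨ht, hy⟩)

/-- The slices of a classical solution with norm at most `M` are regular at all times. -/
lemma Slice.of_ae_time {β T M : ℝ} {θ : ℝ → Plane → ℝ} (hT : 0 < T)
    (hL : LocallyLipschitzOn (Icc 0 T ×ˢ halfPlane) (fun p : ℝ × Plane => θ p.1 p.2))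
    (hae : ∀ᵐ s ∂(volume.restrict (Icc 0 T)), Slice β M (θ s)) {t : ℝ} (ht : t ∈ Icc 0 T) :
    Slice β M (θ t) := by
  rw [ae_restrict_iff' measurableSet_Icc] at hae
  have hcl : t ∈ closure (Ioo 0 T ∩ {s | s ∈ Icc 0 T → Slice β M (θ s)}) := by
    have hd : Dense {s : ℝ | s ∈ Icc 0 T → Slice β M (θ s)} := Measure.dense_of_ae hae
    have h1 := hd.open_subset_closure_inter (isOpen_Ioo (a := (0 : ℝ)) (b := T))
    have h2 : Icc 0 T ⊆ closure (Ioo 0 T ∩ {s : ℝ | s ∈ Icc 0 T → Slice β M (θ s)}) := by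
      have := closure_minimal h1 isClosed_closure
      rwa [closure_Ioo hT.ne] at this
    exact h2 ht
  obtain ⟨s, hs, hlim⟩ := mem_closure_iff_seq_limit.1 hcl
  refine Slice.limit (g := fun k => θ (s k)) (fun k => (hs k).2 (Ioo_subset_Icc_self (hs k).1))
    (fun y hy => ?_) (continuousOn_slice hL ht)
  have := (continuousOn_time hL hy) t ht
  exact this.tendsto.comp (tendsto_nhdsWithin_iff.2
    ⟨hlim, Eventually.of_forall fun k => Ioo_subset_Icc_self (hs k).1⟩)

/-! ### The velocity of a regular slice -/

lemma abs_oddExt_sub_le {g : Plane → ℝ} {D : ℝ} {y y' : Plane} (h : y 1 = y' 1) (hD : 0 ≤ D)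
    (hg : ∀ x x' : Plane, x 0 = y 0 → x' 0 = y' 0 → 0 < x 1 → x 1 = x' 1 → |x 1| = |y 1| →
      |g x - g x'| ≤ D) :
    |oddExt g y - oddExt g y'| ≤ D := by
  rcases lt_trichotomy (y 1) 0 with h1 | h1 | h1
  · rw [oddExt_of_neg h1, oddExt_of_neg (h ▸ h1), neg_sub_neg, abs_sub_comm]
    refine hg _ _ (bar_apply_zero _) (bar_apply_zero _) ?_ ?_ ?_
    · rw [bar_apply_one]; linarith
    · rw [bar_apply_one, bar_apply_one, h]
    · rw [bar_apply_one, abs_neg]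
  · rw [oddExt_of_zero h1, oddExt_of_zero (h ▸ h1)]; simpa using hD
  · rw [oddExt_of_pos h1, oddExt_of_pos (h ▸ h1)]
    exact hg _ _ rfl rfl h1 h rfl

lemma Slice.oddExt_horiz {β M : ℝ} {g : Plane → ℝ} (h : Slice β M g) (y y' : Plane)
    (hy : y 1 = y' 1) : |oddExt g y - oddExt g y'| ≤ M * |y 0 - y' 0| := by
  refine abs_oddExt_sub_le hy (mul_nonneg h.nonneg (abs_nonneg _)) fun x x' h0 h0' hx hxx _ => ?_
  rw [← h0, ← h0']
  exact h.horiz x hx x' (hxx ▸ hx : 0 < x' 1) hxx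

/-- Bounds for the velocity generated by a slice of norm `M`, up to the constant `C`. -/
structure VelocityBounds (α C M : ℝ) (u : Plane → Plane) : Prop where
  abs_le : ∀ i x, |u x i| ≤ C * M
  horiz : ∀ i x d, |u (x + d • e 0) i - u x i| ≤ C * M * |d|
  normal : ∀ x d, |u (x + d • e 1) 1 - u x 1| ≤ C * M * |d|
  normal_le : ∀ x, |u x 1| ≤ C * M * |x 1|
  shear : ∀ ℓ x d, 0 < ℓ → ℓ ≤ 1 → ℓ ≤ x 1 → |d| ≤ ℓ / 4 →
    |u (x + d • e 1) 0 - u x 0| ≤ C * M * ℓ ^ (-(2 * α)) * |d|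

lemma exists_velocityBounds {α : ℝ} (hα : 0 < α) (hα' : α < 1 / 2) : ∃ C : ℝ, 0 < C ∧
    ∀ (β M : ℝ) (g : Plane → ℝ), 0 ≤ β → β < 1 → Slice β M g →
      VelocityBounds α C M (velocity α g) := by
  obtain ⟨C₀, hC₀, h0⟩ := exists_abs_conv_le hα hα'
  obtain ⟨C₁, hC₁, h1⟩ := exists_conv_lipschitz_dir hα hα'
  obtain ⟨C₂, hC₂, h2⟩ := exists_conv_normal_lipschitz hα hα'
  obtain ⟨C₃, hC₃, h3⟩ := exists_conv_diff_le hα hα'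
  set C₄ := discArea + discArea / α
  have hC₄ : 0 ≤ C₄ := add_nonneg discArea_nonneg (div_nonneg discArea_nonneg hα.le)
  have h2p : (0 : ℝ) < 2 ^ (2 * α) := by positivity
  refine ⟨2 * C₀ + 2 * C₁ + 2 * C₂ + C₃ * (2 ^ (2 * α) * (2 + C₄ * 2)), by positivity, ?_⟩
  intro β M g hβ hβ' hg
  have hM := hg.nonneg
  have hadm := hg.admissible
  have hle : ∀ a b : ℝ, 0 ≤ b → a ≤ 2 * C₀ + 2 * C₁ + 2 * C₂ + C₃ * (2 ^ (2 * α) * (2 + C₄ * 2)) →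
      a * M * b ≤ (2 * C₀ + 2 * C₁ + 2 * C₂ + C₃ * (2 ^ (2 * α) * (2 + C₄ * 2))) * M * b :=
    fun a b hb h => by gcongr
  have hX : 0 ≤ C₃ * (2 ^ (2 * α) * (2 + C₄ * 2)) := by positivity
  have hn : ∀ x d, |velocity α g (x + d • e 1) 1 - velocity α g x 1| ≤ 2 * C₂ * M * |d| := fun x d => by
    rw [velocity_apply hα hα' hadm, velocity_apply hα hα' hadm]
    refine (h2 (2 * M) _ x d hadm fun y y' hy => (hg.oddExt_horiz y y' hy).trans ?_).trans (by linarith)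
    gcongr; linarith
  refine ⟨fun i x => ?_, fun i x d => ?_, fun x d => ?_, fun x => ?_, fun ℓ x d hℓ hℓ1 hx hd => ?_⟩
  · rw [velocity_apply hα hα' hadm]
    have := hle (2 * C₀) 1 zero_le_one (by linarith)
    linarith [h0 _ _ i x hadm]
  · rw [velocity_apply hα hα' hadm, velocity_apply hα hα' hadm]
    have := h1 (2 * M) _ i x (d • e 0) hadm fun y => by
      refine (hg.oddExt_horiz _ _ (by simp [e])).trans ?_
      rw [norm_smul_e, add_smul_e_apply, if_pos rfl, add_sub_cancel_left]
      gcongr; linarith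
    rw [norm_smul_e] at this
    refine le_trans (by linarith) (hle (2 * C₁) |d| (abs_nonneg _) (by linarith))
  · exact (hn x d).trans (hle (2 * C₂) |d| (abs_nonneg _) (by linarith))
  · have hz : velocity α g (x + (-x 1) • e 1) 1 = 0 := by
      rw [velocity_apply hα hα' hadm]
      exact conv_eq_zero_of_odd (oddExt_bar g) (by rw [add_smul_e_apply]; simp)
    have := hn x (-x 1)
    rw [hz, zero_sub, abs_neg, abs_neg] at this
    exact this.trans (hle (2 * C₂) _ (abs_nonneg _) (by linarith))
  · rw [velocity_apply hα hα' hadm, velocity_apply hα hα' hadm]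
    have hR : (0 : ℝ) < ℓ / 2 := by linarith
    have hm : max ((ℓ / 4) ^ (-β)) 1 = (ℓ / 4) ^ (-β) :=
      max_eq_left (Real.one_le_rpow_of_pos_of_le_one_of_nonpos (by linarith) (by linarith) (by linarith))
    have := h3 (2 * M) (ℓ / 2) (M * (ℓ / 4) ^ (-β)) _ 0 x (d • e 1) hadm hR (by positivity)
      (by rw [norm_smul_e]; linarith) (fun z hz => by
        have hz1 := (abs_coord_le z 1).trans_lt hz
        rw [abs_lt] at hz1
        have hd1 := abs_le.1 hd
        have q1 : ℓ / 4 < (x - z) 1 := by simp; linarith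
        rw [show x + d • e 1 - z = (x - z) + d • e 1 by abel]
        have q3 : ((x - z) + d • e 1 : Plane) 1 = (x - z) 1 + d := by
          rw [add_smul_e_apply, if_pos rfl]
        have q2 : ℓ / 4 < (x - z + d • e 1) 1 := by rw [q3]; simp; linarith
        rw [oddExt_of_pos (by linarith), oddExt_of_pos (by linarith)]
        have := hg.vert (ℓ / 4) (by linarith) _ _ q2 q1 (by rw [add_smul_e_apply]; simp)
        rwa [hm, q3, add_sub_cancel_left, ← norm_smul_e d 1] at this)
    rw [norm_smul_e] at this
    have hj := integral_maxPow_mul_le hα hR hadm x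
    have hp : (ℓ / 4) ^ (-β) * (ℓ / 2) ^ (1 - 2 * α) ≤ 2 * (ℓ / 2) ^ (-(2 * α)) := by
      calc (ℓ / 4) ^ (-β) * (ℓ / 2) ^ (1 - 2 * α) ≤ (ℓ / 4) ^ (-1 : ℝ) * (ℓ / 2) ^ (1 - 2 * α) := by
            gcongr ?_ * _
            exact Real.rpow_le_rpow_of_exponent_ge (by linarith) (by linarith) (by linarith)
        _ = 2 * (ℓ / 2) ^ (-(2 * α)) := by
            rw [sub_eq_add_neg, Real.rpow_add hR, Real.rpow_one, Real.rpow_neg_one]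
            field_simp; norm_num
    have hq : (ℓ / 2) ^ (-(2 * α)) = 2 ^ (2 * α) * ℓ ^ (-(2 * α)) := by
      rw [Real.div_rpow hℓ.le zero_le_two, Real.rpow_neg zero_le_two, div_inv_eq_mul, mul_comm]
    have hsum : M * (ℓ / 4) ^ (-β) * (ℓ / 2) ^ (1 - 2 * α)
        + ∫ z, maxPow (ℓ / 2) (2 + 2 * α) z * |oddExt g (x - z)|
        ≤ 2 ^ (2 * α) * (2 + C₄ * 2) * M * ℓ ^ (-(2 * α)) := by
      have := mul_le_mul_of_nonneg_left hp hM
      rw [hq] at this hj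
      linarith
    calc _ ≤ C₃ * |d| * (2 ^ (2 * α) * (2 + C₄ * 2) * M * ℓ ^ (-(2 * α))) :=
          this.trans (by gcongr)
      _ = C₃ * (2 ^ (2 * α) * (2 + C₄ * 2)) * M * (ℓ ^ (-(2 * α)) * |d|) := by ring
      _ ≤ _ := (hle _ (ℓ ^ (-(2 * α)) * |d|) (by positivity) (by linarith)).trans_eq (by ring)

/-- A field that is Lipschitz and bounded away from the boundary, with normal component at most
proportional to the height. -/
structure FlowField (T C V : ℝ) (w : ℝ → Plane → Plane) : Prop where
  cont : ∀ x ∈ halfPlane, ContinuousOn (fun t => w t x) (Icc 0 T)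
  norm_le : ∀ t ∈ Icc 0 T, ∀ x ∈ halfPlane, ‖w t x‖ ≤ V
  lip : ∀ ε : ℝ, 0 < ε → ∃ K : ℝ, ∀ t ∈ Icc 0 T, ∀ x x' : Plane, ε ≤ x 1 → ε ≤ x' 1 →
    ‖w t x - w t x'‖ ≤ K * ‖x - x'‖
  normal : ∀ t ∈ Icc 0 T, ∀ x ∈ halfPlane, |w t x 1| ≤ C * x 1

lemma norm_le_abs_add (z : Plane) : ‖z‖ ≤ |z 0| + |z 1| := by
  have h := norm_sq_eq z
  refine abs_le_of_sq_le_sq' ?_ (by positivity) |>.2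
  nlinarith [sq_abs (z 0), sq_abs (z 1), mul_nonneg (abs_nonneg (z 0)) (abs_nonneg (z 1))]

lemma VelocityBounds.norm_sub_le {α C M ε : ℝ} {u : Plane → Plane} (hα : 0 < α) (hα' : α < 1 / 2)
    (hu : VelocityBounds α C M u)
    (hCM : 0 ≤ C * M) (hε : 0 < ε) (hε1 : ε ≤ 1) {x x' : Plane} (hx' : ε ≤ x' 1) :
    ‖u x - u x'‖ ≤ 16 * (C * M) / ε * ‖x - x'‖ := by
  have hX := abs_coord_le (x - x') 0
  have hY := abs_coord_le (x - x') 1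
  simp only [PiLp.sub_apply] at hX hY
  by_cases hd : ‖x - x'‖ ≤ ε / 4
  · set m := x' + (x 1 - x' 1) • e 1 with hm
    have hxm : x = m + (x 0 - x' 0) • e 0 := by
      ext j; fin_cases j <;> simp [hm, e]
    have a0 := hu.horiz 0 m (x 0 - x' 0)
    have a1 := hu.horiz 1 m (x 0 - x' 0)
    rw [← hxm] at a0 a1
    have b1 := hu.normal x' (x 1 - x' 1)
    have b0 := hu.shear ε x' (x 1 - x' 1) hε hε1 hx' (hY.trans hd)
    rw [← hm] at b0 b1
    have hpw : ε ^ (-(2 * α)) ≤ ε⁻¹ := by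
      rw [← Real.rpow_neg_one]
      exact Real.rpow_le_rpow_of_exponent_ge hε hε1 (by linarith)
    have h1 : 1 ≤ ε⁻¹ := (one_le_inv₀ hε).2 hε1
    have key : ∀ p q : ℝ, 0 ≤ p → p ≤ ε⁻¹ → 0 ≤ q → q ≤ ‖x - x'‖ → C * M * p * q ≤ C * M * ε⁻¹ * ‖x - x'‖ := by
      intro p q hp hp' hq hq'
      gcongr
    have k0 := key 1 |x 0 - x' 0| zero_le_one h1 (abs_nonneg _) hX
    have k1 := key 1 |x 1 - x' 1| zero_le_one h1 (abs_nonneg _) hY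
    have k2 := key _ |x 1 - x' 1| (by positivity) hpw (abs_nonneg _) hY
    refine (norm_le_abs_add _).trans ?_
    simp only [PiLp.sub_apply]
    have c0 := abs_sub_le (u x 0) (u m 0) (u x' 0)
    have c1 := abs_sub_le (u x 1) (u m 1) (u x' 1)
    have hn : 0 ≤ C * M * ε⁻¹ * ‖x - x'‖ := by positivity
    have : 16 * (C * M) / ε * ‖x - x'‖ = 16 * (C * M * ε⁻¹ * ‖x - x'‖) := by field_simp
    rw [this]; linarith
  · push Not at hd
    refine (norm_le_abs_add _).trans ?_
    simp only [PiLp.sub_apply]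
    have a0 := (abs_sub (u x 0) (u x' 0)).trans (add_le_add (hu.abs_le 0 x) (hu.abs_le 0 x'))
    have a1 := (abs_sub (u x 1) (u x' 1)).trans (add_le_add (hu.abs_le 1 x) (hu.abs_le 1 x'))
    have : 4 * (C * M) ≤ 16 * (C * M) / ε * ‖x - x'‖ := by
      rw [div_mul_eq_mul_div, le_div_iff₀ hε]
      nlinarith
    linarith

lemma hasDerivWithinAt_coord {X : ℝ → Plane} {v : Plane} {s : Set ℝ} {τ : ℝ}
    (h : HasDerivWithinAt X v s τ) (i : Fin 2) : HasDerivWithinAt (fun σ => X σ i) (v i) s τ :=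
  (EuclideanSpace.proj i : Plane →L[ℝ] ℝ).hasFDerivAt.comp_hasDerivWithinAt τ h

lemma exists_trajectory {T C V : ℝ} {w : ℝ → Plane → Plane} {y : Plane} (hT : 0 ≤ T)
    (hw : FlowField T C V w) (hy : y ∈ halfPlane) : ∃ X : ℝ → Plane, X 0 = y ∧
      ∀ τ ∈ Icc 0 T, X τ ∈ halfPlane ∧ HasDerivWithinAt X (w τ (X τ)) (Icc 0 T) τ := by
  have hy : 0 < y 1 := hy
  have hC : 0 ≤ C := by
    have := (abs_nonneg _).trans (hw.normal 0 (left_mem_Icc.2 hT) y hy)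
    exact nonneg_of_mul_nonneg_left this hy
  have hV : 0 ≤ V := (norm_nonneg _).trans (hw.norm_le 0 (left_mem_Icc.2 hT) y hy)
  set ε := y 1 * Real.exp (-((C + 1) * T)) with hε
  have hε0 : 0 < ε := by positivity
  set κ : Plane → Plane := fun x => !₂[x 0, max (x 1) ε] with hκ
  have hκ1 : ∀ x, ε ≤ κ x 1 := fun x => by simp [hκ]
  have hκH : ∀ x, κ x ∈ halfPlane := fun x => hε0.trans_le (hκ1 x)
  have hκl : ∀ x x', ‖κ x - κ x'‖ ≤ ‖x - x'‖ := by
    intro x x'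
    refine abs_le_of_sq_le_sq' ?_ (norm_nonneg _) |>.2
    rw [norm_sq_eq, norm_sq_eq]
    have := abs_max_sub_max_le_abs (x 1) (x' 1) ε
    simp only [hκ, PiLp.sub_apply]
    have := sq_le_sq.2 this
    simp; simpa using this
  obtain ⟨K, hK⟩ := hw.lip ε hε0
  have hpl : IsPicardLindelof (fun t x => w t (κ x)) (⟨0, left_mem_Icc.2 hT⟩ : Icc 0 T) y
      (V.toNNReal * T.toNNReal) 0 V.toNNReal K.toNNReal := by
    refine ⟨fun t ht => LipschitzOnWith.of_dist_le_mul fun x _ x' _ => ?_, fun x _ => hw.cont _ (hκH x),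
      fun t ht x _ => ?_, ?_⟩
    · rw [dist_eq_norm, dist_eq_norm]
      refine (hK t ht _ _ (hκ1 x) (hκ1 x')).trans ?_
      have := hκl x x'
      have h2 := Real.le_coe_toNNReal K
      calc K * ‖κ x - κ x'‖ ≤ K.toNNReal * ‖κ x - κ x'‖ := by gcongr
        _ ≤ _ := by gcongr
    · rw [Real.coe_toNNReal V hV]; exact hw.norm_le t ht _ (hκH x)
    · simp [hT]
  obtain ⟨X, hX0, hX⟩ := hpl.exists_eq_forall_mem_Icc_hasDerivWithinAt₀
  have hX0 : X 0 = y := hX0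
  have hXd : ∀ τ ∈ Icc 0 T, HasDerivWithinAt (fun s => X s 1) (w τ (κ (X τ)) 1) (Icc 0 T) τ :=
    fun τ hτ => hasDerivWithinAt_coord (hX τ hτ) 1
  have hfence : ∀ τ ∈ Icc 0 T, -X τ 1 ≤ -(y 1 * Real.exp (-((C + 1) * τ))) := by
    refine image_le_of_deriv_right_lt_deriv_boundary (f := fun τ => -X τ 1)
      (f' := fun τ => -(w τ (κ (X τ)) 1))
      (B := fun τ => -(y 1 * Real.exp (-((C + 1) * τ))))
      (B' := fun τ => (C + 1) * (y 1 * Real.exp (-((C + 1) * τ))))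
      (fun τ hτ => (hXd τ hτ).continuousWithinAt.neg) (fun τ hτ => ?_) (by simp [hX0]) (fun τ => ?_)
      (fun τ hτ heq => ?_)
    · exact ((hXd τ (Ico_subset_Icc_self hτ)).mono_of_mem_nhdsWithin
        (Icc_mem_nhdsGE_of_mem hτ)).neg
    · have h1 : HasDerivAt (fun τ : ℝ => -((C + 1) * τ)) (-(C + 1)) τ := by
        have := ((hasDerivAt_id τ).const_mul (C + 1)).neg
        rwa [mul_one] at this
      refine (h1.exp.const_mul (y 1)).neg.congr_deriv ?_
      ring
    · have heq : X τ 1 = y 1 * Real.exp (-((C + 1) * τ)) := neg_injective heq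
      have hge : ε ≤ X τ 1 := by
        rw [heq, hε]
        have : τ ≤ T := hτ.2.le
        gcongr
      have hκX : κ (X τ) = X τ := by
        ext j; fin_cases j <;> simp [hκ, hge]
      have hpos : 0 < X τ 1 := hε0.trans_le hge
      have := (abs_le.1 (hw.normal τ (Ico_subset_Icc_self hτ) _ (hpos : X τ ∈ halfPlane))).1
      simp only [hκX]
      rw [← heq]
      nlinarith
  have hge : ∀ τ ∈ Icc 0 T, ε ≤ X τ 1 := by
    intro τ hτ
    have h1 := hfence τ hτ
    have h2 : ε ≤ y 1 * Real.exp (-((C + 1) * τ)) := by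
      rw [hε]
      have : τ ≤ T := hτ.2
      gcongr
    linarith
  refine ⟨X, hX0, fun τ hτ => ⟨hε0.trans_le (hge τ hτ), ?_⟩⟩
  have hκX : κ (X τ) = X τ := by
    ext j; fin_cases j <;> simp [hκ, hge τ hτ]
  have := hX τ hτ
  rwa [hκX] at this

/-- Heights along a trajectory change at most exponentially. -/
lemma height_le_exp {T C V : ℝ} {w : ℝ → Plane → Plane} {X : ℝ → Plane} (hw : FlowField T C V w)
    (hX : ∀ τ ∈ Icc 0 T, X τ ∈ halfPlane ∧ HasDerivWithinAt X (w τ (X τ)) (Icc 0 T) τ)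
    {s t : ℝ} (hs : s ∈ Icc 0 T) (ht : t ∈ Icc 0 T) : X t 1 ≤ Real.exp (C * |t - s|) * X s 1 := by
  have hpos : ∀ τ ∈ Icc 0 T, 0 < X τ 1 := fun τ hτ => (hX τ hτ).1
  have hd : ∀ τ ∈ Icc 0 T, HasDerivWithinAt (fun s => Real.log (X s 1)) (w τ (X τ) 1 / X τ 1) (Icc 0 T) τ :=
    fun τ hτ => (hasDerivWithinAt_coord (hX τ hτ).2 1).log (hpos τ hτ).ne'
  have := (convex_Icc 0 T).norm_image_sub_le_of_norm_hasDerivWithin_le (C := C) hd (fun τ hτ => by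
    rw [Real.norm_eq_abs, abs_div, abs_of_pos (hpos τ hτ), div_le_iff₀ (hpos τ hτ)]
    exact hw.normal τ hτ _ (hX τ hτ).1) hs ht
  rw [Real.norm_eq_abs, Real.norm_eq_abs] at this
  have h1 := (abs_le.1 this).2
  rw [← Real.exp_log (hpos t ht), ← Real.exp_log (hpos s hs), ← Real.exp_add, Real.exp_le_exp]
  linarith

/-! ### Characteristics of classical solutions -/

lemma continuousOn_conv {α B : ℝ} {s : Set ℝ} {G : ℝ → Plane → ℝ} (hα : 0 < α) (hα' : α < 1 / 2)
    (hG : ∀ t ∈ s, Admissible B (G t)) (hc : ∀ y, ContinuousOn (fun t => G t y) s)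
    (i : Fin 2) (x : Plane) : ContinuousOn (fun t => conv α (G t) i x) s := by
  rcases s.eq_empty_or_nonempty with rfl | ⟨t₀, ht₀⟩
  · exact continuousOn_empty _
  have hB := (hG t₀ ht₀).nonneg
  have hnear : ∀ n : ℕ, ContinuousOn
      (fun t => ∫ z, (kernel α z i - truncKernel α (n + 1 : ℝ) i z) * G t (x - z)) s := by
    intro n
    refine continuousOn_of_dominated (bound := fun z => innerPow (n + 1) (1 + 2 * α) z * B)
      (fun t ht => (integrable_near hα hα' (by positivity) (hG t ht) i x).1)
      (fun t ht => Eventually.of_forall fun z => ?_)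
      ((integrable_innerPow (by linarith) (by positivity)).mul_const B)
      (Eventually.of_forall fun z => continuousOn_const.mul (hc _))
    rw [Real.norm_eq_abs, abs_mul]
    exact mul_le_mul (abs_kernel_sub_truncKernel_le hα z i) ((hG t ht).bound _) (abs_nonneg _)
      (innerPow_nonneg _ _ _)
  refine TendstoUniformlyOn.continuousOn (p := atTop) (F := fun (n : ℕ) t =>
    ∫ z, (kernel α z i - truncKernel α (n + 1 : ℝ) i z) * G t (x - z)) ?_
    (Eventually.of_forall hnear).frequently
  have hlim : Tendsto (fun n : ℕ => ((n : ℝ) + 1) ^ (-(1 + 2 * α)) * B) atTop (𝓝 0) := by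
    have h1 : Tendsto (fun n : ℕ => (n : ℝ) + 1) atTop atTop :=
      tendsto_atTop_add_const_right _ _ tendsto_natCast_atTop_atTop
    simpa using ((tendsto_rpow_neg_atTop (by linarith : 0 < 1 + 2 * α)).comp h1).mul_const B
  rw [Metric.tendstoUniformlyOn_iff]
  intro ε hε
  filter_upwards [hlim.eventually_lt_const hε] with n hn t ht
  refine lt_of_le_of_lt ?_ hn
  have hR : (0 : ℝ) < n + 1 := by positivity
  rw [conv_eq_near_add_far hα hα' hR (hG t ht), Real.dist_eq, add_sub_cancel_left]
  have hint := ((hG t ht).comp_sub x).abs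
  calc |∫ z, truncKernel α (n + 1) i z * G t (x - z)|
      ≤ ∫ z, (n + 1 : ℝ) ^ (-(1 + 2 * α)) * |G t (x - z)| := by
        refine norm_integral_le_of_norm_le (f := fun z => truncKernel α (n + 1) i z * G t (x - z))
          (hint.const_mul _) (Eventually.of_forall fun z => ?_)
        rw [Real.norm_eq_abs, abs_mul]
        exact mul_le_mul_of_nonneg_right (abs_truncKernel_le hα hR z i) (abs_nonneg _)
    _ = (n + 1 : ℝ) ^ (-(1 + 2 * α)) * ∫ y, |G t y| := by
        rw [integral_const_mul, integral_sub_left_eq_self (fun y => |G t y|) volume x]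
    _ ≤ _ := by gcongr; exact (hG t ht).l1

/-- A classical solution together with a uniform bound for its slices. -/
structure BoundedSolution (α β M T : ℝ) (θ : ℝ → Plane → ℝ) : Prop where
  slice : ∀ t ∈ Icc 0 T, Slice β M (θ t)
  lip : LocallyLipschitzOn (Icc 0 T ×ˢ halfPlane) (fun p : ℝ × Plane => θ p.1 p.2)
  equation : ∀ᵐ p : ℝ × Plane ∂(volume.restrict (Icc 0 T ×ˢ halfPlane)),
    deriv (fun t => θ t p.2) p.1 + fderiv ℝ (θ p.1) p.2 (velocity α (θ p.1) p.2) = 0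

lemma IsClassicalSolution.bounded_of_ae {α β T M : ℝ} {θ₀ : Plane → ℝ} {θ : ℝ → Plane → ℝ}
    (hT : 0 < T) (h : IsClassicalSolution α β T θ₀ θ)
    (hae : ∀ᵐ s ∂(volume.restrict (Icc 0 T)), Slice β M (θ s)) : BoundedSolution α β M T θ :=
  ⟨fun _ ht => Slice.of_ae_time hT h.locallyLipschitz hae ht, h.locallyLipschitz, h.equation⟩

lemma MemLinftyX.ae_slice {β T : ℝ} {θ : ℝ → Plane → ℝ} (hβ : 0 ≤ β) (h : MemLinftyX β T θ) :
    ∀ᵐ s ∂(volume.restrict (Icc 0 T)), Slice β (timeNorm β T θ).toReal (θ s) := by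
  filter_upwards [h.1, ENNReal.ae_le_essSup (fun t => xNorm β (θ t))] with s h1 h2
  refine memX_slice hβ ENNReal.toReal_nonneg h1 ?_
  rwa [ENNReal.ofReal_toReal h.2.ne]

lemma continuousOn_oddExt_time {T : ℝ} {θ : ℝ → Plane → ℝ}
    (h : LocallyLipschitzOn (Icc 0 T ×ˢ halfPlane) (fun p : ℝ × Plane => θ p.1 p.2)) (y : Plane) :
    ContinuousOn (fun t => oddExt (θ t) y) (Icc 0 T) := by
  rcases lt_trichotomy (y 1) 0 with h1 | h1 | h1
  · simp only [oddExt_of_neg h1]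
    exact (continuousOn_time h (by rw [mem_halfPlane, bar_apply_one]; linarith)).neg
  · simp only [oddExt_of_zero h1]; exact continuousOn_const
  · simp only [oddExt_of_pos h1]; exact continuousOn_time h h1

lemma continuousOn_plane {s : Set ℝ} {f : ℝ → Plane} (h : ∀ i, ContinuousOn (fun t => f t i) s) :
    ContinuousOn f s := by
  have h1 : ContinuousOn (fun t => WithLp.ofLp (f t)) s := continuousOn_pi.2 h
  exact (PiLp.continuous_toLp 2 (fun _ : Fin 2 => ℝ)).comp_continuousOn h1

lemma BoundedSolution.flowField {α β M T C : ℝ} {θ : ℝ → Plane → ℝ} (hα : 0 < α) (hα' : α < 1 / 2)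
    (h : BoundedSolution α β M T θ) (hCM : 0 ≤ C * M)
    (hv : ∀ t ∈ Icc 0 T, VelocityBounds α C M (velocity α (θ t))) :
    FlowField T (C * M) (2 * (C * M)) (fun t => velocity α (θ t)) where
  cont x _ := by
    refine continuousOn_plane fun i => ?_
    refine (continuousOn_conv hα hα' (fun t ht => (h.slice t ht).admissible)
      (continuousOn_oddExt_time h.lip) i x).congr fun t ht => ?_
    exact velocity_apply hα hα' (h.slice t ht).admissible x i
  norm_le t ht x _ := by
    have := norm_le_abs_add (velocity α (θ t) x)
    linarith [(hv t ht).abs_le 0 x, (hv t ht).abs_le 1 x]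
  lip ε hε := ⟨16 * (C * M) / min ε 1, fun t ht x x' hx hx' =>
    (hv t ht).norm_sub_le hα hα' hCM (lt_min hε one_pos) (min_le_right _ _)
      ((min_le_left _ _).trans hx')⟩
  normal t ht x hx := by
    have := (hv t ht).normal_le x
    have hx : 0 < x 1 := hx
    rwa [abs_of_pos hx] at this

lemma FlowField.exists_near {T C V : ℝ} {w : ℝ → Plane → Plane} (hw : FlowField T C V w) {τ : ℝ}
    (hτ : τ ∈ Icc 0 T) {x : Plane} (hx : x ∈ halfPlane) {ε : ℝ} (hε : 0 < ε) :
    ∃ δ > 0, ∀ s ∈ Icc 0 T, |s - τ| < δ → ∀ z, ‖z - x‖ < δ → ‖w s z - w τ x‖ ≤ ε := by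
  have hx : 0 < x 1 := hx
  obtain ⟨K, hK⟩ := hw.lip (x 1 / 2) (by positivity)
  obtain ⟨δ₁, hδ₁, h1⟩ := Metric.continuousWithinAt_iff.1 (hw.cont x hx τ hτ) (ε / 2) (by positivity)
  refine ⟨min δ₁ (min (x 1 / 2) (ε / 2 / (|K| + 1))), by positivity, fun s hs hsτ z hz => ?_⟩
  have h2 := h1 hs (by rw [Real.dist_eq]; exact hsτ.trans_le (min_le_left _ _))
  rw [dist_eq_norm] at h2
  have hz1 := hz.trans_le ((min_le_right _ _).trans (min_le_left _ _))
  have hz2 := hz.trans_le ((min_le_right _ _).trans (min_le_right _ _))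
  have hzh := (abs_le.1 ((abs_coord_le (z - x) 1).trans hz1.le)).1
  simp only [PiLp.sub_apply] at hzh
  have h3 := hK s hs z x (by linarith) (by linarith)
  have h4 : K * ‖z - x‖ ≤ ε / 2 := by
    rw [lt_div_iff₀ (by positivity)] at hz2
    nlinarith [le_abs_self K, norm_nonneg (z - x)]
  have := norm_sub_le_norm_sub_add_norm_sub (w s z) (w s x) (w τ x)
  linarith

/-- A solution is constant along the characteristics of its velocity. -/
lemma BoundedSolution.conserved {α β M T C V b : ℝ} {θ : ℝ → Plane → ℝ} {X : ℝ → Plane}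
    (h : BoundedSolution α β M T θ) (hw : FlowField T C V (fun t => velocity α (θ t))) (hb : b ≤ T)
    (hX : ∀ τ ∈ Icc 0 b, X τ ∈ halfPlane ∧ HasDerivWithinAt X (velocity α (θ τ) (X τ)) (Icc 0 b) τ)
    {t : ℝ} (ht : t ∈ Icc 0 b) : θ t (X t) = θ 0 (X 0) := by
  have : (volume : Measure (ℝ × Plane)).IsAddHaarMeasure := by
    rw [Measure.volume_eq_prod]; infer_instance
  rcases ht.1.eq_or_lt with rfl | h0
  · rfl
  set f : ℝ × Plane → ℝ := fun p => θ p.1 p.2 with hf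
  have hXc : ContinuousOn X (Icc 0 b) := fun τ hτ => (hX τ hτ).2.continuousWithinAt
  have hcont : ContinuousOn (fun τ => θ τ (X τ)) (Icc 0 t) :=
    h.lip.continuousOn.comp (f := fun τ => (τ, X τ))
      (continuousOn_id.prodMk (hXc.mono (Icc_subset_Icc_right ht.2)))
      (fun τ hτ => ⟨⟨hτ.1, hτ.2.trans (ht.2.trans hb)⟩, (hX τ ⟨hτ.1, hτ.2.trans ht.2⟩).1⟩)
  have hder : ∀ τ ∈ Ioo 0 t, HasDerivAt (fun τ => θ τ (X τ)) 0 τ := by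
    intro τ₀ hτ₀
    have hτb : τ₀ ∈ Ioo 0 b := ⟨hτ₀.1, hτ₀.2.trans_le ht.2⟩
    have hτT : τ₀ ∈ Ioo 0 T := ⟨hτ₀.1, hτb.2.trans_le hb⟩
    have hU : IsOpen (Ioo 0 T ×ˢ halfPlane) := isOpen_Ioo.prod isOpen_halfPlane
    have hp₀ : (τ₀, X τ₀) ∈ Ioo 0 T ×ˢ halfPlane := ⟨hτT, (hX τ₀ (Ioo_subset_Icc_self hτb)).1⟩
    have hLU : LocallyLipschitzOn (Ioo 0 T ×ˢ halfPlane) f :=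
      h.lip.mono (prod_mono_left Ioo_subset_Icc_self)
    obtain ⟨K, N, hN, hKN⟩ := hLU hp₀
    rw [hU.nhdsWithin_eq hp₀] at hN
    obtain ⟨ρ, hρ, hρN⟩ := Metric.mem_nhds_iff.1 (inter_mem hN (hU.mem_nhds hp₀))
    rw [hasDerivAt_iff_isLittleO, Asymptotics.isLittleO_iff]
    intro ε hε
    obtain ⟨δ, hδ, hnear⟩ := hw.exists_near (Ioo_subset_Icc_self hτT) hp₀.2
      (ε := ε / (2 * (K + 1))) (by positivity)
    set r := min ρ δ / 2 with hr
    have hr0 : 0 < r := by positivity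
    have hXn : ∀ᶠ τ in 𝓝 τ₀, ‖X τ - X τ₀‖ < r ∧ |τ - τ₀| < r ∧ τ ∈ Ioo 0 b := by
      have hca : ContinuousAt X τ₀ := hXc.continuousAt (Icc_mem_nhds hτb.1 hτb.2)
      filter_upwards [Metric.tendsto_nhds.1 hca r hr0, Metric.ball_mem_nhds τ₀ hr0,
        isOpen_Ioo.mem_nhds hτb] with τ h1 h2 h3
      exact ⟨by rwa [dist_eq_norm] at h1, h2, h3⟩
    obtain ⟨σ, hσ, hball⟩ := Metric.eventually_nhds_iff.1 hXn
    have hgood : ∀ᵐ p : ℝ × Plane, p ∈ Metric.ball (τ₀, X τ₀) ρ → DifferentiableAt ℝ f p ∧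
        deriv (fun t => θ t p.2) p.1 + fderiv ℝ (θ p.1) p.2 (velocity α (θ p.1) p.2) = 0 := by
      have e1 := h.equation
      rw [ae_restrict_iff' (measurableSet_Icc.prod measurableSet_halfPlane)] at e1
      filter_upwards [e1, (hKN.mono (hρN.trans inter_subset_left)).ae_differentiableWithinAt_of_mem
        (μ := volume)] with p hp1 hp2 hpb
      exact ⟨(hp2 hpb).differentiableAt (Metric.isOpen_ball.mem_nhds hpb),
        hp1 ⟨Ioo_subset_Icc_self (hρN hpb).2.1, (hρN hpb).2.2⟩⟩
    have hseg : ∀ a' b' : ℝ, a' ≤ b' → |a' - τ₀| < σ → |b' - τ₀| < σ →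
        |θ b' (X b') - θ a' (X a')| ≤ ε * (b' - a') := by
      intro a' b' hab ha' hb'
      have hin : ∀ τ ∈ Icc a' b', |τ - τ₀| < σ := fun τ hτ => by
        rw [abs_lt] at ha' hb' ⊢
        exact ⟨by linarith [hτ.1], by linarith [hτ.2]⟩
      have hinb : ∀ τ ∈ Icc a' b', τ ∈ Ioo 0 b := fun τ hτ => (hball (hin τ hτ)).2.2
      refine abs_sub_le_along_curve volume hU hLU (c := fun τ => (τ, X τ))
        (c' := fun τ => (1, velocity α (θ τ) (X τ))) (S := max 1 V) hab hr0 (fun τ hτ => ?_)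
        (fun τ hτ => ?_) (fun τ hτ => ?_) ?_
      · exact (hasDerivWithinAt_id τ _).prodMk ((hX τ (Ioo_subset_Icc_self (hinb τ hτ))).2.mono
          fun σ hσ => Ioo_subset_Icc_self (hinb σ hσ))
      · rw [Prod.norm_def, norm_one]
        have hτI := Ioo_subset_Icc_self (hinb τ hτ)
        exact max_le_max le_rfl (hw.norm_le τ ⟨hτI.1, hτI.2.trans hb⟩ _ (hX τ hτI).1)
      · exact ⟨⟨(hinb τ hτ).1, (hinb τ hτ).2.trans_le hb⟩,
          (hX τ (Ioo_subset_Icc_self (hinb τ hτ))).1⟩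
      · filter_upwards [hgood] with p hp τ hτ hpb
        have hτI := Ioo_subset_Icc_self (hinb τ hτ)
        have hq := hball (hin τ hτ)
        rw [Metric.mem_ball, Prod.dist_eq, max_lt_iff, dist_eq_norm, dist_eq_norm, Real.norm_eq_abs] at hpb
        have hp1 : |p.1 - τ₀| < min ρ δ := by
          have := abs_sub_le p.1 τ τ₀
          have := hpb.1; linarith [hq.2.1]
        have hp2 : ‖p.2 - X τ₀‖ < min ρ δ := by
          have := norm_sub_le_norm_sub_add_norm_sub p.2 (X τ) (X τ₀)
          have := hpb.2; linarith [hq.1]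
        have hpρ : p ∈ Metric.ball (τ₀, X τ₀) ρ := by
          rw [Metric.mem_ball, Prod.dist_eq, max_lt_iff, dist_eq_norm, dist_eq_norm]
          exact ⟨hp1.trans_le (min_le_left _ _), hp2.trans_le (min_le_left _ _)⟩
        obtain ⟨hd, heq⟩ := hp hpρ
        have hpT := (hρN hpρ).2.1
        have hrδ : r ≤ δ := by
          have := min_le_right ρ δ
          have : 0 < min ρ δ := by positivity
          rw [hr]; linarith
        have v1 := hnear p.1 (Ioo_subset_Icc_self hpT) (hp1.trans_le (min_le_right _ _)) p.2
          (hp2.trans_le (min_le_right _ _))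
        have v2 := hnear τ ⟨hτI.1, hτI.2.trans hb⟩ (hq.2.1.trans_le hrδ) (X τ) (hq.1.trans_le hrδ)
        have d1 : deriv (fun t => θ t p.2) p.1 = fderiv ℝ f p (1, 0) := by
          have hc : HasDerivAt (fun t : ℝ => (t, p.2)) ((1 : ℝ), (0 : Plane)) p.1 :=
            (hasDerivAt_id p.1).prodMk (hasDerivAt_const p.1 p.2)
          have := hd.hasFDerivAt.comp_hasDerivAt p.1 hc
          exact this.deriv
        have d2 : fderiv ℝ (θ p.1) p.2 (velocity α (θ p.1) p.2)
            = fderiv ℝ f p (0, velocity α (θ p.1) p.2) := by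
          have hc : HasFDerivAt (fun y : Plane => (p.1, y)) (ContinuousLinearMap.inr ℝ ℝ Plane) p.2 :=
            hasFDerivAt_prodMk_right p.1 p.2
          have := (hd.hasFDerivAt.comp p.2 hc).fderiv
          rw [show θ p.1 = f ∘ (fun y : Plane => (p.1, y)) from rfl, this]
          simp
        have d3 : fderiv ℝ f p (1, velocity α (θ τ) (X τ))
            = fderiv ℝ f p (0, velocity α (θ τ) (X τ) - velocity α (θ p.1) p.2) := by
          rw [d1, d2, ← map_add] at heq
          have : ((1 : ℝ), velocity α (θ τ) (X τ)) = ((1, 0) + (0, velocity α (θ p.1) p.2))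
              + (0, velocity α (θ τ) (X τ) - velocity α (θ p.1) p.2) := by
            simp
          rw [this, map_add, heq, zero_add]
        have hfd : ‖fderiv ℝ f p‖ ≤ K := norm_fderiv_le_of_lipschitzOn ℝ
          (Metric.isOpen_ball.mem_nhds hpρ) (hKN.mono (hρN.trans inter_subset_left))
        rw [d3, ← Real.norm_eq_abs]
        refine ((fderiv ℝ f p).le_of_opNorm_le hfd _).trans ?_
        have hnn : ‖((0 : ℝ), velocity α (θ τ) (X τ) - velocity α (θ p.1) p.2)‖ ≤ ε / (K + 1) := by
          rw [Prod.norm_def, norm_zero, max_eq_right (norm_nonneg _)]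
          have := norm_sub_le_norm_sub_add_norm_sub (velocity α (θ τ) (X τ))
            (velocity α (θ τ₀) (X τ₀)) (velocity α (θ p.1) p.2)
          rw [norm_sub_rev (velocity α (θ τ₀) (X τ₀))] at this
          have e2 : ε / (2 * (K + 1)) + ε / (2 * (K + 1)) = ε / ((K : ℝ) + 1) := by field_simp; ring
          linarith
        calc (K : ℝ) * _ ≤ K * (ε / (K + 1)) := by gcongr
          _ ≤ ε := by
            rw [← mul_div_assoc, div_le_iff₀ (by positivity)]
            nlinarith [K.2]
    refine Metric.eventually_nhds_iff.2 ⟨σ, hσ, fun τ hτ => ?_⟩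
    rw [Real.dist_eq] at hτ
    rw [smul_zero, sub_zero, Real.norm_eq_abs, Real.norm_eq_abs]
    rcases le_total τ₀ τ with hle | hle
    · rw [abs_of_nonneg (sub_nonneg.2 hle)]
      exact hseg τ₀ τ hle (by simpa using hσ) hτ
    · rw [abs_sub_comm, abs_sub_comm τ, abs_of_nonneg (sub_nonneg.2 hle)]
      exact hseg τ τ₀ hle hτ (by simpa using hσ)
  obtain ⟨c, _, hc⟩ := exists_hasDerivAt_eq_slope (fun τ => θ τ (X τ)) (fun _ => 0) h0 hcont hder
  have : 0 = θ t (X t) - θ 0 (X 0) := by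
    rw [eq_div_iff (by linarith)] at hc
    linarith
  linarith

lemma exists_backward_trajectory {T C V t : ℝ} {w : ℝ → Plane → Plane} {y : Plane}
    (hw : FlowField T C V w) (ht : t ∈ Icc 0 T) (hy : y ∈ halfPlane) : ∃ X : ℝ → Plane, X t = y ∧
      ∀ τ ∈ Icc 0 t, X τ ∈ halfPlane ∧ HasDerivWithinAt X (w τ (X τ)) (Icc 0 t) τ := by
  have hmap : ∀ s ∈ Icc 0 t, t - s ∈ Icc 0 t := fun s hs => ⟨by linarith [hs.2], by linarith [hs.1]⟩
  have hmapT : ∀ s ∈ Icc 0 t, t - s ∈ Icc 0 T := fun s hs =>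
    ⟨by linarith [hs.2], by linarith [hs.1, ht.2]⟩
  have hrev : FlowField t C V (fun s x => -w (t - s) x) := by
    refine ⟨fun x hx => ((hw.cont x hx).comp (f := fun s => t - s) (by fun_prop) hmapT).neg,
      fun s hs x hx => ?_, fun ε hε => ?_, fun s hs x hx => ?_⟩
    · rw [norm_neg]; exact hw.norm_le _ (hmapT s hs) x hx
    · obtain ⟨K, hK⟩ := hw.lip ε hε
      refine ⟨K, fun s hs x x' hx hx' => ?_⟩
      rw [neg_sub_neg, norm_sub_rev]
      exact hK _ (hmapT s hs) x x' hx hx'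
    · simpa using hw.normal _ (hmapT s hs) x hx
  obtain ⟨Y, hY0, hY⟩ := exists_trajectory ht.1 hrev hy
  refine ⟨fun τ => Y (t - τ), by simpa using hY0, fun τ hτ => ⟨(hY _ (hmap τ hτ)).1, ?_⟩⟩
  have h1 : HasDerivWithinAt (fun τ : ℝ => t - τ) (-1) (Icc 0 t) τ := by
    simpa using (hasDerivWithinAt_id τ (Icc 0 t)).const_sub t
  have := (hY _ (hmap τ hτ)).2.scomp τ h1 hmap
  rw [neg_one_smul, neg_neg, sub_sub_cancel] at this
  exact this

/-! ### A criterion for membership in `X_β` -/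

lemma locallyLipschitzOn_of_directional {β M : ℝ} {g : Plane → ℝ} (hM : 0 ≤ M)
    (horiz : ∀ x ∈ halfPlane, ∀ y ∈ halfPlane, x 1 = y 1 → |g x - g y| ≤ M * |x 0 - y 0|)
    (vert : ∀ ℓ : ℝ, 0 < ℓ → ∀ x y : Plane, ℓ < x 1 → ℓ < y 1 → x 0 = y 0 →
      |g x - g y| ≤ M * max (ℓ ^ (-β)) 1 * |x 1 - y 1|) : LocallyLipschitzOn halfPlane g := by
  intro x hx
  have hx : 0 < x 1 := hx
  set K := M + M * max ((x 1 / 2) ^ (-β)) 1 with hK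
  have hK0 : 0 ≤ K := by
    have : 0 ≤ max ((x 1 / 2) ^ (-β)) 1 := le_max_of_le_right zero_le_one
    positivity
  refine ⟨K.toNNReal, Metric.ball x (x 1 / 2),
    mem_nhdsWithin_of_mem_nhds (Metric.ball_mem_nhds _ (by positivity)),
    LipschitzOnWith.of_dist_le_mul fun y hy y' hy' => ?_⟩
  have hh : ∀ z ∈ Metric.ball x (x 1 / 2), x 1 / 2 < z 1 := by
    intro z hz
    rw [Metric.mem_ball, dist_eq_norm] at hz
    have := (abs_lt.1 ((abs_coord_le (z - x) 1).trans_lt hz)).1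
    simp only [PiLp.sub_apply] at this
    linarith
  set m : Plane := !₂[y' 0, y 1] with hm
  have m0 : m 0 = y' 0 := by simp [hm]
  have m1 : m 1 = y 1 := by simp [hm]
  have h1 := horiz y (by have := hh y hy; rw [mem_halfPlane]; linarith) m
    (by have := hh y hy; rw [mem_halfPlane, m1]; linarith) m1.symm
  have h2 := vert (x 1 / 2) (by positivity) m y' (by rw [m1]; exact hh y hy) (hh y' hy') m0
  rw [m0] at h1; rw [m1] at h2
  have n0 := abs_coord_le (y - y') 0
  have n1 := abs_coord_le (y - y') 1
  simp only [PiLp.sub_apply] at n0 n1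
  rw [Real.dist_eq, dist_eq_norm, Real.coe_toNNReal _ hK0]
  have h3 := abs_sub_le (g y) (g m) (g y')
  have h4 : 0 ≤ max ((x 1 / 2) ^ (-β)) 1 := le_max_of_le_right zero_le_one
  calc |g y - g y'| ≤ M * |y 0 - y' 0| + M * max ((x 1 / 2) ^ (-β)) 1 * |y 1 - y' 1| := by linarith
    _ ≤ M * ‖y - y'‖ + M * max ((x 1 / 2) ^ (-β)) 1 * ‖y - y'‖ := by gcongr
    _ = K * ‖y - y'‖ := by rw [hK]; ring

lemma Slice.locallyLipschitzOn {β M : ℝ} {g : Plane → ℝ} (h : Slice β M g) :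
    LocallyLipschitzOn halfPlane g := locallyLipschitzOn_of_directional h.nonneg h.horiz h.vert

lemma Slice.add {β M M' : ℝ} {f g : Plane → ℝ} (hf : Slice β M f) (hg : Slice β M' g) :
    Slice β (M + M') (fun y => f y + g y) where
  cont := hf.cont.add hg.cont
  bound y hy := (abs_add_le _ _).trans (add_le_add (hf.bound y hy) (hg.bound y hy))
  horiz x hx y hy hxy := by
    rw [add_sub_add_comm, add_mul]
    exact (abs_add_le _ _).trans (add_le_add (hf.horiz x hx y hy hxy) (hg.horiz x hx y hy hxy))
  vert ℓ hℓ x y hx hy hxy := by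
    rw [add_sub_add_comm, add_mul, add_mul]
    exact (abs_add_le _ _).trans (add_le_add (hf.vert ℓ hℓ x y hx hy hxy) (hg.vert ℓ hℓ x y hx hy hxy))
  l1 := by
    rw [ENNReal.ofReal_add hf.nonneg hg.nonneg]
    refine le_trans ?_ (add_le_add hf.l1 hg.l1)
    rw [← lintegral_add_left' hf.aestronglyMeasurable.enorm]
    exact lintegral_mono fun y => enorm_add_le _ _

lemma Slice.mono {β M M' : ℝ} {g : Plane → ℝ} (h : Slice β M g) (hM : M ≤ M') : Slice β M' g where
  cont := h.cont
  bound y hy := (h.bound y hy).trans hM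
  horiz x hx y hy hxy := (h.horiz x hx y hy hxy).trans (by gcongr)
  vert ℓ hℓ x y hx hy hxy := (h.vert ℓ hℓ x y hx hy hxy).trans (by gcongr)
  l1 := h.l1.trans (ENNReal.ofReal_le_ofReal hM)

lemma Slice.of_support {β M A r : ℝ} {g : Plane → ℝ} (hA : 0 ≤ A) (hr : 0 ≤ r)
    (bound : ∀ y ∈ halfPlane, |g y| ≤ A)
    (horiz : ∀ x ∈ halfPlane, ∀ y ∈ halfPlane, x 1 = y 1 → |g x - g y| ≤ M * |x 0 - y 0|)
    (vert : ∀ ℓ : ℝ, 0 < ℓ → ∀ x y : Plane, ℓ < x 1 → ℓ < y 1 → x 0 = y 0 →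
      |g x - g y| ≤ M * max (ℓ ^ (-β)) 1 * |x 1 - y 1|)
    (supp : ∀ y ∈ halfPlane, g y ≠ 0 → |y 0| ≤ r ∧ y 1 ≤ r) (hM : A ≤ M) (hM' : A * (2 * r * r) ≤ M) :
    Slice β M g where
  cont := (locallyLipschitzOn_of_directional (hA.trans hM) horiz vert).continuousOn
  bound y hy := (bound y hy).trans hM
  horiz := horiz
  vert := vert
  l1 := by
    have hle : ∫⁻ y in halfPlane, ‖g y‖ₑ
        ≤ ∫⁻ y in halfPlane, (prodSet (Icc (-r) r) (Icc 0 r)).indicator (fun _ => ENNReal.ofReal A) y := by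
      refine setLIntegral_mono' measurableSet_halfPlane fun y hy => ?_
      by_cases h : g y = 0
      · simp [h]
      · obtain ⟨h0, h1⟩ := supp y hy h
        have hmem : y ∈ prodSet (Icc (-r) r) (Icc 0 r) := ⟨abs_le.1 h0, le_of_lt hy, h1⟩
        rw [indicator_of_mem hmem, ← ofReal_norm]
        exact ENNReal.ofReal_le_ofReal (bound y hy)
    refine hle.trans ((lintegral_mono_set (subset_univ _)).trans ?_)
    rw [setLIntegral_univ, lintegral_indicator (measurableSet_prodSet measurableSet_Icc measurableSet_Icc),
      setLIntegral_const, volume_prodSet _ _ measurableSet_Icc measurableSet_Icc, Real.volume_Icc,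
      Real.volume_Icc, ← ENNReal.ofReal_mul (by linarith), ← ENNReal.ofReal_mul hA]
    refine ENNReal.ofReal_le_ofReal (le_trans (le_of_eq ?_) hM')
    ring

lemma eLpNorm_top_le {g : Plane → ℝ} {M : ℝ} (h : ∀ y ∈ halfPlane, |g y| ≤ M) :
    eLpNorm g ∞ hpVolume ≤ ENNReal.ofReal M := by
  rw [eLpNorm_exponent_top]
  refine eLpNormEssSup_le_of_ae_bound ?_
  rw [hpVolume]
  exact (ae_restrict_iff' measurableSet_halfPlane).2 (Eventually.of_forall h)

lemma abs_fderiv_le {g : Plane → ℝ} {x v : Plane} {K : ℝ} (hK : 0 ≤ K)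
    (h : ∀ᶠ t : ℝ in 𝓝 0, |g (x + t • v) - g x| ≤ K * |t|) : |fderiv ℝ g x v| ≤ K := by
  by_cases hd : DifferentiableAt ℝ g x
  · have h1 : HasDerivAt (fun t : ℝ => g (x + t • v)) (fderiv ℝ g x v) 0 :=
      hd.hasFDerivAt.hasLineDerivAt v
    refine h1.le_of_lip' hK ?_
    filter_upwards [h] with t ht
    simpa using ht
  · simpa [fderiv_zero_of_not_differentiableAt hd] using hK

lemma Slice.xNorm_le {β M : ℝ} {g : Plane → ℝ} (h : Slice β M g) :
    xNorm β g ≤ ENNReal.ofReal (4 * M) := by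
  have hM := h.nonneg
  have h1 : eLpNorm g ∞ hpVolume ≤ ENNReal.ofReal M := eLpNorm_top_le h.bound
  have h2 : eLpNorm (fun x => fderiv ℝ g x (e 0)) ∞ hpVolume ≤ ENNReal.ofReal M := by
    refine eLpNorm_top_le fun x hx => abs_fderiv_le hM (Eventually.of_forall fun t => ?_)
    have hx : 0 < x 1 := hx
    have e1 : (x + t • e 0) 1 = x 1 := by rw [add_smul_e_apply]; simp
    have := h.horiz (x + t • e 0) (by rw [mem_halfPlane, e1]; exact hx) x hx e1
    rwa [add_smul_e_apply, if_pos rfl, add_sub_cancel_left] at this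
  have h3 : eLpNorm (fun x => min ((x 1) ^ β) 1 * fderiv ℝ g x (e 1)) ∞ hpVolume
      ≤ ENNReal.ofReal M := by
    refine eLpNorm_top_le fun x hx => ?_
    have hx : 0 < x 1 := hx
    have hbd : ∀ ℓ, 0 < ℓ → ℓ < x 1 → |fderiv ℝ g x (e 1)| ≤ M * max (ℓ ^ (-β)) 1 := by
      intro ℓ hℓ hℓx
      refine abs_fderiv_le (mul_nonneg hM (le_max_of_le_right zero_le_one)) ?_
      have : ∀ᶠ t : ℝ in 𝓝 0, ℓ - x 1 < t := lt_mem_nhds (by linarith)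
      filter_upwards [this] with t ht
      have e1 : (x + t • e 1) 1 = x 1 + t := by rw [add_smul_e_apply, if_pos rfl]
      have := h.vert ℓ hℓ (x + t • e 1) x (by rw [e1]; linarith) hℓx
        (by rw [add_smul_e_apply]; simp)
      rwa [e1, add_sub_cancel_left] at this
    have hlim : |fderiv ℝ g x (e 1)| ≤ M * max ((x 1) ^ (-β)) 1 := by
      have hc : ContinuousAt (fun ℓ : ℝ => M * max (ℓ ^ (-β)) 1) (x 1) :=
        ((Real.continuousAt_rpow_const _ _ (Or.inl hx.ne')).max continuousAt_const).const_mul M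
      refine ge_of_tendsto (x := 𝓝[<] (x 1)) (hc.tendsto.mono_left nhdsWithin_le_nhds) ?_
      filter_upwards [Ioo_mem_nhdsLT hx] with ℓ hℓ using hbd ℓ hℓ.1 hℓ.2
    have hp : 0 < x 1 ^ β := by positivity
    have hmin : 0 ≤ min (x 1 ^ β) 1 := le_min hp.le zero_le_one
    have hone : min (x 1 ^ β) 1 * max ((x 1) ^ (-β)) 1 = 1 := by
      rw [Real.rpow_neg hx.le]
      rcases le_total (x 1 ^ β) 1 with h6 | h6
      · rw [min_eq_left h6, max_eq_left ((one_le_inv₀ hp).2 h6), mul_inv_cancel₀ hp.ne']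
      · rw [min_eq_right h6, max_eq_right (inv_le_one_of_one_le₀ h6), one_mul]
    rw [abs_mul, abs_of_nonneg hmin]
    calc _ ≤ min (x 1 ^ β) 1 * (M * max ((x 1) ^ (-β)) 1) := by gcongr
      _ = M * (min (x 1 ^ β) 1 * max ((x 1) ^ (-β)) 1) := by ring
      _ = M := by rw [hone, mul_one]
  have h4 : eLpNorm g 1 hpVolume ≤ ENNReal.ofReal M := by
    rw [eLpNorm_one_eq_lintegral_enorm]; exact h.l1
  rw [show 4 * M = M + (M + M) + M by ring, ENNReal.ofReal_add (by positivity) hM,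
    ENNReal.ofReal_add hM (by positivity), ENNReal.ofReal_add hM hM, xNorm]
  gcongr

lemma Slice.memX {β M : ℝ} {g : Plane → ℝ} (h : Slice β M g) : MemX β g :=
  ⟨h.locallyLipschitzOn, h.xNorm_le.trans_lt ENNReal.ofReal_lt_top⟩

/-! ### The stretching function -/

lemma lamInv_of_le {β s : ℝ} (hβ : β < 1) (h : s ≤ 1) : lamInv β s = (1 - β)⁻¹ * s ^ (1 - β) := by
  rcases h.lt_or_eq with h | rfl
  · rw [lamInv, if_pos h]
  · have : 1 - β ≠ 0 := by linarith
    rw [lamInv, if_neg (lt_irrefl _), Real.one_rpow]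
    field_simp; ring

lemma lamInv_of_ge {β s : ℝ} (h : 1 ≤ s) : lamInv β s = s + β / (1 - β) := by
  rw [lamInv, if_neg (not_lt.2 h)]

lemma lamInv_sub_bounds {β ℓ s s' : ℝ} (hβ : 0 ≤ β) (hβ' : β < 1) (hℓ : 0 < ℓ) (hs : ℓ ≤ s)
    (hss : s ≤ s') : s' - s ≤ lamInv β s' - lamInv β s ∧
      lamInv β s' - lamInv β s ≤ max (ℓ ^ (-β)) 1 * (s' - s) := by
  have hb : 0 < 1 - β := by linarith
  have low : ∀ a b, ℓ ≤ a → a ≤ b → b ≤ 1 → b - a ≤ lamInv β b - lamInv β a ∧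
      lamInv β b - lamInv β a ≤ max (ℓ ^ (-β)) 1 * (b - a) := by
    intro a b ha hab hb1
    rw [lamInv_of_le hβ' hb1, lamInv_of_le hβ' (hab.trans hb1)]
    rcases hab.eq_or_lt with rfl | hlt
    · simp
    have ha0 : 0 < a := hℓ.trans_le ha
    obtain ⟨c, hc, hceq⟩ := exists_hasDerivAt_eq_slope (fun t => (1 - β)⁻¹ * t ^ (1 - β))
      (fun t => t ^ (-β)) hlt
      (continuousOn_const.mul (continuousOn_id.rpow_const fun x hx => Or.inl (ha0.trans_le hx.1).ne'))
      (fun t ht => by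
        have := (Real.hasDerivAt_rpow_const (p := 1 - β) (Or.inl (ha0.trans ht.1).ne')).const_mul
          (1 - β)⁻¹
        refine this.congr_deriv ?_
        rw [← mul_assoc, inv_mul_cancel₀ hb.ne', one_mul]
        congr 1; ring)
    have hc0 : 0 < c := ha0.trans hc.1
    have hba : 0 < b - a := by linarith
    rw [eq_div_iff hba.ne'] at hceq
    have h1 : 1 ≤ c ^ (-β) :=
      Real.one_le_rpow_of_pos_of_le_one_of_nonpos hc0 (hc.2.le.trans hb1) (by linarith)
    have h2 : c ^ (-β) ≤ max (ℓ ^ (-β)) 1 :=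
      (Real.rpow_le_rpow_of_nonpos hℓ (ha.trans hc.1.le) (by linarith)).trans (le_max_left _ _)
    constructor
    · nlinarith
    · rw [← hceq]; gcongr
  have high : ∀ a b, 1 ≤ a → a ≤ b → lamInv β b - lamInv β a = b - a := by
    intro a b ha hab
    rw [lamInv_of_ge ha, lamInv_of_ge (ha.trans hab)]; ring
  have h1 : 1 ≤ max (ℓ ^ (-β)) 1 := le_max_right _ _
  rcases le_total s' 1 with h | h
  · exact low s s' hs hss h
  rcases le_total s 1 with h' | h'
  · have l1 := low s 1 hs h' le_rfl
    have l2 := high 1 s' le_rfl h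
    constructor
    · linarith
    · nlinarith
  · rw [high s s' h' hss]
    exact ⟨le_rfl, by nlinarith⟩

lemma abs_lamInv_sub_le {β ℓ s s' : ℝ} (hβ : 0 ≤ β) (hβ' : β < 1) (hℓ : 0 < ℓ) (hs : ℓ ≤ s)
    (hs' : ℓ ≤ s') : |lamInv β s - lamInv β s'| ≤ max (ℓ ^ (-β)) 1 * |s - s'| := by
  rcases le_total s s' with h | h
  · have := lamInv_sub_bounds hβ hβ' hℓ hs h
    rw [abs_sub_comm, abs_sub_comm s, abs_of_nonneg (sub_nonneg.2 h), abs_of_nonneg (by linarith)]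
    exact this.2
  · have := lamInv_sub_bounds hβ hβ' hℓ hs' h
    rw [abs_of_nonneg (sub_nonneg.2 h), abs_of_nonneg (by linarith)]
    exact this.2

lemma lamInv_sub_ge {β s s' : ℝ} (hβ : 0 ≤ β) (hβ' : β < 1) (hs : 0 < s) (hss : s ≤ s') (hs' : s' ≤ 1) :
    s' ^ (-β) * (s' - s) ≤ lamInv β s' - lamInv β s := by
  have hb : 0 < 1 - β := by linarith
  rw [lamInv_of_le hβ' hs', lamInv_of_le hβ' (hss.trans hs')]
  rcases hss.eq_or_lt with rfl | hlt
  · simp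
  obtain ⟨c, hc, hceq⟩ := exists_hasDerivAt_eq_slope (fun t => (1 - β)⁻¹ * t ^ (1 - β))
    (fun t => t ^ (-β)) hlt
    (continuousOn_const.mul (continuousOn_id.rpow_const fun x hx => Or.inl (hs.trans_le hx.1).ne'))
    (fun t ht => by
      have := (Real.hasDerivAt_rpow_const (p := 1 - β) (Or.inl (hs.trans ht.1).ne')).const_mul
        (1 - β)⁻¹
      refine this.congr_deriv ?_
      rw [← mul_assoc, inv_mul_cancel₀ hb.ne', one_mul]
      congr 1; ring)
  have hba : 0 < s' - s := by linarith
  rw [eq_div_iff hba.ne'] at hceq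
  rw [← hceq]
  exact mul_le_mul_of_nonneg_right
    (Real.rpow_le_rpow_of_nonpos (hs.trans hc.1) hc.2.le (by linarith)) hba.le

lemma le_abs_lamInv_sub {β r s s' : ℝ} (hβ : 0 ≤ β) (hβ' : β < 1) (hs : 0 < s) (hs' : 0 < s')
    (hsr : s ≤ r) (hsr' : s' ≤ r) (hr : r ≤ 1) :
    r ^ (-β) * |s - s'| ≤ |lamInv β s - lamInv β s'| := by
  wlog h : s' ≤ s generalizing s s'
  · rw [abs_sub_comm, abs_sub_comm (lamInv β s)]
    exact this hs' hs hsr' hsr (le_of_not_ge h)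
  rw [abs_of_nonneg (sub_nonneg.2 h)]
  refine le_trans (mul_le_mul_of_nonneg_right ?_ (sub_nonneg.2 h))
    ((lamInv_sub_ge hβ hβ' hs' h (hsr.trans hr)).trans (le_abs_self _))
  exact Real.rpow_le_rpow_of_nonpos hs hsr (by linarith)

/-! ### The plateau functions -/

lemma infDist_compl_rect {a b c d : ℝ} {x : Plane} (hx : x ∈ rect a b c d) :
    Metric.infDist x (rect a b c d)ᶜ = min (min (x 0 - a) (b - x 0)) (min (x 1 - c) (d - x 1)) := by
  have hne : ((rect a b c d)ᶜ).Nonempty := by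
    refine ⟨!₂[b + 1, 0], fun h => ?_⟩
    have := h.1.2; simp at this; linarith
  have hout : ∀ (i : Fin 2) (s : ℝ), x + s • e i ∉ rect a b c d →
      Metric.infDist x (rect a b c d)ᶜ ≤ |s| := fun i s h => by
    have := Metric.infDist_le_dist_of_mem (x := x) (mem_compl h)
    rwa [dist_eq_norm, sub_add_cancel_left, norm_neg, norm_smul_e] at this
  apply le_antisymm
  · refine le_of_forall_pos_le_add fun ε hε => ?_
    obtain ⟨⟨h1, h2⟩, h3, h4⟩ := hx
    have k1 := hout 0 (-(x 0 - a + ε)) (fun h => by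
      have := h.1.1; rw [add_smul_e_apply, if_pos rfl] at this; linarith)
    have k2 := hout 0 (b - x 0 + ε) (fun h => by
      have := h.1.2; rw [add_smul_e_apply, if_pos rfl] at this; linarith)
    have k3 := hout 1 (-(x 1 - c + ε)) (fun h => by
      have := h.2.1; rw [add_smul_e_apply, if_pos rfl] at this; linarith)
    have k4 := hout 1 (d - x 1 + ε) (fun h => by
      have := h.2.2; rw [add_smul_e_apply, if_pos rfl] at this; linarith)
    rw [abs_neg, abs_of_pos (by linarith)] at k1 k3
    rw [abs_of_pos (by linarith)] at k2 k4
    rw [← sub_le_iff_le_add]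
    exact le_min (le_min (by linarith) (by linarith)) (le_min (by linarith) (by linarith))
  · rw [Metric.le_infDist hne]
    intro z hz
    rw [dist_eq_norm]
    have n0 := abs_coord_le (x - z) 0
    have n1 := abs_coord_le (x - z) 1
    simp only [PiLp.sub_apply, abs_le] at n0 n1
    by_contra! hlt
    simp only [lt_min_iff] at hlt
    exact hz ⟨⟨by linarith, by linarith⟩, by linarith, by linarith⟩

lemma plateau_of_mem {a b c d : ℝ} {x : Plane} (hx : x ∈ rect a b c d) :
    plateau (rect a b c d) x
      = min 1 (min (min (x 0 - a) (b - x 0)) (min (x 1 - c) (d - x 1))) := by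
  rw [plateau, infDist_compl_rect hx]

lemma plateau_of_notMem {R : Set Plane} {x : Plane} (hx : x ∉ R) : plateau R x = 0 := by
  rw [plateau, Metric.infDist_zero_of_mem hx]; simp

lemma plateau_nonneg (R : Set Plane) (x : Plane) : 0 ≤ plateau R x :=
  le_min zero_le_one Metric.infDist_nonneg

lemma abs_plateau_le (R : Set Plane) (x : Plane) : |plateau R x| ≤ 1 := by
  rw [abs_of_nonneg (plateau_nonneg R x)]; exact min_le_left _ _

lemma abs_plateau_sub_le (R : Set Plane) (x y : Plane) : |plateau R x - plateau R y| ≤ ‖x - y‖ := by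
  have h1 := (Metric.lipschitz_infDist_pt Rᶜ).dist_le_mul x y
  rw [Real.dist_eq, NNReal.coe_one, one_mul, dist_eq_norm] at h1
  have h2 := abs_min_sub_min_le_max 1 (Metric.infDist x Rᶜ) 1 (Metric.infDist y Rᶜ)
  rw [sub_self, abs_zero, max_eq_right (abs_nonneg _)] at h2
  exact h2.trans h1

/-! ### Sums of caps at separated heights -/

/-- The height `2^{-4n}`. -/
def level (n : ℕ) : ℝ := ((2 : ℝ) ^ (4 * n))⁻¹

lemma level_pos (n : ℕ) : 0 < level n := by unfold level; positivity

lemma level_le_of_lt {m n : ℕ} (h : m < n) : level n ≤ level m / 16 := by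
  have h1 : (2 : ℝ) ^ (4 * n) = 2 ^ (4 * m) * 2 ^ (4 * (n - m)) := by
    rw [← pow_add]; congr 1; omega
  have h2 : (16 : ℝ) ≤ 2 ^ (4 * (n - m)) := by
    calc (16 : ℝ) = 2 ^ 4 := by norm_num
      _ ≤ _ := pow_le_pow_right₀ one_le_two (by omega)
  unfold level
  rw [h1, mul_inv, div_eq_mul_inv]
  gcongr

lemma level_le {n : ℕ} (h : 1 ≤ n) : level n ≤ 1 / 16 := by
  have := level_le_of_lt (show 0 < n by omega)
  simpa [level] using this

lemma tendsto_level : Tendsto level atTop (𝓝 0) := by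
  have : level = fun n => ((1 / 16 : ℝ)) ^ n := by
    ext n; simp only [level]
    rw [pow_mul, one_div, inv_pow]; norm_num
  rw [this]
  exact tendsto_pow_atTop_nhds_zero_of_lt_one (by norm_num) (by norm_num)

/-- The `n`-th weighted cap. -/
def capTerm (w a : ℕ → ℝ) (p : ℕ → Plane) (n : ℕ) (z : Plane) : ℝ := w n * max 0 (a n - ‖z - p n‖)

/-- The sum of a family of weighted caps. -/
def capSum (w a : ℕ → ℝ) (p : ℕ → Plane) (z : Plane) : ℝ := ∑' n, capTerm w a p n z

/-- Caps with weights at most `W`, centred at the heights `level (n + 1)`, with disjoint supports. -/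
structure CapFamily (W : ℝ) (w a : ℕ → ℝ) (p : ℕ → Plane) : Prop where
  w_nonneg : ∀ n, 0 ≤ w n
  w_le : ∀ n, w n ≤ W
  a_pos : ∀ n, 0 < a n
  a_le : ∀ n, a n ≤ level (n + 1) / 2
  height : ∀ n, p n 1 = level (n + 1)
  abscissa : ∀ n, p n 0 ∈ Icc (0 : ℝ) 1

section
variable {W : ℝ} {w a : ℕ → ℝ} {p : ℕ → Plane}

lemma capTerm_nonneg (h : CapFamily W w a p) (n : ℕ) (z : Plane) : 0 ≤ capTerm w a p n z :=
  mul_nonneg (h.w_nonneg n) (le_max_left _ _)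

lemma capTerm_of_le {n : ℕ} {z : Plane} (hz : a n ≤ ‖z - p n‖) : capTerm w a p n z = 0 := by
  rw [capTerm, max_eq_left (by linarith), mul_zero]

lemma height_of_capTerm_ne_zero (h : CapFamily W w a p) {n : ℕ} {z : Plane}
    (hz : capTerm w a p n z ≠ 0) :
    level (n + 1) / 2 < z 1 ∧ z 1 < 3 / 2 * level (n + 1) ∧ |z 0| ≤ 2 := by
  have h1 : ‖z - p n‖ < a n := by
    by_contra! hc; exact hz (capTerm_of_le hc)
  have h2 := abs_lt.1 ((abs_coord_le (z - p n) 1).trans_lt h1)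
  have h3 := abs_lt.1 ((abs_coord_le (z - p n) 0).trans_lt h1)
  simp only [PiLp.sub_apply, h.height] at h2 h3
  have h4 := h.a_le n
  have h5 := h.abscissa n
  have h6 := level_le (n := n + 1) (by omega)
  refine ⟨by linarith, by linarith, abs_le.2 ⟨?_, ?_⟩⟩ <;> linarith [h5.1, h5.2]

lemma capTerm_eq_zero_of_ne (h : CapFamily W w a p) {n m : ℕ} {z : Plane}
    (h1 : level (n + 1) / 2 ≤ z 1) (h2 : z 1 ≤ 2 * level (n + 1)) (hm : m ≠ n) :
    capTerm w a p m z = 0 := by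
  by_contra hne
  obtain ⟨h3, h4, -⟩ := height_of_capTerm_ne_zero h hne
  have hp := level_pos (n + 1)
  have hp' := level_pos (m + 1)
  rcases lt_or_gt_of_ne hm with hlt | hlt
  · have := level_le_of_lt (show m + 1 < n + 1 by omega); linarith
  · have := level_le_of_lt (show n + 1 < m + 1 by omega); linarith

lemma capSum_eq_of_height (h : CapFamily W w a p) {n : ℕ} {z : Plane}
    (h1 : level (n + 1) / 2 ≤ z 1) (h2 : z 1 ≤ 2 * level (n + 1)) :
    capSum w a p z = capTerm w a p n z :=
  tsum_eq_single n fun _ hm => capTerm_eq_zero_of_ne h h1 h2 hm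

lemma exists_capSum_eq (h : CapFamily W w a p) (z : Plane) :
    ∃ n, capSum w a p z = capTerm w a p n z ∧ ∀ m, m ≠ n → capTerm w a p m z = 0 := by
  by_cases hex : ∃ n, capTerm w a p n z ≠ 0
  · obtain ⟨n, hn⟩ := hex
    obtain ⟨h1, h2, -⟩ := height_of_capTerm_ne_zero h hn
    have hp := level_pos (n + 1)
    have h2' : z 1 ≤ 2 * level (n + 1) := by linarith
    exact ⟨n, capSum_eq_of_height h h1.le h2', fun m hm => capTerm_eq_zero_of_ne h h1.le h2' hm⟩
  · push Not at hex
    exact ⟨0, by simp [capSum, hex], fun m _ => hex m⟩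

lemma capTerm_le_capSum (h : CapFamily W w a p) (n : ℕ) (z : Plane) :
    capTerm w a p n z ≤ capSum w a p z := by
  obtain ⟨k, hk, hk'⟩ := exists_capSum_eq h z
  rw [hk]
  by_cases hn : n = k
  · rw [hn]
  · rw [hk' n hn]; exact capTerm_nonneg h k z

lemma capSum_nonneg (h : CapFamily W w a p) (z : Plane) : 0 ≤ capSum w a p z :=
  tsum_nonneg fun n => capTerm_nonneg h n z

lemma CapFamily.nonneg (h : CapFamily W w a p) : 0 ≤ W := (h.w_nonneg 0).trans (h.w_le 0)

lemma capTerm_le (h : CapFamily W w a p) (n : ℕ) (z : Plane) : capTerm w a p n z ≤ W * a n := by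
  refine mul_le_mul (h.w_le n) (max_le (h.a_pos n).le ?_) (le_max_left _ _) h.nonneg
  linarith [norm_nonneg (z - p n)]

lemma abs_capSum_le (h : CapFamily W w a p) (z : Plane) : |capSum w a p z| ≤ W := by
  rw [abs_of_nonneg (capSum_nonneg h z)]
  obtain ⟨n, hn, -⟩ := exists_capSum_eq h z
  rw [hn]
  refine (capTerm_le h n z).trans (mul_le_of_le_one_right h.nonneg ?_)
  have := h.a_le n
  have := level_le (n := n + 1) (by omega)
  linarith

lemma capSum_sub_le (h : CapFamily W w a p) (z z' : Plane) :
    capSum w a p z - capSum w a p z' ≤ W * ‖z - z'‖ := by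
  obtain ⟨n, hn, -⟩ := exists_capSum_eq h z
  have h1 := capTerm_le_capSum h n z'
  have h2 : capTerm w a p n z - capTerm w a p n z' ≤ w n * ‖z - z'‖ := by
    rw [capTerm, capTerm, ← mul_sub]
    refine mul_le_mul_of_nonneg_left ?_ (h.w_nonneg n)
    have t1 := abs_max_sub_max_le_abs (a n - ‖z - p n‖) (a n - ‖z' - p n‖) 0
    rw [max_comm, max_comm (a n - ‖z' - p n‖), sub_sub_sub_cancel_left] at t1
    have t2 := abs_norm_sub_norm_le (z' - p n) (z - p n)
    rw [sub_sub_sub_cancel_right, norm_sub_rev z' z] at t2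
    exact (le_abs_self _).trans (t1.trans t2)
  have h3 : w n * ‖z - z'‖ ≤ W * ‖z - z'‖ := mul_le_mul_of_nonneg_right (h.w_le n) (norm_nonneg _)
  linarith

lemma abs_capSum_sub_le (h : CapFamily W w a p) (z z' : Plane) :
    |capSum w a p z - capSum w a p z'| ≤ W * ‖z - z'‖ := by
  refine abs_le.2 ⟨?_, capSum_sub_le h z z'⟩
  have := capSum_sub_le h z' z
  rw [norm_sub_rev] at this
  linarith

lemma capSum_support (h : CapFamily W w a p) {z : Plane} (hz : capSum w a p z ≠ 0) :
    |z 0| ≤ 2 ∧ z 1 ≤ 1 := by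
  obtain ⟨n, hn, -⟩ := exists_capSum_eq h z
  rw [hn] at hz
  obtain ⟨-, h2, h3⟩ := height_of_capTerm_ne_zero h hz
  have := level_le (n := n + 1) (by omega)
  exact ⟨h3, by linarith⟩

lemma capSum_le_rpow (h : CapFamily W w a p) {A q : ℝ} (hA : 0 ≤ A) (hq : 0 ≤ q)
    (ha : ∀ n, a n ≤ A * level (n + 1) ^ q) {z : Plane} (hz : 0 < z 1) :
    capSum w a p z ≤ W * A * (2 * z 1) ^ q := by
  have hW := h.nonneg
  obtain ⟨n, hn, -⟩ := exists_capSum_eq h z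
  rw [hn]
  by_cases h0 : capTerm w a p n z = 0
  · rw [h0]; positivity
  obtain ⟨h1, -, -⟩ := height_of_capTerm_ne_zero h h0
  have := level_pos (n + 1)
  calc capTerm w a p n z ≤ W * a n := capTerm_le h n z
    _ ≤ W * (A * (2 * z 1) ^ q) := by
      refine mul_le_mul_of_nonneg_left ((ha n).trans ?_) hW
      gcongr; linarith
    _ = _ := by ring

end

lemma mul_cap {a : ℝ} (ha : 0 < a) (v : Plane) : a * cap (a⁻¹ • v) = max 0 (a - ‖v‖) := by
  rw [cap, norm_smul, norm_inv, Real.norm_eq_abs, abs_of_pos ha, mul_max_of_nonneg _ _ ha.le, mul_zero]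
  congr 1; field_simp

/-! ### Composition with the stretching map -/

@[simp] lemma stretchInv_zero (β : ℝ) (x : Plane) : stretchInv β x 0 = x 0 := rfl

@[simp] lemma stretchInv_one (β : ℝ) (x : Plane) : stretchInv β x 1 = lamInv β (x 1) := rfl

lemma le_lamInv {β s : ℝ} (hβ : 0 ≤ β) (hβ' : β < 1) (hs : 0 < s) : s ≤ lamInv β s := by
  have hb : 0 < 1 - β := by linarith
  rcases le_total s 1 with h | h
  · rw [lamInv_of_le hβ' h]
    have h1 : s ≤ s ^ (1 - β) := by
      conv_lhs => rw [← Real.rpow_one s]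
      exact Real.rpow_le_rpow_of_exponent_ge hs h (by linarith)
    have h2 : 1 ≤ (1 - β)⁻¹ := (one_le_inv₀ hb).2 (by linarith)
    nlinarith
  · rw [lamInv_of_ge h]
    have : 0 ≤ β / (1 - β) := div_nonneg hβ hb.le
    linarith

lemma Slice.comp_stretchInv {β A L r : ℝ} {F : Plane → ℝ} (hβ : 0 ≤ β) (hβ' : β < 1) (hA : 0 ≤ A)
    (hL : 0 ≤ L) (hr : 0 ≤ r) (hb : ∀ z, |F z| ≤ A) (hl : ∀ z z', |F z - F z'| ≤ L * ‖z - z'‖)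
    (hs : ∀ z, F z ≠ 0 → |z 0| ≤ r ∧ z 1 ≤ r) :
    Slice β (A + L + A * (2 * r * r)) (fun y => F (stretchInv β y)) := by
  have hX : 0 ≤ A * (2 * r * r) := by positivity
  refine Slice.of_support hA hr (fun y _ => hb _) (fun x _ y _ hxy => ?_) (fun ℓ hℓ x y hx hy hxy => ?_)
    (fun y hy h => ?_) (by linarith) (by linarith)
  · have h1 : ‖stretchInv β x - stretchInv β y‖ ≤ |x 0 - y 0| :=
      (norm_le_abs_add _).trans (by simp [hxy])
    refine (hl _ _).trans ?_
    calc L * _ ≤ L * |x 0 - y 0| := by gcongr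
      _ ≤ _ := by gcongr; linarith
  · have h1 : ‖stretchInv β x - stretchInv β y‖ ≤ max (ℓ ^ (-β)) 1 * |x 1 - y 1| := by
      refine (norm_le_abs_add _).trans ?_
      have := abs_lamInv_sub_le hβ hβ' hℓ hx.le hy.le
      simpa [hxy] using this
    have hm : 0 ≤ max (ℓ ^ (-β)) 1 := le_max_of_le_right zero_le_one
    refine (hl _ _).trans ?_
    rw [mul_assoc]
    calc L * _ ≤ L * (max (ℓ ^ (-β)) 1 * |x 1 - y 1|) := by gcongr
      _ ≤ _ := by gcongr; linarith
  · obtain ⟨h0, h1⟩ := hs _ h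
    exact ⟨h0, (le_lamInv hβ hβ' hy).trans h1⟩

lemma CapFamily.slice {β W : ℝ} {w a : ℕ → ℝ} {p : ℕ → Plane} (h : CapFamily W w a p) (hβ : 0 ≤ β)
    (hβ' : β < 1) : Slice β (10 * W) (fun y => capSum w a p (stretchInv β y)) :=
  (Slice.comp_stretchInv (r := 2) hβ hβ' h.nonneg h.nonneg zero_le_two (abs_capSum_le h)
    (abs_capSum_sub_le h) fun _ hz => ⟨(capSum_support h hz).1, by linarith [(capSum_support h hz).2]⟩).mono
    (by linarith)

lemma lam_level_pos {β : ℝ} (hβ' : β < 1) (n : ℕ) : 0 < lam β (level n) := lam_pos hβ' (level_pos n)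

lemma lam_level_le {β : ℝ} (hβ : 0 ≤ β) (hβ' : β < 1) (n : ℕ) : lam β (level n) ≤ level n := by
  have := le_lamInv hβ hβ' (lam_level_pos hβ' n)
  rwa [lamInv_lam hβ' (level_pos n)] at this

lemma lamInv_mem_of_mem {β s : ℝ} {n : ℕ} (hβ : 0 ≤ β) (hβ' : β < 1) (hn : 1 ≤ n)
    (h1 : lam β (level n) / 2 ≤ s) (h2 : s ≤ 2 * lam β (level n)) :
    level n / 2 ≤ lamInv β s ∧ lamInv β s ≤ 2 * level n := by
  have hb : 0 < 1 - β := by linarith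
  have hp := lam_level_pos hβ' n
  have hle := lam_level_le hβ hβ' n
  have h16 := level_le hn
  have hinv := lamInv_lam hβ' (level_pos n)
  rw [lamInv_of_le hβ' (by linarith)] at hinv
  have hs : 0 < s := by linarith
  rw [lamInv_of_le hβ' (by linarith)]
  have e2 : (2 : ℝ) ^ (1 - β) ≤ 2 := by
    calc (2 : ℝ) ^ (1 - β) ≤ 2 ^ (1 : ℝ) := Real.rpow_le_rpow_of_exponent_le one_le_two (by linarith)
      _ = 2 := Real.rpow_one 2
  have hl := level_pos n
  have hd : lam β (level n) ^ (1 - β) ≤ 2 * s ^ (1 - β) := by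
    calc lam β (level n) ^ (1 - β) ≤ (2 * s) ^ (1 - β) := by gcongr; linarith
      _ = 2 ^ (1 - β) * s ^ (1 - β) := Real.mul_rpow zero_le_two hs.le
      _ ≤ _ := by gcongr
  have hu : s ^ (1 - β) ≤ 2 * lam β (level n) ^ (1 - β) := by
    calc s ^ (1 - β) ≤ (2 * lam β (level n)) ^ (1 - β) := by gcongr
      _ = 2 ^ (1 - β) * lam β (level n) ^ (1 - β) := Real.mul_rpow zero_le_two hp.le
      _ ≤ _ := by gcongr
  have hbi : 0 ≤ (1 - β)⁻¹ := by positivity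
  have d1 := mul_le_mul_of_nonneg_left hd hbi
  have d2 := mul_le_mul_of_nonneg_left hu hbi
  constructor <;> linarith

/-! ### The datum for the tangential mechanism -/

lemma tangential_capFamily {a : ℕ → ℝ} (ha : ∀ n, 1 ≤ n → 0 < a n ∧ a n ≤ level n / 2) :
    CapFamily 1 (fun _ => 1) (fun n => a (n + 1)) (fun n => !₂[0, level (n + 1)]) where
  w_nonneg _ := zero_le_one
  w_le _ := le_rfl
  a_pos n := (ha (n + 1) (by omega)).1
  a_le n := (ha (n + 1) (by omega)).2
  height _ := by simp
  abscissa _ := by simp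

lemma tangentialDatum_eq {a : ℕ → ℝ} (β : ℝ) (ha : ∀ n, 1 ≤ n → 0 < a n ∧ a n ≤ level n / 2) (x : Plane) :
    tangentialDatum β a x = plateau (rect (-3) 3 (-1) (2 + (1 - β)⁻¹)) (stretchInv β x)
      + capSum (fun _ => 1) (fun n => a (n + 1)) (fun n => !₂[0, level (n + 1)]) (stretchInv β x) := by
  rw [tangentialDatum]
  congr 1
  refine tsum_congr fun n => ?_
  rw [capTerm, one_mul, mul_cap (ha (n + 1) (by omega)).1]; rfl

lemma plateau_slice {β r s t u : ℝ} (hβ : 0 ≤ β) (hβ' : β < 1) :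
    ∃ M, Slice β M (fun y => plateau (rect r s t u) (stretchInv β y)) := by
  refine ⟨_, Slice.comp_stretchInv (A := 1) (L := 1) (r := |r| + |s| + |u|) hβ hβ' zero_le_one zero_le_one
    (by positivity) (abs_plateau_le _) (fun z z' => by simpa using abs_plateau_sub_le _ z z')
    fun z hz => ?_⟩
  have hm : z ∈ rect r s t u := by by_contra h; exact hz (plateau_of_notMem h)
  obtain ⟨⟨h1, h2⟩, -, h4⟩ := hm
  have := neg_abs_le r; have := le_abs_self s; have := le_abs_self u
  have := abs_nonneg r; have := abs_nonneg s; have := abs_nonneg u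
  exact ⟨abs_le.2 ⟨by linarith, by linarith⟩, by linarith⟩

lemma memX_tangentialDatum {β : ℝ} {a : ℕ → ℝ} (hβ : 0 ≤ β) (hβ' : β < 1)
    (ha : ∀ n, 1 ≤ n → 0 < a n ∧ a n ≤ level n / 2) : MemX β (tangentialDatum β a) := by
  obtain ⟨M, hM⟩ := plateau_slice (r := -3) (s := 3) (t := -1) (u := 2 + (1 - β)⁻¹) hβ hβ'
  rw [show tangentialDatum β a = _ from funext (tangentialDatum_eq β ha)]
  exact (hM.add ((tangential_capFamily ha).slice hβ hβ')).memX

lemma plateau_eq_one_of_near {β : ℝ} {x : Plane} (hβ : 0 ≤ β) (hβ' : β < 1) (hx0 : |x 0| ≤ 2)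
    (hx : 0 < x 1) (hx1 : x 1 ≤ 1) :
    plateau (rect (-3) 3 (-1) (2 + (1 - β)⁻¹)) (stretchInv β x) = 1 := by
  have hb : 0 < 1 - β := by linarith
  have h0 := abs_le.1 hx0
  have h1 : lamInv β (x 1) ≤ (1 - β)⁻¹ := by
    rw [lamInv_of_le hβ' hx1]
    exact mul_le_of_le_one_right (by positivity) (Real.rpow_le_one hx.le hx1 hb.le)
  have h2 := lamInv_pos hβ hβ' hx
  rw [plateau_of_mem ⟨⟨by simp; linarith, by simp; linarith⟩, by simp; linarith, by simp; linarith⟩]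
  refine min_eq_left (le_min (le_min ?_ ?_) (le_min ?_ ?_)) <;> simp <;> linarith

lemma tangentialDatum_sub_one {β : ℝ} {a : ℕ → ℝ} {x : Plane} (hβ : 0 ≤ β) (hβ' : β < 1)
    (ha : ∀ n, 1 ≤ n → 0 < a n ∧ a n ≤ level n / 2) (hx0 : |x 0| ≤ 2) (hx : 0 < x 1) (hx1 : x 1 ≤ 1) :
    tangentialDatum β a x - 1
      = capSum (fun _ => 1) (fun n => a (n + 1)) (fun n => !₂[0, level (n + 1)]) (stretchInv β x) := by
  rw [tangentialDatum_eq β ha, plateau_eq_one_of_near hβ hβ' hx0 hx hx1, add_sub_cancel_left]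

lemma abs_tangentialDatum_sub_one_le {β A q : ℝ} {a : ℕ → ℝ} {x : Plane} (hβ : 0 ≤ β) (hβ' : β < 1)
    (ha : ∀ n, 1 ≤ n → 0 < a n ∧ a n ≤ level n / 2) (hA : 0 ≤ A) (hq : 0 ≤ q)
    (haq : ∀ n, 1 ≤ n → a n ≤ A * level n ^ q) (hx0 : |x 0| ≤ 2) (hx : 0 < x 1) (hx1 : x 1 ≤ 1) :
    |tangentialDatum β a x - 1| ≤ A * (2 * (1 - β)⁻¹) ^ q * x 1 ^ ((1 - β) * q) := by
  have hb : 0 < 1 - β := by linarith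
  have hF := tangential_capFamily ha
  rw [tangentialDatum_sub_one hβ hβ' ha hx0 hx hx1, abs_of_nonneg (capSum_nonneg hF _)]
  refine (capSum_le_rpow hF hA hq (fun n => haq (n + 1) (by omega)) (lamInv_pos hβ hβ' hx)).trans_eq ?_
  rw [stretchInv_one, lamInv_of_le hβ' hx1, ← mul_assoc, Real.mul_rpow (by positivity) (by positivity),
    ← Real.rpow_mul hx.le]
  ring

lemma tangentialDatum_center {β : ℝ} {a : ℕ → ℝ} {n : ℕ} (hβ : 0 ≤ β) (hβ' : β < 1)
    (ha : ∀ n, 1 ≤ n → 0 < a n ∧ a n ≤ level n / 2) (hn : 1 ≤ n) :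
    tangentialDatum β a !₂[0, lam β (level n)] = 1 + a n := by
  have hp := lam_level_pos hβ' n
  have hl := level_pos n
  have := lam_level_le hβ hβ' n
  have := level_le hn
  have hinv := lamInv_lam hβ' (level_pos n)
  obtain ⟨m, rfl⟩ : ∃ m, n = m + 1 := ⟨n - 1, by omega⟩
  have h := tangentialDatum_sub_one (x := !₂[0, lam β (level (m + 1))]) hβ hβ' ha (by simp) (by simpa using hp)
    (by simp; linarith)
  have hz : stretchInv β !₂[0, lam β (level (m + 1))] = !₂[0, level (m + 1)] := by
    ext j; fin_cases j <;> simp [hinv]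
  rw [hz, capSum_eq_of_height (tangential_capFamily ha) (n := m) (by simp; linarith) (by simp; linarith),
    capTerm, one_mul, sub_self, norm_zero, sub_zero, max_eq_right (ha _ hn).1.le] at h
  linarith

lemma tangentialDatum_off_center {β : ℝ} {a : ℕ → ℝ} {n : ℕ} {x : Plane} (hβ : 0 ≤ β) (hβ' : β < 1)
    (ha : ∀ n, 1 ≤ n → 0 < a n ∧ a n ≤ level n / 2) (hn : 1 ≤ n) (h0 : a n ≤ |x 0|) (h0' : |x 0| ≤ 2)
    (h1 : lam β (level n) / 2 ≤ x 1) (h2 : x 1 ≤ 2 * lam β (level n)) :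
    tangentialDatum β a x = 1 := by
  have hp := lam_level_pos hβ' n
  have := lam_level_le hβ hβ' n
  have := level_le hn
  obtain ⟨l1, l2⟩ := lamInv_mem_of_mem hβ hβ' hn h1 h2
  obtain ⟨m, rfl⟩ : ∃ m, n = m + 1 := ⟨n - 1, by omega⟩
  have h := tangentialDatum_sub_one (x := x) hβ hβ' ha h0' (by linarith) (by linarith)
  rw [capSum_eq_of_height (tangential_capFamily ha) (n := m) l1 l2, capTerm_of_le] at h
  · linarith
  · refine h0.trans ?_
    simpa using abs_coord_le (stretchInv β x - !₂[0, level (m + 1)]) 0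

/-! ### The data for the normal mechanism -/

/-- The base function `φ₀` of the normal mechanism. -/
def wedge (x : Plane) : ℝ := plateau (rect (-3) 0 0 3) x

/-- The weights `1/n` of the caps with `n ≤ N`. -/
def headWeight (N n : ℕ) : ℝ := if n < N then ((n : ℝ) + 1)⁻¹ else 0

/-- The weights `1/n` of the caps with `n > N`. -/
def tailWeight (N n : ℕ) : ℝ := if N ≤ n then ((n : ℝ) + 1)⁻¹ else 0

/-- The centres of the caps, in stretched coordinates. -/
def diagCenter (β : ℝ) (n : ℕ) : Plane := !₂[lam β (level (n + 1)), level (n + 1)]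

section
variable {β : ℝ} {a : ℕ → ℝ}

lemma normal_capFamily {W : ℝ} {w : ℕ → ℝ} (hβ : 0 ≤ β) (hβ' : β < 1)
    (ha : ∀ n, 1 ≤ n → 0 < a n ∧ a n ≤ level n / 2) (hw : ∀ n, 0 ≤ w n ∧ w n ≤ W) :
    CapFamily W w (fun n => a (n + 1)) (diagCenter β) where
  w_nonneg n := (hw n).1
  w_le n := (hw n).2
  a_pos n := (ha (n + 1) (by omega)).1
  a_le n := (ha (n + 1) (by omega)).2
  height _ := by simp [diagCenter]
  abscissa n := by
    have h1 := lam_level_pos hβ' (n + 1)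
    have h2 := lam_level_le hβ hβ' (n + 1)
    have h3 := level_le (n := n + 1) (by omega)
    simp only [diagCenter, mem_Icc]
    exact ⟨by simpa using h1.le, by simp; linarith⟩

lemma headWeight_mem (N n : ℕ) : 0 ≤ headWeight N n ∧ headWeight N n ≤ 1 := by
  unfold headWeight
  split_ifs
  · exact ⟨by positivity, inv_le_one_of_one_le₀ (by linarith [n.cast_nonneg (α := ℝ)])⟩
  · exact ⟨le_rfl, zero_le_one⟩

lemma tailWeight_mem (N n : ℕ) : 0 ≤ tailWeight N n ∧ tailWeight N n ≤ ((N : ℝ) + 1)⁻¹ := by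
  unfold tailWeight
  split_ifs with h
  · have : (N : ℝ) ≤ n := by exact_mod_cast h
    exact ⟨by positivity, by gcongr⟩
  · exact ⟨le_rfl, by positivity⟩

lemma diagonalCap_succ (ha : ∀ n, 1 ≤ n → 0 < a n ∧ a n ≤ level n / 2) (n : ℕ) (x : Plane) :
    diagonalCap β a (n + 1) x
      = ((n : ℝ) + 1)⁻¹ * max 0 (a (n + 1) - ‖stretchInv β x - diagCenter β n‖) := by
  rw [diagonalCap, ← mul_cap (ha (n + 1) (by omega)).1, diagCenter]
  simp only [level]
  push_cast
  ring

lemma normalDatum_eq (ha : ∀ n, 1 ≤ n → 0 < a n ∧ a n ≤ level n / 2) (x : Plane) :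
    normalDatum β a x
      = wedge x + capSum (tailWeight 0) (fun n => a (n + 1)) (diagCenter β) (stretchInv β x) := by
  rw [normalDatum]
  congr 1
  refine tsum_congr fun n => ?_
  rw [diagonalCap_succ ha, capTerm, tailWeight, if_pos (Nat.zero_le n)]

lemma normalDatumTrunc_eq (ha : ∀ n, 1 ≤ n → 0 < a n ∧ a n ≤ level n / 2) (N : ℕ) (x : Plane) :
    normalDatumTrunc β a N x
      = wedge x + capSum (headWeight N) (fun n => a (n + 1)) (diagCenter β) (stretchInv β x) := by
  rw [normalDatumTrunc]
  congr 1
  have h1 : ∑ n ∈ Finset.Icc 1 N, diagonalCap β a n x = ∑ n ∈ Finset.range N, diagonalCap β a (n + 1) x := by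
    have := Finset.sum_Ico_add' (fun n => diagonalCap β a n x) 0 N 1
    rw [Finset.range_eq_Ico, this]
    rfl
  rw [capSum, tsum_eq_sum (s := Finset.range N), h1]
  · refine Finset.sum_congr rfl fun n hn => ?_
    rw [diagonalCap_succ ha, capTerm, headWeight, if_pos (by simpa using hn)]
  · intro n hn
    rw [capTerm, headWeight, if_neg (by simpa using hn), zero_mul]

lemma normalDatumTrunc_sub (hβ : 0 ≤ β) (hβ' : β < 1)
    (ha : ∀ n, 1 ≤ n → 0 < a n ∧ a n ≤ level n / 2) (N : ℕ) (x : Plane) :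
    normalDatum β a x - normalDatumTrunc β a N x
      = capSum (tailWeight N) (fun n => a (n + 1)) (diagCenter β) (stretchInv β x) := by
  have hF := normal_capFamily hβ hβ' ha (tailWeight_mem 0)
  rw [normalDatum_eq ha, normalDatumTrunc_eq ha, add_sub_add_left_eq_sub]
  obtain ⟨n, -, hn⟩ := exists_capSum_eq hF (stretchInv β x)
  have h0 : ∀ m, m ≠ n → max 0 (a (m + 1) - ‖stretchInv β x - diagCenter β m‖) = 0 := fun m hm => by
    have := hn m hm
    rw [capTerm, tailWeight, if_pos (Nat.zero_le m)] at this
    exact (mul_eq_zero.1 this).resolve_left (by positivity)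
  have hs : ∀ w : ℕ → ℝ, capSum w (fun n => a (n + 1)) (diagCenter β) (stretchInv β x)
      = w n * max 0 (a (n + 1) - ‖stretchInv β x - diagCenter β n‖) := fun w =>
    tsum_eq_single n fun m hm => by rw [capTerm, h0 m hm, mul_zero]
  rw [hs, hs, hs, ← sub_mul]
  congr 1
  simp only [tailWeight, headWeight, Nat.zero_le, if_true]
  split_ifs <;> first | omega | simp

lemma abs_wedge_sub_le (x y : Plane) : |wedge x - wedge y| ≤ ‖x - y‖ := abs_plateau_sub_le _ x y

lemma wedge_nonneg (x : Plane) : 0 ≤ wedge x := plateau_nonneg _ x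

lemma wedge_eq_zero {x : Plane} (h : x 0 < -3 ∨ 0 ≤ x 0 ∨ 3 < x 1) : wedge x = 0 := by
  by_cases hx : x ∈ rect (-3) 0 0 3
  · have hx' := hx
    obtain ⟨⟨h1, h2⟩, -, h4⟩ := hx'
    rcases h with h | h | h
    · linarith
    · have h0 : x 0 = 0 := le_antisymm h2 h
      refine le_antisymm ?_ (wedge_nonneg x)
      rw [wedge, plateau_of_mem hx]
      exact (min_le_right _ _).trans ((min_le_left _ _).trans ((min_le_right _ _).trans (by linarith)))
    · linarith
  · exact plateau_of_notMem hx

lemma wedge_le {x : Plane} (hx : 0 < x 1) : wedge x ≤ x 1 := by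
  by_cases h : x ∈ rect (-3) 0 0 3
  · rw [wedge, plateau_of_mem h]
    exact (min_le_right _ _).trans ((min_le_right _ _).trans ((min_le_left _ _).trans (by linarith)))
  · rw [wedge, plateau_of_notMem h]; exact hx.le

lemma wedge_slice {β : ℝ} : Slice β 19 wedge := by
  refine Slice.of_support (A := 1) (r := 3) zero_le_one (by norm_num) (fun y _ => abs_plateau_le _ y)
    (fun x _ y _ hxy => ?_) (fun ℓ _ x y _ _ hxy => ?_) (fun y _ h => ?_) (by norm_num) (by norm_num)
  · refine (abs_wedge_sub_le x y).trans ((norm_le_abs_add _).trans ?_)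
    simp only [PiLp.sub_apply, hxy, sub_self, abs_zero, add_zero]
    linarith [abs_nonneg (x 0 - y 0)]
  · refine (abs_wedge_sub_le x y).trans ((norm_le_abs_add _).trans ?_)
    simp only [PiLp.sub_apply, hxy, sub_self, abs_zero, zero_add]
    have : 1 ≤ max (ℓ ^ (-β)) 1 := le_max_right _ _
    nlinarith [abs_nonneg (x 1 - y 1)]
  · have hm : y ∈ rect (-3) 0 0 3 := by by_contra hc; exact h (plateau_of_notMem hc)
    obtain ⟨⟨h1, h2⟩, -, h4⟩ := hm
    exact ⟨abs_le.2 ⟨by linarith, by linarith⟩, h4⟩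

lemma wedge_antitone {y : Plane} {d : ℝ} (hd : 0 ≤ d) (h : -2 ≤ y 0) :
    wedge (y + d • e 0) ≤ wedge y := by
  have e0 : (y + d • e 0) 0 = y 0 + d := by rw [add_smul_e_apply, if_pos rfl]
  have e1 : (y + d • e 0) 1 = y 1 := by rw [add_smul_e_apply]; simp
  by_cases hm : y + d • e 0 ∈ rect (-3) 0 0 3
  · have hm' := hm
    obtain ⟨⟨h1, h2⟩, h3, h4⟩ := hm'
    rw [e0] at h1 h2; rw [e1] at h3 h4
    have hm2 : y ∈ rect (-3) 0 0 3 := ⟨⟨by linarith, by linarith⟩, h3, h4⟩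
    rw [wedge, wedge, plateau_of_mem hm, plateau_of_mem hm2, e0, e1]
    refine le_min (min_le_left _ _) ?_
    refine le_min (le_min ?_ ?_) ?_
    · exact (min_le_left _ _).trans (by linarith)
    · exact (min_le_right _ _).trans ((min_le_left _ _).trans ((min_le_right _ _).trans (by linarith)))
    · exact (min_le_right _ _).trans (min_le_right _ _)
  · rw [wedge, plateau_of_notMem hm]; exact wedge_nonneg y

lemma wedge_of_near {y : Plane} (h0 : y 0 ≤ 0) (h0' : -1 ≤ y 0) (h1 : -y 0 ≤ y 1) (h1' : y 1 ≤ 2) :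
    wedge y = -y 0 := by
  rw [wedge, plateau_of_mem ⟨⟨by linarith, h0⟩, by linarith, by linarith⟩]
  have h2 : min (y 0 - -3) (0 - y 0) = -y 0 := by rw [min_eq_right (by linarith), zero_sub]
  rw [h2, min_eq_left (a := -y 0) (le_min (by linarith) (by linarith)), min_eq_right (by linarith)]

lemma normalDatum_slice (hβ : 0 ≤ β) (hβ' : β < 1)
    (ha : ∀ n, 1 ≤ n → 0 < a n ∧ a n ≤ level n / 2) :
    MemX β (normalDatum β a) ∧ ∀ N, MemX β (normalDatumTrunc β a N) := by
  constructor
  · rw [show normalDatum β a = _ from funext (normalDatum_eq ha)]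
    exact (wedge_slice.add ((normal_capFamily hβ hβ' ha (tailWeight_mem 0)).slice hβ hβ')).memX
  · intro N
    rw [show normalDatumTrunc β a N = _ from funext (normalDatumTrunc_eq ha N)]
    exact (wedge_slice.add ((normal_capFamily hβ hβ' ha (headWeight_mem N)).slice hβ hβ')).memX

lemma Slice.neg {β M : ℝ} {g : Plane → ℝ} (h : Slice β M g) : Slice β M (fun y => -g y) where
  cont := h.cont.neg
  bound y hy := by rw [abs_neg]; exact h.bound y hy
  horiz x hx y hy hxy := by rw [neg_sub_neg, abs_sub_comm]; exact h.horiz x hx y hy hxy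
  vert ℓ hℓ x y hx hy hxy := by rw [neg_sub_neg, abs_sub_comm]; exact h.vert ℓ hℓ x y hx hy hxy
  l1 := by simpa using h.l1

lemma tendsto_normalDatumTrunc (hβ : 0 ≤ β) (hβ' : β < 1)
    (ha : ∀ n, 1 ≤ n → 0 < a n ∧ a n ≤ level n / 2) :
    Tendsto (fun N => xNorm β (normalDatumTrunc β a N - normalDatum β a)) atTop (𝓝 0) := by
  have hle : ∀ N : ℕ, xNorm β (normalDatumTrunc β a N - normalDatum β a)
      ≤ ENNReal.ofReal (40 * ((N : ℝ) + 1)⁻¹) := by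
    intro N
    have h := ((normal_capFamily hβ hβ' ha (tailWeight_mem N)).slice hβ hβ').neg.xNorm_le
    have e1 : normalDatumTrunc β a N - normalDatum β a
        = fun y => -capSum (tailWeight N) (fun n => a (n + 1)) (diagCenter β) (stretchInv β y) := by
      ext y
      rw [Pi.sub_apply, ← normalDatumTrunc_sub hβ hβ' ha]; ring
    rw [e1]
    refine h.trans (le_of_eq ?_)
    congr 1; ring
  refine tendsto_of_tendsto_of_tendsto_of_le_of_le tendsto_const_nhds ?_ (fun _ => zero_le) hle
  have : Tendsto (fun N : ℕ => 40 * ((N : ℝ) + 1)⁻¹) atTop (𝓝 (40 * 0)) := by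
    refine Tendsto.const_mul _ (tendsto_inv_atTop_zero.comp ?_)
    exact tendsto_atTop_add_const_right _ _ tendsto_natCast_atTop_atTop
  simpa using ENNReal.tendsto_ofReal this

lemma abs_normalDatumTrunc_sub_wedge_le {A q : ℝ} {x : Plane} (hβ : 0 ≤ β) (hβ' : β < 1)
    (ha : ∀ n, 1 ≤ n → 0 < a n ∧ a n ≤ level n / 2) (hA : 0 ≤ A) (hq : 0 ≤ q)
    (haq : ∀ n, 1 ≤ n → a n ≤ A * level n ^ q) (N : ℕ) (hx : 0 < x 1) :
    |normalDatumTrunc β a N x - wedge x| ≤ A * (2 * (1 - β)⁻¹) ^ q * x 1 ^ ((1 - β) * q) := by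
  have hb : 0 < 1 - β := by linarith
  have hF := normal_capFamily hβ hβ' ha (headWeight_mem N)
  rw [normalDatumTrunc_eq ha, add_sub_cancel_left, abs_of_nonneg (capSum_nonneg hF _)]
  rcases le_total (x 1) 1 with hx1 | hx1
  · refine (capSum_le_rpow hF hA hq (fun n => haq (n + 1) (by omega)) (lamInv_pos hβ hβ' hx)).trans_eq ?_
    rw [stretchInv_one, lamInv_of_le hβ' hx1, ← mul_assoc, Real.mul_rpow (by positivity) (by positivity),
      ← Real.rpow_mul hx.le]
    ring
  · rw [show capSum (headWeight N) (fun n => a (n + 1)) (diagCenter β) (stretchInv β x) = 0 from ?_]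
    · positivity
    · by_contra hne
      obtain ⟨n, hn, -⟩ := exists_capSum_eq hF (stretchInv β x)
      rw [hn] at hne
      obtain ⟨-, h2, -⟩ := height_of_capTerm_ne_zero hF hne
      have := le_lamInv hβ hβ' hx
      have := level_le (n := n + 1) (by omega)
      rw [stretchInv_one] at h2
      linarith

lemma normalDatumTrunc_center {n N : ℕ} (hβ : 0 ≤ β) (hβ' : β < 1)
    (ha : ∀ n, 1 ≤ n → 0 < a n ∧ a n ≤ level n / 2) (hn : 1 ≤ n) (hN : n ≤ N) :
    normalDatumTrunc β a N !₂[lam β (level n), lam β (level n)] = a n / n := by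
  have hp := lam_level_pos hβ' n
  have hl := level_pos n
  have hinv := lamInv_lam hβ' (level_pos n)
  obtain ⟨m, rfl⟩ : ∃ m, n = m + 1 := ⟨n - 1, by omega⟩
  have hz : stretchInv β !₂[lam β (level (m + 1)), lam β (level (m + 1))] = diagCenter β m := by
    ext j; fin_cases j <;> simp [hinv, diagCenter]
  rw [normalDatumTrunc_eq ha, wedge_eq_zero (Or.inr (Or.inl (by simpa using hp.le))), hz,
    capSum_eq_of_height (normal_capFamily hβ hβ' ha (headWeight_mem N)) (n := m)
      (by simp [diagCenter]; linarith) (by simp [diagCenter]; linarith),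
    capTerm, sub_self, norm_zero, sub_zero, max_eq_right (ha _ hn).1.le, headWeight, if_pos (by omega)]
  push_cast
  ring

lemma normalDatumTrunc_off_center {n N : ℕ} {x : Plane} (hβ : 0 ≤ β) (hβ' : β < 1)
    (ha : ∀ n, 1 ≤ n → 0 < a n ∧ a n ≤ level n / 2) (hn : 1 ≤ n) (h0 : 0 ≤ x 0)
    (h1 : lam β (level n) / 2 ≤ x 1) (h2 : x 1 ≤ 2 * lam β (level n))
    (h3 : (2 * lam β (level n)) ^ β * a n ≤ |x 1 - lam β (level n)|) :
    normalDatumTrunc β a N x = 0 := by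
  have hp := lam_level_pos hβ' n
  have hinv := lamInv_lam hβ' (level_pos n)
  obtain ⟨l1, l2⟩ := lamInv_mem_of_mem hβ hβ' hn h1 h2
  have h4 := le_abs_lamInv_sub hβ hβ' (by linarith : 0 < x 1) hp h2 (by linarith)
    (by linarith [lam_level_le hβ hβ' n, level_le hn])
  rw [hinv] at h4
  have h5 : a n ≤ (2 * lam β (level n)) ^ (-β) * |x 1 - lam β (level n)| := by
    rwa [Real.rpow_neg (by positivity), ← div_eq_inv_mul, le_div_iff₀ (by positivity), mul_comm]
  obtain ⟨m, rfl⟩ : ∃ m, n = m + 1 := ⟨n - 1, by omega⟩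
  rw [normalDatumTrunc_eq ha, wedge_eq_zero (Or.inr (Or.inl h0)),
    capSum_eq_of_height (normal_capFamily hβ hβ' ha (headWeight_mem N)) (n := m) l1 l2, capTerm_of_le,
    add_zero]
  refine h5.trans (h4.trans ?_)
  simpa [diagCenter] using abs_coord_le (stretchInv β x - diagCenter β m) 1

end

lemma eventually_mul_rpow_le {e c : ℝ} (C : ℝ) (he : 0 < e) (hc : 0 < c) :
    ∀ᶠ h in 𝓝[>] (0 : ℝ), C * h ^ e ≤ c := by
  have h1 : Tendsto (fun h : ℝ => C * h ^ e) (𝓝 0) (𝓝 (C * 0 ^ e)) :=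
    ((Real.continuousAt_rpow_const 0 e (Or.inr he.le)).tendsto).const_mul C
  rw [Real.zero_rpow he.ne', mul_zero] at h1
  exact (h1.mono_left nhdsWithin_le_nhds).eventually_le_const hc

lemma eventually_le_const {c : ℝ} (hc : 0 < c) : ∀ᶠ h in 𝓝[>] (0 : ℝ), h ≤ c := by
  simpa using eventually_mul_rpow_le 1 one_pos hc

/-- If `x` grows at a rate comparable to `y`, and `y` changes only slowly, then `y` stays comparable
to its initial value and `x` grows linearly. -/
lemma growth_of_differential_inequalities {x y x' y' : ℝ → ℝ} {t δ X σ σ' η C : ℝ} (ht : 0 < t)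
    (hδ : 0 < δ) (hX : 0 < X) (hσ : 0 ≤ σ) (hσ' : 0 ≤ σ') (hη : 0 ≤ η) (hC : 0 ≤ C)
    (hx : ∀ s ∈ Icc 0 t, HasDerivWithinAt x (x' s) (Icc 0 t) s)
    (hy : ∀ s ∈ Icc 0 t, HasDerivWithinAt y (y' s) (Icc 0 t) s) (hx0 : x 0 = 0) (hy0 : y 0 = δ)
    (hb : ∀ s ∈ Icc 0 t, |x s| ≤ X → |y s - δ| ≤ δ / 2 →
      σ * y s - C * |x s| ≤ x' s ∧ |x' s| ≤ σ' * y s + C * |x s| ∧ |y' s| ≤ η * |x s| + C * y s)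
    (h1 : t * (σ' * (3 * δ / 2) + C * X) < X) (h2 : t * (η * X + C * (3 * δ / 2)) < δ / 2) :
    |x t| ≤ X ∧ |y t - δ| ≤ δ / 2 ∧ t * (σ * (δ / 2) - C * X) ≤ x t := by
  have hxc : ContinuousOn x (Icc 0 t) := fun s hs => (hx s hs).continuousWithinAt
  have hyc : ContinuousOn y (Icc 0 t) := fun s hs => (hy s hs).continuousWithinAt
  have hbox : ∀ s ∈ Icc 0 t, |x s| < X ∧ |y s - δ| < δ / 2 := by
    by_contra! hcon
    set S := {s ∈ Icc 0 t | X ≤ |x s| ∨ δ / 2 ≤ |y s - δ|} with hS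
    have hSne : S.Nonempty := by
      obtain ⟨s, hs, h⟩ := hcon
      refine ⟨s, hs, ?_⟩
      by_cases hlt : |x s| < X
      · exact Or.inr (h hlt)
      · exact Or.inl (not_lt.1 hlt)
    have hScl : IsClosed S := by
      have c1 : IsClosed (Icc 0 t ∩ (fun s => |x s|) ⁻¹' Ici X) :=
        hxc.abs.preimage_isClosed_of_isClosed isClosed_Icc isClosed_Ici
      have c2 : IsClosed (Icc 0 t ∩ (fun s => |y s - δ|) ⁻¹' Ici (δ / 2)) :=
        (hyc.sub continuousOn_const).abs.preimage_isClosed_of_isClosed isClosed_Icc isClosed_Ici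
      convert c1.union c2 using 1
      ext s
      simp only [hS, mem_union, mem_inter_iff, mem_preimage, mem_Ici]
      constructor
      · rintro ⟨a, b | b⟩
        · exact Or.inl ⟨a, b⟩
        · exact Or.inr ⟨a, b⟩
      · rintro (⟨a, b⟩ | ⟨a, b⟩)
        · exact ⟨a, Or.inl b⟩
        · exact ⟨a, Or.inr b⟩
    have hbdd : BddBelow S := ⟨0, fun s hs => hs.1.1⟩
    set s₀ := sInf S
    obtain ⟨hs₀, hbad⟩ : s₀ ∈ S := hScl.csInf_mem hSne hbdd
    have hsub : Icc 0 s₀ ⊆ Icc 0 t := Icc_subset_Icc_right hs₀.2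
    have hin : ∀ s ∈ Ico 0 s₀, |x s| ≤ X ∧ |y s - δ| ≤ δ / 2 := by
      intro s hs
      by_contra hc
      have hmem : s ∈ S := by
        refine ⟨⟨hs.1, hs.2.le.trans hs₀.2⟩, ?_⟩
        rw [not_and_or, not_le, not_le] at hc
        exact hc.imp le_of_lt le_of_lt
      exact absurd (csInf_le hbdd hmem) (not_le.2 hs.2)
    have bx := norm_image_sub_le_of_norm_deriv_le_segment' (f := x) (f' := x')
      (C := σ' * (3 * δ / 2) + C * X) (fun s hs => (hx s (hsub hs)).mono hsub) (fun s hs => by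
        obtain ⟨i1, i2⟩ := hin s hs
        obtain ⟨-, j2, -⟩ := hb s (hsub (Ico_subset_Icc_self hs)) i1 i2
        have := abs_le.1 i2
        rw [Real.norm_eq_abs]
        refine j2.trans ?_
        gcongr; linarith) s₀ (right_mem_Icc.2 hs₀.1)
    have by' := norm_image_sub_le_of_norm_deriv_le_segment' (f := y) (f' := y')
      (C := η * X + C * (3 * δ / 2)) (fun s hs => (hy s (hsub hs)).mono hsub) (fun s hs => by
        obtain ⟨i1, i2⟩ := hin s hs
        obtain ⟨-, -, j3⟩ := hb s (hsub (Ico_subset_Icc_self hs)) i1 i2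
        have := abs_le.1 i2
        rw [Real.norm_eq_abs]
        refine j3.trans ?_
        gcongr; linarith) s₀ (right_mem_Icc.2 hs₀.1)
    rw [hx0, sub_zero, sub_zero, Real.norm_eq_abs] at bx
    rw [hy0, sub_zero, Real.norm_eq_abs] at by'
    have m1 : (σ' * (3 * δ / 2) + C * X) * s₀ ≤ t * (σ' * (3 * δ / 2) + C * X) := by
      rw [mul_comm]; gcongr; exact hs₀.2
    have m2 : (η * X + C * (3 * δ / 2)) * s₀ ≤ t * (η * X + C * (3 * δ / 2)) := by
      rw [mul_comm]; gcongr; exact hs₀.2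
    rcases hbad with hbad | hbad <;> linarith
  have htm : t ∈ Icc 0 t := right_mem_Icc.2 ht.le
  refine ⟨(hbox t htm).1.le, (hbox t htm).2.le, ?_⟩
  have hlow := image_le_of_deriv_right_le_deriv_boundary (f := fun s => -x s) (f' := fun s => -x' s)
    (a := 0) (b := t) (B := fun s => -(s * (σ * (δ / 2) - C * X)))
    (B' := fun _ => -(σ * (δ / 2) - C * X)) hxc.neg
    (fun s hs => ((hx s (Ico_subset_Icc_self hs)).mono_of_mem_nhdsWithin
      (Icc_mem_nhdsGE_of_mem hs)).neg) (by simp [hx0]) (by fun_prop)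
    (fun s _ => by
      have := ((hasDerivAt_id s).mul_const (σ * (δ / 2) - C * X)).neg
      rw [one_mul] at this
      exact this.hasDerivWithinAt)
    (fun s hs => by
      obtain ⟨i1, i2⟩ := hbox s (Ico_subset_Icc_self hs)
      obtain ⟨j1, -, -⟩ := hb s (Ico_subset_Icc_self hs) i1.le i2.le
      have := (abs_lt.1 i2).1
      have k1 : σ * (δ / 2) ≤ σ * y s := by gcongr; linarith
      have k2 : C * |x s| ≤ C * X := by gcongr
      linarith) htm
  linarith

lemma Admissible.sub {B B' : ℝ} {G F : Plane → ℝ} (hG : Admissible B G) (hF : Admissible B' F) :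
    Admissible (B + B') (fun y => G y - F y) where
  bound y := (abs_sub _ _).trans (add_le_add (hG.bound y) (hF.bound y))
  int := hG.int.sub hF.int
  l1 := by
    calc ∫ y, |G y - F y| ≤ ∫ y, (|G y| + |F y|) :=
          integral_mono (hG.int.sub hF.int).abs (hG.int.abs.add hF.int.abs) fun y => abs_sub _ _
      _ = (∫ y, |G y|) + ∫ y, |F y| := integral_add hG.int.abs hF.int.abs
      _ ≤ _ := add_le_add hG.l1 hF.l1

lemma abs_oddExt_le_of_dist {f : Plane → ℝ} {Φ : ℝ → ℝ} {x : Plane} (hx : 0 < x 1)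
    (hΦ : Monotone Φ) (hΦ0 : ∀ r, 0 ≤ Φ r) (hf : ∀ y ∈ halfPlane, |f y| ≤ Φ ‖x - y‖) (y : Plane) :
    |oddExt f y| ≤ Φ ‖x - y‖ := by
  rcases lt_trichotomy (y 1) 0 with h | h | h
  · have hb : 0 < bar y 1 := by rw [bar_apply_one]; linarith
    have := norm_sub_le_norm_sub_bar hx hb
    rw [bar_bar] at this
    rw [oddExt_of_neg h, abs_neg]
    exact (hf _ hb).trans (hΦ this)
  · rw [oddExt_of_zero h, abs_zero]; exact hΦ0 _
  · rw [oddExt_of_pos h]; exact hf y h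

/-! ### Velocity near a point where the solution is close to one -/

section
variable {α β M A p : ℝ}

lemma velocity_sub_box {g : Plane → ℝ} (hα : 0 < α) (hα' : α < 1 / 2) (hg : Slice β M g) (a : ℝ)
    (i : Fin 2) (x : Plane) :
    velocity α g x i = conv α (oddExt fun y => g y - box a y) i x + conv α (oddExt (box a)) i x := by
  have h1 : (oddExt fun y => g y - box a y) = fun y => oddExt g y - oddExt (box a) y :=
    funext (oddExt_sub g (box a))
  rw [velocity_apply hα hα' hg.admissible, h1, conv_sub hα hα' hg.admissible (admissible_box a)]
  ring

lemma admissible_sub_box {g : Plane → ℝ} (hg : Slice β M g) (a : ℝ) :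
    Admissible (2 * M + 2) (oddExt fun y => g y - box a y) := by
  rw [show (oddExt fun y => g y - box a y) = fun y => oddExt g y - oddExt (box a) y from
    funext (oddExt_sub g (box a))]
  exact hg.admissible.sub (admissible_box a)

lemma sub_box_eq {g : Plane → ℝ} {a : ℝ} {y : Plane} (h0 : |y 0 - a| < 1 / 2) (h1 : y 1 < 1) :
    g y - box a y = g y - 1 := by
  rw [box, if_pos ⟨h0, h1⟩]

lemma exists_shear_lower (hα : 0 < α) (hα' : α < 1 / 2) (hβ : 0 ≤ β) (hβ' : β < 1)
    (hA : 0 ≤ A) (hp : 2 ≤ p) : ∃ c : ℝ, 0 < c ∧ ∀ᶠ h in 𝓝[>] (0 : ℝ),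
    ∀ (g : Plane → ℝ) (x : Plane) (d : ℝ), Slice β M g → h / 2 ≤ x 1 → x 1 ≤ 2 * h →
      (∀ y ∈ halfPlane, |y 0 - x 0| < 1 / 2 → y 1 < 1 → |g y - 1| ≤ A * y 1 ^ p) →
      0 < d → d ≤ h / 16 →
      c * h ^ (-(2 * α)) * d ≤ velocity α g (x + d • e 1) 0 - velocity α g x 0 := by
  obtain ⟨c₀, C₀, hc₀, hC₀, hbox⟩ := exists_box_shear hα hα'
  obtain ⟨C₁, hC₁, hdiff⟩ := exists_conv_diff_le hα hα'
  obtain ⟨C₂, hC₂, hint⟩ := exists_integral_maxPow_mul_le hα hα'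
  refine ⟨c₀ / 4, by positivity, ?_⟩
  set A₃ := 17 * A + 2 * (M + 1) with hA₃
  filter_upwards [self_mem_nhdsWithin, eventually_le_const (c := 1 / 16) (by norm_num),
    eventually_mul_rpow_le (e := 2 * α) (c := c₀ / 8) (C₀ + C₁ * (C₂ * (A₃ + (2 * M + 2)))) (by linarith)
      (by positivity),
    eventually_mul_rpow_le (e := 1 - β) (c := c₀ / 8) (C₁ * (8 * M)) (by linarith) (by positivity)]
    with h hh hh16 hs1 hs2 g x d hg hx1 hx2 hnear hd hd16
  have hh : 0 < h := hh
  have hM := hg.nonneg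
  have hx : 0 < x 1 := by linarith
  set F := oddExt fun y => g y - box (x 0) y with hF
  have hadm : Admissible (2 * M + 2) F := admissible_sub_box hg (x 0)
  have hR : (0 : ℝ) < h / 8 := by positivity
  have hloc : ∀ y ∈ halfPlane, |g y - box (x 0) y| ≤ min (A₃ * max ‖x - y‖ (h / 8)) (M + 1) := by
    intro y hy
    have hy : 0 < y 1 := hy
    have hall : |g y - box (x 0) y| ≤ M + 1 :=
      (abs_sub _ _).trans (add_le_add (hg.bound y hy) (abs_box_le _ _))
    refine le_min ?_ hall
    have n0 := abs_coord_le (x - y) 0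
    have n1 := abs_coord_le (x - y) 1
    simp only [PiLp.sub_apply] at n0 n1
    rw [abs_sub_comm] at n0 n1
    have hmx := le_max_left ‖x - y‖ (h / 8)
    have hmx' := le_max_right ‖x - y‖ (h / 8)
    set m := max ‖x - y‖ (h / 8)
    by_cases hc : |y 0 - x 0| < 1 / 2 ∧ y 1 < 1
    · rw [sub_box_eq hc.1 hc.2]
      refine (hnear y hy hc.1 hc.2).trans ?_
      have h1 : y 1 ^ p ≤ y 1 := by
        conv_rhs => rw [← Real.rpow_one (y 1)]
        exact Real.rpow_le_rpow_of_exponent_ge hy hc.2.le (by linarith)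
      have h2 : y 1 ≤ 17 * m := by linarith [(abs_le.1 n1).2]
      have hm0 : 0 ≤ m := by linarith
      calc A * y 1 ^ p ≤ A * (17 * m) := by gcongr; linarith
        _ ≤ A₃ * m := by rw [hA₃]; nlinarith
    · refine hall.trans ?_
      have hm2 : 1 / 2 ≤ m := by
        rw [not_and_or, not_lt, not_lt] at hc
        rcases hc with hc | hc
        · linarith
        · linarith [(abs_le.1 n1).2]
      rw [hA₃]; nlinarith
  have hfar : ∀ z : Plane, ‖z‖ < 1 → |F (x - z)| ≤ A₃ * max ‖z‖ (h / 8) := by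
    intro z _
    have := abs_oddExt_le_of_dist (Φ := fun r => A₃ * max r (h / 8)) hx
      (fun r s hrs => by dsimp only; gcongr) (fun r => by positivity)
      (fun y hy => (hloc y hy).trans (min_le_left _ _)) (x - z)
    simpa using this
  have hI := hint A₃ _ (h / 8) F x hadm hR (by positivity) hfar
  have hβ4 : max ((h / 4) ^ (-β)) 1 = (h / 4) ^ (-β) :=
    max_eq_left (Real.one_le_rpow_of_pos_of_le_one_of_nonpos (by linarith) (by linarith) (by linarith))
  have hD := hdiff _ (h / 8) (M * (h / 4) ^ (-β)) F 0 x (d • e 1) hadm hR (by positivity)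
    (by rw [norm_smul_e, abs_of_pos hd]; linarith) (fun z hz => by
      have hz0 := (abs_coord_le z 0).trans_lt hz
      have hz1 := abs_lt.1 ((abs_coord_le z 1).trans_lt hz)
      have q1 : (x - z) 1 = x 1 - z 1 := rfl
      have q0 : (x - z) 0 = x 0 - z 0 := rfl
      rw [show x + d • e 1 - z = (x - z) + d • e 1 by abel]
      have q3 : ((x - z) + d • e 1 : Plane) 1 = (x - z) 1 + d := by
        rw [add_smul_e_apply, if_pos rfl]
      have q4 : ((x - z) + d • e 1 : Plane) 0 = (x - z) 0 := by
        rw [add_smul_e_apply]; simp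
      have hab : |(x - z) 0 - x 0| < 1 / 2 := by
        rw [q0, sub_sub_cancel_left, abs_neg]; linarith
      rw [hF, oddExt_of_pos (by rw [q3, q1]; linarith), oddExt_of_pos (by rw [q1]; linarith),
        sub_box_eq (by rwa [q4]) (by rw [q3, q1]; linarith), sub_box_eq hab (by rw [q1]; linarith),
        sub_sub_sub_cancel_right]
      have := hg.vert (h / 4) (by linarith) _ _ (by rw [q3, q1]; linarith) (by rw [q1]; linarith) q4
      rwa [hβ4, q3, add_sub_cancel_left, ← norm_smul_e d 1] at this)
  rw [norm_smul_e, abs_of_pos hd] at hD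
  have hB := hbox x d hx (by linarith) hd (by linarith) (by linarith)
  have hhp : 0 < h ^ (-(2 * α)) := by positivity
  have hx2α : h ^ (-(2 * α)) / 2 ≤ x 1 ^ (-(2 * α)) := by
    calc h ^ (-(2 * α)) / 2 = 2 ^ (-1 : ℝ) * h ^ (-(2 * α)) := by rw [Real.rpow_neg_one]; ring
      _ ≤ 2 ^ (-(2 * α)) * h ^ (-(2 * α)) := by
        gcongr
        · norm_num
        · linarith
      _ = (2 * h) ^ (-(2 * α)) := (Real.mul_rpow zero_le_two hh.le).symm
      _ ≤ x 1 ^ (-(2 * α)) := Real.rpow_le_rpow_of_nonpos hx hx2 (by linarith)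
  have hLR : M * (h / 4) ^ (-β) * (h / 8) ^ (1 - 2 * α) ≤ 8 * M * h ^ (1 - β) * h ^ (-(2 * α)) := by
    have e1 : (h / 4) ^ (-β) ≤ (h / 8) ^ (-β) :=
      Real.rpow_le_rpow_of_nonpos (by positivity) (by linarith) (by linarith)
    have e2 : (h / 8) ^ (1 - β) ≤ h ^ (1 - β) :=
      Real.rpow_le_rpow (by positivity) (by linarith) (by linarith)
    have e3 : (h / 8) ^ (-(2 * α)) ≤ 8 * h ^ (-(2 * α)) := by
      rw [Real.div_rpow hh.le (by norm_num), Real.rpow_neg (by norm_num : (0 : ℝ) ≤ 8), div_inv_eq_mul,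
        mul_comm]
      gcongr
      calc (8 : ℝ) ^ (2 * α) ≤ 8 ^ (1 : ℝ) :=
            Real.rpow_le_rpow_of_exponent_le (by norm_num) (by linarith)
        _ = 8 := Real.rpow_one 8
    calc M * (h / 4) ^ (-β) * (h / 8) ^ (1 - 2 * α)
        ≤ M * (h / 8) ^ (-β) * (h / 8) ^ (1 - 2 * α) := by gcongr
      _ = M * ((h / 8) ^ (1 - β) * (h / 8) ^ (-(2 * α))) := by
        rw [mul_assoc, ← Real.rpow_add hR, ← Real.rpow_add hR]
        congr 2; ring
      _ ≤ M * (h ^ (1 - β) * (8 * h ^ (-(2 * α)))) := by gcongr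
      _ = _ := by ring
  have hone : h ^ (2 * α) * h ^ (-(2 * α)) = 1 := by rw [← Real.rpow_add hh]; simp
  rw [velocity_sub_box hα hα' hg (x 0), velocity_sub_box hα hα' hg (x 0)]
  have hD' := (abs_le.1 hD).1
  have hE : M * (h / 4) ^ (-β) * (h / 8) ^ (1 - 2 * α)
        + ∫ z, maxPow (h / 8) (2 + 2 * α) z * |F (x - z)|
      ≤ (8 * M * h ^ (1 - β) + C₂ * (A₃ + (2 * M + 2)) * h ^ (2 * α)) * h ^ (-(2 * α)) := by
    rw [add_mul, mul_assoc (C₂ * _), hone, mul_one]; linarith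
  have hE' : C₁ * d * (M * (h / 4) ^ (-β) * (h / 8) ^ (1 - 2 * α)
        + ∫ z, maxPow (h / 8) (2 + 2 * α) z * |F (x - z)|)
      ≤ C₁ * d * ((8 * M * h ^ (1 - β) + C₂ * (A₃ + (2 * M + 2)) * h ^ (2 * α)) * h ^ (-(2 * α))) := by
    gcongr
  have hB' : c₀ * d * (h ^ (-(2 * α)) / 2) ≤ c₀ * d * x 1 ^ (-(2 * α)) := by gcongr
  have hC0 : C₀ * d = C₀ * h ^ (2 * α) * (h ^ (-(2 * α)) * d) := by
    rw [mul_assoc C₀, ← mul_assoc (h ^ (2 * α)), hone, one_mul]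
  have hfin : (C₁ * (8 * M) * h ^ (1 - β)
      + (C₀ + C₁ * (C₂ * (A₃ + (2 * M + 2)))) * h ^ (2 * α)) * (h ^ (-(2 * α)) * d)
      ≤ (c₀ / 8 + c₀ / 8) * (h ^ (-(2 * α)) * d) := by gcongr
  linarith

lemma exists_tangential_le (hα : 0 < α) (hα' : α < 1 / 2) (hβ : 0 ≤ β) (hβα : β < 2 * α) (hM : 0 ≤ M)
    (hA : 0 ≤ A) (hp : 2 / (1 - 2 * α) ≤ p) : ∃ C : ℝ, 0 < C ∧ ∀ᶠ h in 𝓝[>] (0 : ℝ),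
    ∀ (g : Plane → ℝ) (x : Plane) (d : ℝ), Slice β M g → h / 2 ≤ x 1 → x 1 ≤ 2 * h →
      (∀ y ∈ halfPlane, |y 0 - x 0| < 1 / 2 → y 1 < 1 → |g y - 1| ≤ A * y 1 ^ p) →
      |d| ≤ h ^ (1 / (1 - 2 * α)) / 2 →
      |velocity α g (x + d • e 0) 1 - velocity α g x 1| ≤ C * h ^ (1 - α + β / 2) * |d| := by
  obtain ⟨C₀, hC₀, hbox⟩ := exists_box_tangential hα hα'
  obtain ⟨C₁, hC₁, htan⟩ := exists_conv_tangential_le (κ := (β + 2 * α) / 2) hα hα' (by linarith)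
  have h2α : 0 < 1 - 2 * α := by linarith
  have hp2 : 2 ≤ p := le_trans (by rw [le_div_iff₀ h2α]; linarith) hp
  refine ⟨C₁ * (M + A * 4 ^ p + A * 2 ^ p * 2 + (2 * M + 2) * 2) + C₀ * 2, by positivity, ?_⟩
  filter_upwards [self_mem_nhdsWithin, eventually_le_const (c := 1 / 16) (by norm_num),
    eventually_mul_rpow_le (e := 2 * α / (1 - 2 * α)) (c := 1 / 8) 1 (by positivity) (by norm_num)]
    with h hh hh16 hs1 g x d hg hx1 hx2 hnear hd
  have hh : 0 < h := hh
  have hx : 0 < x 1 := by linarith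
  set F := oddExt fun y => g y - box (x 0) y with hF
  have hadm : Admissible (2 * M + 2) F := admissible_sub_box hg (x 0)
  set R := h ^ (1 / (1 - 2 * α)) with hRdef
  have hR0 : 0 < R := by positivity
  have hRh : R ≤ h / 8 := by
    have : R = h * h ^ (2 * α / (1 - 2 * α)) := by
      rw [hRdef, ← Real.rpow_one_add' hh.le (by positivity)]
      congr 1; field_simp; ring
    rw [this]; nlinarith
  have hloc : ∀ y ∈ halfPlane, ‖x - y‖ < 1 / 2 → |F y| ≤ A * y 1 ^ p := by
    intro y hy hxy
    have hy : 0 < y 1 := hy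
    have n0 := abs_coord_le (x - y) 0
    have n1 := abs_coord_le (x - y) 1
    simp only [PiLp.sub_apply] at n0 n1
    rw [abs_sub_comm] at n0 n1
    have h0 : |y 0 - x 0| < 1 / 2 := n0.trans_lt hxy
    have h1 : y 1 < 1 := by linarith [(abs_le.1 n1).2]
    rw [hF, oddExt_of_pos hy, sub_box_eq h0 h1]
    exact hnear y hy h0 h1
  have hT := htan _ R M (A * (4 * h) ^ p) (A * 2 ^ p) F x d hadm (oddExt_bar _) hR0 (by linarith)
    (by linarith) hd hM (by positivity) (by positivity) (fun z hz => by
      have hz0 := (abs_coord_le z 0).trans_lt hz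
      have hz1 := abs_lt.1 ((abs_coord_le z 1).trans_lt hz)
      have q1 : (x - z) 1 = x 1 - z 1 := rfl
      have q0 : (x - z) 0 = x 0 - z 0 := rfl
      rw [show x + d • e 0 - z = (x - z) + d • e 0 by abel]
      have q3 : ((x - z) + d • e 0 : Plane) 0 = (x - z) 0 + d := by
        rw [add_smul_e_apply, if_pos rfl]
      have q4 : ((x - z) + d • e 0 : Plane) 1 = (x - z) 1 := by
        rw [add_smul_e_apply]; simp
      have hab : |(x - z) 0 - x 0| < 1 / 2 := by
        rw [q0, sub_sub_cancel_left, abs_neg]; linarith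
      have hab' : |(x - z + d • e 0 : Plane) 0 - x 0| < 1 / 2 := by
        rw [q3, q0, show x 0 - z 0 + d - x 0 = d - z 0 by ring]
        exact (abs_sub _ _).trans_lt (by linarith)
      have hH : 0 < (x - z) 1 := by rw [q1]; linarith
      rw [hF, oddExt_of_pos (by rwa [q4]), oddExt_of_pos hH,
        sub_box_eq hab' (by rw [q4, q1]; linarith), sub_box_eq hab (by rw [q1]; linarith),
        sub_sub_sub_cancel_right]
      have := hg.horiz _ (by rwa [mem_halfPlane, q4]) _ hH q4
      rwa [q3, add_sub_cancel_left] at this)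
    (fun y hy hxy => by
      have hy' : 0 < y 1 := hy
      refine (hloc y hy (by linarith)).trans ?_
      have n1 := abs_coord_le (x - y) 1
      simp only [PiLp.sub_apply] at n1
      have : y 1 ≤ 4 * h := by linarith [(abs_le.1 n1).1]
      gcongr)
    (fun y hy hxy hxy' => by
      have hy' : 0 < y 1 := hy
      have hr : 0 < ‖x - y‖ := hx.trans_le hxy
      refine (hloc y hy hxy').trans ?_
      have n1 := abs_coord_le (x - y) 1
      simp only [PiLp.sub_apply] at n1
      have h1 : y 1 ≤ 2 * ‖x - y‖ := by linarith [(abs_le.1 n1).1]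
      calc A * y 1 ^ p ≤ A * (2 * ‖x - y‖) ^ p := by gcongr
        _ = A * 2 ^ p * ‖x - y‖ ^ p := by rw [Real.mul_rpow zero_le_two hr.le, mul_assoc]
        _ ≤ A * 2 ^ p * ‖x - y‖ ^ (1 + (β + 2 * α) / 2) := by
          gcongr _ * ?_
          exact Real.rpow_le_rpow_of_exponent_ge hr (by linarith) (by linarith))
  have hB := hbox x d hx (by linarith)
  set e₀ := 1 - α + β / 2 with he₀
  have hhe : h ≤ h ^ e₀ := by
    conv_lhs => rw [← Real.rpow_one h]
    exact Real.rpow_le_rpow_of_exponent_ge hh (by linarith) (by rw [he₀]; linarith)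
  have hR1 : R ^ (1 - 2 * α) = h := by
    rw [hRdef, ← Real.rpow_mul hh.le, one_div_mul_cancel h2α.ne', Real.rpow_one]
  have hR2 : (4 * h) ^ p * R ^ (-(2 * α)) ≤ 4 ^ p * h ^ e₀ := by
    rw [Real.mul_rpow (by norm_num) hh.le, mul_assoc, hRdef, ← Real.rpow_mul hh.le, ← Real.rpow_add hh]
    gcongr _ * ?_
    refine Real.rpow_le_rpow_of_exponent_ge hh (by linarith) ?_
    have : 2 / (1 - 2 * α) + 1 / (1 - 2 * α) * -(2 * α) = 1 + 1 / (1 - 2 * α) := by field_simp; ring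
    have h3 : 0 < 1 / (1 - 2 * α) := by positivity
    rw [he₀]; linarith
  have hx3 : x 1 ^ (1 - 2 * α + (β + 2 * α) / 2) ≤ 2 * h ^ e₀ := by
    rw [show 1 - 2 * α + (β + 2 * α) / 2 = e₀ by rw [he₀]; ring]
    calc x 1 ^ e₀ ≤ (2 * h) ^ e₀ := by
          refine Real.rpow_le_rpow hx.le hx2 ?_
          rw [he₀]; linarith
      _ = 2 ^ e₀ * h ^ e₀ := Real.mul_rpow zero_le_two hh.le
      _ ≤ 2 * h ^ e₀ := by
        gcongr
        calc (2 : ℝ) ^ e₀ ≤ 2 ^ (1 : ℝ) :=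
              Real.rpow_le_rpow_of_exponent_le one_le_two (by rw [he₀]; linarith)
          _ = 2 := Real.rpow_one 2
  rw [velocity_sub_box hα hα' hg (x 0), velocity_sub_box hα hα' hg (x 0)]
  rw [add_sub_add_comm]
  refine (abs_add_le _ _).trans ?_
  have hsum : M * R ^ (1 - 2 * α) + A * (4 * h) ^ p * R ^ (-(2 * α))
      + A * 2 ^ p * x 1 ^ (1 - 2 * α + (β + 2 * α) / 2) + (2 * M + 2) * x 1
      ≤ (M + A * 4 ^ p + A * 2 ^ p * 2 + (2 * M + 2) * 2) * h ^ e₀ := by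
    have s1 : M * R ^ (1 - 2 * α) ≤ M * h ^ e₀ := by rw [hR1]; gcongr
    have s2 : A * ((4 * h) ^ p * R ^ (-(2 * α))) ≤ A * (4 ^ p * h ^ e₀) := by gcongr
    have s3 : A * 2 ^ p * x 1 ^ (1 - 2 * α + (β + 2 * α) / 2) ≤ A * 2 ^ p * (2 * h ^ e₀) := by gcongr
    have s4 : (2 * M + 2) * x 1 ≤ (2 * M + 2) * (2 * h ^ e₀) := by
      gcongr; linarith
    linarith
  have hT' := hT.trans (mul_le_mul_of_nonneg_left hsum (by positivity))
  have hB' : C₀ * |d| * x 1 ≤ C₀ * |d| * (2 * h ^ e₀) := by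
    gcongr; linarith
  linarith

end

/-! ### Displacement along characteristics -/

lemma FlowField.mono {T T' C V : ℝ} {w : ℝ → Plane → Plane} (hw : FlowField T C V w) (h : T' ≤ T) :
    FlowField T' C V w where
  cont x hx := (hw.cont x hx).mono (Icc_subset_Icc_right h)
  norm_le t ht := hw.norm_le t ⟨ht.1, ht.2.trans h⟩
  lip ε hε := by
    obtain ⟨K, hK⟩ := hw.lip ε hε
    exact ⟨K, fun t ht => hK t ⟨ht.1, ht.2.trans h⟩⟩
  normal t ht := hw.normal t ⟨ht.1, ht.2.trans h⟩

lemma exp_half_le : Real.exp (1 / 2) ≤ 2 := by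
  have h1 := Real.add_one_le_exp (-(1 / 2 : ℝ))
  rw [Real.exp_neg] at h1
  have h2 := Real.exp_pos (1 / 2)
  have h3 : (1 / 2 : ℝ) ≤ (Real.exp (1 / 2))⁻¹ := by linarith
  rw [le_inv_comm₀ (by norm_num) h2] at h3
  simpa using h3

section
variable {b C V : ℝ} {w : ℝ → Plane → Plane} {X : ℝ → Plane}

lemma height_le_two_mul (hw : FlowField b C V w)
    (hX : ∀ τ ∈ Icc 0 b, X τ ∈ halfPlane ∧ HasDerivWithinAt X (w τ (X τ)) (Icc 0 b) τ) (hC : 0 ≤ C)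
    (hb : C * b ≤ 1 / 2) {s t : ℝ} (hs : s ∈ Icc 0 b) (ht : t ∈ Icc 0 b) : X t 1 ≤ 2 * X s 1 := by
  refine (height_le_exp hw hX hs ht).trans (mul_le_mul_of_nonneg_right ?_ (hX s hs).1.le)
  refine le_trans (Real.exp_le_exp.2 (le_trans ?_ hb)) exp_half_le
  gcongr
  exact abs_le.2 ⟨by linarith [ht.1, hs.2], by linarith [ht.2, hs.1]⟩

lemma norm_sub_le_of_trajectory (hw : FlowField b C V w)
    (hX : ∀ τ ∈ Icc 0 b, X τ ∈ halfPlane ∧ HasDerivWithinAt X (w τ (X τ)) (Icc 0 b) τ)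
    {t : ℝ} (ht : t ∈ Icc 0 b) : ‖X t - X 0‖ ≤ V * t := by
  have := norm_image_sub_le_of_norm_deriv_le_segment' (f := X) (C := V) (fun τ hτ => (hX τ hτ).2)
    (fun τ hτ => hw.norm_le τ (Ico_subset_Icc_self hτ) _ (hX τ (Ico_subset_Icc_self hτ)).1) t ht
  simpa using this

end

lemma hasDerivWithinAt_reverse {f f' : ℝ → ℝ} {t : ℝ}
    (hf : ∀ τ ∈ Icc 0 t, HasDerivWithinAt f (f' τ) (Icc 0 t) τ) :
    ∀ s ∈ Icc 0 t, HasDerivWithinAt (fun s => f (t - s)) (-f' (t - s)) (Icc 0 t) s := by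
  intro s hs
  have hmap : ∀ s ∈ Icc 0 t, t - s ∈ Icc 0 t := fun s hs => ⟨by linarith [hs.2], by linarith [hs.1]⟩
  have h1 : HasDerivWithinAt (fun s : ℝ => t - s) (-1) (Icc 0 t) s := by
    simpa using (hasDerivWithinAt_id s (Icc 0 t)).const_sub t
  have := (hf _ (hmap s hs)).scomp s h1 hmap
  rw [neg_one_smul] at this
  exact this

lemma near_one_of_datum {α β M T C V A p τ : ℝ} {θ : ℝ → Plane → ℝ} (h : BoundedSolution α β M T θ)
    (hw : FlowField T C V (fun t => velocity α (θ t))) (hC : 0 ≤ C) (hA : 0 ≤ A) (hp : 0 ≤ p)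
    (hdat : ∀ y ∈ halfPlane, |y 0| ≤ 2 → y 1 ≤ 1 → |θ 0 y - 1| ≤ A * y 1 ^ p)
    (hτ : τ ∈ Icc 0 T) (hCτ : C * τ ≤ 1 / 2) (hVτ : V * τ ≤ 1) {y : Plane} (hy : y ∈ halfPlane)
    (hy0 : |y 0| ≤ 1) : |θ τ y - 1| ≤ (A + M + 1) * 2 ^ p * y 1 ^ p := by
  have hM := (h.slice τ hτ).nonneg
  have hyp : 0 < y 1 := hy
  have hτ0 : τ ∈ Icc 0 τ := right_mem_Icc.2 hτ.1
  have hz : (0 : ℝ) ∈ Icc 0 τ := left_mem_Icc.2 hτ.1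
  obtain ⟨Y, hYτ, hY⟩ := exists_backward_trajectory hw hτ hy
  have hwτ := hw.mono hτ.2
  have hcons := h.conserved hw hτ.2 hY hτ0
  have hheight := height_le_two_mul hwτ hY hC hCτ hτ0 hz
  have hdisp := norm_sub_le_of_trajectory hwτ hY hτ0
  rw [hYτ] at hcons hheight hdisp
  have hY1 : 0 < Y 0 1 := (hY 0 hz).1
  rw [hcons]
  have e1 : (A + M + 1) * 2 ^ p * y 1 ^ p = (A + M + 1) * (2 * y 1) ^ p := by
    rw [Real.mul_rpow zero_le_two hyp.le, mul_assoc]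
  rw [e1]
  rcases le_total (Y 0 1) 1 with hle | hle
  · have h0 : |Y 0 0| ≤ 2 := by
      have n0 := abs_coord_le (y - Y 0) 0
      simp only [PiLp.sub_apply] at n0
      have := abs_sub_abs_le_abs_sub (Y 0 0) (y 0)
      rw [abs_sub_comm] at this
      linarith
    refine (hdat _ (hY 0 hz).1 h0 hle).trans ?_
    gcongr
    linarith
  · have h1 : |θ 0 (Y 0) - 1| ≤ M + 1 := by
      refine (abs_sub _ _).trans ?_
      rw [abs_one]
      have := (h.slice 0 (left_mem_Icc.2 (hτ.1.trans hτ.2))).bound _ (hY 0 hz).1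
      linarith
    have h2 : 1 ≤ (2 * y 1) ^ p := Real.one_le_rpow (by linarith) hp
    nlinarith

/-! ### The tangential mechanism -/

lemma tendsto_lam_level {β : ℝ} (hβ : 0 ≤ β) (hβ' : β < 1) :
    Tendsto (fun n => lam β (level n)) atTop (𝓝[>] 0) := by
  refine tendsto_nhdsWithin_iff.2 ⟨?_, Eventually.of_forall fun n => lam_level_pos hβ' n⟩
  exact tendsto_of_tendsto_of_tendsto_of_le_of_le tendsto_const_nhds tendsto_level
    (fun n => (lam_level_pos hβ' n).le) (fun n => lam_level_le hβ hβ' n)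

lemma level_eq_lamInv {β : ℝ} (hβ : 0 ≤ β) (hβ' : β < 1) {n : ℕ} (hn : 1 ≤ n) :
    level n = (1 - β)⁻¹ * lam β (level n) ^ (1 - β) := by
  have h1 := lam_level_le hβ hβ' n
  have h2 := level_le hn
  rw [← lamInv_of_le hβ' (by linarith), lamInv_lam hβ' (level_pos n)]

set_option maxHeartbeats 1000000 in
/-- The solution cannot stay regular near a cap of size `a` at the height `h`. -/
lemma exists_tangential_contradiction {α β M A A₀ p T : ℝ} (hα : 0 < α) (hα' : α < 1 / 2) (hβ : 0 ≤ β)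
    (hβα : β < 2 * α) (hβ' : β < 1) (hM : 0 ≤ M) (hA : 0 ≤ A) (hA₀ : 0 ≤ A₀)
    (hp : 2 / (1 - 2 * α) ≤ p) (hT : 0 < T) :
    ∀ᶠ h in 𝓝[>] (0 : ℝ), ∀ (a : ℝ) (θ : ℝ → Plane → ℝ), 0 < a → a ≤ A₀ * h ^ p →
      BoundedSolution α β M T θ →
      (∀ y ∈ halfPlane, |y 0| ≤ 2 → y 1 ≤ 1 → |θ 0 y - 1| ≤ A * y 1 ^ p) →
      θ 0 !₂[0, h] = 1 + a →
      (∀ y ∈ halfPlane, a ≤ |y 0| → |y 0| ≤ 2 → h / 2 ≤ y 1 → y 1 ≤ 2 * h → θ 0 y = 1) → False := by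
  have h2α : 0 < 1 - 2 * α := by linarith
  have hp2 : 2 ≤ p := le_trans (by rw [le_div_iff₀ h2α]; linarith) hp
  obtain ⟨C₀, hC₀, hvel⟩ := exists_velocityBounds hα hα'
  set A' := (A + M + 1) * 2 ^ p with hA'
  have hA'0 : 0 ≤ A' := by positivity
  obtain ⟨c, hc, hshear⟩ := exists_shear_lower (M := M) hα hα' hβ hβ' hA'0 hp2
  obtain ⟨Ct, hCt, htang⟩ := exists_tangential_le hα hα' hβ hβα hM hA'0 hp
  set C₁ := C₀ * M with hC₁
  have hC₁0 : 0 ≤ C₁ := by positivity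
  set κ := (2 * α - β) / 2 with hκ
  have hκ0 : 0 < κ := by rw [hκ]; linarith
  set K := 4 / c with hK
  have hK0 : 0 < K := by positivity
  set K₂ := 4 * (C₁ + 1) * 2 ^ (2 * α) * K with hK₂
  have hK₂0 : 0 < K₂ := by positivity
  have hpe : 0 < p - 1 / (1 - 2 * α) := by
    have : 0 < 1 / (1 - 2 * α) := by positivity
    have h3 : 2 / (1 - 2 * α) = 1 / (1 - 2 * α) + 1 / (1 - 2 * α) := by ring
    linarith
  filter_upwards [self_mem_nhdsWithin, eventually_le_const (c := 1 / 16) (by norm_num),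
    eventually_mul_rpow_le 1 hκ0 hT,
    eventually_mul_rpow_le (c := 1 / 16) (C₁ + 1) hκ0 (by norm_num),
    eventually_mul_rpow_le (c := 1 / 2) (K₂ * A₀) hpe (by norm_num),
    eventually_mul_rpow_le (e := p - 1) (c := 1 / 24) (K * A₀) (by linarith) (by norm_num),
    eventually_mul_rpow_le (e := 1 - α - β / 2) (c := 1 / 4) (4 * Ct * (C₁ + 1) * 2 ^ (2 * α)) (by linarith)
      (by norm_num),
    eventually_mul_rpow_le (c := 1) (C₁ * K₂) hκ0 one_pos,
    eventually_mul_rpow_le (c := 1 / 2) (M * 4 ^ β * K) hκ0 (by norm_num), hshear, htang]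
    with h hh hh16 c1 c2 c3 c4 c5 c6 c7 hsh htg a θ ha haA hθ hdat hcen hoff
  have hh : 0 < h := hh
  set t := h ^ κ with ht
  have ht0 : 0 < t := by positivity
  have htT : t ≤ T := by linarith
  have htI : t ∈ Icc 0 T := ⟨ht0.le, htT⟩
  have hC1t : C₁ * t ≤ 1 / 16 := by linarith
  set δ := K * a * h ^ (2 * α) / t with hδ
  have hδ0 : 0 < δ := by positivity
  set σ' := (C₁ + 1) * (h / 2) ^ (-(2 * α)) with hσ'
  have hσ'0 : 0 < σ' := by positivity
  set X := 4 * t * σ' * δ with hX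
  have hX0 : 0 < X := by positivity
  have hpow : (h / 2) ^ (-(2 * α)) = 2 ^ (2 * α) * h ^ (-(2 * α)) := by
    rw [Real.div_rpow hh.le zero_le_two, Real.rpow_neg zero_le_two, div_inv_eq_mul, mul_comm]
  have hone : h ^ (2 * α) * h ^ (-(2 * α)) = 1 := by rw [← Real.rpow_add hh]; simp
  have htδ : t * δ = K * a * h ^ (2 * α) := by rw [hδ]; field_simp
  have hXa : X = K₂ * a := by
    calc X = 4 * σ' * (t * δ) := by rw [hX]; ring
      _ = K₂ * a * (h ^ (2 * α) * h ^ (-(2 * α))) := by rw [htδ, hσ', hpow, hK₂]; ring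
      _ = K₂ * a := by rw [hone, mul_one]
  have hXR : X ≤ h ^ (1 / (1 - 2 * α)) / 2 := by
    have e1 : h ^ p = h ^ (p - 1 / (1 - 2 * α)) * h ^ (1 / (1 - 2 * α)) := by
      rw [← Real.rpow_add hh]; congr 1; ring
    calc X ≤ K₂ * (A₀ * h ^ p) := by rw [hXa]; gcongr
      _ = K₂ * A₀ * h ^ (p - 1 / (1 - 2 * α)) * h ^ (1 / (1 - 2 * α)) := by rw [e1]; ring
      _ ≤ 1 / 2 * h ^ (1 / (1 - 2 * α)) := by gcongr
      _ = _ := by ring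
  have hR1 : h ^ (1 / (1 - 2 * α)) ≤ 1 := Real.rpow_le_one hh.le (by linarith) (by positivity)
  have hδh : 3 * δ / 2 ≤ h / 16 := by
    have e1 : h ^ p = h ^ (p - 1) * h := by
      rw [← Real.rpow_add_one hh.ne']; congr 1; ring
    have e2 : h ^ (2 * α) / t ≤ 1 := by
      rw [div_le_one ht0, ht]
      exact Real.rpow_le_rpow_of_exponent_ge hh (by linarith) (by rw [hκ]; linarith)
    have e3 : δ ≤ h / 24 := by
      calc δ = K * a * (h ^ (2 * α) / t) := by rw [hδ]; ring
        _ ≤ K * (A₀ * h ^ p) * 1 := by gcongr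
        _ = K * A₀ * h ^ (p - 1) * h := by rw [e1]; ring
        _ ≤ 1 / 24 * h := by gcongr
        _ = h / 24 := by ring
    linarith
  have hv : ∀ τ ∈ Icc 0 T, VelocityBounds α C₀ M (velocity α (θ τ)) := fun τ hτ =>
    hvel β M _ hβ hβ' (hθ.slice τ hτ)
  have hwT : FlowField T C₁ (2 * C₁) (fun τ => velocity α (θ τ)) := hθ.flowField hα hα' hC₁0 hv
  have hw := hwT.mono htT
  obtain ⟨P, hP0, hP⟩ := exists_trajectory (y := !₂[0, h]) ht0.le hw (by simpa [mem_halfPlane] using hh)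
  have hP01 : P 0 1 = h := by rw [hP0]; simp
  have hP00 : P 0 0 = 0 := by rw [hP0]; simp
  have hI0 : (0 : ℝ) ∈ Icc 0 t := left_mem_Icc.2 ht0.le
  have hIt : t ∈ Icc 0 t := right_mem_Icc.2 ht0.le
  have hPh : ∀ τ ∈ Icc 0 t, h / 2 ≤ P τ 1 ∧ P τ 1 ≤ 2 * h := fun τ hτ => by
    have h1 := height_le_two_mul hw hP hC₁0 (by linarith) hI0 hτ
    have h2 := height_le_two_mul hw hP hC₁0 (by linarith) hτ hI0
    rw [hP01] at h1 h2
    exact ⟨by linarith, h1⟩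
  have hPx : ∀ τ ∈ Icc 0 t, |P τ 0| ≤ 1 / 2 := fun τ hτ => by
    have h1 := norm_sub_le_of_trajectory hw hP hτ
    have h2 := (abs_coord_le (P τ - P 0) 0).trans h1
    simp only [PiLp.sub_apply, hP00, sub_zero] at h2
    refine h2.trans ?_
    have : 2 * C₁ * τ ≤ 2 * C₁ * t := by gcongr; exact hτ.2
    linarith
  obtain ⟨Q, hQt, hQ⟩ := exists_backward_trajectory (y := P t + δ • e 1) hw hIt (by
    rw [mem_halfPlane, add_smul_e_apply, if_pos rfl]
    linarith [(hPh t hIt).1])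
  have hnear : ∀ τ ∈ Icc 0 t, ∀ y ∈ halfPlane, |y 0 - P τ 0| < 1 / 2 → y 1 < 1 →
      |θ τ y - 1| ≤ A' * y 1 ^ p := by
    intro τ hτ y hy hy0 _
    have hτT : τ ∈ Icc 0 T := ⟨hτ.1, hτ.2.trans htT⟩
    have hτ2 : C₁ * τ ≤ C₁ * t := by gcongr; exact hτ.2
    refine near_one_of_datum hθ hwT hC₁0 hA (by linarith) hdat hτT (by linarith) (by linarith) hy ?_
    have := abs_sub_abs_le_abs_sub (y 0) (P τ 0)
    linarith [hPx τ hτ]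
  set u := fun τ => velocity α (θ τ) with hu
  have hdP : ∀ i, ∀ τ ∈ Icc 0 t, HasDerivWithinAt (fun τ => P τ i) (u τ (P τ) i) (Icc 0 t) τ :=
    fun i τ hτ => hasDerivWithinAt_coord (hP τ hτ).2 i
  have hdQ : ∀ i, ∀ τ ∈ Icc 0 t, HasDerivWithinAt (fun τ => Q τ i) (u τ (Q τ) i) (Icc 0 t) τ :=
    fun i τ hτ => hasDerivWithinAt_coord (hQ τ hτ).2 i
  set η := Ct * h ^ (1 - α + β / 2) with hη
  have hη0 : 0 < η := by positivity
  have htrap := growth_of_differential_inequalities (t := t) (δ := δ) (X := X) (σ := c * h ^ (-(2 * α)))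
    (σ' := σ') (η := η) (C := C₁)
    (x := fun s => P (t - s) 0 - Q (t - s) 0) (y := fun s => Q (t - s) 1 - P (t - s) 1)
    (x' := fun s => -(u (t - s) (P (t - s)) 0 - u (t - s) (Q (t - s)) 0))
    (y' := fun s => -(u (t - s) (Q (t - s)) 1 - u (t - s) (P (t - s)) 1))
    ht0 hδ0 hX0 (by positivity) hσ'0.le hη0.le hC₁0
    (hasDerivWithinAt_reverse (f := fun τ => P τ 0 - Q τ 0)
      (f' := fun τ => u τ (P τ) 0 - u τ (Q τ) 0) fun τ hτ => (hdP 0 τ hτ).sub (hdQ 0 τ hτ))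
    (hasDerivWithinAt_reverse (f := fun τ => Q τ 1 - P τ 1)
      (f' := fun τ => u τ (Q τ) 1 - u τ (P τ) 1) fun τ hτ => (hdQ 1 τ hτ).sub (hdP 1 τ hτ))
    (by simp only [sub_zero, hQt]; rw [add_smul_e_apply]; simp)
    (by simp only [sub_zero, hQt]; rw [add_smul_e_apply, if_pos rfl, add_sub_cancel_left])
    (fun s hs hxs hys => ?_) ?_ ?_
  · simp only [sub_self] at htrap
    obtain ⟨hxX, hyδ, hxlow⟩ := htrap
    have htσ : t * (c * h ^ (-(2 * α)) * (δ / 2)) = 2 * a := by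
      calc t * (c * h ^ (-(2 * α)) * (δ / 2)) = c / 2 * (t * δ) * h ^ (-(2 * α)) := by ring
        _ = c / 2 * K * a * (h ^ (2 * α) * h ^ (-(2 * α))) := by rw [htδ]; ring
        _ = 2 * a := by rw [hone, hK]; field_simp; norm_num
    have htX : t * (C₁ * X) ≤ a := by
      rw [hXa]
      calc t * (C₁ * (K₂ * a)) = C₁ * K₂ * t * a := by ring
        _ ≤ 1 * a := by gcongr
        _ = a := one_mul a
    have hxa : a ≤ P 0 0 - Q 0 0 := by linarith
    rw [hP00, zero_sub] at hxa hxX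
    rw [hP01] at hyδ
    rw [abs_neg] at hxX
    have hyδ' := abs_le.1 hyδ
    have hQ01 : θ 0 (Q 0) = 1 := hoff (Q 0) (hQ 0 hI0).1 (by linarith [neg_le_abs (Q 0 0)])
      (by linarith) (by linarith) (by linarith)
    have e1 : θ t (P t) = 1 + a := by rw [hθ.conserved hwT htT hP hIt, hP0, hcen]
    have e2 : θ t (Q t) = 1 := by rw [hθ.conserved hwT htT hQ hIt, hQ01]
    have hPt := hPh t hIt
    have hvert := (hθ.slice t htI).vert (h / 4) (by positivity) (P t) (Q t) (by linarith)
      (by rw [hQt, add_smul_e_apply, if_pos rfl]; linarith) (by rw [hQt, add_smul_e_apply]; simp)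
    rw [e1, e2, add_sub_cancel_left, abs_of_pos ha, hQt, add_smul_e_apply, if_pos rfl,
      sub_add_cancel_left, abs_neg, abs_of_pos hδ0,
      max_eq_left (Real.one_le_rpow_of_pos_of_le_one_of_nonpos (by linarith) (by linarith) (by linarith))]
      at hvert
    have e3 : M * (h / 4) ^ (-β) * δ = M * 4 ^ β * K * t * a := by
      rw [hδ, Real.div_rpow hh.le (by norm_num), Real.rpow_neg (by norm_num : (0 : ℝ) ≤ 4), div_inv_eq_mul]
      have : h ^ (-β) * h ^ (2 * α) = t * t := by
        rw [ht, ← Real.rpow_add hh, ← Real.rpow_add hh]; congr 1; rw [hκ]; ring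
      calc M * (h ^ (-β) * 4 ^ β) * (K * a * h ^ (2 * α) / t)
          = M * 4 ^ β * K * a * (h ^ (-β) * h ^ (2 * α)) / t := by ring
        _ = M * 4 ^ β * K * a * (t * t) / t := by rw [this]
        _ = _ := by field_simp
    rw [e3] at hvert
    nlinarith
  · set τ := t - s with hτdef
    have hτ : τ ∈ Icc 0 t := ⟨by linarith [hs.2], by linarith [hs.1]⟩
    have hτT : τ ∈ Icc 0 T := ⟨hτ.1, hτ.2.trans htT⟩
    dsimp only at hxs hys ⊢
    set ξ := P τ 0 - Q τ 0 with hξ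
    set ζ := Q τ 1 - P τ 1 with hζ
    have hζ' := abs_le.1 hys
    have hζ0 : 0 < ζ := by linarith
    have hvτ := hv τ hτT
    have hPτ := hPh τ hτ
    have hQe : Q τ = P τ + (-ξ) • e 0 + ζ • e 1 := by
      ext j; fin_cases j <;> simp [hξ, hζ, e]
    have hQe' : Q τ = P τ + ζ • e 1 + (-ξ) • e 0 := by rw [hQe]; abel
    have b1 := hvτ.horiz 0 (P τ + ζ • e 1) (-ξ)
    have b2 := hvτ.normal (P τ + (-ξ) • e 0) ζ
    rw [← hQe'] at b1
    rw [← hQe] at b2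
    have b3 := hsh _ (P τ) ζ (hθ.slice τ hτT) hPτ.1 hPτ.2 (hnear τ hτ) hζ0 (by linarith)
    have b4 := hvτ.shear (h / 2) (P τ) ζ (by positivity) (by linarith) hPτ.1
      (by rw [abs_of_pos hζ0]; linarith)
    have b5 := htg _ (P τ) (-ξ) (hθ.slice τ hτT) hPτ.1 hPτ.2 (hnear τ hτ)
      (by rw [abs_neg]; exact hxs.trans hXR)
    rw [abs_of_pos hζ0] at b2 b4
    rw [abs_neg] at b1 b5
    have b1' := abs_le.1 b1
    have b4' : |velocity α (θ τ) (P τ + ζ • e 1) 0 - velocity α (θ τ) (P τ) 0| ≤ σ' * ζ := by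
      refine b4.trans ?_
      rw [hσ']
      gcongr; linarith
    have b4'' := abs_le.1 b4'
    refine ⟨?_, ?_, ?_⟩
    · simp only [hu]; linarith
    · rw [abs_neg, abs_sub_comm]
      simp only [hu]
      have := abs_sub_le (velocity α (θ τ) (Q τ) 0) (velocity α (θ τ) (P τ + ζ • e 1) 0)
        (velocity α (θ τ) (P τ) 0)
      linarith
    · rw [abs_neg]
      simp only [hu]
      have := abs_sub_le (velocity α (θ τ) (Q τ) 1) (velocity α (θ τ) (P τ + (-ξ) • e 0) 1)
        (velocity α (θ τ) (P τ) 1)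
      linarith
  · have e1 : t * (σ' * (3 * δ / 2)) = 3 / 8 * X := by rw [hX]; ring
    have e2 : t * (C₁ * X) ≤ 1 / 16 * X := by
      calc t * (C₁ * X) = C₁ * t * X := by ring
        _ ≤ _ := by gcongr
    linarith
  · have e1 : t * (C₁ * (3 * δ / 2)) ≤ 1 / 16 * (3 * δ / 2) := by
      calc t * (C₁ * (3 * δ / 2)) = C₁ * t * (3 * δ / 2) := by ring
        _ ≤ _ := by gcongr
    have e2 : t * (η * X) ≤ 1 / 4 * δ := by
      have e3 : t * (t * (h ^ (1 - α + β / 2) * h ^ (-(2 * α)))) = h ^ (1 - α - β / 2) := by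
        rw [ht, ← Real.rpow_add hh, ← Real.rpow_add hh, ← Real.rpow_add hh]
        congr 1; rw [hκ]; ring
      calc t * (η * X) = 4 * Ct * (C₁ + 1) * 2 ^ (2 * α)
            * (t * (t * (h ^ (1 - α + β / 2) * h ^ (-(2 * α))))) * δ := by rw [hX, hη, hσ', hpow]; ring
        _ = 4 * Ct * (C₁ + 1) * 2 ^ (2 * α) * h ^ (1 - α - β / 2) * δ := by rw [e3]
        _ ≤ 1 / 4 * δ := by gcongr
    linarith

lemma not_exists_tangential_solution {α β T M : ℝ} {a : ℕ → ℝ} {θ : ℝ → Plane → ℝ} (hα : 0 < α)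
    (hα' : α < 1 / 2) (hβ : 0 ≤ β) (hβ' : β < 1) (hβα : β < 2 * α) (hT : 0 < T)
    (ha : ∀ n, 1 ≤ n → 0 < a n ∧ a n ≤ level n / 2)
    (haq : ∀ n, 1 ≤ n → a n ≤ 1 / 2 * level n ^ (2 / (1 - 2 * α) ^ 2))
    (hθ : BoundedSolution α β M T θ) (h0 : ∀ x ∈ halfPlane, θ 0 x = tangentialDatum β a x) : False := by
  have h2α : 0 < 1 - 2 * α := by linarith
  have hb : 0 < 1 - β := by linarith
  set q := 2 / (1 - 2 * α) ^ 2 with hq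
  have hq0 : 0 < q := by positivity
  have hp : 2 / (1 - 2 * α) ≤ (1 - β) * q := by
    rw [hq, ← mul_div_assoc, div_le_div_iff₀ h2α (by positivity)]
    nlinarith [mul_pos h2α h2α]
  have hM : 0 ≤ M := (hθ.slice 0 (left_mem_Icc.2 hT.le)).nonneg
  have hev := exists_tangential_contradiction (M := M) (A := 1 / 2 * (2 * (1 - β)⁻¹) ^ q)
    (A₀ := 1 / 2 * ((1 - β)⁻¹) ^ q) hα hα' hβ hβα hβ' hM (by positivity) (by positivity) hp hT
  obtain ⟨n, hn, hn1⟩ := (((tendsto_lam_level hβ hβ').eventually hev).and (eventually_ge_atTop 1)).exists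
  have hpos := lam_level_pos hβ' n
  refine hn (a n) θ (ha n hn1).1 ?_ hθ (fun y hy hy0 hy1 => ?_) ?_ (fun y hy k0 k1 k2 k3 => ?_)
  · refine (haq n hn1).trans_eq ?_
    conv_lhs => rw [level_eq_lamInv hβ hβ' hn1]
    rw [Real.mul_rpow (by positivity) (by positivity), ← Real.rpow_mul hpos.le]
    ring
  · rw [h0 y hy]
    exact abs_tangentialDatum_sub_one_le hβ hβ' ha (by norm_num) hq0.le haq hy0 hy hy1
  · rw [h0 _ (by simpa [mem_halfPlane] using hpos), tangentialDatum_center hβ hβ' ha hn1]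
  · rw [h0 y hy]
    exact tangentialDatum_off_center hβ hβ' ha hn1 k0 k1 k2 k3

/-! ### Slices that vanish linearly at the boundary -/

lemma abs_oddExt_le_height {g : Plane → ℝ} {A : ℝ} (hg : ∀ y ∈ halfPlane, |g y| ≤ A * y 1) (y : Plane) :
    |oddExt g y| ≤ A * |y 1| := by
  rcases lt_trichotomy (y 1) 0 with h | h | h
  · rw [oddExt_of_neg h, abs_neg, abs_of_neg h, ← bar_apply_one]
    exact hg _ (by rw [mem_halfPlane, bar_apply_one]; linarith)
  · rw [oddExt_of_zero h, h]; simp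
  · rw [oddExt_of_pos h, abs_of_pos h]; exact hg y h

lemma exists_boundary_shear_le {α : ℝ} (hα : 0 < α) (hα' : α < 1 / 2) : ∃ C : ℝ, 0 < C ∧
    ∀ (β M A : ℝ) (g : Plane → ℝ) (x x' : Plane), 0 ≤ β → β < 1 → 0 ≤ A → Slice β M g →
      (∀ y ∈ halfPlane, |g y| ≤ A * y 1) → 0 < x 1 → 0 < x' 1 →
      |velocity α g x 0 - velocity α g x' 0| ≤ C * (M + A) * (|x 0 - x' 0| + x 1 + x' 1) := by
  obtain ⟨C₀, hC₀, hvel⟩ := exists_velocityBounds hα hα'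
  obtain ⟨C₁, hC₁, hdiff⟩ := exists_conv_diff_le hα hα'
  obtain ⟨C₂, hC₂, hint⟩ := exists_integral_maxPow_mul_le hα hα'
  refine ⟨4 * C₀ + C₁ * (5 + C₂ * 2), by positivity, ?_⟩
  intro β M A g x x' hβ hβ' hA hg hlin hx hx'
  have hM := hg.nonneg
  have hv := hvel β M g hβ hβ' hg
  have hG := hg.admissible
  have hodd := abs_oddExt_le_height hlin
  have hbd : ∀ (y : Plane) (d : ℝ), y 1 = 0 → 0 < d →
      |velocity α g (y + d • e 1) 0 - velocity α g y 0| ≤ (4 * C₀ + C₁ * (5 + C₂ * 2)) * (M + A) * d := by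
    intro y d hy hd
    rcases le_total d (1 / 2) with hd2 | hd2
    · have hI := hint A (2 * M) (2 * d) (oddExt g) y hG (by positivity) hA (fun z _ => by
        refine (hodd _).trans ?_
        gcongr
        rw [PiLp.sub_apply, hy, zero_sub, abs_neg]
        exact (abs_coord_le z 1).trans (le_max_left _ _))
      have hD := hdiff (2 * M) (2 * d) (5 * A) (oddExt g) 0 y (d • e 1) hG (by positivity) (by positivity)
        (by rw [norm_smul_e, abs_of_pos hd]; linarith) (fun z hz => by
          have hz1 := abs_lt.1 ((abs_coord_le z 1).trans_lt hz)
          have k1 := hodd (y + d • e 1 - z)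
          have k2 := hodd (y - z)
          have q1 : (y + d • e 1 - z) 1 = d - z 1 := by
            rw [PiLp.sub_apply, add_smul_e_apply, if_pos rfl, hy, zero_add]
          have q2 : (y - z) 1 = -z 1 := by rw [PiLp.sub_apply, hy, zero_sub]
          rw [q1] at k1; rw [q2] at k2
          have m1 : |d - z 1| ≤ 3 * d := abs_le.2 ⟨by linarith, by linarith⟩
          have m2 : |-z 1| ≤ 2 * d := abs_le.2 ⟨by linarith, by linarith⟩
          have n1 := mul_le_mul_of_nonneg_left m1 hA
          have n2 := mul_le_mul_of_nonneg_left m2 hA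
          rw [norm_smul_e, abs_of_pos hd]
          refine (abs_sub _ _).trans ?_
          linarith)
      rw [norm_smul_e, abs_of_pos hd] at hD
      have hR : (2 * d) ^ (1 - 2 * α) ≤ 1 := Real.rpow_le_one (by positivity) (by linarith) (by linarith)
      have hs : 5 * A * (2 * d) ^ (1 - 2 * α)
          + ∫ z, maxPow (2 * d) (2 + 2 * α) z * |oddExt g (y - z)| ≤ (5 + C₂ * 2) * (M + A) := by
        have : 5 * A * (2 * d) ^ (1 - 2 * α) ≤ 5 * A * 1 := by gcongr
        nlinarith
      rw [velocity_apply hα hα' hG, velocity_apply hα hα' hG]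
      refine hD.trans ((mul_le_mul_of_nonneg_left hs (by positivity)).trans ?_)
      have : 0 ≤ 4 * C₀ * (M + A) * d := by positivity
      linarith
    · have h1 := (abs_sub (velocity α g (y + d • e 1) 0) (velocity α g y 0)).trans
        (add_le_add (hv.abs_le 0 _) (hv.abs_le 0 _))
      refine h1.trans ?_
      have h2 : C₀ * M ≤ C₀ * M * (2 * d) := le_mul_of_one_le_right (by positivity) (by linarith)
      have h3 : 0 ≤ 4 * C₀ * A * d := by positivity
      have h4 : 0 ≤ C₁ * (5 + C₂ * 2) * (M + A) * d := by positivity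
      linarith
  have hbase : ∀ y : Plane, 0 < y 1 → ∃ y' : Plane, y' 1 = 0 ∧ y' 0 = y 0 ∧ y = y' + y 1 • e 1 := by
    intro y _
    refine ⟨y + (-y 1) • e 1, ?_, ?_, ?_⟩
    · rw [add_smul_e_apply]; simp
    · rw [add_smul_e_apply]; simp
    · rw [add_assoc, ← add_smul, neg_add_cancel, zero_smul, add_zero]
  obtain ⟨y, hy1, hy0, hxy⟩ := hbase x hx
  obtain ⟨y', hy1', hy0', hxy'⟩ := hbase x' hx'
  have b1 := hbd y (x 1) hy1 hx
  have b2 := hbd y' (x' 1) hy1' hx'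
  rw [← hxy] at b1
  rw [← hxy'] at b2
  have b3 := hv.horiz 0 y' (x 0 - x' 0)
  have hyy : y' + (x 0 - x' 0) • e 0 = y := by
    ext j; fin_cases j <;> simp [e, hy1, hy1', hy0, hy0']
  rw [hyy] at b3
  have c1 := abs_sub_le (velocity α g x 0) (velocity α g y 0) (velocity α g x' 0)
  have c2 := abs_sub_le (velocity α g y 0) (velocity α g y' 0) (velocity α g x' 0)
  rw [abs_sub_comm (velocity α g y' 0) (velocity α g x' 0)] at c2
  have h5 : C₀ * M * |x 0 - x' 0| ≤ (4 * C₀ + C₁ * (5 + C₂ * 2)) * (M + A) * |x 0 - x' 0| := by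
    gcongr
    · have : 0 ≤ C₁ * (5 + C₂ * 2) := by positivity
      linarith
    · linarith
  linarith

lemma exists_tangential_upper {α : ℝ} (hα : 0 < α) (hα' : α < 1 / 2) : ∃ C : ℝ, 0 < C ∧
    ∀ (β M A h : ℝ) (g : Plane → ℝ) (x : Plane) (d : ℝ), 0 ≤ A → Slice β M g →
      (∀ y ∈ halfPlane, |g y| ≤ A * y 1) → 0 < h → h ≤ 1 / 16 → h / 2 ≤ x 1 → x 1 ≤ 2 * h →
      |d| ≤ h / 16 →
      |velocity α g (x + d • e 0) 1 - velocity α g x 1| ≤ C * (M + A) * h ^ (1 - 2 * α) * |d| := by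
  obtain ⟨C, hC, htan⟩ := exists_conv_tangential_le (κ := 0) hα hα' (by linarith)
  refine ⟨C * 20, by positivity, ?_⟩
  intro β M A h g x d hA hg hlin hh hh16 hx1 hx2 hd
  have hM := hg.nonneg
  have hx : 0 < x 1 := by linarith
  have hodd := abs_oddExt_le_height hlin
  have hlin2 : ∀ y ∈ halfPlane, |oddExt g y| ≤ A * (x 1 + ‖x - y‖) := by
    intro y hy
    have hy : 0 < y 1 := hy
    have n1 := abs_coord_le (x - y) 1
    simp only [PiLp.sub_apply] at n1
    refine (hodd y).trans ?_
    rw [abs_of_pos hy]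
    gcongr
    linarith [(abs_le.1 n1).1]
  have hT := htan (2 * M) (x 1 / 4) M (2 * A * x 1) (2 * A) (oddExt g) x d hg.admissible (oddExt_bar _)
    (by positivity) le_rfl (by linarith) (by linarith) hM (by positivity) (by positivity)
    (fun z _ => by
      refine (hg.oddExt_horiz _ _ (by simp [e])).trans_eq ?_
      congr 2
      simp [e])
    (fun y hy hxy => (hlin2 y hy).trans (by nlinarith))
    (fun y hy hxy _ => (hlin2 y hy).trans (by
      rw [add_zero, Real.rpow_one]; nlinarith))
  rw [velocity_apply hα hα' hg.admissible, velocity_apply hα hα' hg.admissible]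
  refine hT.trans ?_
  rw [add_zero]
  set m := x 1 ^ (1 - 2 * α) with hm
  have hm0 : 0 < m := by positivity
  have e1 : (x 1 / 4) ^ (1 - 2 * α) ≤ m := Real.rpow_le_rpow (by positivity) (by linarith) (by linarith)
  have e2 : x 1 * (x 1 / 4) ^ (-(2 * α)) ≤ 4 * m := by
    have : (4 : ℝ) ^ (2 * α) ≤ 4 := by
      calc (4 : ℝ) ^ (2 * α) ≤ 4 ^ (1 : ℝ) :=
            Real.rpow_le_rpow_of_exponent_le (by norm_num) (by linarith)
        _ = 4 := Real.rpow_one 4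
    have e3 : m = x 1 * x 1 ^ (-(2 * α)) := by
      rw [hm, sub_eq_add_neg, Real.rpow_add hx, Real.rpow_one]
    rw [Real.div_rpow hx.le (by norm_num), Real.rpow_neg (by norm_num : (0 : ℝ) ≤ 4), div_inv_eq_mul,
      ← mul_assoc, ← e3, mul_comm]
    gcongr
  have e4 : x 1 ≤ m := by
    conv_lhs => rw [← Real.rpow_one (x 1)]
    exact Real.rpow_le_rpow_of_exponent_ge hx (by linarith) (by linarith)
  have e5 : m ≤ 2 * h ^ (1 - 2 * α) := by
    calc m ≤ (2 * h) ^ (1 - 2 * α) := Real.rpow_le_rpow hx.le hx2 (by linarith)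
      _ = 2 ^ (1 - 2 * α) * h ^ (1 - 2 * α) := Real.mul_rpow zero_le_two hh.le
      _ ≤ 2 * h ^ (1 - 2 * α) := by
        gcongr
        calc (2 : ℝ) ^ (1 - 2 * α) ≤ 2 ^ (1 : ℝ) :=
              Real.rpow_le_rpow_of_exponent_le one_le_two (by linarith)
          _ = 2 := Real.rpow_one 2
  have hs : M * (x 1 / 4) ^ (1 - 2 * α) + 2 * A * x 1 * (x 1 / 4) ^ (-(2 * α)) + 2 * A * m + 2 * M * x 1
      ≤ 20 * (M + A) * h ^ (1 - 2 * α) := by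
    have f1 := mul_le_mul_of_nonneg_left e1 hM
    have f2 := mul_le_mul_of_nonneg_left e2 hA
    have f3 := mul_le_mul_of_nonneg_left e4 hM
    have f4 := mul_le_mul_of_nonneg_left e5 hM
    have f5 := mul_le_mul_of_nonneg_left e5 hA
    have f6 : 0 ≤ M * h ^ (1 - 2 * α) := by positivity
    linarith
  calc _ ≤ C * |d| * (20 * (M + A) * h ^ (1 - 2 * α)) := by gcongr
    _ = _ := by ring

lemma exists_vertical_shear_le {α : ℝ} (hα : 0 < α) (hα' : α < 1 / 2) : ∃ C : ℝ, 0 < C ∧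
    ∀ (β M A h : ℝ) (g : Plane → ℝ) (x : Plane) (d : ℝ), 1 - 2 * α ≤ β → β < 1 → 0 ≤ A → Slice β M g →
      (∀ y ∈ halfPlane, |g y| ≤ A * y 1) → 0 < h → h ≤ 1 / 16 → h / 2 ≤ x 1 → x 1 ≤ 2 * h →
      |d| ≤ h / 16 →
      |velocity α g (x + d • e 1) 0 - velocity α g x 0| ≤ C * (M + A) * h ^ (1 - 2 * α - β) * |d| := by
  obtain ⟨C₁, hC₁, hdiff⟩ := exists_conv_diff_le hα hα'
  obtain ⟨C₂, hC₂, hint⟩ := exists_integral_maxPow_mul_le hα hα'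
  refine ⟨C₁ * (8 + C₂ * 17), by positivity, ?_⟩
  intro β M A h g x d hβ hβ' hA hg hlin hh hh16 hx1 hx2 hd
  have hM := hg.nonneg
  have hx : 0 < x 1 := by linarith
  have hG := hg.admissible
  have hR : (0 : ℝ) < h / 8 := by positivity
  have hodd := abs_oddExt_le_height hlin
  have hI := hint (17 * A) (2 * M) (h / 8) (oddExt g) x hG hR (by positivity) (fun z _ => by
    refine (hodd _).trans ?_
    have m1 := le_max_left ‖z‖ (h / 8)
    have m2 := le_max_right ‖z‖ (h / 8)
    have n1 := abs_coord_le z 1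
    have : |(x - z) 1| ≤ 17 * max ‖z‖ (h / 8) := by
      rw [PiLp.sub_apply]
      refine (abs_sub _ _).trans ?_
      rw [abs_of_pos hx]; linarith
    calc A * |(x - z) 1| ≤ A * (17 * max ‖z‖ (h / 8)) := by gcongr
      _ = _ := by ring)
  have hβ4 : max ((h / 4) ^ (-β)) 1 = (h / 4) ^ (-β) :=
    max_eq_left (Real.one_le_rpow_of_pos_of_le_one_of_nonpos (by linarith) (by linarith) (by linarith))
  have hD := hdiff _ (h / 8) (M * (h / 4) ^ (-β)) (oddExt g) 0 x (d • e 1) hG hR (by positivity)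
    (by rw [norm_smul_e]; linarith) (fun z hz => by
      have hz1 := abs_lt.1 ((abs_coord_le z 1).trans_lt hz)
      have hd1 := abs_le.1 hd
      have q1 : (x - z) 1 = x 1 - z 1 := rfl
      rw [show x + d • e 1 - z = (x - z) + d • e 1 by abel]
      have q3 : ((x - z) + d • e 1 : Plane) 1 = (x - z) 1 + d := by
        rw [add_smul_e_apply, if_pos rfl]
      have q4 : ((x - z) + d • e 1 : Plane) 0 = (x - z) 0 := by
        rw [add_smul_e_apply]; simp
      rw [oddExt_of_pos (by rw [q3, q1]; linarith), oddExt_of_pos (by rw [q1]; linarith)]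
      have := hg.vert (h / 4) (by linarith) _ _ (by rw [q3, q1]; linarith) (by rw [q1]; linarith) q4
      rwa [hβ4, q3, add_sub_cancel_left, ← norm_smul_e d 1] at this)
  rw [norm_smul_e] at hD
  rw [velocity_apply hα hα' hG, velocity_apply hα hα' hG]
  set E := h ^ (1 - 2 * α - β) with hE
  have hE1 : 1 ≤ E := Real.one_le_rpow_of_pos_of_le_one_of_nonpos hh (by linarith) (by linarith)
  have hLR : (h / 4) ^ (-β) * (h / 8) ^ (1 - 2 * α) ≤ 8 * E := by
    have e1 : (h / 4) ^ (-β) ≤ (h / 8) ^ (-β) :=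
      Real.rpow_le_rpow_of_nonpos (by positivity) (by linarith) (by linarith)
    calc (h / 4) ^ (-β) * (h / 8) ^ (1 - 2 * α) ≤ (h / 8) ^ (-β) * (h / 8) ^ (1 - 2 * α) := by gcongr
      _ = (h / 8) ^ (-(β - (1 - 2 * α))) := by rw [← Real.rpow_add hR]; congr 1; ring
      _ = 8 ^ (β - (1 - 2 * α)) * E := by
        rw [Real.div_rpow hh.le (by norm_num), Real.rpow_neg (by norm_num : (0 : ℝ) ≤ 8), div_inv_eq_mul,
          mul_comm, hE]
        congr 2; ring
      _ ≤ 8 * E := by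
        gcongr
        calc (8 : ℝ) ^ (β - (1 - 2 * α)) ≤ 8 ^ (1 : ℝ) :=
              Real.rpow_le_rpow_of_exponent_le (by norm_num) (by linarith)
          _ = 8 := Real.rpow_one 8
  have hs : M * (h / 4) ^ (-β) * (h / 8) ^ (1 - 2 * α)
      + ∫ z, maxPow (h / 8) (2 + 2 * α) z * |oddExt g (x - z)| ≤ (8 + C₂ * 17) * (M + A) * E := by
    have f1 := mul_le_mul_of_nonneg_left hLR hM
    have f2 : C₂ * (17 * A + 2 * M) * 1 ≤ C₂ * (17 * (M + A)) * E := by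
      gcongr; linarith
    have f3 : 0 ≤ A * E := by positivity
    linarith
  calc _ ≤ C₁ * |d| * ((8 + C₂ * 17) * (M + A) * E) := hD.trans (by gcongr)
    _ = _ := by ring

lemma Slice.shift {β M : ℝ} {g : Plane → ℝ} (h : Slice β M g) (V : ℝ) :
    Slice β M (fun y => g (y - V • e 0)) := by
  have e0 : ∀ y : Plane, (y - V • e 0) 0 = y 0 - V := fun y => by simp [e]
  have e1 : ∀ y : Plane, (y - V • e 0) 1 = y 1 := fun y => by simp [e]
  have hH : ∀ y ∈ halfPlane, y - V • e 0 ∈ halfPlane := fun y hy => by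
    rw [mem_halfPlane, e1]; exact hy
  refine ⟨h.cont.comp (by fun_prop) hH, fun y hy => h.bound _ (hH y hy), fun x hx y hy hxy => ?_,
    fun ℓ hℓ x y hx hy hxy => ?_, ?_⟩
  · have := h.horiz _ (hH x hx) _ (hH y hy) (by rw [e1, e1, hxy])
    rwa [e0, e0, sub_sub_sub_cancel_right] at this
  · have := h.vert ℓ hℓ _ _ (by rwa [e1]) (by rwa [e1]) (show (x - V • e 0) 0 = (y - V • e 0) 0 by
      rw [e0, e0, hxy])
    rwa [e1, e1] at this
  · have hp := (measurePreserving_sub_right volume (V • e 0)).setLIntegral_comp_preimage_emb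
      (MeasurableEquiv.subRight (V • e 0)).measurableEmbedding (fun y => ‖g y‖ₑ) halfPlane
    have hpre : (fun x => x - V • e 0) ⁻¹' halfPlane = halfPlane := by
      ext y; simp only [mem_preimage, mem_halfPlane, e1]
    rw [hpre] at hp
    exact hp.trans_le h.l1

lemma sub_smul_e_apply (x : Plane) (d : ℝ) (i j : Fin 2) :
    (x - d • e i) j = x j - if j = i then d else 0 := by
  simp [e]

/-- The normal velocity increases in the tangential direction near the tip of the wedge. -/
lemma exists_normal_lower {α β M A κ : ℝ} (hα : 0 < α) (hα' : α < 1 / 2) (hM : 0 ≤ M) (hA : 0 ≤ A)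
    (hκ : 0 < κ) (hκ' : κ < 2 * α) : ∃ c : ℝ, 0 < c ∧ ∀ᶠ h in 𝓝[>] (0 : ℝ),
    ∀ (g : Plane → ℝ) (x : Plane) (V d : ℝ), Slice β M g → x 0 = V + h → h / 2 ≤ x 1 → x 1 ≤ 2 * h →
      (∀ y ∈ halfPlane, ∀ ρ, ‖x - y‖ ≤ ρ → h ≤ ρ → ρ ≤ 1 →
        |g y - wedge (y - V • e 0)| ≤ A * ρ ^ (1 + κ)) →
      0 < d → d ≤ h ^ (1 + κ) / 2 →
      c * h ^ (1 - 2 * α) * d ≤ velocity α g (x + d • e 0) 1 - velocity α g x 1 := by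
  obtain ⟨c₀, C₀, hc₀, hC₀, hwedge⟩ := exists_wedge_lower hα hα'
  obtain ⟨C₁, hC₁, htan⟩ := exists_conv_tangential_le hα hα' hκ'
  refine ⟨c₀ / 2, by positivity, ?_⟩
  set B := 2 * M + 2 * 19 with hB
  filter_upwards [self_mem_nhdsWithin, eventually_le_const (c := 1 / 16) (by norm_num),
    eventually_mul_rpow_le (c := 1 / 8) 1 hκ (by norm_num),
    eventually_mul_rpow_le (e := 2 * α) (c := c₀ / 8) (C₀ + C₁ * (B * 2)) (by linarith) (by positivity),
    eventually_mul_rpow_le (e := κ * (1 - 2 * α)) (c := c₀ / 8) (C₁ * (M + 1 + A * 4))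
      (mul_pos hκ (by linarith)) (by positivity),
    eventually_mul_rpow_le (c := c₀ / 8) (C₁ * (A * 16)) hκ (by positivity)]
    with h hh hh16 hs0 hs1 hs2 hs3 g x V d hg hx0 hx1 hx2 hnear hd hdR
  have hh : 0 < h := hh
  have hx : 0 < x 1 := by linarith
  set R := h ^ (1 + κ) with hR
  have hR0 : 0 < R := by positivity
  have hRh : R ≤ h / 8 := by
    rw [hR, Real.rpow_add hh, Real.rpow_one]; nlinarith
  set ψ : Plane → ℝ := fun y => wedge (y - V • e 0) with hψ
  have hψs : Slice β 19 ψ := wedge_slice.shift V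
  have e0 : ∀ y : Plane, (y - V • e 0) 0 = y 0 - V := fun y => by rw [sub_smul_e_apply, if_pos rfl]
  have e1 : ∀ y : Plane, (y - V • e 0) 1 = y 1 := fun y => by rw [sub_smul_e_apply]; simp
  have hcomm : ∀ y : Plane, y + d • e 0 - V • e 0 = (y - V • e 0) + d • e 0 := fun y => by abel
  have hψlip : ∀ y : Plane, |ψ (y + d • e 0) - ψ y| ≤ d := fun y => by
    have := abs_wedge_sub_le (y + d • e 0 - V • e 0) (y - V • e 0)
    rwa [hcomm, add_sub_cancel_left, norm_smul_e, abs_of_pos hd, ← hcomm] at this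
  have hW := hwedge (2 * 19) V h d ψ x hψs.admissible hh (by linarith) hd (by linarith) hx0 hx1 hx2
    (fun y _ => hψlip y)
    (fun y _ hy => wedge_eq_zero (by rw [e0, e1]; tauto))
    (fun y hy hy0 => by
      simp only [hψ, hcomm]
      exact wedge_antitone hd.le (by rwa [e0]))
    (fun y _ hy => wedge_eq_zero (by rw [e0, e1]; right; left; linarith))
    (fun y _ k1 k2 k3 k4 => by
      simp only [hψ, hcomm]
      have a0 : (y - V • e 0 + d • e 0) 0 = y 0 - V + d := by rw [add_smul_e_apply, if_pos rfl, e0]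
      have a1 : (y - V • e 0 + d • e 0) 1 = y 1 := by
        rw [add_smul_e_apply, e1]; simp
      rw [wedge_of_near (by rw [a0]; linarith) (by rw [a0]; linarith) (by rw [a0, a1]; linarith)
          (by rw [a1]; linarith),
        wedge_of_near (by rw [e0]; linarith) (by rw [e0]; linarith) (by rw [e0, e1]; linarith)
          (by rw [e1]; linarith), a0, e0]
      ring)
  set F := oddExt fun y => g y - ψ y with hF
  have hFe : F = fun y => oddExt g y - oddExt ψ y := funext (oddExt_sub g ψ)
  have hadm : Admissible B F := by rw [hFe]; exact hg.admissible.sub hψs.admissible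
  have hvel : ∀ y, velocity α g y 1 = conv α F 1 y + conv α (oddExt ψ) 1 y := fun y => by
    rw [velocity_apply hα hα' hg.admissible, hFe, conv_sub hα hα' hg.admissible hψs.admissible]
    ring
  have hT := htan B R (M + 1) (A * (2 * h) ^ (1 + κ)) (A * 2 ^ (1 + κ)) F x d hadm (oddExt_bar _) hR0
    (by linarith) (by linarith) (by rw [abs_of_pos hd]; exact hdR) (by linarith) (by positivity)
    (by positivity)
    (fun z hz => by
      have hz1 := abs_lt.1 ((abs_coord_le z 1).trans_lt hz)
      have q1 : (x - z) 1 = x 1 - z 1 := rfl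
      rw [show x + d • e 0 - z = (x - z) + d • e 0 by abel]
      have q3 : ((x - z) + d • e 0 : Plane) 0 = (x - z) 0 + d := by
        rw [add_smul_e_apply, if_pos rfl]
      have q4 : ((x - z) + d • e 0 : Plane) 1 = (x - z) 1 := by
        rw [add_smul_e_apply]; simp
      have hH : 0 < (x - z) 1 := by rw [q1]; linarith
      have hl := hg.horiz _ (by rwa [mem_halfPlane, q4]) _ hH q4
      rw [q3, add_sub_cancel_left] at hl
      have hl2 := hψlip (x - z)
      rw [hF, oddExt_of_pos (by rwa [q4]), oddExt_of_pos hH, sub_sub_sub_comm, add_mul, one_mul]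
      refine (abs_sub _ _).trans (add_le_add hl ?_)
      rwa [abs_of_pos hd])
    (fun y hy hxy => by
      rw [hF, oddExt_of_pos hy]
      exact hnear y hy (2 * h) (by linarith) (by linarith) (by linarith))
    (fun y hy hxy hxy' => by
      rw [hF, oddExt_of_pos hy]
      have hr : 0 < ‖x - y‖ := hx.trans_le hxy
      have := hnear y hy (2 * ‖x - y‖) (by linarith) (by linarith) (by linarith)
      rwa [Real.mul_rpow zero_le_two hr.le, ← mul_assoc] at this)
  rw [hvel, hvel]
  set E := h ^ (1 - 2 * α) with hE
  have hE0 : 0 < E := by positivity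
  have h2κ : (2 : ℝ) ^ (1 + κ) ≤ 4 := by
    calc (2 : ℝ) ^ (1 + κ) ≤ 2 ^ (2 : ℝ) := Real.rpow_le_rpow_of_exponent_le one_le_two (by linarith)
      _ = 4 := by norm_num
  have hhE : h = h ^ (2 * α) * E := by
    rw [hE, ← Real.rpow_add hh, add_sub_cancel, Real.rpow_one]
  have r1 : R ^ (1 - 2 * α) = h ^ (κ * (1 - 2 * α)) * E := by
    rw [hR, hE, ← Real.rpow_mul hh.le, ← Real.rpow_add hh]; congr 1; ring
  have r2 : (2 * h) ^ (1 + κ) * R ^ (-(2 * α)) ≤ 4 * (h ^ (κ * (1 - 2 * α)) * E) := by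
    rw [Real.mul_rpow zero_le_two hh.le, mul_assoc, ← hR, ← r1, sub_eq_add_neg, Real.rpow_add hR0,
      Real.rpow_one]
    gcongr
  have r3 : x 1 ^ (1 - 2 * α + κ) ≤ 4 * (h ^ κ * E) := by
    calc x 1 ^ (1 - 2 * α + κ) ≤ (2 * h) ^ (1 - 2 * α + κ) :=
          Real.rpow_le_rpow hx.le hx2 (by linarith)
      _ = 2 ^ (1 - 2 * α + κ) * (h ^ κ * E) := by
        rw [Real.mul_rpow zero_le_two hh.le, hE, ← Real.rpow_add hh, add_comm κ]
      _ ≤ 4 * (h ^ κ * E) := by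
        gcongr
        refine le_trans ?_ h2κ
        exact Real.rpow_le_rpow_of_exponent_le one_le_two (by linarith)
  have hsum : (M + 1) * R ^ (1 - 2 * α) + A * (2 * h) ^ (1 + κ) * R ^ (-(2 * α))
      + A * 2 ^ (1 + κ) * x 1 ^ (1 - 2 * α + κ) + B * x 1
      ≤ ((M + 1 + A * 4) * h ^ (κ * (1 - 2 * α)) + A * 16 * h ^ κ + B * 2 * h ^ (2 * α)) * E := by
    have s2 := mul_le_mul_of_nonneg_left r2 hA
    have s3 : A * 2 ^ (1 + κ) * x 1 ^ (1 - 2 * α + κ) ≤ A * 4 * (4 * (h ^ κ * E)) := by gcongr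
    have s4 : B * x 1 ≤ B * (2 * (h ^ (2 * α) * E)) := by
      rw [← hhE]
      have := hadm.nonneg
      gcongr
    rw [r1]
    linarith
  rw [abs_of_pos hd] at hT
  have hT' := (abs_le.1 (hT.trans (mul_le_mul_of_nonneg_left hsum (by positivity)))).1
  have hW' : C₀ * d * h = C₀ * h ^ (2 * α) * (E * d) := by
    conv_lhs => rw [hhE]
    ring
  rw [hW'] at hW
  have hfin : ((C₀ + C₁ * (B * 2)) * h ^ (2 * α) + C₁ * (M + 1 + A * 4) * h ^ (κ * (1 - 2 * α))
      + C₁ * (A * 16) * h ^ κ) * (E * d) ≤ (c₀ / 8 + c₀ / 8 + c₀ / 8) * (E * d) := by gcongr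
  have hpos : 0 ≤ c₀ / 8 * (E * d) := by positivity
  linarith

/-! ### Transport of the wedge -/

section
variable {α β M T C V A τ : ℝ} {θ : ℝ → Plane → ℝ}

lemma linear_of_datum (h : BoundedSolution α β M T θ) (hw : FlowField T C V (fun t => velocity α (θ t)))
    (hC : 0 ≤ C) (hA : 0 ≤ A) (hdat : ∀ y ∈ halfPlane, |θ 0 y| ≤ A * y 1) (hτ : τ ∈ Icc 0 T)
    (hCτ : C * τ ≤ 1 / 2) {y : Plane} (hy : y ∈ halfPlane) : |θ τ y| ≤ 2 * A * y 1 := by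
  have hτ0 : τ ∈ Icc 0 τ := right_mem_Icc.2 hτ.1
  have hz : (0 : ℝ) ∈ Icc 0 τ := left_mem_Icc.2 hτ.1
  obtain ⟨Y, hYτ, hY⟩ := exists_backward_trajectory hw hτ hy
  have hcons := h.conserved hw hτ.2 hY hτ0
  have hheight := height_le_two_mul (hw.mono hτ.2) hY hC hCτ hτ0 hz
  rw [hYτ] at hcons hheight
  rw [hcons]
  calc |θ 0 (Y 0)| ≤ A * Y 0 1 := hdat _ (hY 0 hz).1
    _ ≤ A * (2 * y 1) := by gcongr
    _ = _ := by ring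

lemma abs_sub_le_of_abs_deriv_le {f f' : ℝ → ℝ} {b D : ℝ}
    (hf : ∀ s ∈ Icc 0 b, HasDerivWithinAt f (f' s) (Icc 0 b) s) (hD : ∀ s ∈ Icc 0 b, |f' s| ≤ D)
    {s t : ℝ} (hs : s ∈ Icc 0 b) (ht : t ∈ Icc 0 b) : |f t - f s| ≤ D * b := by
  have hD0 : 0 ≤ D := (abs_nonneg _).trans (hD s hs)
  have := (convex_Icc 0 b).norm_image_sub_le_of_norm_hasDerivWithin_le hf hD hs ht
  refine this.trans (mul_le_mul_of_nonneg_left ?_ hD0)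
  rw [Real.norm_eq_abs, abs_le]
  exact ⟨by linarith [ht.1, hs.2], by linarith [ht.2, hs.1]⟩

lemma near_wedge_of_datum {K h ρ p : ℝ} (hθ : BoundedSolution α β M T θ)
    (hw : FlowField T C V (fun t => velocity α (θ t))) (hC : 0 ≤ C) (hA : 0 ≤ A) (hp : 0 ≤ p)
    (hτ : τ ∈ Icc 0 T) (hCτ : C * τ ≤ 1 / 2) (hK : 0 ≤ K) (hKτ : K * τ ≤ 1 / 2)
    (hshear : ∀ s ∈ Icc 0 τ, ∀ x ∈ halfPlane, ∀ x' ∈ halfPlane,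
      |velocity α (θ s) x 0 - velocity α (θ s) x' 0| ≤ K * (|x 0 - x' 0| + x 1 + x' 1))
    (hdat : ∀ y ∈ halfPlane, |θ 0 y - wedge y| ≤ A * y 1 ^ p) {P : ℝ → Plane}
    (hP : ∀ s ∈ Icc 0 τ, P s ∈ halfPlane ∧ HasDerivWithinAt P (velocity α (θ s) (P s)) (Icc 0 τ) s)
    (hPh : ∀ s ∈ Icc 0 τ, P s 1 ≤ 2 * h) {y : Plane} (hy : y ∈ halfPlane) (hPy : ‖P τ - y‖ ≤ ρ)
    (hh : 0 ≤ h) (hρ : h ≤ ρ) :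
    |θ τ y - wedge (y - (P τ 0 - P 0 0) • e 0)| ≤ (18 * K + 6 * C) * τ * ρ + A * (6 * ρ) ^ p := by
  have hρ0 : 0 ≤ ρ := hh.trans hρ
  have hτ0 : τ ∈ Icc 0 τ := right_mem_Icc.2 hτ.1
  have hz : (0 : ℝ) ∈ Icc 0 τ := left_mem_Icc.2 hτ.1
  obtain ⟨Y, hYτ, hY⟩ := exists_backward_trajectory hw hτ hy
  have hwτ := hw.mono hτ.2
  have hcons := hθ.conserved hw hτ.2 hY hτ0
  rw [hYτ] at hcons
  have n0 := (abs_coord_le (P τ - y) 0).trans hPy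
  have n1 := (abs_coord_le (P τ - y) 1).trans hPy
  simp only [PiLp.sub_apply] at n0 n1
  have hYh : ∀ s ∈ Icc 0 τ, Y s 1 ≤ 6 * ρ := fun s hs => by
    have h1 := height_le_two_mul hwτ hY hC hCτ hτ0 hs
    rw [hYτ] at h1
    linarith [hPh τ hτ0, (abs_le.1 n1).1]
  have hd : ∀ s ∈ Icc 0 τ, HasDerivWithinAt (fun s => P s 0 - Y s 0)
      (velocity α (θ s) (P s) 0 - velocity α (θ s) (Y s) 0) (Icc 0 τ) s := fun s hs =>
    (hasDerivWithinAt_coord (hP s hs).2 0).sub (hasDerivWithinAt_coord (hY s hs).2 0)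
  obtain ⟨s₀, hs₀, hmax⟩ := isCompact_Icc.exists_isMaxOn (nonempty_Icc.2 hτ.1)
    (f := fun s => |P s 0 - Y s 0|) (ContinuousOn.abs fun s hs => (hd s hs).continuousWithinAt)
  set S := |P s₀ 0 - Y s₀ 0| with hS
  have hbd : ∀ s ∈ Icc 0 τ,
      |velocity α (θ s) (P s) 0 - velocity α (θ s) (Y s) 0| ≤ K * (S + 8 * ρ) := fun s hs => by
    refine (hshear s hs _ (hP s hs).1 _ (hY s hs).1).trans ?_
    have h1 : |P s 0 - Y s 0| ≤ S := hmax hs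
    exact mul_le_mul_of_nonneg_left (by linarith [hPh s hs, hYh s hs]) hK
  have hS0 : 0 ≤ S := abs_nonneg _
  have hS10 : S ≤ 10 * ρ := by
    have h1 := abs_sub_le_of_abs_deriv_le hd hbd hτ0 hs₀
    simp only [hYτ] at h1
    have h2 := abs_sub_abs_le_abs_sub (P s₀ 0 - Y s₀ 0) (P τ 0 - y 0)
    have h3 : K * (S + 8 * ρ) * τ ≤ 1 / 2 * (S + 8 * ρ) := by
      calc K * (S + 8 * ρ) * τ = K * τ * (S + 8 * ρ) := by ring
        _ ≤ _ := by gcongr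
    linarith
  have hhor := abs_sub_le_of_abs_deriv_le hd hbd hz hτ0
  simp only [hYτ] at hhor
  have hver := abs_sub_le_of_abs_deriv_le (D := C * (6 * ρ))
    (fun s hs => hasDerivWithinAt_coord (hY s hs).2 1) (fun s hs =>
      (hwτ.normal s hs _ (hY s hs).1).trans (mul_le_mul_of_nonneg_left (hYh s hs) hC)) hτ0 hz
  simp only [hYτ] at hver
  have hlip : ∀ z : Plane, |wedge (Y 0) - wedge z| ≤ |Y 0 0 - z 0| + |Y 0 1 - z 1| := fun z =>
    (abs_wedge_sub_le (Y 0) z).trans (norm_le_abs_add _)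
  have hlip := hlip (y - (P τ 0 - P 0 0) • e 0)
  rw [sub_smul_e_apply, sub_smul_e_apply, if_pos rfl, if_neg (by decide), sub_zero] at hlip
  rw [show Y 0 0 - (y 0 - (P τ 0 - P 0 0)) = P τ 0 - y 0 - (P 0 0 - Y 0 0) by ring] at hlip
  have hD := hdat _ (hY 0 hz).1
  have hYp : A * Y 0 1 ^ p ≤ A * (6 * ρ) ^ p := by
    have : 0 < Y 0 1 := (hY 0 hz).1
    gcongr
    exact hYh 0 hz
  rw [hcons]
  have htri := abs_sub_le (θ 0 (Y 0)) (wedge (Y 0)) (wedge (y - (P τ 0 - P 0 0) • e 0))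
  have hK18 : K * (S + 8 * ρ) * τ ≤ K * (18 * ρ) * τ := by
    have := hτ.1
    gcongr; linarith
  linarith

end

/-! ### The normal mechanism -/

set_option maxHeartbeats 1000000 in
/-- A cap of size `a` and height `b` near the tip of the wedge must satisfy `b ≲ a h ^ κ`. -/
lemma exists_normal_cap_le {α β M A A₀ p T : ℝ} (hα : 0 < α) (hα' : α < 1 / 2) (hβ : 0 ≤ β)
    (hβα : 1 - 2 * α < β) (hβ' : β < 1) (hM : 0 ≤ M) (hA : 0 ≤ A) (hp : 2 ≤ p)
    (hT : 0 < T) : ∃ D : ℝ, ∀ᶠ h in 𝓝[>] (0 : ℝ), ∀ (a b : ℝ) (θ : ℝ → Plane → ℝ),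
      0 < a → a ≤ A₀ * h ^ p → BoundedSolution α β M T θ →
      (∀ y ∈ halfPlane, |θ 0 y - wedge y| ≤ A * y 1 ^ p) → θ 0 !₂[h, h] = b →
      (∀ y ∈ halfPlane, 0 ≤ y 0 → h / 2 ≤ y 1 → y 1 ≤ 2 * h → (2 * h) ^ β * a ≤ |y 1 - h| →
        θ 0 y = 0) →
      b ≤ D * a * h ^ ((2 * α + β - 1) / 2) := by
  obtain ⟨C₀, hC₀, hvel⟩ := exists_velocityBounds hα hα'
  obtain ⟨Cb, hCb, hbdry⟩ := exists_boundary_shear_le hα hα'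
  obtain ⟨Ct, hCt, htang⟩ := exists_tangential_upper hα hα'
  obtain ⟨Cv, hCv, hvert⟩ := exists_vertical_shear_le hα hα'
  set κ := (2 * α + β - 1) / 2 with hκ
  have hκ0 : 0 < κ := by rw [hκ]; linarith
  set A₁ := 2 * (1 + A + M) with hA₁
  have hA₁0 : 0 < A₁ := by positivity
  set C₁ := C₀ * M with hC₁
  have hC₁0 : 0 ≤ C₁ := by positivity
  set K₁ := Cb * (M + A₁) with hK₁
  have hK₁0 : 0 < K₁ := by positivity
  set K₂ := Ct * (M + A₁) with hK₂
  have hK₂0 : 0 < K₂ := by positivity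
  set K₃ := Cv * (M + A₁) with hK₃
  have hK₃0 : 0 < K₃ := by positivity
  set A₂ := 18 * K₁ + 6 * C₁ + A * 6 ^ p with hA₂
  have hA₂0 : 0 ≤ A₂ := by positivity
  obtain ⟨c, hc, hlower⟩ := exists_normal_lower (β := β) (κ := κ) hα hα' hM hA₂0 hκ0
    (by rw [hκ]; linarith)
  set K := 8 / c with hK
  have hK0 : 0 < K := by positivity
  have hcK : c * K = 8 := by rw [hK]; field_simp
  refine ⟨M * K, ?_⟩
  filter_upwards [self_mem_nhdsWithin, eventually_le_const (c := 1 / 16) (by norm_num),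
    eventually_mul_rpow_le 1 hκ0 hT,
    eventually_mul_rpow_le (c := 1 / 16) C₁ hκ0 (by norm_num),
    eventually_mul_rpow_le (c := 1 / 2) K₁ hκ0 (by norm_num),
    eventually_mul_rpow_le (e := p - 1) (c := 1 / 16) (4 * K₂ * K * A₀) (by linarith) (by norm_num),
    eventually_mul_rpow_le (e := p - 1) (c := 1 / 24) (K * A₀) (by linarith) (by norm_num),
    eventually_mul_rpow_le (c := 2) (C₁ * (4 * K₂ * K)) hκ0 (by norm_num),
    eventually_mul_rpow_le (e := 1 - 2 * α) (c := 1 / 4) (4 * K₂ * K₃) (by linarith) (by norm_num),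
    hlower]
    with h hh hh16 c1 c2 c3 c4 c5 c6 c7 hlow a b θ ha haA hθ hdat hcen hoff
  have hh : 0 < h := hh
  set t := h ^ κ with ht
  have ht0 : 0 < t := by positivity
  have ht1 : t ≤ 1 := Real.rpow_le_one hh.le (by linarith) hκ0.le
  have htT : t ≤ T := by linarith
  have htI : t ∈ Icc 0 T := ⟨ht0.le, htT⟩
  set δ := K * a * t with hδ
  have hδ0 : 0 < δ := by positivity
  set E := h ^ (1 - 2 * α) with hE
  have hE0 : 0 < E := by positivity
  set σ' := K₂ * E with hσ'
  have hσ'0 : 0 < σ' := by positivity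
  set X := 4 * t * σ' * δ with hX
  have hX0 : 0 < X := by positivity
  have httE : t * t * E = h ^ β := by
    rw [ht, hE, ← Real.rpow_add hh, ← Real.rpow_add hh]; congr 1; rw [hκ]; ring
  have hXa : X = 4 * K₂ * K * (h ^ β * a) := by
    rw [hX, hσ', hδ, ← httE]; ring
  have hβ1 : h ^ β ≤ 1 := Real.rpow_le_one hh.le (by linarith) hβ
  have hpp : h ^ p = h ^ (p - 1) * h := by
    rw [← Real.rpow_add_one hh.ne']; congr 1; ring
  have hXh : X ≤ h / 16 := by
    calc X ≤ 4 * K₂ * K * (1 * (A₀ * h ^ p)) := by rw [hXa]; gcongr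
      _ = 4 * K₂ * K * A₀ * h ^ (p - 1) * h := by rw [hpp]; ring
      _ ≤ 1 / 16 * h := by gcongr
      _ = h / 16 := by ring
  have hδt : δ ≤ 1 / 24 * (h * t) := by
    calc δ ≤ K * (A₀ * h ^ p) * t := by rw [hδ]; gcongr
      _ = K * A₀ * h ^ (p - 1) * (h * t) := by rw [hpp]; ring
      _ ≤ _ := by gcongr
  have hht : h * t ≤ h := mul_le_of_le_one_right hh.le ht1
  have hR : h ^ (1 + κ) = h * t := by rw [Real.rpow_add hh, Real.rpow_one]
  have hv : ∀ τ ∈ Icc 0 T, VelocityBounds α C₀ M (velocity α (θ τ)) := fun τ hτ =>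
    hvel β M _ hβ hβ' (hθ.slice τ hτ)
  have hwT : FlowField T C₁ (2 * C₁) (fun τ => velocity α (θ τ)) := hθ.flowField hα hα' hC₁0 hv
  have hw := hwT.mono htT
  obtain ⟨P, hP0, hP⟩ := exists_trajectory (y := !₂[h, h]) ht0.le hw (by simpa [mem_halfPlane] using hh)
  have hP01 : P 0 1 = h := by rw [hP0]; simp
  have hP00 : P 0 0 = h := by rw [hP0]; simp
  have hI0 : (0 : ℝ) ∈ Icc 0 t := left_mem_Icc.2 ht0.le
  have hIt : t ∈ Icc 0 t := right_mem_Icc.2 ht0.le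
  have hPh : ∀ τ ∈ Icc 0 t, h / 2 ≤ P τ 1 ∧ P τ 1 ≤ 2 * h := fun τ hτ => by
    have h1 := height_le_two_mul hw hP hC₁0 (by linarith) hI0 hτ
    have h2 := height_le_two_mul hw hP hC₁0 (by linarith) hτ hI0
    rw [hP01] at h1 h2
    exact ⟨by linarith, h1⟩
  obtain ⟨Q, hQt, hQ⟩ := exists_backward_trajectory (y := P t + δ • e 0) hw hIt (by
    rw [mem_halfPlane, add_smul_e_apply, if_neg (by decide)]
    linarith [(hPh t hIt).1])
  have hC₁τ : ∀ τ ∈ Icc 0 t, C₁ * τ ≤ 1 / 2 := fun τ hτ => by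
    have : C₁ * τ ≤ C₁ * t := by gcongr; exact hτ.2
    linarith
  have hdat0 : ∀ y ∈ halfPlane, |θ 0 y| ≤ (1 + A + M) * y 1 := by
    intro y hy
    have hy' : 0 < y 1 := hy
    rcases le_total (y 1) 1 with h1 | h1
    · have k1 := hdat y hy
      have k2 := wedge_le hy'
      have k3 := wedge_nonneg y
      have k4 : y 1 ^ p ≤ y 1 := by
        conv_rhs => rw [← Real.rpow_one (y 1)]
        exact Real.rpow_le_rpow_of_exponent_ge hy' h1 (by linarith)
      have k5 := mul_le_mul_of_nonneg_left k4 hA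
      have k6 := abs_sub_abs_le_abs_sub (θ 0 y) (wedge y)
      rw [abs_of_nonneg k3] at k6
      have : 0 ≤ M * y 1 := by positivity
      linarith
    · refine ((hθ.slice 0 (left_mem_Icc.2 hT.le)).bound y hy).trans ?_
      calc M ≤ M * y 1 := le_mul_of_one_le_right hM h1
        _ ≤ _ := by gcongr; linarith
  have hlin : ∀ τ ∈ Icc 0 t, ∀ y ∈ halfPlane, |θ τ y| ≤ A₁ * y 1 := fun τ hτ y hy =>
    linear_of_datum hθ hwT hC₁0 (by positivity) hdat0 ⟨hτ.1, hτ.2.trans htT⟩ (hC₁τ τ hτ) hy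
  have hslice : ∀ τ ∈ Icc 0 t, Slice β M (θ τ) := fun τ hτ => hθ.slice τ ⟨hτ.1, hτ.2.trans htT⟩
  have hnear : ∀ τ ∈ Icc 0 t, ∀ y ∈ halfPlane, ∀ ρ, ‖P τ - y‖ ≤ ρ → h ≤ ρ → ρ ≤ 1 →
      |θ τ y - wedge (y - (P τ 0 - P 0 0) • e 0)| ≤ A₂ * ρ ^ (1 + κ) := by
    intro τ hτ y hy ρ hρ hhρ hρ1
    have hρ0 : 0 < ρ := hh.trans_le hhρ
    have hsub : Icc 0 τ ⊆ Icc 0 t := Icc_subset_Icc_right hτ.2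
    refine (near_wedge_of_datum (h := h) (K := K₁) hθ hwT hC₁0 hA (by linarith)
      ⟨hτ.1, hτ.2.trans htT⟩ (hC₁τ τ hτ) hK₁0.le ?_ (fun s hs x hx x' hx' =>
        hbdry β M A₁ (θ s) x x' hβ hβ' hA₁0.le (hslice s (hsub hs)) (hlin s (hsub hs)) hx hx') hdat
      (fun s hs => ⟨(hP s (hsub hs)).1, (hP s (hsub hs)).2.mono hsub⟩) (fun s hs => (hPh s (hsub hs)).2)
      hy hρ hh.le hhρ).trans ?_
    · have : K₁ * τ ≤ K₁ * t := by gcongr; exact hτ.2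
      linarith
    · have e1 : τ * ρ ≤ ρ ^ (1 + κ) := by
        rw [Real.rpow_add hρ0, Real.rpow_one, mul_comm]
        have : t ≤ ρ ^ κ := Real.rpow_le_rpow hh.le hhρ hκ0.le
        gcongr
        exact hτ.2.trans this
      have e2 : (6 * ρ) ^ p ≤ 6 ^ p * ρ ^ (1 + κ) := by
        rw [Real.mul_rpow (by norm_num) hρ0.le]
        gcongr _ * ?_
        exact Real.rpow_le_rpow_of_exponent_ge hρ0 hρ1 (by rw [hκ]; linarith)
      calc (18 * K₁ + 6 * C₁) * τ * ρ + A * (6 * ρ) ^ p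
          ≤ (18 * K₁ + 6 * C₁) * ρ ^ (1 + κ) + A * (6 ^ p * ρ ^ (1 + κ)) := by
            rw [mul_assoc]; gcongr
        _ = _ := by rw [hA₂]; ring
  set u := fun τ => velocity α (θ τ) with hu
  have hdP : ∀ i, ∀ τ ∈ Icc 0 t, HasDerivWithinAt (fun τ => P τ i) (u τ (P τ) i) (Icc 0 t) τ :=
    fun i τ hτ => hasDerivWithinAt_coord (hP τ hτ).2 i
  have hdQ : ∀ i, ∀ τ ∈ Icc 0 t, HasDerivWithinAt (fun τ => Q τ i) (u τ (Q τ) i) (Icc 0 t) τ :=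
    fun i τ hτ => hasDerivWithinAt_coord (hQ τ hτ).2 i
  set η := K₃ * h ^ (1 - 2 * α - β) with hη
  have hη0 : 0 < η := by positivity
  have htrap := growth_of_differential_inequalities (t := t) (δ := δ) (X := X) (σ := c * E)
    (σ' := σ') (η := η) (C := C₁)
    (x := fun s => P (t - s) 1 - Q (t - s) 1) (y := fun s => Q (t - s) 0 - P (t - s) 0)
    (x' := fun s => -(u (t - s) (P (t - s)) 1 - u (t - s) (Q (t - s)) 1))
    (y' := fun s => -(u (t - s) (Q (t - s)) 0 - u (t - s) (P (t - s)) 0))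
    ht0 hδ0 hX0 (by positivity) hσ'0.le hη0.le hC₁0
    (hasDerivWithinAt_reverse (f := fun τ => P τ 1 - Q τ 1)
      (f' := fun τ => u τ (P τ) 1 - u τ (Q τ) 1) fun τ hτ => (hdP 1 τ hτ).sub (hdQ 1 τ hτ))
    (hasDerivWithinAt_reverse (f := fun τ => Q τ 0 - P τ 0)
      (f' := fun τ => u τ (Q τ) 0 - u τ (P τ) 0) fun τ hτ => (hdQ 0 τ hτ).sub (hdP 0 τ hτ))
    (by simp only [sub_zero, hQt]; rw [add_smul_e_apply]; simp)
    (by simp only [sub_zero, hQt]; rw [add_smul_e_apply, if_pos rfl, add_sub_cancel_left])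
    (fun s hs hxs hys => ?_) ?_ ?_
  · simp only [sub_self] at htrap
    obtain ⟨hxX, hyδ, hxlow⟩ := htrap
    set m := h ^ β * a with hm
    have hm0 : 0 < m := by positivity
    have htσ : t * (c * E * (δ / 2)) = 4 * m := by
      calc t * (c * E * (δ / 2)) = c * K / 2 * ((t * t * E) * a) := by rw [hδ]; ring
        _ = 4 * m := by rw [httE, hcK, hm]; ring
    have htX : t * (C₁ * X) ≤ 2 * m := by
      rw [hXa]
      calc t * (C₁ * (4 * K₂ * K * m)) = C₁ * (4 * K₂ * K) * t * m := by ring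
        _ ≤ 2 * m := by gcongr
    have hxa : 2 * m ≤ P 0 1 - Q 0 1 := by linarith
    rw [hP01] at hxa hxX
    rw [hP00] at hyδ
    have hxX' := abs_le.1 hxX
    have hyδ' := abs_le.1 hyδ
    have h2m : (2 * h) ^ β * a ≤ 2 * m := by
      have : (2 : ℝ) ^ β ≤ 2 := by
        calc (2 : ℝ) ^ β ≤ 2 ^ (1 : ℝ) := Real.rpow_le_rpow_of_exponent_le one_le_two hβ'.le
          _ = 2 := Real.rpow_one 2
      rw [Real.mul_rpow zero_le_two hh.le, mul_assoc]
      gcongr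
    have hQ01 : θ 0 (Q 0) = 0 := hoff (Q 0) (hQ 0 hI0).1 (by linarith) (by linarith) (by linarith)
      (by rw [abs_sub_comm]; exact h2m.trans (hxa.trans (le_abs_self _)))
    have e1 : θ t (P t) = b := by rw [hθ.conserved hwT htT hP hIt, hP0, hcen]
    have e2 : θ t (Q t) = 0 := by rw [hθ.conserved hwT htT hQ hIt, hQ01]
    have hhor := (hslice t hIt).horiz (P t) (hP t hIt).1 (Q t) (hQ t hIt).1
      (by rw [hQt, add_smul_e_apply]; simp)
    rw [e1, e2, sub_zero, hQt, add_smul_e_apply, if_pos rfl, sub_add_cancel_left, abs_neg,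
      abs_of_pos hδ0] at hhor
    calc b ≤ M * δ := (le_abs_self b).trans hhor
      _ = _ := by rw [hδ]; ring
  · set τ := t - s with hτdef
    have hτ : τ ∈ Icc 0 t := ⟨by linarith [hs.2], by linarith [hs.1]⟩
    have hτT : τ ∈ Icc 0 T := ⟨hτ.1, hτ.2.trans htT⟩
    dsimp only at hxs hys ⊢
    set ξ := P τ 1 - Q τ 1 with hξ
    set ζ := Q τ 0 - P τ 0 with hζ
    have hζ' := abs_le.1 hys
    have hζ0 : 0 < ζ := by linarith
    have hvτ := hv τ hτT
    have hPτ := hPh τ hτ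
    have hQe : Q τ = P τ + ζ • e 0 + (-ξ) • e 1 := by
      ext j; fin_cases j <;> simp [hξ, hζ, e]
    have hQe' : Q τ = P τ + (-ξ) • e 1 + ζ • e 0 := by rw [hQe]; abel
    have b1 := hvτ.horiz 0 (P τ + (-ξ) • e 1) ζ
    have b2 := hvτ.normal (P τ + ζ • e 0) (-ξ)
    rw [← hQe'] at b1
    rw [← hQe] at b2
    have b3 := hlow _ (P τ) (P τ 0 - P 0 0) ζ (hslice τ hτ) (by rw [hP00]; ring) hPτ.1 hPτ.2
      (hnear τ hτ) hζ0 (by rw [hR]; linarith)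
    have b4 := htang β M A₁ h _ (P τ) ζ hA₁0.le (hslice τ hτ) (hlin τ hτ) hh hh16 hPτ.1 hPτ.2
      (by rw [abs_of_pos hζ0]; linarith)
    have b5 := hvert β M A₁ h _ (P τ) (-ξ) hβα.le hβ' hA₁0.le (hslice τ hτ) (hlin τ hτ) hh hh16
      hPτ.1 hPτ.2 (by rw [abs_neg]; linarith)
    rw [abs_of_pos hζ0] at b1 b4
    rw [abs_neg] at b2 b5
    have b2' := abs_le.1 b2
    refine ⟨?_, ?_, ?_⟩
    · simp only [hu]; linarith
    · rw [abs_neg, abs_sub_comm]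
      simp only [hu]
      have := abs_sub_le (velocity α (θ τ) (Q τ) 1) (velocity α (θ τ) (P τ + ζ • e 0) 1)
        (velocity α (θ τ) (P τ) 1)
      linarith
    · rw [abs_neg]
      simp only [hu]
      have := abs_sub_le (velocity α (θ τ) (Q τ) 0) (velocity α (θ τ) (P τ + (-ξ) • e 1) 0)
        (velocity α (θ τ) (P τ) 0)
      linarith
  · have e1 : t * (σ' * (3 * δ / 2)) = 3 / 8 * X := by rw [hX]; ring
    have e2 : t * (C₁ * X) ≤ 1 / 16 * X := by
      calc t * (C₁ * X) = C₁ * t * X := by ring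
        _ ≤ _ := by gcongr
    linarith
  · have e1 : t * (C₁ * (3 * δ / 2)) ≤ 1 / 16 * (3 * δ / 2) := by
      calc t * (C₁ * (3 * δ / 2)) = C₁ * t * (3 * δ / 2) := by ring
        _ ≤ _ := by gcongr
    have e2 : t * (η * X) ≤ 1 / 4 * δ := by
      have e3 : t * t * E * h ^ (1 - 2 * α - β) = E := by
        rw [httE, hE, ← Real.rpow_add hh]; congr 1; ring
      calc t * (η * X) = 4 * K₂ * K₃ * (t * t * E * h ^ (1 - 2 * α - β)) * δ := by
            rw [hX, hη, hσ']; ring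
        _ = 4 * K₂ * K₃ * E * δ := by rw [e3]
        _ ≤ 1 / 4 * δ := by gcongr
    linarith

/-! ### Sequences of solutions -/

lemma exists_eventually_ae_slice {β T : ℝ} {Θ : ℕ → ℝ → Plane → ℝ} {θ : ℝ → Plane → ℝ} (hβ : 0 ≤ β)
    (hΘ : ∀ k, MemLinftyX β T (Θ k)) (hθ : MemLinftyX β T θ)
    (hlim : Tendsto (fun k => timeNorm β T (Θ k - θ)) atTop (𝓝 0)) :
    ∃ M : ℝ, 0 ≤ M ∧ ∀ᶠ k in atTop, ∀ᵐ s ∂(volume.restrict (Icc 0 T)), Slice β M (Θ k s) := by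
  refine ⟨(timeNorm β T θ).toReal + 1, by positivity, ?_⟩
  filter_upwards [hlim.eventually_le_const one_pos] with k hk
  filter_upwards [(hΘ k).ae_slice hβ, hθ.ae_slice hβ,
    ENNReal.ae_le_essSup (fun t => xNorm β ((Θ k - θ) t))] with s h1 h2 h3
  have hle : xNorm β ((Θ k - θ) s) ≤ ENNReal.ofReal 1 := by
    rw [ENNReal.ofReal_one]; exact h3.trans hk
  have e1 : (Θ k - θ) s = fun y => Θ k s y + -θ s y := by ext y; simp [sub_eq_add_neg]
  have hd : Slice β 1 ((Θ k - θ) s) := by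
    refine memX_slice hβ zero_le_one ⟨?_, hle.trans_lt ENNReal.ofReal_lt_top⟩ hle
    rw [e1]
    exact (h1.add h2.neg).locallyLipschitzOn
  have e2 : Θ k s = fun y => θ s y + (Θ k - θ) s y := by ext y; simp
  rw [e2]
  exact h2.add hd

lemma tendsto_nat_mul_level_rpow {κ : ℝ} (hκ : 0 < κ) :
    Tendsto (fun n : ℕ => (n : ℝ) * level n ^ κ) atTop (𝓝 0) := by
  have h := tendsto_self_mul_const_pow_of_lt_one (r := (1 / 16 : ℝ) ^ κ) (by positivity)
    (Real.rpow_lt_one (by norm_num) (by norm_num) hκ)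
  refine h.congr fun n => ?_
  congr 1
  have : level n = (1 / 16 : ℝ) ^ n := by
    rw [level, pow_mul, ← inv_pow]; norm_num
  rw [this, Real.rpow_pow_comm (by norm_num)]

lemma not_exists_normal_sequence {α β T q : ℝ} {a : ℕ → ℝ} {N : ℕ → ℕ} {Θ : ℕ → ℝ → Plane → ℝ}
    {θ : ℝ → Plane → ℝ} (hα : 0 < α) (hα' : α < 1 / 2) (hβ : 0 ≤ β) (hβ' : β < 1)
    (hβα : 1 - 2 * α < β) (hT : 0 < T) (ha : ∀ n, 1 ≤ n → 0 < a n ∧ a n ≤ level n / 2) (hq : 0 ≤ q)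
    (hq' : 2 ≤ (1 - β) * q) (haq : ∀ n, 1 ≤ n → a n ≤ level n ^ q) (hN : StrictMono N)
    (hΘ : ∀ k, IsClassicalSolution α β T (normalDatumTrunc β a (N k)) (Θ k)) (hθ : MemLinftyX β T θ)
    (hlim : Tendsto (fun k => timeNorm β T (Θ k - θ)) atTop (𝓝 0)) : False := by
  have hb : 0 < 1 - β := by linarith
  obtain ⟨M, hM, hslice⟩ := exists_eventually_ae_slice hβ (fun k => (hΘ k).memLinftyX) hθ hlim
  have hκ : 0 < (2 * α + β - 1) / 2 := by linarith
  obtain ⟨D, hev⟩ := exists_normal_cap_le (M := M) (A := 1 * (2 * (1 - β)⁻¹) ^ q)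
    (A₀ := ((1 - β)⁻¹) ^ q) hα hα' hβ hβα hβ' hM (by positivity) hq' hT
  have hsmall := ((tendsto_nat_mul_level_rpow hκ).const_mul |D|).eventually_lt_const
    (by rw [mul_zero]; exact one_pos)
  obtain ⟨n, hn, hn1, hns⟩ := (((tendsto_lam_level hβ hβ').eventually hev).and
    ((eventually_ge_atTop 1).and hsmall)).exists
  obtain ⟨k, hk, hkn⟩ := (hslice.and (eventually_ge_atTop n)).exists
  have hpos := lam_level_pos hβ' n
  have h0 := (hΘ k).initial
  have hle := hn (a n) (a n / n) (Θ k) (ha n hn1).1 ?_ ((hΘ k).bounded_of_ae hT hk)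
    (fun y hy => ?_) ?_ (fun y hy k0 k1 k2 k3 => ?_)
  · have hn0 : (0 : ℝ) < n := by exact_mod_cast hn1
    have han := (ha n hn1).1
    have h1 : lam β (level n) ^ ((2 * α + β - 1) / 2) ≤ level n ^ ((2 * α + β - 1) / 2) :=
      Real.rpow_le_rpow hpos.le (lam_level_le hβ hβ' n) hκ.le
    have h2 : D * a n * lam β (level n) ^ ((2 * α + β - 1) / 2)
        ≤ |D| * a n * level n ^ ((2 * α + β - 1) / 2) := by
      gcongr; exact le_abs_self D
    have h3 := hle.trans h2
    rw [div_le_iff₀ hn0] at h3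
    have h4 := mul_lt_mul_of_pos_left hns han
    linarith
  · refine (haq n hn1).trans_eq ?_
    conv_lhs => rw [level_eq_lamInv hβ hβ' hn1]
    rw [Real.mul_rpow (by positivity) (by positivity), ← Real.rpow_mul hpos.le]
  · rw [h0 y hy]
    exact abs_normalDatumTrunc_sub_wedge_le hβ hβ' ha zero_le_one hq
      (fun m hm => (haq m hm).trans_eq (one_mul _).symm) (N k) hy
  · rw [h0 _ (by simpa [mem_halfPlane] using hpos)]
    exact normalDatumTrunc_center hβ hβ' ha hn1 (hkn.trans hN.le_apply)
  · rw [h0 y hy]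
    exact normalDatumTrunc_off_center hβ hβ' ha hn1 k0 k1 k2 k3

lemma two_rpow_eq_level_rpow (γ : ℝ) (n : ℕ) : (2 : ℝ) ^ (-(γ * n)) = level n ^ (γ / 4) := by
  rw [level, ← Real.rpow_natCast, ← Real.rpow_neg zero_le_two, ← Real.rpow_mul zero_le_two]
  congr 1
  push_cast
  ring

lemma half_level (n : ℕ) : level n / 2 = ((2 : ℝ) ^ (4 * n + 1))⁻¹ := by
  rw [level, pow_succ, mul_inv, div_eq_mul_inv]

end GSQG

end

theorem theorem1p2 (α β : ℝ) (hα : 0 < α) (hα' : α < 1 / 2)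
    (hβ : β ∈ Set.Ico (0 : ℝ) 1 \ Set.Icc (2 * α) (1 - 2 * α)) :
    (β < 2 * α →
      ∃ a : ℕ → ℝ,
        (∃ c : ℝ, ∀ n, a n = c * (2 : ℝ) ^ (-(8 * (n : ℝ) / (1 - 2 * α) ^ 2))) ∧
        (∀ n, 1 ≤ n → 0 < a n ∧ a n ≤ ((2 : ℝ) ^ (4 * n + 1))⁻¹) ∧
        GSQG.MemX β (GSQG.tangentialDatum β a) ∧
        ∀ T : ℝ, 0 < T →
          ¬ ∃ θ : ℝ → GSQG.Plane → ℝ,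
            GSQG.IsClassicalSolution α β T (GSQG.tangentialDatum β a) θ) ∧
    (1 - 2 * α < β →
      ∃ a : ℕ → ℝ,
        (∃ γ : ℝ, ∀ n, a n = (2 : ℝ) ^ (-(γ * (n : ℝ)))) ∧
        (∀ n, 1 ≤ n → 0 < a n ∧ a n ≤ ((2 : ℝ) ^ (4 * n + 1))⁻¹) ∧
        GSQG.MemX β (GSQG.normalDatum β a) ∧
        (∀ n₀, GSQG.MemX β (GSQG.normalDatumTrunc β a n₀)) ∧
        Filter.Tendsto
          (fun n₀ => GSQG.xNorm β (GSQG.normalDatumTrunc β a n₀ - GSQG.normalDatum β a))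
          Filter.atTop (nhds 0) ∧
        ∀ T : ℝ, 0 < T → ∀ N : ℕ → ℕ, StrictMono N →
          ¬ ∃ (Θ : ℕ → ℝ → GSQG.Plane → ℝ) (θ : ℝ → GSQG.Plane → ℝ),
            (∀ k, GSQG.IsClassicalSolution α β T (GSQG.normalDatumTrunc β a (N k)) (Θ k)) ∧
            GSQG.MemLinftyX β T θ ∧
            Filter.Tendsto (fun k => GSQG.timeNorm β T (Θ k - θ)) Filter.atTop (nhds 0)) := by
  obtain ⟨⟨hβ₀, hβ₁⟩, -⟩ := hβ
  refine ⟨fun hβα => ?_, fun hβα => ?_⟩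
  · have h2α : 0 < 1 - 2 * α := by linarith
    have hq1 : 1 ≤ 2 / (1 - 2 * α) ^ 2 := by
      rw [le_div_iff₀ (by positivity)]; nlinarith
    have hae : ∀ n : ℕ, 1 / 2 * (2 : ℝ) ^ (-(8 * (n : ℝ) / (1 - 2 * α) ^ 2))
        = 1 / 2 * GSQG.level n ^ (2 / (1 - 2 * α) ^ 2) := fun n => by
      have := GSQG.two_rpow_eq_level_rpow (8 / (1 - 2 * α) ^ 2) n
      rw [show 8 / (1 - 2 * α) ^ 2 * (n : ℝ) = 8 * n / (1 - 2 * α) ^ 2 by ring,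
        show 8 / (1 - 2 * α) ^ 2 / 4 = 2 / (1 - 2 * α) ^ 2 by ring] at this
      rw [this]
    have ha : ∀ n : ℕ, 1 ≤ n → 0 < 1 / 2 * (2 : ℝ) ^ (-(8 * (n : ℝ) / (1 - 2 * α) ^ 2)) ∧
        1 / 2 * (2 : ℝ) ^ (-(8 * (n : ℝ) / (1 - 2 * α) ^ 2)) ≤ GSQG.level n / 2 := fun n hn => by
      refine ⟨by positivity, ?_⟩
      rw [hae]
      have h1 : GSQG.level n ^ (2 / (1 - 2 * α) ^ 2) ≤ GSQG.level n ^ (1 : ℝ) :=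
        Real.rpow_le_rpow_of_exponent_ge (GSQG.level_pos n) (by linarith [GSQG.level_le hn]) hq1
      rw [Real.rpow_one] at h1
      linarith
    refine ⟨fun n => 1 / 2 * (2 : ℝ) ^ (-(8 * (n : ℝ) / (1 - 2 * α) ^ 2)), ⟨1 / 2, fun n => rfl⟩,
      fun n hn => ?_, GSQG.memX_tangentialDatum hβ₀ hβ₁ ha, ?_⟩
    · rw [← GSQG.half_level]; exact ha n hn
    · rintro T hT ⟨θ, hθ⟩
      exact GSQG.not_exists_tangential_solution hα hα' hβ₀ hβ₁ hβα hT ha (fun n _ => (hae n).le)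
        (hθ.bounded_of_ae hT (hθ.memLinftyX.ae_slice hβ₀)) hθ.initial
  · have hb : 0 < 1 - β := by linarith
    have hq : 4 ≤ 4 / (1 - β) := by
      rw [le_div_iff₀ hb]; linarith
    have hae : ∀ n : ℕ, (2 : ℝ) ^ (-(16 / (1 - β) * (n : ℝ))) = GSQG.level n ^ (4 / (1 - β)) :=
      fun n => by
        rw [GSQG.two_rpow_eq_level_rpow]; congr 1; ring
    have ha : ∀ n : ℕ, 1 ≤ n → 0 < (2 : ℝ) ^ (-(16 / (1 - β) * (n : ℝ))) ∧
        (2 : ℝ) ^ (-(16 / (1 - β) * (n : ℝ))) ≤ GSQG.level n / 2 := fun n hn => by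
      refine ⟨by positivity, ?_⟩
      have hl := GSQG.level_le hn
      have hl0 := GSQG.level_pos n
      rw [hae]
      have h1 : GSQG.level n ^ (4 / (1 - β)) ≤ GSQG.level n ^ (2 : ℝ) :=
        Real.rpow_le_rpow_of_exponent_ge hl0 (by linarith) (by linarith)
      rw [Real.rpow_two] at h1
      nlinarith
    obtain ⟨h1, h2⟩ := GSQG.normalDatum_slice hβ₀ hβ₁ ha
    refine ⟨fun n => (2 : ℝ) ^ (-(16 / (1 - β) * (n : ℝ))), ⟨16 / (1 - β), fun n => rfl⟩,
      fun n hn => ?_, h1, h2, GSQG.tendsto_normalDatumTrunc hβ₀ hβ₁ ha, ?_⟩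
    · rw [← GSQG.half_level]; exact ha n hn
    · rintro T hT N hN ⟨Θ, θ, hΘ, hθ, hlim⟩
      exact GSQG.not_exists_normal_sequence hα hα' hβ₀ hβ₁ hβα hT ha (by linarith)
        (by rw [mul_div_cancel₀ _ hb.ne']; norm_num) (fun n _ => (hae n).le) hN hΘ hθ hlim
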